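/- **Setting.** All $|\cdot|$ are Euclidean norms, and $a\wedge b=\min(a,b)$ for real numbers (while $\wedge$ between vectors of $\mathbf R^3$ is the vector product). Let $v(\xi)=\xi/\sqrt{1+|\xi|^2}$ for $\xi\in\mathbf R^3$. Let $\chi\in C_c^\infty(\mathbf R^3)$ be nonnegative and even, with support in the unit ball and $\int\chi=1$; let $\epsilon>0$ and $\chi_\epsilon(x)=\epsilon^{-3}\chi(x/\epsilon)$. Let $Y(t,\cdot)=\frac{1}{4\pi t}\delta(|x|-t)$ for $t>0$ be the forward fundamental solution of $\partial_t^2-\Delta_x$ on $\mathbf R\times\mathbf R^3$, let $G(z)=\frac1{4\pi|z|}$, and let $Y_\epsilon=\chi_\epsilon\star_x\chi_\epsilon\star_xY$, which is smooth on $[0,\infty)\times\mathbf R^3$. For a finite positive measure $\mu$ on $\mathbf R^3\times\mathbf R^3$ let $\rho_\mu=\int\mu(\cdot,d\xi)$ and $j_\mu=\int v(\xi)\,\mu(\cdot,d\xi)$; a density $f$ is identified with the measure $f\,dx\,d\xi$. For probability measures on $\mathbf R^d$ let $\operatorname{dist}_{MKR}(\mu,\nu)=\inf_\pi\iint 1\wedge|x-y|\,\pi(dx\,dy)$,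 the infimum being over all couplings $\pi$ of $\mu$ and $\nu$. Let $\|g\|_{W^{1,\infty}}=\max(\|g\|_{L^\infty},\|\nabla g\|_{L^\infty})$, and let $\|j\|_{W^{-1,1}(\mathbf R^3)}=\sup\{|\int\psi\cdot dj| : \psi\in W^{1,\infty}(\mathbf R^3;\mathbf R^3),\ \|\psi\|_{W^{1,\infty}}\le1\}$. **Constants.** For $z=(x,\xi)$ and $\zeta=(y,\eta)$ in $\mathbf R^3\times\mathbf R^3$ set $m_\epsilon=(v(\xi),m^2_\epsilon)$ and $r_\epsilon=(0,r^2_\epsilon)$ with $$m^2_\epsilon(t,z,\zeta)=-(\partial_t\nabla_xY_\epsilon\star_xG)(t,x-y),$$ $$r^2_\epsilon(t,z,\tau,\zeta)=-(\nabla_x+v(\eta)\partial_t)Y_\epsilon(t-\tau,x-y)-v(\xi)\wedge\big(v(\eta)\wedge\nabla_xY_\epsilon(t-\tau,x-y)\big)$$ for $0\le\tau\le t$, and $r^2_\epsilon=0$ otherwise. Let $L(T,\epsilon)$ be the least $L\ge0$ such that $$|r_\epsilon(t,z,\tau,\zeta)-r_\epsilon(t,z',\tau,\zeta')|+|m_\epsilon(t,z,\zeta_0)-m_\epsilon(t,z',\zeta_0')|\le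 L\,\big(1\wedge|z-z'|+1\wedge|\zeta-\zeta'|+1\wedge|\zeta_0-\zeta_0'|\big)$$ for all $t,\tau\in[0,T]$ and all $z,z',\zeta,\zeta',\zeta_0,\zeta_0'\in\mathbf R^6$, and put $$C(T,\epsilon)=(1+TL(T,\epsilon))\,e^{T^2L(T,\epsilon)},$$ $$C'(T,\epsilon)=4T\,C(T,\epsilon)\,\|\nabla_xY_\epsilon\|_{L^\infty([0,T];W^{1,\infty}(\mathbf R^3))},$$ $$C''(T,\epsilon)=4T\,C(T,\epsilon)\,\|\nabla_{t,x}Y_\epsilon\|_{L^\infty([0,T];W^{1,\infty}(\mathbf R^3))}+2\,\|\partial_t\nabla_xY_\epsilon\star_xG\|_{L^\infty([0,T];W^{1,\infty}(\mathbf R^3))}.$$ **Fields.** For a family $(\mu_t)_{t\ge0}$ of measures, the regularized field $(E,B)$ created by $\mu$ is the $C^1$ solution on $[0,\infty)\times\mathbf R^3$ of $$\operatorname{div}B=0,\quad\partial_tB+\operatorname{curl}E=0,\quad\operatorname{div}E=\chi_\epsilon\star\chi_\epsilon\star\rho_{\mu_t},\quad\partial_tE-\operatorname{curl}B=-\chi_\epsilon\star\chi_\epsilon\star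 j_{\mu_t},$$ with $E|_{t=0}=-\nabla(\chi_\epsilon\star\chi_\epsilon\star G\star\rho_{\mu_0})$ and $B|_{t=0}=0$. **Hypotheses.** Let $f^{in}\in L^\infty(\mathbf R^3\times\mathbf R^3)$ be a.e. nonnegative with compact support and $\iint f^{in}\,dx\,d\xi=1$. Let $(f_\epsilon,E_\epsilon,B_\epsilon)$ be the solution of the regularized Vlasov-Maxwell system: $f_\epsilon(t,\cdot,\cdot)\ge0$ is integrable and weakly continuous in $t\ge0$ (tested against bounded continuous functions), it satisfies $$\partial_tf_\epsilon+v(\xi)\cdot\nabla_xf_\epsilon+(E_\epsilon+v(\xi)\wedge B_\epsilon)\cdot\nabla_\xi f_\epsilon=0,\qquad f_\epsilon|_{t=0}=f^{in},$$ in the sense of distributions, and $(E_\epsilon,B_\epsilon)$ is the regularized field created by $f_\epsilon$. For $N\ge1$ let $(x^{in}_{i,N},\xi^{in}_{i,N})_{1\le i\le N}$ be points of $\mathbf R^3\times\mathbf R^3$ such that $f^{in}_N:=\frac1N\sum_i\delta_{(x^{in}_{i,N},\xi^{in}_{i,N})}\to f^{in}dx\,d\xi$ weakly as $N\to\infty$.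 Let $z_i=(x_{i,N},\xi_{i,N})$, $1\le i\le N$, be the solution for $t\ge0$ of $$\dot x_{i,N}(t)=v(\xi_{i,N}(t)),\qquad\dot\xi_{i,N}(t)=\frac1N\sum_{j=1}^N\Big(m^2_\epsilon(t,z_i(t),z_j(0))+\int_0^tr^2_\epsilon(t,z_i(t),s,z_j(s))\,ds\Big)$$ with these initial data, let $f_{N,\epsilon}(t)=\frac1N\sum_i\delta_{(x_{i,N}(t),\xi_{i,N}(t))}$, and let $(E_{N,\epsilon},B_{N,\epsilon})$ be the regularized field created by $f_{N,\epsilon}$. **Conclusion.** Let $T>0$. a) For all $t\in[0,T]$ and $N\ge1$, $$\operatorname{dist}_{MKR}(\rho_{f_\epsilon}(t),\rho_{f_{N,\epsilon}}(t))\le C(T,\epsilon)\operatorname{dist}_{MKR}(f^{in},f^{in}_N),$$ $$\|j_{f_\epsilon}(t)-j_{f_{N,\epsilon}}(t)\|_{W^{-1,1}(\mathbf R^3)}\le4C(T,\epsilon)\operatorname{dist}_{MKR}(f^{in},f^{in}_N),$$ and, as $N\to\infty$, $\frac1N\sum_i\delta_{x_{i,N}(t)}\to\rho_{f_\epsilon}(t)$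 weakly in $\mathcal P(\mathbf R^3)$ and $\frac1N\sum_iv(\xi_{i,N}(t))\delta_{x_{i,N}(t)}\to j_{f_\epsilon}(t)$ weakly in the space of bounded Radon measures (both tested against bounded continuous functions), uniformly in $t\in[0,T]$. b) $(E_{N,\epsilon},B_{N,\epsilon})\to(E_\epsilon,B_\epsilon)$ uniformly on $[0,T]\times\mathbf R^3$ as $N\to\infty$, and for all $N\ge1$ $$\|B_\epsilon-B_{N,\epsilon}\|_{L^\infty([0,T]\times\mathbf R^3)}\le C'(T,\epsilon)\operatorname{dist}_{MKR}(f^{in},f^{in}_N),$$ $$\|E_\epsilon-E_{N,\epsilon}\|_{L^\infty([0,T]\times\mathbf R^3)}\le C''(T,\epsilon)\operatorname{dist}_{MKR}(f^{in},f^{in}_N).$$ -/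

import Mathlib

open MeasureTheory Filter Set Topology
open scoped ENNReal ContDiff BoundedContinuousFunction

noncomputable section

namespace RegVM

/-- Euclidean three-space. -/
abbrev R3 := EuclideanSpace ℝ (Fin 3)

/-- Phase space: pairs `(x, ξ)` of a position and a momentum. Its canonical measure is `dx dξ`. -/
abbrev Phase := R3 × R3

/-- The Euclidean distance of `ℝ⁶` on phase space (the instance on the product is the sup
distance, so it is written out). -/
def phaseDist (z w : Phase) : ℝ :=
  Real.sqrt (‖z.1 - w.1‖ ^ 2 + ‖z.2 - w.2‖ ^ 2)

/-- The vector product in `ℝ³`. -/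
def cross (a b : R3) : R3 :=
  WithLp.toLp 2 (crossProduct (WithLp.ofLp a) (WithLp.ofLp b))

/-- The relativistic velocity `v(ξ) = ξ / √(1 + |ξ|²)`. -/
def vel (ξ : R3) : R3 :=
  (Real.sqrt (1 + ‖ξ‖ ^ 2))⁻¹ • ξ

/-! ### Differential operators in the space variable -/

/-- `∂_i F_j (x)`. -/
def pd (i j : Fin 3) (F : R3 → R3) (x : R3) : ℝ :=
  fderiv ℝ F x (EuclideanSpace.single i 1) j

def divg (F : R3 → R3) (x : R3) : ℝ :=
  pd 0 0 F x + pd 1 1 F x + pd 2 2 F x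

def curl (F : R3 → R3) (x : R3) : R3 :=
  !₂[pd 1 2 F x - pd 2 1 F x, pd 2 0 F x - pd 0 2 F x, pd 0 1 F x - pd 1 0 F x]

/-! ### The mollifier and the regularized fundamental solution of the wave equation -/

structure IsMollifier (χ : R3 → ℝ) : Prop where
  smooth : ContDiff ℝ ∞ χ
  supp : tsupport χ ⊆ Metric.closedBall 0 1
  even : ∀ x, χ (-x) = χ x
  nonneg : ∀ x, 0 ≤ χ x
  integral_eq_one : ∫ x, χ x = 1

/-- `χ_ε(x) = ε⁻³ χ(x / ε)`. -/
def chiEps (χ : R3 → ℝ) (ε : ℝ) (x : R3) : ℝ :=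
  (ε ^ 3)⁻¹ * χ (ε⁻¹ • x)

/-- `χ_ε ⋆ χ_ε`. -/
def chi2 (χ : R3 → ℝ) (ε : ℝ) : R3 → ℝ :=
  convolution (chiEps χ ε) (chiEps χ ε) (ContinuousLinearMap.mul ℝ ℝ) volume

/-- `Y_ε(t, ·) = χ_ε ⋆ χ_ε ⋆ Y(t, ·)` for `t ≥ 0`, where `Y(t, ·)` is `(4πt)⁻¹` times the surface
measure of the sphere of radius `t` about the origin. After scaling to the unit sphere this is
`(t / 4π) ∫_{|σ| = 1} (χ_ε ⋆ χ_ε)(x - tσ) dσ`. It is only ever used for `t ≥ 0`; the formula makes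
sense, and is smooth, for all real `t`, so that its `t`-derivative at `t = 0` is the one-sided
one. -/
def Yeps (χ : R3 → ℝ) (ε : ℝ) (t : ℝ) (x : R3) : ℝ :=
  t / (4 * Real.pi) *
    ∫ σ : Metric.sphere (0 : R3) 1, chi2 χ ε (x - t • (σ : R3)) ∂(volume : Measure R3).toSphere

/-- `∂_t Y_ε`. -/
def dtY (χ : R3 → ℝ) (ε : ℝ) (t : ℝ) (x : R3) : ℝ :=
  deriv (fun s => Yeps χ ε s x) t

/-- `∇_x Y_ε`. -/
def gradY (χ : R3 → ℝ) (ε : ℝ) (t : ℝ) (x : R3) : R3 :=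
  gradient (Yeps χ ε t) x

/-- `∇_{t,x} Y_ε`, with the Euclidean norm on `ℝ × ℝ³ = ℝ⁴`. -/
def gradtxY (χ : R3 → ℝ) (ε : ℝ) (t : ℝ) (x : R3) : WithLp 2 (ℝ × R3) :=
  WithLp.toLp 2 (dtY χ ε t x, gradY χ ε t x)

/-- `G(z) = 1 / (4π|z|)`, the fundamental solution of `-Δ`. -/
def green (z : R3) : ℝ := 1 / (4 * Real.pi * ‖z‖)

/-- `∂_t ∇_x Y_ε(t, ·) ⋆_x G`. -/
def gradDtYG (χ : R3 → ℝ) (ε : ℝ) (t : ℝ) : R3 → R3 :=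
  convolution green (gradient (dtY χ ε t)) (ContinuousLinearMap.lsmul ℝ ℝ) volume

/-! ### The integral kernel of the regularized mean-field dynamics -/

/-- Force at time `t` on a particle in the state `z = (x, ξ)` due to the initial electrostatic field
of a particle with initial state `ζ = (y, η)`. -/
def mForce (χ : R3 → ℝ) (ε : ℝ) (t : ℝ) (z ζ : Phase) : R3 :=
  -gradDtYG χ ε t (z.1 - ζ.1)

/-- Density in `τ` of the retarded force at time `t` on a particle in the state `z = (x, ξ)` due to
a particle which is in the state `ζ = (y, η)` at time `τ ∈ [0, t]`. -/
def rForce (χ : R3 → ℝ) (ε : ℝ) (t : ℝ) (z : Phase) (τ : ℝ) (ζ : Phase) : R3 :=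
  -(gradY χ ε (t - τ) (z.1 - ζ.1) + dtY χ ε (t - τ) (z.1 - ζ.1) • vel ζ.2)
    - cross (vel z.2) (cross (vel ζ.2) (gradY χ ε (t - τ) (z.1 - ζ.1)))

/-- The kernel `m_ε = (1_{t ≥ 0} v(ξ), m²_ε)` (used for `t ≥ 0` only). -/
def mKer (χ : R3 → ℝ) (ε : ℝ) (t : ℝ) (z ζ : Phase) : Phase :=
  (vel z.2, mForce χ ε t z ζ)

/-- The kernel `r_ε = (0, r²_ε)`, which vanishes unless `0 ≤ τ ≤ t`. -/
def rKer (χ : R3 → ℝ) (ε : ℝ) (t : ℝ) (z : Phase) (τ : ℝ) (ζ : Phase) : Phase :=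
  (0, if 0 ≤ τ ∧ τ ≤ t then rForce χ ε t z τ ζ else 0)

/-- `L(T, ε)`: the least constant in the Lipschitz condition on the kernels, for times in
`[0, T]`. -/
def lipConst (χ : R3 → ℝ) (ε T : ℝ) : ℝ :=
  sInf {L : ℝ | 0 ≤ L ∧ ∀ t ∈ Icc 0 T, ∀ τ ∈ Icc 0 T, ∀ z z' ζ ζ' ζ₀ ζ₀' : Phase,
    phaseDist (rKer χ ε t z τ ζ) (rKer χ ε t z' τ ζ')
        + phaseDist (mKer χ ε t z ζ₀) (mKer χ ε t z' ζ₀')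
      ≤ L * (min 1 (phaseDist z z') + min 1 (phaseDist ζ ζ') + min 1 (phaseDist ζ₀ ζ₀'))}

/-! ### The explicit constants -/

/-- The norm of `L^∞([0, T]; W^{1,∞}(ℝ³))`, the norm of `W^{1,∞}` being
`max (‖g‖_∞) (‖∇g‖_∞)`. -/
def normLW {F : Type*} [NormedAddCommGroup F] [NormedSpace ℝ F] (T : ℝ) (g : ℝ → R3 → F) : ℝ :=
  ⨆ p : Icc (0 : ℝ) T × R3, max ‖g p.1 p.2‖ ‖fderiv ℝ (g p.1) p.2‖

/-- `C(T, ε)`. -/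
def constC (χ : R3 → ℝ) (ε T : ℝ) : ℝ :=
  (1 + T * lipConst χ ε T) * Real.exp (T ^ 2 * lipConst χ ε T)

/-- `C'(T, ε)`. -/
def constC' (χ : R3 → ℝ) (ε T : ℝ) : ℝ :=
  4 * T * constC χ ε T * normLW T (gradY χ ε)

/-- `C''(T, ε)`. -/
def constC'' (χ : R3 → ℝ) (ε T : ℝ) : ℝ :=
  4 * T * constC χ ε T * normLW T (gradtxY χ ε) + 2 * normLW T (gradDtYG χ ε)

/-! ### Distances between measures, charge and current -/

/-- The Monge-Kantorovich-Rubinstein distance for the cost `1 ∧ d`: the infimum over all couplings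
(it is `∞` if there is none). -/
def mkr {X : Type*} [MeasurableSpace X] (d : X → X → ℝ) (μ ν : Measure X) : ℝ≥0∞ :=
  ⨅ π ∈ {π : Measure (X × X) | π.fst = μ ∧ π.snd = ν},
    ∫⁻ p, ENNReal.ofReal (min 1 (d p.1 p.2)) ∂π

/-- The measure `g dx dξ` with density `g`. -/
def phaseMeasure (g : Phase → ℝ) : Measure Phase :=
  volume.withDensity fun z => ENNReal.ofReal (g z)

/-- The empirical measure of the configuration `z`. -/
def empirical {N : ℕ} (z : Fin N → Phase) : Measure Phase :=
  (N : ℝ≥0∞)⁻¹ • ∑ i, Measure.dirac (z i)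

/-- The charge density `ρ_μ = ∫ μ(·, dξ)`, as a measure on `ℝ³`. -/
def charge (μ : Measure Phase) : Measure R3 := μ.fst

/-- The current `j_μ = ∫ v(ξ) μ(·, dξ)`, an `ℝ³`-valued measure, applied to the scalar function
`φ`. -/
def current (μ : Measure Phase) (φ : R3 → ℝ) : R3 :=
  ∫ z, φ z.1 • vel z.2 ∂μ

/-- `∫ ψ · dj_μ` for a vector field `ψ`. -/
def currentPairing (μ : Measure Phase) (ψ : R3 → R3) : ℝ :=
  ∫ z, inner ℝ (ψ z.1) (vel z.2) ∂μ

/-- `‖j_μ - j_ν‖` in `W^{-1,1}(ℝ³)`, i.e. in the dual norm of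
`‖ψ‖_{W^{1,∞}} = max (‖ψ‖_∞) (‖∇ψ‖_∞)`. -/
def currentNegNorm (μ ν : Measure Phase) : ℝ≥0∞ :=
  ⨆ ψ ∈ {ψ : R3 → R3 | (∀ x, ‖ψ x‖ ≤ 1) ∧ LipschitzWith 1 ψ},
    ENNReal.ofReal |currentPairing μ ψ - currentPairing ν ψ|

/-- `χ_ε ⋆ χ_ε ⋆ ρ_μ`. -/
def regCharge (χ : R3 → ℝ) (ε : ℝ) (μ : Measure Phase) (x : R3) : ℝ :=
  ∫ y, chi2 χ ε (x - y) ∂(charge μ)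

/-- `χ_ε ⋆ χ_ε ⋆ j_μ`. -/
def regCurrent (χ : R3 → ℝ) (ε : ℝ) (μ : Measure Phase) (x : R3) : R3 :=
  current μ fun y => chi2 χ ε (x - y)

/-- `-∇ (χ_ε ⋆ χ_ε ⋆ G ⋆ ρ_μ)`, the regularized electrostatic field of the charge density of
`μ`. -/
def electrostatic (χ : R3 → ℝ) (ε : ℝ) (μ : Measure Phase) (x : R3) : R3 :=
  -gradient (fun x' =>
    ∫ y, convolution green (chi2 χ ε) (ContinuousLinearMap.mul ℝ ℝ) volume (x' - y) ∂(charge μ)) x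

/-! ### The Maxwell, Vlasov-Maxwell and particle systems -/

/-- `(E, B)` is a classical (`C¹`) solution for `t ≥ 0` of the Maxwell system with charge density
`ρ` and current density `j`, and with initial data `(E₀, 0)`. -/
structure IsMaxwellSolution (ρ : ℝ → R3 → ℝ) (j : ℝ → R3 → R3) (E₀ : R3 → R3)
    (E B : ℝ → R3 → R3) : Prop where
  contDiff_E : ContDiffOn ℝ 1 (fun p : ℝ × R3 => E p.1 p.2) (Ici 0 ×ˢ univ)
  contDiff_B : ContDiffOn ℝ 1 (fun p : ℝ × R3 => B p.1 p.2) (Ici 0 ×ˢ univ)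
  div_B : ∀ t, 0 ≤ t → ∀ x, divg (B t) x = 0
  faraday : ∀ t, 0 ≤ t → ∀ x, derivWithin (fun s => B s x) (Ici 0) t + curl (E t) x = 0
  gauss : ∀ t, 0 ≤ t → ∀ x, divg (E t) x = ρ t x
  ampere : ∀ t, 0 ≤ t → ∀ x, derivWithin (fun s => E s x) (Ici 0) t - curl (B t) x = -j t x
  init_E : ∀ x, E 0 x = E₀ x
  init_B : ∀ x, B 0 x = 0

/-- `(E, B)` is the regularized electromagnetic field, initially electrostatic, created by the
time-dependent phase space measure `μ`. -/
def IsFieldOf (χ : R3 → ℝ) (ε : ℝ) (μ : ℝ → Measure Phase) (E B : ℝ → R3 → R3) : Prop :=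
  IsMaxwellSolution (fun t => regCharge χ ε (μ t)) (fun t => regCurrent χ ε (μ t))
    (electrostatic χ ε (μ 0)) E B

/-- `(f, E, B)` is a (global in time) weak solution of the regularized Vlasov-Maxwell system with
initial data `f^in`: `f t` is a nonnegative integrable density, weakly continuous in `t`, which
satisfies the Vlasov equation in the sense of distributions on `[0, ∞) × ℝ³ × ℝ³`, initial
condition included, and `(E, B)` solves the regularized Maxwell system. -/
structure IsVlasovMaxwellSolution (χ : R3 → ℝ) (ε : ℝ) (fin : Phase → ℝ) (f : ℝ → Phase → ℝ)
    (E B : ℝ → R3 → R3) : Prop where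
  integrable : ∀ t, 0 ≤ t → Integrable (f t)
  nonneg : ∀ t, 0 ≤ t → ∀ᵐ z, 0 ≤ f t z
  weak_continuous : ∀ φ : Phase →ᵇ ℝ, ContinuousOn (fun t => ∫ z, φ z * f t z) (Ici 0)
  init : f 0 =ᵐ[volume] fin
  vlasov : ∀ φ : ℝ × Phase → ℝ, ContDiff ℝ ∞ φ → HasCompactSupport φ →
    (∫ t in Ioi (0 : ℝ), ∫ z : Phase,
        f t z * fderiv ℝ φ (t, z) (1, (vel z.2, E t z.1 + cross (vel z.2) (B t z.1))))
      + ∫ z : Phase, fin z * φ (0, z) = 0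
  maxwell : IsFieldOf χ ε (fun t => phaseMeasure (f t)) E B

/-- `t ↦ (z i t)_i = (x_i(t), ξ_i(t))_i` is a solution for `t ≥ 0` of the regularized system of
delay differential equations for `N` particles, with initial data `zin`. -/
structure IsParticleSolution (χ : R3 → ℝ) (ε : ℝ) {N : ℕ} (zin : Fin N → Phase)
    (z : Fin N → ℝ → Phase) : Prop where
  init : ∀ i, z i 0 = zin i
  position : ∀ i, ∀ t, 0 ≤ t →
    HasDerivWithinAt (fun s => (z i s).1) (vel (z i t).2) (Ici 0) t
  momentum : ∀ i, ∀ t, 0 ≤ t →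
    HasDerivWithinAt (fun s => (z i s).2)
      ((N : ℝ)⁻¹ • ∑ j, (mForce χ ε t (z i t) (z j 0)
        + ∫ s in (0 : ℝ)..t, rForce χ ε t (z i t) s (z j s))) (Ici 0) t

end RegVM

end

open MeasureTheory Filter Set Topology
open scoped ENNReal ContDiff BoundedContinuousFunction

noncomputable section

set_option linter.unusedSectionVars false

namespace RegVM

/-! The Maxwell system can be solved explicitly in terms of its sources. With the kernels `gradY`,
`dtY` and `gradDtYG`, which are smooth because of the double mollification, the field at `(t, x)` is
a retarded average over the measures `μ s`, `0 ≤ s ≤ t`, plus an average over `μ 0` (`electric_eq`,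
`magnetic_eq`). Hence the Lorentz force is exactly the mean-field force with the kernels `mForce`
and `rForce` (`lorentz_force_eq`). The Vlasov-Maxwell density and the empirical measure of the
particles thus become two instances of one object: a weakly continuous family of measures carried
along by the characteristics of the field which it creates.

The fields are only `C¹`, so the wave equation cannot be applied to their components. The explicit
formula is proved by duality instead: a component is tested at time `t` against `ψ`, and `ψ` is
propagated backwards by a smooth solution of the wave equation given by spherical means
(`spread_wave`, `integral_mul_eq_of_maxwell`). The mean-value operator is then transposed onto the
mollifier. That particles follow characteristics is read off from their differential equations. For
the density, which is only a weak solution, it is a uniqueness theorem for the continuity equation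
with a bounded Lipschitz field (`NiceField.eq_map_flow`), proved by testing with mollified solutions
of the backward transport equation.

The stability estimate is Dobrushin's argument. Given a coupling of the initial measures, both flows
are run, one from each coordinate. The means of `1 ∧ |x - x'|` and `2 ∧ |ξ - ξ'|` satisfy a linear
Volterra system (`meanPos_le_add`, `meanMom_le_add`), which is compared with the explicit
supersolution `posBound`, `momBound`. Two facts make the prescribed constant `C(T, ε)` sufficient.
The retarded force is affine in each velocity, and velocities fill a ball of diameter `2`, so its
Lipschitz constant in a velocity is `L / 2` rather than `L` (`norm_rForce_sub_le_split`); and the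
velocity component of `m_ε` forces `L ≥ 2` (`two_le_lipConst`). Charges, currents and fields are
averages of kernels controlled by these mean distances, and the infimum over all couplings gives the
estimates.

For the limit it remains to see that the initial distance tends to `0`. Space is cut into the atoms
of finitely many small balls, whose boundaries are null sets for an absolutely continuous measure,
and as much mass as possible is matched inside each atom (`tendsto_mkr_zero`). A test function for
charge or current is merely bounded and continuous, but the limit density stays in one compact set
up to time `T`, so a modulus of continuity near that set suffices (`exists_modulus`). -/

/-- The surface measure of the unit sphere of `ℝ³`. -/
abbrev sphereMeasure : Measure (Metric.sphere (0 : R3) 1) := (volume : Measure R3).toSphere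

/-! ### Smooth dependence on parameters of integrals over the unit sphere. -/

section SphereParametric

variable {P G : Type} [NormedAddCommGroup P] [NormedSpace ℝ P] [FiniteDimensional ℝ P]
  [NormedAddCommGroup G] [NormedSpace ℝ G]

theorem exists_bound_ball_sphere {F : P × R3 → G} (hF : Continuous F) (p : P) :
    ∃ C, ∀ q ∈ Metric.ball p 1, ∀ σ : Metric.sphere (0 : R3) 1, ‖F (q, σ)‖ ≤ C := by
  have : ProperSpace P := FiniteDimensional.proper ℝ P
  obtain ⟨C, hC⟩ := ((isCompact_closedBall p 1).prod
    (isCompact_sphere (0 : R3) 1)).exists_bound_of_continuousOn hF.continuousOn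
  exact ⟨C, fun q hq σ => hC (q, σ) ⟨Metric.ball_subset_closedBall hq, σ.2⟩⟩

theorem continuous_sphere_slice {F : P × R3 → G} (hF : Continuous F) (p : P) :
    Continuous fun σ : Metric.sphere (0 : R3) 1 => F (p, σ) :=
  hF.comp (continuous_const.prodMk continuous_subtype_val)

theorem integrable_sphere {g : Metric.sphere (0 : R3) 1 → G} (hg : Continuous g) :
    Integrable g sphereMeasure :=
  hg.integrable_of_hasCompactSupport (HasCompactSupport.of_compactSpace g)

theorem hasFDerivAt_integral_sphere {F : P × R3 → G} (hF : ContDiff ℝ 1 F) (p : P) :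
    HasFDerivAt (fun p => ∫ σ : Metric.sphere (0 : R3) 1, F (p, σ) ∂sphereMeasure)
      (∫ σ : Metric.sphere (0 : R3) 1,
        (fderiv ℝ F (p, σ)).comp (ContinuousLinearMap.inl ℝ P R3) ∂sphereMeasure) p := by
  have hF' : Continuous fun q : P × R3 =>
      (fderiv ℝ F q).comp (ContinuousLinearMap.inl ℝ P R3) :=
    (hF.continuous_fderiv one_ne_zero).clm_comp continuous_const
  obtain ⟨C, hC⟩ := exists_bound_ball_sphere hF' p
  refine hasFDerivAt_integral_of_dominated_of_fderiv_le (bound := fun _ => C)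
    (F' := fun p (σ : Metric.sphere (0 : R3) 1) =>
      (fderiv ℝ F (p, σ)).comp (ContinuousLinearMap.inl ℝ P R3))
    (Metric.ball_mem_nhds p one_pos)
    (Eventually.of_forall fun q => (integrable_sphere
      (continuous_sphere_slice hF.continuous q)).aestronglyMeasurable)
    (integrable_sphere (continuous_sphere_slice hF.continuous p))
    (integrable_sphere (continuous_sphere_slice hF' p)).aestronglyMeasurable
    (Eventually.of_forall fun σ q hq => hC q hq σ) (integrable_const C)
    (Eventually.of_forall fun σ q _ => ?_)
  exact ((hF.differentiable one_ne_zero _).hasFDerivAt).comp q (hasFDerivAt_prodMk_left q (σ : R3))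

/-- Induction on the order of smoothness. The target space is quantified inside the statement
because the derivative of the integral is an integral with values in `P →L[ℝ] G`. -/
theorem contDiff_integral_sphere_nat (n : ℕ) : ∀ {G : Type} [NormedAddCommGroup G]
    [NormedSpace ℝ G] {F : P × R3 → G} (_ : ContDiff ℝ ∞ F),
    ContDiff ℝ n (fun p => ∫ σ : Metric.sphere (0 : R3) 1, F (p, σ) ∂sphereMeasure) := by
  induction n with
  | zero =>
    intro G _ _ F hF
    exact contDiff_zero.2 (Differentiable.continuous (𝕜 := ℝ) fun p =>
      (hasFDerivAt_integral_sphere (hF.of_le (by simp)) p).differentiableAt)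
  | succ n ih =>
    intro G _ _ F hF
    have h1 := fun p => hasFDerivAt_integral_sphere (hF.of_le (by simp)) p
    rw [Nat.cast_add, Nat.cast_one, contDiff_succ_iff_fderiv]
    refine ⟨fun p => (h1 p).differentiableAt, by simp, ?_⟩
    rw [funext fun p => (h1 p).fderiv]
    exact ih (F := fun q : P × R3 => (fderiv ℝ F q).comp (ContinuousLinearMap.inl ℝ P R3))
      ((hF.fderiv_right (by simp)).clm_comp contDiff_const)

theorem contDiff_integral_sphere {F : P × R3 → G} (hF : ContDiff ℝ ∞ F) :
    ContDiff ℝ ∞ (fun p => ∫ σ : Metric.sphere (0 : R3) 1, F (p, σ) ∂sphereMeasure) :=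
  contDiff_infty.2 fun n => contDiff_integral_sphere_nat n hF

end SphereParametric

/-! ### Spherical means and the Kirchhoff formula. -/

section SphericalMeans

variable {G : Type} [NormedAddCommGroup G] [NormedSpace ℝ G]

/-- The integral of `g` over the sphere of radius `|t|` about `x`, after scaling to the unit
sphere. -/
def sphInt (g : R3 → G) (t : ℝ) (x : R3) : G :=
  ∫ σ : Metric.sphere (0 : R3) 1, g (x - t • (σ : R3)) ∂sphereMeasure

/-- The Kirchhoff operator: the solution of the wave equation with data `(0, g)`. -/
def kirchhoff (g : R3 → G) (t : ℝ) (x : R3) : G :=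
  (t / (4 * Real.pi)) • sphInt g t x

theorem contDiff_sphInt {g : R3 → G} (hg : ContDiff ℝ ∞ g) :
    ContDiff ℝ ∞ (fun p : ℝ × R3 => sphInt g p.1 p.2) := by
  refine contDiff_integral_sphere (P := ℝ × R3)
    (F := fun q : (ℝ × R3) × R3 => g (q.1.2 - q.1.1 • q.2)) ?_
  exact hg.comp (by fun_prop)

theorem contDiff_kirchhoff {g : R3 → G} (hg : ContDiff ℝ ∞ g) :
    ContDiff ℝ ∞ (fun p : ℝ × R3 => kirchhoff g p.1 p.2) := by
  have := contDiff_sphInt hg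
  unfold kirchhoff
  fun_prop

theorem fderiv_sphInt_space {g : R3 → G} (hg : ContDiff ℝ ∞ g) (t : ℝ) (x v : R3) :
    fderiv ℝ (sphInt g t) x v = sphInt (fun y => fderiv ℝ g y v) t x := by
  have hF : ContDiff ℝ 1 fun q : R3 × R3 => g (q.1 - t • q.2) :=
    (hg.of_le (by simp)).comp (by fun_prop)
  have h := hasFDerivAt_integral_sphere hF x
  have hd : ∀ σ : Metric.sphere (0 : R3) 1, (fderiv ℝ (fun q : R3 × R3 => g (q.1 - t • q.2))
      (x, (σ : R3))).comp (ContinuousLinearMap.inl ℝ R3 R3) = fderiv ℝ g (x - t • (σ : R3)) := by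
    intro σ
    have h1 : HasFDerivAt (fun q : R3 × R3 => g (q.1 - t • q.2)) _ (x, (σ : R3)) :=
      (hg.differentiable (by simp) _).hasFDerivAt.comp (x, (σ : R3))
        (hasFDerivAt_fst.sub (hasFDerivAt_snd.const_smul t))
    rw [h1.fderiv]
    ext w
    simp
  simp only [hd] at h
  have hi : Integrable (fun σ : Metric.sphere (0 : R3) 1 => fderiv ℝ g (x - t • (σ : R3)))
      sphereMeasure := integrable_sphere
    ((hg.continuous_fderiv (by simp)).comp (by fun_prop))
  rw [show fderiv ℝ (sphInt g t) x = _ from h.fderiv, ContinuousLinearMap.integral_apply hi]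
  rfl

theorem hasDerivAt_sphInt_time {g : R3 → G} (hg : ContDiff ℝ ∞ g) (t : ℝ) (x : R3) :
    HasDerivAt (fun s => sphInt g s x)
      (-∫ σ : Metric.sphere (0 : R3) 1, fderiv ℝ g (x - t • (σ : R3)) σ ∂sphereMeasure) t := by
  have hF : ContDiff ℝ 1 fun q : ℝ × R3 => g (x - q.1 • q.2) :=
    (hg.of_le (by simp)).comp (by fun_prop)
  have h := (hasFDerivAt_integral_sphere hF t).hasDerivAt
  have hi : Integrable (fun σ : Metric.sphere (0 : R3) 1 =>
      (fderiv ℝ (fun q : ℝ × R3 => g (x - q.1 • q.2)) (t, (σ : R3))).comp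
        (ContinuousLinearMap.inl ℝ ℝ R3)) sphereMeasure := integrable_sphere
    (((hF.continuous_fderiv one_ne_zero).comp (by fun_prop)).clm_comp continuous_const)
  have hd : ∀ σ : Metric.sphere (0 : R3) 1, (fderiv ℝ (fun q : ℝ × R3 => g (x - q.1 • q.2))
      (t, (σ : R3))).comp (ContinuousLinearMap.inl ℝ ℝ R3) 1
        = - fderiv ℝ g (x - t • (σ : R3)) σ := by
    intro σ
    have h1 : HasFDerivAt (fun q : ℝ × R3 => g (x - q.1 • q.2)) _ (t, (σ : R3)) :=
      (hg.differentiable (by simp) _).hasFDerivAt.comp (t, (σ : R3))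
        ((hasFDerivAt_fst.fun_smul hasFDerivAt_snd).const_sub x)
    rw [h1.fderiv]
    simp
  rw [ContinuousLinearMap.integral_apply hi] at h
  simp only [hd, integral_neg] at h
  exact h

/-- Finite speed of propagation: the points `x - tσ` have distance `|t|` from `x`, hence lie outside
of the ball of radius `R`. -/
theorem sphInt_eq_zero {g : R3 → G} {R : ℝ} (hg : ∀ x, R < ‖x‖ → g x = 0) {t : ℝ} {x : R3}
    (hx : R + |t| < ‖x‖) : sphInt g t x = 0 := by
  refine integral_eq_zero_of_ae (Eventually.of_forall fun σ => hg _ ?_)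
  have h1 : ‖t • (σ : R3)‖ = |t| := by
    rw [norm_smul, Real.norm_eq_abs, norm_eq_of_mem_sphere, mul_one]
  have := norm_sub_norm_le x (t • (σ : R3))
  linarith

theorem kirchhoff_eq_zero {g : R3 → G} {R : ℝ} (hg : ∀ x, R < ‖x‖ → g x = 0) {t : ℝ} {x : R3}
    (hx : R + |t| < ‖x‖) : kirchhoff g t x = 0 := by
  rw [kirchhoff, sphInt_eq_zero hg hx, smul_zero]

end SphericalMeans
end RegVM

namespace RegVM

/-! ### Directional derivatives, in general and on space-time. -/

section DirectionalDerivative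

variable {V G : Type} [NormedAddCommGroup V] [NormedSpace ℝ V] [NormedAddCommGroup G]
  [NormedSpace ℝ G]

/-- The derivative of `F` in the direction `v`. -/
def dirD (v : V) (F : V → G) (p : V) : G := fderiv ℝ F p v

theorem contDiff_dirD {F : V → G} (hF : ContDiff ℝ ∞ F) (v : V) : ContDiff ℝ ∞ (dirD v F) :=
  (hF.fderiv_right (by simp)).clm_apply contDiff_const

theorem continuous_dirD {F : V → G} (hF : ContDiff ℝ 1 F) (v : V) : Continuous (dirD v F) :=
  (hF.continuous_fderiv one_ne_zero).clm_apply continuous_const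

theorem dirD_comm {F : V → G} (hF : ContDiff ℝ ∞ F) (v w : V) :
    dirD v (dirD w F) = dirD w (dirD v F) := by
  have hd : Differentiable ℝ (fderiv ℝ F) :=
    (hF.fderiv_right (m := ∞) (by simp)).differentiable (by simp)
  have h : ∀ v w p, dirD v (dirD w F) p = fderiv ℝ (fderiv ℝ F) p v w := by
    intro v w p
    have := ((hd p).hasFDerivAt.clm_apply (hasFDerivAt_const w p)).fderiv
    unfold dirD
    rw [this]
    simp
  funext p
  rw [h, h]
  exact (((contDiff_infty.1 hF 2).contDiffAt (x := p)).isSymmSndFDerivAt (by simp)).eq v w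

theorem dirD_eq_zero {F : V → G} {U : Set V} (hU : IsOpen U) (h : ∀ p ∈ U, F p = 0) (v : V)
    {p : V} (hp : p ∈ U) : dirD v F p = 0 := by
  have : F =ᶠ[𝓝 p] fun _ => 0 := by
    filter_upwards [hU.mem_nhds hp] with q hq using h q hq
  rw [dirD, this.fderiv_eq]
  simp

end DirectionalDerivative

section SpaceTime

variable {G : Type} [NormedAddCommGroup G] [NormedSpace ℝ G]

/-- The unit vector of the time direction of `ℝ × ℝ³`. -/
def dirT : ℝ × R3 := (1, 0)

/-- The standard unit vectors of `ℝ³`. -/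
def basisVec (i : Fin 3) : R3 := EuclideanSpace.single i 1

/-- The unit vectors of the space directions of `ℝ × ℝ³`. -/
def dirX (i : Fin 3) : ℝ × R3 := (0, basisVec i)

theorem hasDerivAt_slice_time {F : ℝ × R3 → G} {s : ℝ} {y : R3} (hF : DifferentiableAt ℝ F (s, y)) :
    HasDerivAt (fun r => F (r, y)) (dirD dirT F (s, y)) s :=
  hF.hasFDerivAt.comp_hasDerivAt s ((hasDerivAt_id s).prodMk (hasDerivAt_const s y))

theorem hasFDerivAt_slice_space {F : ℝ × R3 → G} {s : ℝ} {y : R3}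
    (hF : DifferentiableAt ℝ F (s, y)) :
    HasFDerivAt (fun z => F (s, z)) ((fderiv ℝ F (s, y)).comp (ContinuousLinearMap.inr ℝ ℝ R3)) y :=
  hF.hasFDerivAt.comp y (hasFDerivAt_prodMk_right s y)

theorem fderiv_slice_space {F : ℝ × R3 → G} {s : ℝ} {y : R3} (hF : DifferentiableAt ℝ F (s, y))
    (v : R3) : fderiv ℝ (fun z => F (s, z)) y v = dirD (0, v) F (s, y) := by
  rw [(hasFDerivAt_slice_space hF).fderiv]
  simp [dirD]

end SpaceTime

/-! ### Polar coordinates. -/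

section Polar

theorem integral_polar (F : R3 → ℝ) (hF : Integrable F) :
    ∫ x, F x = ∫ r in Ioi (0 : ℝ), r ^ 2 *
      ∫ σ : Metric.sphere (0 : R3) 1, F (r • (σ : R3)) ∂sphereMeasure := by
  have hdim : Module.finrank ℝ R3 - 1 = 2 := by simp
  have hmp := (volume : Measure R3).measurePreserving_homeomorphUnitSphereProd
  rw [hdim] at hmp
  have hms : MeasurableSet ({0}ᶜ : Set R3) := (measurableSet_singleton _).compl
  have h1 : ∫ x, F x = ∫ x : ({0}ᶜ : Set R3), F x ∂((volume : Measure R3).comap (↑)) := by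
    rw [integral_subtype_comap hms, restrict_compl_singleton]
  have hsf : SigmaFinite (Measure.volumeIoiPow 2) := by infer_instance
  have h2 : ∫ x : ({0}ᶜ : Set R3), F x ∂((volume : Measure R3).comap (↑))
      = ∫ q : Metric.sphere (0 : R3) 1 × Ioi (0 : ℝ), F (q.2.1 • q.1.1)
          ∂(sphereMeasure.prod (Measure.volumeIoiPow 2)) := by
    rw [← hmp.integral_comp (Homeomorph.measurableEmbedding _)]
    refine integral_congr_ae (Eventually.of_forall fun x => ?_)
    simp only
    rw [← homeomorphUnitSphereProd_symm_apply_coe, Homeomorph.symm_apply_apply]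
  have hint : Integrable (fun q : Metric.sphere (0 : R3) 1 × Ioi (0 : ℝ) => F (q.2.1 • q.1.1))
      (sphereMeasure.prod (Measure.volumeIoiPow 2)) := by
    rw [← hmp.integrable_comp_emb (Homeomorph.measurableEmbedding _)]
    have : (fun q : Metric.sphere (0 : R3) 1 × Ioi (0 : ℝ) => F (q.2.1 • q.1.1)) ∘
        (homeomorphUnitSphereProd R3) = F ∘ (↑) := by
      funext x
      simp only [Function.comp]
      rw [← homeomorphUnitSphereProd_symm_apply_coe, Homeomorph.symm_apply_apply]
    rw [this, ← integrableOn_iff_comap_subtypeVal hms]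
    exact hF.integrableOn
  rw [h1, h2, integral_prod_symm _ hint]
  unfold Measure.volumeIoiPow
  have hm : Measurable fun r : Ioi (0 : ℝ) => Real.toNNReal (r.1 ^ 2) := by fun_prop
  have h3 := integral_withDensity_eq_integral_smul (μ := Measure.comap Subtype.val volume) hm
    (fun r : Ioi (0 : ℝ) => ∫ σ : Metric.sphere (0 : R3) 1, F (r.1 • (σ : R3)) ∂sphereMeasure)
  refine (Eq.trans ?_ h3).trans ?_
  · rfl
  · rw [← integral_subtype_comap measurableSet_Ioi (fun r : ℝ => r ^ 2 *
      ∫ σ : Metric.sphere (0 : R3) 1, F (r • (σ : R3)) ∂sphereMeasure)]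
    refine integral_congr_ae (Eventually.of_forall fun r => ?_)
    simp only [NNReal.smul_def, smul_eq_mul]
    rw [Real.coe_toNNReal _ (by positivity)]

end Polar

/-! ### The divergence theorem on spheres and the wave equation for spherical means. -/

section Wave

/-- The Laplacian. -/
def lapl (g : R3 → ℝ) (x : R3) : ℝ :=
  ∑ i, dirD (basisVec i) (dirD (basisVec i) g) x

theorem contDiff_radial {θ : ℝ → ℝ} (hθ : ContDiff ℝ ∞ θ) (h0 : tsupport θ ⊆ Ioi 0) :
    ContDiff ℝ ∞ fun y : R3 => θ ‖y‖ := by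
  rw [contDiff_iff_contDiffAt]
  intro y
  by_cases hy : y = 0
  · have h1 : (0 : ℝ) ∉ tsupport θ := fun h => lt_irrefl (0 : ℝ) (h0 h)
    have h2 : θ =ᶠ[𝓝 0] 0 := notMem_tsupport_iff_eventuallyEq.1 h1
    have h3 : Tendsto (fun y : R3 => ‖y‖) (𝓝 y) (𝓝 0) := by
      rw [hy]; simpa using (continuous_norm (E := R3)).tendsto 0
    exact (contDiffAt_const (c := (0 : ℝ))).congr_of_eventuallyEq (h3.eventually h2)
  · exact hθ.contDiffAt.comp y (contDiffAt_norm ℝ hy)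

theorem fderiv_radial {θ : ℝ → ℝ} (hθ : ContDiff ℝ ∞ θ) {y : R3} (hy : y ≠ 0) (v : R3) :
    fderiv ℝ (fun y : R3 => θ ‖y‖) y v = deriv θ ‖y‖ * (‖y‖⁻¹ * inner ℝ y v) := by
  have h2 : HasFDerivAt (fun y : R3 => ‖y‖) (‖y‖⁻¹ • innerSL ℝ y) y := by
    have h := (hasStrictFDerivAt_norm_sq y).hasFDerivAt.sqrt
      (by positivity : (‖y‖ ^ 2 : ℝ) ≠ 0)
    have e : (fun y : R3 => √(‖y‖ ^ 2)) = fun y => ‖y‖ := by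
      funext y; exact Real.sqrt_sq (norm_nonneg y)
    rw [e] at h
    refine h.congr_fderiv ?_
    rw [Real.sqrt_sq (norm_nonneg y)]
    ext w
    simp
    ring
  have h3 := ((hθ.differentiable (by simp) ‖y‖).hasDerivAt).comp_hasFDerivAt y h2
  have h4 : fderiv ℝ (fun y : R3 => θ ‖y‖) y = _ := h3.fderiv
  rw [h4]
  simp

theorem sum_inner_basisVec (A : R3 →L[ℝ] ℝ) (y : R3) :
    ∑ i, inner ℝ y (basisVec i) * A (basisVec i) = A y := by
  have h : y = ∑ i, y i • basisVec i := by
    ext j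
    simp [basisVec, Fin.sum_univ_three]
    fin_cases j <;> simp
  conv_rhs => rw [h]
  simp [basisVec, EuclideanSpace.inner_single_right]

/-- The divergence theorem on balls in weak form: integration by parts against a radial test
function leaves only the radial derivative of `φ`, since the gradient of `θ(|y|)` is `θ'(|y|) y /
|y|`. The support of `θ` avoids `0`, so the singularity of the norm does no harm. -/
theorem integral_radial_mul_lapl {θ : ℝ → ℝ} (hθ : ContDiff ℝ ∞ θ) (hc : HasCompactSupport θ)
    (h0 : tsupport θ ⊆ Ioi 0) {φ : R3 → ℝ} (hφ : ContDiff ℝ ∞ φ) :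
    ∫ y, θ ‖y‖ * lapl φ y = -∫ y, deriv θ ‖y‖ * (‖y‖⁻¹ * fderiv ℝ φ y y) := by
  have hΘ := contDiff_radial hθ h0
  have hcΘ : HasCompactSupport fun y : R3 => θ ‖y‖ := by
    obtain ⟨R, hR⟩ := hc.isBounded.subset_closedBall 0
    refine HasCompactSupport.of_support_subset_isCompact (isCompact_closedBall (0 : R3) R) ?_
    intro y hy
    have := hR (subset_tsupport θ hy)
    simpa using this
  have hparts : ∀ i, ∫ y, θ ‖y‖ * dirD (basisVec i) (dirD (basisVec i) φ) y
      = -∫ y, dirD (basisVec i) (fun y : R3 => θ ‖y‖) y * dirD (basisVec i) φ y := by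
    intro i
    have c1 := contDiff_dirD hφ (basisVec i)
    have c2 := contDiff_dirD c1 (basisVec i)
    have c3 := contDiff_dirD hΘ (basisVec i)
    refine integral_mul_fderiv_eq_neg_fderiv_mul_of_integrable ?_ ?_ ?_ ?_ ?_
    · exact (c3.continuous.mul c1.continuous).integrable_of_hasCompactSupport
        ((hcΘ.fderiv_apply (𝕜 := ℝ) _).mul_right)
    · exact (hΘ.continuous.mul c2.continuous).integrable_of_hasCompactSupport hcΘ.mul_right
    · exact (hΘ.continuous.mul c1.continuous).integrable_of_hasCompactSupport hcΘ.mul_right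
    · exact fun x _ => hΘ.differentiable (by simp) x
    · exact fun x _ => c1.differentiable (by simp) x
  have hi1 : ∀ i ∈ Finset.univ, Integrable fun y : R3 => θ ‖y‖ *
      dirD (basisVec i) (dirD (basisVec i) φ) y := fun i _ =>
    (hΘ.continuous.mul (contDiff_dirD (contDiff_dirD hφ (basisVec i))
      (basisVec i)).continuous).integrable_of_hasCompactSupport hcΘ.mul_right
  have hi2 : ∀ i ∈ Finset.univ, Integrable fun y : R3 =>
      dirD (basisVec i) (fun y : R3 => θ ‖y‖) y * dirD (basisVec i) φ y := fun i _ =>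
    ((contDiff_dirD hΘ (basisVec i)).continuous.mul
      (contDiff_dirD hφ (basisVec i)).continuous).integrable_of_hasCompactSupport
        ((hcΘ.fderiv_apply (𝕜 := ℝ) _).mul_right)
  simp only [lapl, Finset.mul_sum]
  rw [integral_finsetSum _ hi1, Finset.sum_congr rfl fun i _ => hparts i, Finset.sum_neg_distrib,
    ← integral_finsetSum _ hi2]
  congr 1
  have hne : ∀ᵐ y : R3, y ≠ 0 := by simp [ae_iff, measure_singleton]
  refine integral_congr_ae ?_
  filter_upwards [hne] with y hy
  have := sum_inner_basisVec (fderiv ℝ φ y) y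
  simp only [dirD, fderiv_radial hθ hy]
  rw [← this, Finset.mul_sum, Finset.mul_sum]
  exact Finset.sum_congr rfl fun i _ => by ring

theorem integrable_radial_mul {θ : ℝ → ℝ} (hθ : Continuous θ) (hc : HasCompactSupport θ)
    (h0 : tsupport θ ⊆ Ioi 0) {k : R3 → ℝ} (hk : ∀ y, y ≠ 0 → ContinuousAt k y) :
    Integrable fun y : R3 => θ ‖y‖ * k y := by
  have hcont : Continuous fun y : R3 => θ ‖y‖ * k y := by
    rw [continuous_iff_continuousAt]
    intro y
    by_cases hy : y = 0
    · have h1 : (0 : ℝ) ∉ tsupport θ := fun h => lt_irrefl (0 : ℝ) (h0 h)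
      have h2 : θ =ᶠ[𝓝 0] 0 := notMem_tsupport_iff_eventuallyEq.1 h1
      have h3 : Tendsto (fun y : R3 => ‖y‖) (𝓝 y) (𝓝 0) := by
        rw [hy]; simpa using (continuous_norm (E := R3)).tendsto 0
      refine (continuousAt_const (y := (0 : ℝ))).congr ?_
      filter_upwards [h3.eventually h2] with z hz
      simp [hz]
    · exact (hθ.comp continuous_norm).continuousAt.mul (hk y hy)
  refine hcont.integrable_of_hasCompactSupport ?_
  obtain ⟨R, hR⟩ := hc.isBounded.subset_closedBall 0
  refine HasCompactSupport.of_support_subset_isCompact (isCompact_closedBall (0 : R3) R) ?_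
  intro y hy
  have : ‖y‖ ∈ tsupport θ := subset_tsupport θ (left_ne_zero_of_mul hy)
  simpa using hR this

end Wave
end RegVM

namespace RegVM
section Wave

/-- The flux of the gradient of `φ` through the unit sphere, at dilation `r`. -/
def sphFlux (φ : R3 → ℝ) (r : ℝ) (x : R3) : ℝ :=
  ∫ σ : Metric.sphere (0 : R3) 1, fderiv ℝ φ (x + r • (σ : R3)) σ ∂sphereMeasure

theorem contDiff_sphFlux {φ : R3 → ℝ} (hφ : ContDiff ℝ ∞ φ) (x : R3) :
    ContDiff ℝ ∞ fun r => sphFlux φ r x := by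
  refine contDiff_integral_sphere (P := ℝ)
    (F := fun q : ℝ × R3 => fderiv ℝ φ (x + q.1 • q.2) q.2) ?_
  have h : ContDiff ℝ ∞ fun q : ℝ × R3 => x + q.1 • q.2 := by fun_prop
  exact ((hφ.fderiv_right (m := ∞) (by simp)).comp h).clm_apply contDiff_snd

theorem contDiff_lapl {φ : R3 → ℝ} (hφ : ContDiff ℝ ∞ φ) : ContDiff ℝ ∞ (lapl φ) :=
  ContDiff.sum fun i _ => contDiff_dirD (contDiff_dirD hφ (basisVec i)) (basisVec i)

theorem hasDerivAt_sphInt_neg {φ : R3 → ℝ} (hφ : ContDiff ℝ ∞ φ) (r : ℝ) (x : R3) :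
    HasDerivAt (fun s => sphInt φ (-s) x) (sphFlux φ r x) r := by
  have h := (hasDerivAt_sphInt_time hφ (-r) x).comp r (hasDerivAt_neg r)
  refine HasDerivAt.congr_deriv (f := fun s => sphInt φ (-s) x) h ?_
  rw [mul_neg_one, neg_neg, sphFlux]
  simp only [neg_smul, sub_neg_eq_add]

/-- The flux of `∇φ` through the sphere of radius `s` is `s² sphFlux φ s 0`, and its growth in `s`
is the integral of `Δφ` over that sphere. Written in polar coordinates, `integral_radial_mul_lapl`
is the weak form of this identity on the half-line. Both sides are continuous, so the fundamental
lemma of the calculus of variations makes it pointwise. -/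
theorem deriv_sq_mul_sphFlux_zero {φ : R3 → ℝ} (hφ : ContDiff ℝ ∞ φ) {r : ℝ} (hr : 0 < r) :
    deriv (fun s => s ^ 2 * sphFlux φ s 0) r = r ^ 2 * sphInt (lapl φ) (-r) 0 := by
  set h : ℝ → ℝ := fun s => s ^ 2 * sphFlux φ s 0 with hh
  set q : ℝ → ℝ := fun s => s ^ 2 * sphInt (lapl φ) (-s) 0 with hq
  have hsm : ContDiff ℝ ∞ h := (contDiff_id.pow 2).mul (contDiff_sphFlux hφ 0)
  have hdc : Continuous (deriv h) := hsm.continuous_deriv (by simp)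
  have hqc : Continuous q := by
    have h1 : ContDiff ℝ ∞ fun s : ℝ => sphInt (lapl φ) (-s) 0 :=
      (contDiff_sphInt (contDiff_lapl hφ)).comp (g := fun p : ℝ × R3 => sphInt (lapl φ) p.1 p.2)
        (f := fun s : ℝ => (-s, (0 : R3))) (by fun_prop)
    exact (continuous_pow 2).mul h1.continuous
  have key : ∀ θ : ℝ → ℝ, ContDiff ℝ ∞ θ → HasCompactSupport θ → tsupport θ ⊆ Ioi 0 →
      ∫ s, θ s • (deriv h s - q s) = 0 := by
    intro θ hθ hc h0
    have hzero : ∀ s, s ∉ Ioi (0 : ℝ) → θ s = 0 := fun s hs =>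
      image_eq_zero_of_notMem_tsupport fun hx => hs (h0 hx)
    have hzero' : ∀ s, s ∉ Ioi (0 : ℝ) → deriv θ s = 0 := fun s hs =>
      image_eq_zero_of_notMem_tsupport fun hx => hs (h0 (tsupport_deriv_subset (𝕜 := ℝ) hx))
    have hdθ : ContDiff ℝ ∞ (deriv θ) := ((contDiff_infty_iff_deriv).1 hθ).2
    have hdc' : HasCompactSupport (deriv θ) := hc.deriv
    have hL := integral_polar (fun y => θ ‖y‖ * lapl φ y)
      (integrable_radial_mul hθ.continuous hc h0
        fun y _ => (contDiff_lapl hφ).continuous.continuousAt)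
    have hR := integral_polar (fun y => deriv θ ‖y‖ * (‖y‖⁻¹ * fderiv ℝ φ y y))
      (integrable_radial_mul hdθ.continuous hdc'
        ((tsupport_deriv_subset (𝕜 := ℝ)).trans h0) fun y hy =>
        ((continuous_norm.continuousAt).inv₀ (norm_ne_zero_iff.2 hy)).mul
          ((hφ.continuous_fderiv (by simp)).clm_apply continuous_id).continuousAt)
    have hLR := integral_radial_mul_lapl hθ hc h0 hφ
    have eL : ∫ y, θ ‖y‖ * lapl φ y = ∫ s, θ s * q s := by
      rw [hL, ← setIntegral_eq_integral_of_forall_compl_eq_zero (s := Ioi (0 : ℝ))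
        (f := fun s => θ s * q s) (fun s hs => by simp [hzero s hs])]
      refine setIntegral_congr_fun measurableSet_Ioi fun s hs => ?_
      have hs : 0 < s := hs
      have hn : ∀ σ : Metric.sphere (0 : R3) 1, ‖s • (σ : R3)‖ = s := fun σ => by
        rw [norm_smul, norm_eq_of_mem_sphere, mul_one, Real.norm_of_nonneg hs.le]
      simp only [hn, integral_const_mul, hq, sphInt]
      simp
      ring
    have eR : ∫ y, deriv θ ‖y‖ * (‖y‖⁻¹ * fderiv ℝ φ y y) = ∫ s, deriv θ s * h s := by
      rw [hR, ← setIntegral_eq_integral_of_forall_compl_eq_zero (s := Ioi (0 : ℝ))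
        (f := fun s => deriv θ s * h s) (fun s hs => by simp [hzero' s hs])]
      refine setIntegral_congr_fun measurableSet_Ioi fun s hs => ?_
      have hs : 0 < s := hs
      have hn : ∀ σ : Metric.sphere (0 : R3) 1, ‖s • (σ : R3)‖ = s := fun σ => by
        rw [norm_smul, norm_eq_of_mem_sphere, mul_one, Real.norm_of_nonneg hs.le]
      have hm : ∀ σ : Metric.sphere (0 : R3) 1, s⁻¹ * fderiv ℝ φ (s • (σ : R3)) (s • (σ : R3))
          = fderiv ℝ φ (0 + s • (σ : R3)) σ := fun σ => by
        rw [map_smul, smul_eq_mul, inv_mul_cancel_left₀ hs.ne', zero_add]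
      simp only [hn, integral_const_mul, hm, hh, sphFlux]
      ring
    have hibp : ∫ s, θ s * deriv h s = -∫ s, deriv θ s * h s := by
      have i1 : Integrable fun s => deriv θ s * h s :=
        (hdθ.continuous.mul hsm.continuous).integrable_of_hasCompactSupport hdc'.mul_right
      have i2 : Integrable fun s => θ s * deriv h s :=
        (hθ.continuous.mul hdc).integrable_of_hasCompactSupport hc.mul_right
      have i3 : Integrable fun s => θ s * h s :=
        (hθ.continuous.mul hsm.continuous).integrable_of_hasCompactSupport hc.mul_right
      have := integral_mul_fderiv_eq_neg_fderiv_mul_of_integrable (μ := (volume : Measure ℝ))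
        (f := θ) (g := h) (v := (1 : ℝ)) (by simpa only [fderiv_apply_one_eq_deriv] using i1)
        (by simpa only [fderiv_apply_one_eq_deriv] using i2) i3
        (fun x _ => hθ.differentiable (by simp) x) (fun x _ => hsm.differentiable (by simp) x)
      simpa only [fderiv_apply_one_eq_deriv] using this
    have i1 : Integrable fun s => θ s * deriv h s :=
      (hθ.continuous.mul hdc).integrable_of_hasCompactSupport hc.mul_right
    have i2 : Integrable fun s => θ s * q s :=
      (hθ.continuous.mul hqc).integrable_of_hasCompactSupport hc.mul_right
    simp only [smul_eq_mul, mul_sub]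
    rw [integral_sub i1 i2, hibp, ← eR, ← eL, hLR, sub_self]
  have hae := isOpen_Ioi.ae_eq_zero_of_integral_contDiff_smul_eq_zero (μ := (volume : Measure ℝ))
    (f := fun s => deriv h s - q s) ((hdc.sub hqc).locallyIntegrable.locallyIntegrableOn _) key
  have heq : EqOn (fun s => deriv h s - q s) 0 (Ioi 0) := by
    refine Measure.eqOn_open_of_ae_eq (μ := (volume : Measure ℝ)) ?_ isOpen_Ioi
      (hdc.sub hqc).continuousOn continuousOn_const
    rw [Filter.EventuallyEq, ae_restrict_iff' measurableSet_Ioi]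
    exact hae
  exact sub_eq_zero.1 (heq hr)

theorem deriv_sq_mul_sphFlux {φ : R3 → ℝ} (hφ : ContDiff ℝ ∞ φ) {r : ℝ} (hr : 0 < r) (x : R3) :
    deriv (fun s => s ^ 2 * sphFlux φ s x) r = r ^ 2 * sphInt (lapl φ) (-r) x := by
  have h := deriv_sq_mul_sphFlux_zero (φ := fun y => φ (x + y)) (hφ.comp (by fun_prop)) hr
  have hd : ∀ (g : R3 → ℝ) (y : R3), fderiv ℝ (fun y => g (x + y)) y = fderiv ℝ g (x + y) :=
    fun g y => fderiv_comp_add_left (f := g) x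
  have h1 : ∀ s, sphFlux (fun y => φ (x + y)) s 0 = sphFlux φ s x := fun s => by
    simp [sphFlux, hd]
  have h2 : lapl (fun y => φ (x + y)) = fun y => lapl φ (x + y) := by
    funext y
    have : ∀ v, dirD v (fun y => φ (x + y)) = fun y => dirD v φ (x + y) := fun v => by
      funext z; simp only [dirD, hd]
    simp only [lapl, this]
    refine Finset.sum_congr rfl fun i _ => ?_
    simp only [dirD]
    rw [hd (fun y => fderiv ℝ φ y (basisVec i))]
    rfl
  rw [h2] at h
  simp only [h1] at h
  rw [h]
  simp [sphInt, sub_eq_add_neg]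

/-- `(τ, y) ↦ (τ / 4π) ∫ ψ(y + τσ) dσ`, the solution of the wave equation with data `(0, ψ)`. -/
def spread (ψ : R3 → ℝ) (p : ℝ × R3) : ℝ :=
  p.1 / (4 * Real.pi) * sphInt ψ (-p.1) p.2

theorem contDiff_spread {ψ : R3 → ℝ} (hψ : ContDiff ℝ ∞ ψ) : ContDiff ℝ ∞ (spread ψ) := by
  have h : ContDiff ℝ ∞ fun p : ℝ × R3 => sphInt ψ (-p.1) p.2 :=
    (contDiff_sphInt hψ).comp (f := fun p : ℝ × R3 => (-p.1, p.2)) (by fun_prop)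
  unfold spread
  fun_prop

theorem spread_eq_zero {ψ : R3 → ℝ} {R : ℝ} (hψ : ∀ x, R < ‖x‖ → ψ x = 0) {p : ℝ × R3}
    (hp : R + |p.1| < ‖p.2‖) : spread ψ p = 0 := by
  rw [spread, sphInt_eq_zero hψ (by rwa [abs_neg]), mul_zero]

theorem dirX_spread {ψ : R3 → ℝ} (hψ : ContDiff ℝ ∞ ψ) (i : Fin 3) :
    dirD (dirX i) (spread ψ) = spread (dirD (basisVec i) ψ) := by
  funext ⟨s, y⟩
  rw [dirX, ← fderiv_slice_space ((contDiff_spread hψ).differentiable (by simp) _)]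
  simp only [spread]
  have hd : DifferentiableAt ℝ (sphInt ψ (-s)) y :=
    ((contDiff_sphInt hψ).comp (f := fun y : R3 => (-s, y))
      (by fun_prop)).differentiable (by simp) y
  rw [fderiv_const_mul hd]
  simp only [_root_.smul_apply, smul_eq_mul]
  rw [fderiv_sphInt_space hψ]
  rfl

theorem dirT_spread {ψ : R3 → ℝ} (hψ : ContDiff ℝ ∞ ψ) (s : ℝ) (y : R3) :
    dirD dirT (spread ψ) (s, y) = (4 * Real.pi)⁻¹ * (sphInt ψ (-s) y + s * sphFlux ψ s y) := by
  have h1 := hasDerivAt_slice_time ((contDiff_spread hψ).differentiable (by simp) (s, y))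
  have h2 : HasDerivAt (fun r => spread ψ (r, y)) _ s :=
    ((hasDerivAt_id s).div_const (4 * Real.pi)).mul (hasDerivAt_sphInt_neg hψ s y)
  rw [h1.unique h2]
  simp only [id]
  ring

/-- Let `M` be the spherical integral of `ψ` and `N = M'` its flux. Two time derivatives of `s M /
4π` give `(2 N + s N') / 4π`. The flux identity `(s² N)' = s² M[Δψ]`, divided by `s`, identifies `2
N + s N'` with `s M[Δψ]`, and the Laplacian commutes with spherical means. -/
theorem spread_wave {ψ : R3 → ℝ} (hψ : ContDiff ℝ ∞ ψ) {s : ℝ} (hs : 0 < s) (y : R3) :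
    dirD dirT (dirD dirT (spread ψ)) (s, y)
      = ∑ i, dirD (dirX i) (dirD (dirX i) (spread ψ)) (s, y) := by
  have h1 := hasDerivAt_slice_time
    ((contDiff_dirD (contDiff_spread hψ) dirT).differentiable (by simp) (s, y))
  have hN := ((contDiff_sphFlux hψ y).differentiable (by simp) s).hasDerivAt
  have h2 : HasDerivAt (fun r => (4 * Real.pi)⁻¹ * (sphInt ψ (-r) y + r * sphFlux ψ r y)) _ s :=
    ((hasDerivAt_sphInt_neg hψ s y).add ((hasDerivAt_id s).mul hN)).const_mul _
  simp only [dirT_spread hψ] at h1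
  rw [h1.unique h2]
  have h3 := deriv_sq_mul_sphFlux hψ hs y
  rw [((hasDerivAt_pow 2 s).fun_mul hN).deriv] at h3
  have h4 : ∑ i, dirD (dirX i) (dirD (dirX i) (spread ψ)) (s, y) = spread (lapl ψ) (s, y) := by
    have : ∀ i, dirD (dirX i) (dirD (dirX i) (spread ψ)) (s, y)
        = spread (dirD (basisVec i) (dirD (basisVec i) ψ)) (s, y) := fun i => by
      rw [dirX_spread hψ, dirX_spread (contDiff_dirD hψ _)]
    simp only [this, spread, sphInt, lapl]
    rw [← Finset.mul_sum, integral_finsetSum]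
    intro i _
    exact integrable_sphere ((contDiff_dirD (contDiff_dirD hψ (basisVec i))
      (basisVec i)).continuous.comp (by fun_prop))
  rw [h4, spread]
  have hs' : s ≠ 0 := hs.ne'
  have h5 : 2 * sphFlux ψ s y + s * deriv (fun r => sphFlux ψ r y) s
      = s * sphInt (lapl ψ) (-s) y := by
    apply mul_left_cancel₀ hs'
    simp only [Nat.cast_ofNat, Nat.add_one_sub_one, pow_one] at h3
    linarith [h3]
  have e : (s / (4 * Real.pi)) * sphInt (lapl ψ) (-s) y
      = (4 * Real.pi)⁻¹ * (s * sphInt (lapl ψ) (-s) y) := by ring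
  simp only [id]
  rw [e, ← h5]
  ring

theorem spread_zero (ψ : R3 → ℝ) (y : R3) : spread ψ (0, y) = 0 := by simp [spread]

/-- The normalization `1 / 4π` is the reciprocal of the area of the unit sphere, which is `3` times
the volume of the unit ball; the flux term carries the factor `s = 0`. -/
theorem dirT_spread_zero {ψ : R3 → ℝ} (hψ : ContDiff ℝ ∞ ψ) (y : R3) :
    dirD dirT (spread ψ) (0, y) = ψ y := by
  have hvol : sphereMeasure.real univ = 4 * Real.pi := by
    rw [Measure.toSphere_real_apply_univ]
    simp [Measure.real, EuclideanSpace.volume_ball_fin_three]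
    rw [ENNReal.toReal_ofReal (by positivity)]
    ring
  rw [dirT_spread hψ]
  simp only [sphInt, neg_zero, zero_smul, sub_zero, integral_const, hvol, smul_eq_mul, zero_mul,
    add_zero]
  field_simp
end Wave
end RegVM

namespace RegVM
-- Pairing a Maxwell-type system with a solution of the wave equation.
section MaxwellDuality

theorem integrable_slice {g : R3 → ℝ} {R : ℝ} (hg : Continuous g) (h0 : ∀ y, R < ‖y‖ → g y = 0) :
    Integrable g :=
  hg.integrable_of_hasCompactSupport (HasCompactSupport.intro (isCompact_closedBall 0 R)
    fun y hy => h0 y (by simpa using hy))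

theorem contDiffAt_of_pos {G : Type} [NormedAddCommGroup G] [NormedSpace ℝ G] {F : ℝ × R3 → G}
    (hF : ContDiffOn ℝ 1 F (Ici 0 ×ˢ univ)) {p : ℝ × R3} (hp : 0 < p.1) : ContDiffAt ℝ 1 F p :=
  hF.contDiffAt (prod_mem_nhds (Ici_mem_nhds hp) univ_mem)

/-- All slices live in one ball, and the time derivative is bounded there for times in a compact
subinterval; this constant on the ball is the dominating function. Differentiability is only
required inside the interval, since the fields are `C¹` on a half-space only. -/
theorem hasDerivAt_integral_slices {F : ℝ × R3 → ℝ} {a b R : ℝ}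
    (hF : ContDiffOn ℝ 1 F (Ioo a b ×ˢ univ))
    (h0 : ∀ s ∈ Ioo a b, ∀ y, R < ‖y‖ → F (s, y) = 0) {s : ℝ} (hs : s ∈ Ioo a b) :
    Integrable (fun y => dirD dirT F (s, y)) ∧
    HasDerivAt (fun s => ∫ y, F (s, y)) (∫ y, dirD dirT F (s, y)) s := by
  have hopen : IsOpen (Ioo a b ×ˢ (univ : Set R3)) := isOpen_Ioo.prod isOpen_univ
  obtain ⟨a', b', hab, hsub'⟩ : ∃ a' b', s ∈ Ioo a' b' ∧ Icc a' b' ⊆ Ioo a b :=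
    ⟨(a + s) / 2, (s + b) / 2, ⟨by linarith [hs.1], by linarith [hs.2]⟩, fun x hx =>
      ⟨by linarith [hx.1, hs.1], by linarith [hx.2, hs.2]⟩⟩
  have hdiff : ∀ r ∈ Ioo a b, ∀ y, HasDerivAt (fun s => F (s, y)) (dirD dirT F (r, y)) r :=
    fun r hr y => hasDerivAt_slice_time
      ((hF.contDiffAt (hopen.mem_nhds ⟨hr, trivial⟩)).differentiableAt one_ne_zero)
  have hdc : ContinuousOn (dirD dirT F) (Ioo a b ×ˢ univ) :=
    (hF.continuousOn_fderiv_of_isOpen hopen le_rfl).clm_apply continuousOn_const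
  have hd0 : ∀ r ∈ Ioo a b, ∀ y, R < ‖y‖ → dirD dirT F (r, y) = 0 := by
    intro r hr y hy
    have h1 : (fun s => F (s, y)) =ᶠ[𝓝 r] fun _ => 0 := by
      filter_upwards [isOpen_Ioo.mem_nhds hr] with q hq using h0 q hq y hy
    exact (hdiff r hr y).unique ((hasDerivAt_const r (0 : ℝ)).congr_of_eventuallyEq h1)
  obtain ⟨C, hC⟩ := (isCompact_Icc.prod (isCompact_closedBall (0 : R3) R)).exists_bound_of_continuousOn
    (hdc.mono (prod_mono hsub' (subset_univ _)))
  have hsl : ∀ r ∈ Ioo a b, Continuous fun y => F (r, y) := fun r hr =>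
    continuous_iff_continuousAt.2 fun y =>
      ((hF.continuousOn).continuousAt (hopen.mem_nhds (x := (r, y)) ⟨hr, trivial⟩)).comp
        (f := fun y => (r, y)) (by fun_prop)
  have hsl' : ∀ r ∈ Ioo a b, Continuous fun y => dirD dirT F (r, y) := fun r hr =>
    continuous_iff_continuousAt.2 fun y =>
      (hdc.continuousAt (hopen.mem_nhds (x := (r, y)) ⟨hr, trivial⟩)).comp
        (f := fun y => (r, y)) (by fun_prop)
  refine hasDerivAt_integral_of_dominated_loc_of_deriv_le (F := fun s y => F (s, y))
    (F' := fun s y => dirD dirT F (s, y)) (s := Ioo a' b') (Ioo_mem_nhds hab.1 hab.2)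
    (bound := (Metric.closedBall (0 : R3) R).indicator fun _ => C)
    ?_ (integrable_slice (hsl s hs) (h0 s hs)) (hsl' s hs).aestronglyMeasurable
    (Eventually.of_forall fun y r hr => ?_) ?_ (Eventually.of_forall fun y r hr => ?_)
  · filter_upwards [isOpen_Ioo.mem_nhds hs] with r hr using (hsl r hr).aestronglyMeasurable
  · by_cases hy : y ∈ Metric.closedBall (0 : R3) R
    · rw [indicator_of_mem hy]
      exact hC (r, y) ⟨Ioo_subset_Icc_self hr, hy⟩
    · rw [indicator_of_notMem hy, hd0 r (hsub' (Ioo_subset_Icc_self hr)) y (by simpa using hy),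
        norm_zero]
  · exact (integrable_indicator_iff Metric.isClosed_closedBall.measurableSet).2
      (integrableOn_const (by exact (measure_closedBall_lt_top).ne))
  · exact hdiff r (hsub' (Ioo_subset_Icc_self hr)) y

/-- `f` is integrable with integral `0`. -/
def ZeroIntegral (f : R3 → ℝ) : Prop := Integrable f ∧ ∫ y, f y = 0

theorem ZeroIntegral.add {f g : R3 → ℝ} (hf : ZeroIntegral f) (hg : ZeroIntegral g) :
    ZeroIntegral fun y => f y + g y :=
  ⟨hf.1.add hg.1, by rw [integral_add hf.1 hg.1, hf.2, hg.2, add_zero]⟩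

theorem ZeroIntegral.sub {f g : R3 → ℝ} (hf : ZeroIntegral f) (hg : ZeroIntegral g) :
    ZeroIntegral fun y => f y - g y :=
  ⟨hf.1.sub hg.1, by rw [integral_sub hf.1 hg.1, hf.2, hg.2, sub_zero]⟩

/-- Integration by parts, in the form that a total derivative has integral zero. Bundled with
integrability, several instances can be added and subtracted at once. -/
theorem zeroIntegral_fderiv_mul {f g : R3 → ℝ} {R : ℝ} (hf : ContDiff ℝ 1 f)
    (h0 : ∀ y, R < ‖y‖ → f y = 0) (hg : ContDiff ℝ 1 g) (v : R3) :
    ZeroIntegral fun y => fderiv ℝ f y v * g y + f y * fderiv ℝ g y v := by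
  have hcs : HasCompactSupport f := HasCompactSupport.intro (isCompact_closedBall 0 R)
    fun y hy => h0 y (by simpa using hy)
  have i1 : Integrable fun y => fderiv ℝ f y v * g y :=
    ((continuous_dirD hf v).mul hg.continuous).integrable_of_hasCompactSupport
      ((hcs.fderiv_apply (𝕜 := ℝ) v).mul_right)
  have i2 : Integrable fun y => f y * fderiv ℝ g y v :=
    (hf.continuous.mul (continuous_dirD hg v)).integrable_of_hasCompactSupport hcs.mul_right
  have i3 : Integrable fun y => f y * g y :=
    (hf.continuous.mul hg.continuous).integrable_of_hasCompactSupport hcs.mul_right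
  refine ⟨i1.add i2, ?_⟩
  rw [integral_add i1 i2, integral_mul_fderiv_eq_neg_fderiv_mul_of_integrable i1 i2 i3
    (fun x _ => hf.differentiable one_ne_zero x) (fun x _ => hg.differentiable one_ne_zero x),
    add_neg_cancel]

theorem contDiff_slice_of_pos {F : ℝ × R3 → ℝ} (hF : ContDiffOn ℝ 1 F (Ici 0 ×ˢ univ)) {s : ℝ}
    (hs : 0 ≤ s) : ContDiff ℝ 1 fun y => F (s, y) :=
  contDiffOn_univ.1 (hF.comp (f := fun y : R3 => (s, y)) (by fun_prop) fun _ _ => ⟨hs, trivial⟩)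

theorem zeroIntegral_dirX_mul {f g : ℝ × R3 → ℝ} {R : ℝ} (hf : ContDiff ℝ ∞ f) {s : ℝ} (hs : 0 < s)
    (h0 : ∀ y, R < ‖y‖ → f (s, y) = 0) (hg : ContDiffOn ℝ 1 g (Ici 0 ×ˢ univ)) (i : Fin 3) :
    ZeroIntegral fun y => dirD (dirX i) f (s, y) * g (s, y) + f (s, y) * dirD (dirX i) g (s, y) := by
  have h := zeroIntegral_fderiv_mul (f := fun y => f (s, y)) (g := fun y => g (s, y)) (R := R)
    ((hf.of_le (by simp)).comp (by fun_prop)) h0 (contDiff_slice_of_pos hg hs.le) (basisVec i)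
  have e1 : ∀ y, fderiv ℝ (fun y => f (s, y)) y (basisVec i) = dirD (dirX i) f (s, y) := fun y =>
    fderiv_slice_space (hf.differentiable (by simp) _) _
  have e2 : ∀ y, fderiv ℝ (fun y => g (s, y)) y (basisVec i) = dirD (dirX i) g (s, y) := fun y =>
    fderiv_slice_space ((contDiffAt_of_pos hg (p := (s, y)) hs).differentiableAt one_ne_zero) _
  simpa only [e1, e2] using h

theorem dirD_mul {f g : ℝ × R3 → ℝ} {p v : ℝ × R3} (hf : DifferentiableAt ℝ f p)
    (hg : DifferentiableAt ℝ g p) :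
    dirD v (fun q => f q * g q) p = dirD v f p * g p + f p * dirD v g p := by
  simp only [dirD]
  rw [fderiv_fun_mul hf hg]
  simp
  ring

variable {w e₁ e₂ e₃ b₂ b₃ ρ j k₂ k₃ : ℝ × R3 → ℝ} {i₁ i₂ i₃ : Fin 3} {t R : ℝ}

/-- The duality functional of the component `e₁` of the electric field. -/
def dualFunctional (w e₁ b₂ b₃ : ℝ × R3 → ℝ) (i₂ i₃ : Fin 3) (p : ℝ × R3) : ℝ :=
  -(dirD dirT w p * e₁ p) - (dirD (dirX i₂) w p * b₃ p - dirD (dirX i₃) w p * b₂ p)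

/-- The contribution of the sources. -/
def dualSource (w ρ j k₂ k₃ : ℝ × R3 → ℝ) (i₁ i₂ i₃ : Fin 3) (p : ℝ × R3) : ℝ :=
  dirD (dirX i₁) w p * ρ p + dirD dirT w p * j p
    + (dirD (dirX i₂) w p * k₃ p - dirD (dirX i₃) w p * k₂ p)

/-- A wave equation for `e₁` would need second derivatives of the fields. Here they are paired with
first derivatives of the smooth `w`, so the system is used as it stands. The fictitious sources
`k₂`, `k₃` in the equations for `b` make the statement invariant under the exchange of electric and
magnetic fields, so one computation serves both. -/
theorem hasDerivAt_dualFunctional (hw : ContDiff ℝ ∞ w)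
    (hw0 : ∀ s ∈ Ioo 0 t, ∀ y, R < ‖y‖ → w (s, y) = 0)
    (hwave : ∀ s ∈ Ioo 0 t, ∀ y, dirD dirT (dirD dirT w) (s, y) =
      dirD (dirX i₁) (dirD (dirX i₁) w) (s, y) + dirD (dirX i₂) (dirD (dirX i₂) w) (s, y)
        + dirD (dirX i₃) (dirD (dirX i₃) w) (s, y))
    (he₁ : ContDiffOn ℝ 1 e₁ (Ici 0 ×ˢ univ)) (he₂ : ContDiffOn ℝ 1 e₂ (Ici 0 ×ˢ univ))
    (he₃ : ContDiffOn ℝ 1 e₃ (Ici 0 ×ˢ univ)) (hb₂ : ContDiffOn ℝ 1 b₂ (Ici 0 ×ˢ univ))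
    (hb₃ : ContDiffOn ℝ 1 b₃ (Ici 0 ×ˢ univ))
    (hρ : ContinuousOn ρ (Ici 0 ×ˢ univ)) (hj : ContinuousOn j (Ici 0 ×ˢ univ))
    (hk₂ : ContinuousOn k₂ (Ici 0 ×ˢ univ)) (hk₃ : ContinuousOn k₃ (Ici 0 ×ˢ univ))
    (h1 : ∀ s, 0 < s → ∀ y, dirD dirT e₁ (s, y)
      = dirD (dirX i₂) b₃ (s, y) - dirD (dirX i₃) b₂ (s, y) - j (s, y))
    (h2 : ∀ s, 0 < s → ∀ y, dirD dirT b₂ (s, y)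
      = -(dirD (dirX i₃) e₁ (s, y) - dirD (dirX i₁) e₃ (s, y)) - k₂ (s, y))
    (h3 : ∀ s, 0 < s → ∀ y, dirD dirT b₃ (s, y)
      = -(dirD (dirX i₁) e₂ (s, y) - dirD (dirX i₂) e₁ (s, y)) - k₃ (s, y))
    (h4 : ∀ s, 0 < s → ∀ y, dirD (dirX i₁) e₁ (s, y) + dirD (dirX i₂) e₂ (s, y)
      + dirD (dirX i₃) e₃ (s, y) = ρ (s, y)) {s : ℝ} (hs : s ∈ Ioo 0 t) :
    HasDerivAt (fun s => ∫ y, dualFunctional w e₁ b₂ b₃ i₂ i₃ (s, y))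
      (∫ y, dualSource w ρ j k₂ k₃ i₁ i₂ i₃ (s, y)) s := by
  have hsub : Ioo 0 t ×ˢ (univ : Set R3) ⊆ Ici 0 ×ˢ univ :=
    prod_mono (Ioo_subset_Ioi_self.trans Ioi_subset_Ici_self) le_rfl
  have cT := contDiff_dirD hw dirT
  have cX := fun i => contDiff_dirD hw (dirX i)
  have hd0 : ∀ v, ∀ s ∈ Ioo 0 t, ∀ y, R < ‖y‖ → dirD v w (s, y) = 0 := fun v s hs y hy =>
    dirD_eq_zero (U := Ioo 0 t ×ˢ {y : R3 | R < ‖y‖})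
      (isOpen_Ioo.prod (isOpen_lt continuous_const continuous_norm))
      (fun p hp => hw0 p.1 hp.1 p.2 hp.2) v (p := (s, y)) ⟨hs, hy⟩
  have hA := hasDerivAt_integral_slices (F := dualFunctional w e₁ b₂ b₃ i₂ i₃) (R := R) (b := t)
    (by
      unfold dualFunctional
      exact (((cT.of_le (by simp)).contDiffOn.mul (he₁.mono hsub)).neg).sub
        ((((cX i₂).of_le (by simp)).contDiffOn.mul (hb₃.mono hsub)).sub
          (((cX i₃).of_le (by simp)).contDiffOn.mul (hb₂.mono hsub))))
    (fun s hs y hy => by simp [dualFunctional, hd0 _ s hs y hy]) hs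
  refine hA.2.congr_deriv ?_
  have hsp : 0 < s := hs.1
  have hS : Integrable fun y => dualSource w ρ j k₂ k₃ i₁ i₂ i₃ (s, y) := by
    have hc : ∀ g : ℝ × R3 → ℝ, ContinuousOn g (Ici 0 ×ˢ univ) → Continuous fun y => g (s, y) :=
      fun g hg => continuousOn_univ.1 (hg.comp (f := fun y : R3 => (s, y)) (by fun_prop)
        fun _ _ => ⟨hsp.le, trivial⟩)
    have hc' : ∀ v, Continuous fun y => dirD v w (s, y) := fun v =>
      (contDiff_dirD hw v).continuous.comp (by fun_prop)
    refine integrable_slice (R := R) ?_ fun y hy => by simp [dualSource, hd0 _ s hs y hy]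
    exact (((hc' _).mul (hc ρ hρ)).add ((hc' _).mul (hc j hj))).add
      (((hc' _).mul (hc k₃ hk₃)).sub ((hc' _).mul (hc k₂ hk₂)))
  have z : ∀ (v : ℝ × R3) (g : ℝ × R3 → ℝ), ContDiffOn ℝ 1 g (Ici 0 ×ˢ univ) → ∀ i,
      ZeroIntegral fun y => dirD (dirX i) (dirD v w) (s, y) * g (s, y)
        + dirD v w (s, y) * dirD (dirX i) g (s, y) := fun v g hg i =>
    zeroIntegral_dirX_mul (contDiff_dirD hw v) hsp (hd0 v s hs) hg i
  -- After insertion of the equations for `e`, `b` and `w`, the two integrands differ by nine total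
  -- space derivatives: two come from the curl of `b`, three from the wave equation against `e₁`,
  -- and four form pairs for `e₂` and `e₃` in which the mixed second derivatives of `w` cancel.
  have hz := (((((((((z dirT b₂ hb₂ i₃).sub (z dirT b₃ hb₃ i₂)).sub (z (dirX i₂) e₁ he₁ i₂)).sub
    (z (dirX i₃) e₁ he₁ i₃)).sub (z (dirX i₁) e₁ he₁ i₁)).add (z (dirX i₂) e₂ he₂ i₁)).sub
    (z (dirX i₁) e₂ he₂ i₂)).add (z (dirX i₃) e₃ he₃ i₁)).sub (z (dirX i₁) e₃ he₃ i₃))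
  rw [← sub_eq_zero, ← integral_sub hA.1 hS, ← hz.2]
  refine integral_congr_ae (Eventually.of_forall fun y => ?_)
  have dd : ∀ {g : ℝ × R3 → ℝ}, ContDiffOn ℝ 1 g (Ici 0 ×ˢ univ) → DifferentiableAt ℝ g (s, y) :=
    fun hg => (contDiffAt_of_pos hg (p := (s, y)) hsp).differentiableAt one_ne_zero
  have dw : ∀ v, DifferentiableAt ℝ (dirD v w) (s, y) := fun v =>
    (contDiff_dirD hw v).differentiable (by simp) _
  have hexp : dirD dirT (dualFunctional w e₁ b₂ b₃ i₂ i₃) (s, y) =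
      -(dirD dirT (dirD dirT w) (s, y) * e₁ (s, y) + dirD dirT w (s, y) * dirD dirT e₁ (s, y))
      - ((dirD dirT (dirD (dirX i₂) w) (s, y) * b₃ (s, y)
          + dirD (dirX i₂) w (s, y) * dirD dirT b₃ (s, y))
        - (dirD dirT (dirD (dirX i₃) w) (s, y) * b₂ (s, y)
          + dirD (dirX i₃) w (s, y) * dirD dirT b₂ (s, y))) := by
    rw [← dirD_mul (dw _) (dd he₁), ← dirD_mul (dw _) (dd hb₃), ← dirD_mul (dw _) (dd hb₂)]
    have m1 := (dw dirT).mul (dd he₁)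
    have m2 := (dw (dirX i₂)).mul (dd hb₃)
    have m3 := (dw (dirX i₃)).mul (dd hb₂)
    have := ((m1.hasFDerivAt.neg).sub (m2.hasFDerivAt.sub m3.hasFDerivAt)).fderiv
    have h : fderiv ℝ (dualFunctional w e₁ b₂ b₃ i₂ i₃) (s, y) = _ := this
    simp only [dirD] at h ⊢
    rw [h]
    rfl
  simp only
  rw [hexp, dirD_comm hw dirT (dirX i₂), dirD_comm hw dirT (dirX i₃), hwave s hs y, h1 s hsp y,
    h2 s hsp y, h3 s hsp y, dualSource, ← h4 s hsp y, dirD_comm hw (dirX i₁) (dirX i₂),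
    dirD_comm hw (dirX i₁) (dirX i₃)]
  ring

end MaxwellDuality
end RegVM

namespace RegVM
-- The weak representation formula for solutions of the Maxwell system.
section MaxwellRepresentation

/-- The time-reversed spread function `(s, y) ↦ spread ψ (t - s, y)`. -/
def revSpread (ψ : R3 → ℝ) (t : ℝ) (p : ℝ × R3) : ℝ := spread ψ (t - p.1, p.2)

theorem contDiff_revSpread {ψ : R3 → ℝ} (hψ : ContDiff ℝ ∞ ψ) (t : ℝ) :
    ContDiff ℝ ∞ (revSpread ψ t) :=
  (contDiff_spread hψ).comp (f := fun p : ℝ × R3 => (t - p.1, p.2)) (by fun_prop)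

theorem dirT_rev {F : ℝ × R3 → ℝ} (hF : ContDiff ℝ ∞ F) (t : ℝ) (p : ℝ × R3) :
    dirD dirT (fun q => F (t - q.1, q.2)) p = -dirD dirT F (t - p.1, p.2) := by
  have h1 : HasFDerivAt (fun q : ℝ × R3 => (t - q.1, q.2)) _ p :=
    ((hasFDerivAt_fst (𝕜 := ℝ) (E := ℝ) (F := R3) (p := p)).const_sub t).prodMk hasFDerivAt_snd
  have h2 : HasFDerivAt (fun q => F (t - q.1, q.2)) _ p :=
    ((hF.differentiable (by simp) (t - p.1, p.2)).hasFDerivAt).comp p h1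
  rw [dirD, h2.fderiv, dirD, ← map_neg]
  simp [dirT]

theorem dirX_rev {F : ℝ × R3 → ℝ} (hF : ContDiff ℝ ∞ F) (t : ℝ) (i : Fin 3) (p : ℝ × R3) :
    dirD (dirX i) (fun q => F (t - q.1, q.2)) p = dirD (dirX i) F (t - p.1, p.2) := by
  have h1 : HasFDerivAt (fun q : ℝ × R3 => (t - q.1, q.2)) _ p :=
    ((hasFDerivAt_fst (𝕜 := ℝ) (E := ℝ) (F := R3) (p := p)).const_sub t).prodMk hasFDerivAt_snd
  have h2 : HasFDerivAt (fun q => F (t - q.1, q.2)) _ p :=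
    ((hF.differentiable (by simp) (t - p.1, p.2)).hasFDerivAt).comp p h1
  rw [dirD, h2.fderiv, dirD]
  simp [dirX]

theorem dirT_revSpread {ψ : R3 → ℝ} (hψ : ContDiff ℝ ∞ ψ) (t : ℝ) :
    dirD dirT (revSpread ψ t) = fun p => -dirD dirT (spread ψ) (t - p.1, p.2) :=
  funext fun p => dirT_rev (contDiff_spread hψ) t p

theorem dirX_revSpread {ψ : R3 → ℝ} (hψ : ContDiff ℝ ∞ ψ) (t : ℝ) (i : Fin 3) :
    dirD (dirX i) (revSpread ψ t) = fun p => dirD (dirX i) (spread ψ) (t - p.1, p.2) :=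
  funext fun p => dirX_rev (contDiff_spread hψ) t i p

theorem revSpread_wave {ψ : R3 → ℝ} (hψ : ContDiff ℝ ∞ ψ) {t s : ℝ} (hs : s < t) (y : R3) :
    dirD dirT (dirD dirT (revSpread ψ t)) (s, y)
      = ∑ i, dirD (dirX i) (dirD (dirX i) (revSpread ψ t)) (s, y) := by
  have cT := contDiff_dirD (contDiff_spread hψ) dirT
  have h1 : dirD dirT (dirD dirT (revSpread ψ t)) (s, y)
      = dirD dirT (dirD dirT (spread ψ)) (t - s, y) := by
    rw [dirT_revSpread hψ]
    have := dirT_rev cT.neg t (s, y)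
    rw [show (fun q : ℝ × R3 => -dirD dirT (spread ψ) (t - q.1, q.2))
      = fun q => (fun x => -dirD dirT (spread ψ) x) (t - q.1, q.2) from rfl, this]
    simp only [dirD, fderiv_fun_neg, neg_apply, neg_neg]
    rfl
  rw [h1, spread_wave hψ (sub_pos.2 hs)]
  refine Finset.sum_congr rfl fun i _ => ?_
  rw [dirX_revSpread hψ]
  exact (dirX_rev (contDiff_dirD (contDiff_spread hψ) (dirX i)) t i (s, y)).symm

variable {e₁ e₂ e₃ b₂ b₃ ρ j k₂ k₃ : ℝ × R3 → ℝ} {i₁ i₂ i₃ : Fin 3} {t : ℝ}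

/-- Take `w(s, y) = spread ψ (t - s, y)` in the dual functional. At `s = t` it vanishes and has time
derivative `-ψ`, so the functional is the left-hand side there; at `s = 0` it sees only the initial
data. The formula is the fundamental theorem of calculus between these times. The derivative is
known for `0 < s < t` only, and continuity up to the end points does the rest. -/
theorem integral_mul_eq_of_maxwell {ψ : R3 → ℝ} (hψ : ContDiff ℝ ∞ ψ) (hψc : HasCompactSupport ψ)
    (hsum : ∀ f : Fin 3 → ℝ, ∑ i, f i = f i₁ + f i₂ + f i₃)
    (he₁ : ContDiffOn ℝ 1 e₁ (Ici 0 ×ˢ univ)) (he₂ : ContDiffOn ℝ 1 e₂ (Ici 0 ×ˢ univ))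
    (he₃ : ContDiffOn ℝ 1 e₃ (Ici 0 ×ˢ univ)) (hb₂ : ContDiffOn ℝ 1 b₂ (Ici 0 ×ˢ univ))
    (hb₃ : ContDiffOn ℝ 1 b₃ (Ici 0 ×ˢ univ))
    (hρ : ContinuousOn ρ (Ici 0 ×ˢ univ)) (hj : ContinuousOn j (Ici 0 ×ˢ univ))
    (hk₂ : ContinuousOn k₂ (Ici 0 ×ˢ univ)) (hk₃ : ContinuousOn k₃ (Ici 0 ×ˢ univ))
    (h1 : ∀ s, 0 < s → ∀ y, dirD dirT e₁ (s, y)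
      = dirD (dirX i₂) b₃ (s, y) - dirD (dirX i₃) b₂ (s, y) - j (s, y))
    (h2 : ∀ s, 0 < s → ∀ y, dirD dirT b₂ (s, y)
      = -(dirD (dirX i₃) e₁ (s, y) - dirD (dirX i₁) e₃ (s, y)) - k₂ (s, y))
    (h3 : ∀ s, 0 < s → ∀ y, dirD dirT b₃ (s, y)
      = -(dirD (dirX i₁) e₂ (s, y) - dirD (dirX i₂) e₁ (s, y)) - k₃ (s, y))
    (h4 : ∀ s, 0 < s → ∀ y, dirD (dirX i₁) e₁ (s, y) + dirD (dirX i₂) e₂ (s, y)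
      + dirD (dirX i₃) e₃ (s, y) = ρ (s, y)) (ht : 0 < t) :
    ∫ y, ψ y * e₁ (t, y) =
      (∫ y, dirD dirT (spread ψ) (t, y) * e₁ (0, y)
        - (dirD (dirX i₂) (spread ψ) (t, y) * b₃ (0, y)
          - dirD (dirX i₃) (spread ψ) (t, y) * b₂ (0, y)))
      + ∫ s in (0 : ℝ)..t, ∫ y, dirD (dirX i₁) (spread ψ) (t - s, y) * ρ (s, y)
        - dirD dirT (spread ψ) (t - s, y) * j (s, y)
        + (dirD (dirX i₂) (spread ψ) (t - s, y) * k₃ (s, y)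
          - dirD (dirX i₃) (spread ψ) (t - s, y) * k₂ (s, y)) := by
  obtain ⟨R₀, hR₀⟩ := hψc.isBounded.subset_closedBall 0
  have hψ0 : ∀ y, R₀ < ‖y‖ → ψ y = 0 := fun y hy => image_eq_zero_of_notMem_tsupport fun h =>
    absurd (hR₀ h) (by simpa using hy)
  set w := revSpread ψ t with hwdef
  have hw : ContDiff ℝ ∞ w := contDiff_revSpread hψ t
  -- An open time interval around `[0, t]` is needed, so that the derivatives of `w` vanish outside
  -- of the ball also at the end points.
  have hw0 : ∀ s ∈ Ioo (-1) (t + 1), ∀ y, R₀ + (t + 1) < ‖y‖ → w (s, y) = 0 := by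
    intro s hs y hy
    refine spread_eq_zero hψ0 (lt_of_le_of_lt ?_ hy)
    have : |t - s| ≤ t + 1 := abs_le.2 ⟨by linarith [hs.2], by linarith [hs.1]⟩
    simpa using this
  have hd0 : ∀ v, ∀ s ∈ Icc 0 t, ∀ y, R₀ + (t + 1) < ‖y‖ → dirD v w (s, y) = 0 := fun v s hs y hy =>
    dirD_eq_zero (U := Ioo (-1) (t + 1) ×ˢ {y : R3 | R₀ + (t + 1) < ‖y‖})
      (isOpen_Ioo.prod (isOpen_lt continuous_const continuous_norm))
      (fun p hp => hw0 p.1 hp.1 p.2 hp.2) v (p := (s, y))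
      ⟨⟨by linarith [hs.1], by linarith [hs.2]⟩, hy⟩
  have hder : ∀ s ∈ Ioo 0 t, HasDerivAt (fun s => ∫ y, dualFunctional w e₁ b₂ b₃ i₂ i₃ (s, y))
      (∫ y, dualSource w ρ j k₂ k₃ i₁ i₂ i₃ (s, y)) s := fun s hs =>
    hasDerivAt_dualFunctional hw (R := R₀ + (t + 1)) (t := t)
      (fun r hr y hy => hw0 r ⟨by linarith [hr.1], by linarith [hr.2]⟩ y hy)
      (fun r hr y => by rw [revSpread_wave hψ hr.2, hsum])
      he₁ he₂ he₃ hb₂ hb₃ hρ hj hk₂ hk₃ h1 h2 h3 h4 hs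
  have hsub : Icc 0 t ×ˢ (univ : Set R3) ⊆ Ici 0 ×ˢ univ := prod_mono Icc_subset_Ici_self le_rfl
  have cw : ∀ v, ContinuousOn (dirD v w) (Icc 0 t ×ˢ univ) := fun v =>
    (contDiff_dirD hw v).continuous.continuousOn
  have hcA : ContinuousOn (fun s => ∫ y, dualFunctional w e₁ b₂ b₃ i₂ i₃ (s, y)) (Icc 0 t) := by
    refine continuousOn_integral_of_compact_support
      (f := fun s y => dualFunctional w e₁ b₂ b₃ i₂ i₃ (s, y))
      (isCompact_closedBall (0 : R3) (R₀ + (t + 1))) ?_ fun s y hs hy => ?_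
    · exact (((cw _).mul (he₁.continuousOn.mono hsub)).neg).sub
        (((cw _).mul (hb₃.continuousOn.mono hsub)).sub ((cw _).mul (hb₂.continuousOn.mono hsub)))
    · simp [dualFunctional, hd0 _ s hs y (by simpa using hy)]
  have hcS : ContinuousOn (fun s => ∫ y, dualSource w ρ j k₂ k₃ i₁ i₂ i₃ (s, y)) (Icc 0 t) := by
    refine continuousOn_integral_of_compact_support
      (f := fun s y => dualSource w ρ j k₂ k₃ i₁ i₂ i₃ (s, y))
      (isCompact_closedBall (0 : R3) (R₀ + (t + 1))) ?_ fun s y hs hy => ?_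
    · exact (((cw _).mul (hρ.mono hsub)).add ((cw _).mul (hj.mono hsub))).add
        (((cw _).mul (hk₃.mono hsub)).sub ((cw _).mul (hk₂.mono hsub)))
    · simp [dualSource, hd0 _ s hs y (by simpa using hy)]
  have hftc := intervalIntegral.integral_eq_sub_of_hasDerivAt_of_le ht.le hcA hder
    (hcS.intervalIntegrable_of_Icc ht.le)
  have hXw : ∀ i p, dirD (dirX i) w p = dirD (dirX i) (spread ψ) (t - p.1, p.2) := fun i p => by
    rw [hwdef, dirX_revSpread hψ]
  have hTw : ∀ p, dirD dirT w p = -dirD dirT (spread ψ) (t - p.1, p.2) := fun p => by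
    rw [hwdef, dirT_revSpread hψ]
  have hX0 : ∀ i y, dirD (dirX i) (spread ψ) (0, y) = 0 := fun i y => by
    rw [dirX_spread hψ, spread_zero]
  have hend : ∀ y, dualFunctional w e₁ b₂ b₃ i₂ i₃ (t, y) = ψ y * e₁ (t, y) := fun y => by
    simp only [dualFunctional, hXw, hTw, sub_self, hX0, dirT_spread_zero hψ]
    ring
  have hstart : ∀ y, dualFunctional w e₁ b₂ b₃ i₂ i₃ (0, y)
      = dirD dirT (spread ψ) (t, y) * e₁ (0, y) - (dirD (dirX i₂) (spread ψ) (t, y) * b₃ (0, y)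
          - dirD (dirX i₃) (spread ψ) (t, y) * b₂ (0, y)) := fun y => by
    simp only [dualFunctional, hXw, hTw, sub_zero]
    ring
  simp only [hend, hstart] at hftc
  rw [eq_sub_iff_add_eq'] at hftc
  rw [← hftc]
  congr 1
  refine intervalIntegral.integral_congr fun s _ => integral_congr_ae (Eventually.of_forall fun y => ?_)
  simp only [dualSource, hXw, hTw]
  ring

/-- The components of a vector field on space-time. -/
def comp (E : ℝ → R3 → R3) (i : Fin 3) (p : ℝ × R3) : ℝ := E p.1 p.2 i

theorem contDiffOn_comp {E : ℝ → R3 → R3}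
    (hE : ContDiffOn ℝ 1 (fun p : ℝ × R3 => E p.1 p.2) (Ici 0 ×ˢ univ)) (i : Fin 3) :
    ContDiffOn ℝ 1 (comp E i) (Ici 0 ×ˢ univ) :=
  (EuclideanSpace.proj (𝕜 := ℝ) i).contDiff.comp_contDiffOn hE

theorem pd_eq_dirD_comp {E : ℝ → R3 → R3}
    (hE : ContDiffOn ℝ 1 (fun p : ℝ × R3 => E p.1 p.2) (Ici 0 ×ˢ univ)) (i j : Fin 3) {s : ℝ}
    (hs : 0 < s) (y : R3) : pd i j (E s) y = dirD (dirX i) (comp E j) (s, y) := by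
  have hd : DifferentiableAt ℝ (comp E j) (s, y) :=
    (contDiffAt_of_pos (contDiffOn_comp hE j) (p := (s, y)) hs).differentiableAt one_ne_zero
  have hd' : DifferentiableAt ℝ (E s) y :=
    (((contDiffAt_of_pos hE (p := (s, y)) hs).comp y (f := fun y => (s, y))
      (by fun_prop)).differentiableAt one_ne_zero)
  have h1 := fderiv_slice_space hd (basisVec i)
  rw [dirX, ← h1, pd]
  have h2 : HasFDerivAt (fun z => comp E j (s, z)) _ y :=
    (EuclideanSpace.proj (𝕜 := ℝ) j).hasFDerivAt.comp y hd'.hasFDerivAt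
  rw [h2.fderiv]
  rfl

theorem derivWithin_eq_dirD_comp {E : ℝ → R3 → R3}
    (hE : ContDiffOn ℝ 1 (fun p : ℝ × R3 => E p.1 p.2) (Ici 0 ×ˢ univ)) (i : Fin 3) {s : ℝ}
    (hs : 0 < s) (y : R3) :
    (derivWithin (fun r => E r y) (Ici 0) s) i = dirD dirT (comp E i) (s, y) := by
  have hd : DifferentiableAt ℝ (comp E i) (s, y) :=
    (contDiffAt_of_pos (contDiffOn_comp hE i) (p := (s, y)) hs).differentiableAt one_ne_zero
  have hd' : DifferentiableAt ℝ (fun r => E r y) s :=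
    (((contDiffAt_of_pos hE (p := (s, y)) hs).comp s (f := fun r => (r, y))
      (by fun_prop)).differentiableAt one_ne_zero)
  rw [derivWithin_of_mem_nhds (Ici_mem_nhds hs)]
  have h2 : HasDerivAt (fun r => comp E i (r, y)) (deriv (fun r => E r y) s i) s :=
    (EuclideanSpace.proj (𝕜 := ℝ) i).hasFDerivAt.comp_hasDerivAt s hd'.hasDerivAt
  exact h2.unique (hasDerivAt_slice_time hd)

/-- Indices modulo `3` turn curl and divergence into cyclic formulas, so that one argument treats
all three components. -/
theorem sum_cyclic (i : Fin 3) (f : Fin 3 → ℝ) : ∑ k, f k = f i + f (i + 1) + f (i + 2) := by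
  fin_cases i
  · simp [Fin.sum_univ_three]
  · rw [Fin.sum_univ_three]
    show f 0 + f 1 + f 2 = f 1 + f 2 + f 0
    ring
  · rw [Fin.sum_univ_three]
    show f 0 + f 1 + f 2 = f 2 + f 0 + f 1
    ring

theorem curl_apply (F : R3 → R3) (x : R3) (i : Fin 3) :
    curl F x i = pd (i + 1) (i + 2) F x - pd (i + 2) (i + 1) F x := by
  fin_cases i <;> rfl

theorem divg_eq (F : R3 → R3) (x : R3) (i : Fin 3) :
    divg F x = pd i i F x + pd (i + 1) (i + 1) F x + pd (i + 2) (i + 2) F x := by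
  rw [← sum_cyclic i fun k => pd k k F x, Fin.sum_univ_three]
  rfl

variable {rho : ℝ → R3 → ℝ} {cur : ℝ → R3 → R3} {E₀ : R3 → R3} {E B : ℝ → R3 → R3}

theorem IsMaxwellSolution.integral_mul_electric (h : IsMaxwellSolution rho cur E₀ E B)
    (hρ : ContinuousOn (fun p : ℝ × R3 => rho p.1 p.2) (Ici 0 ×ˢ univ))
    (hj : ContinuousOn (fun p : ℝ × R3 => cur p.1 p.2) (Ici 0 ×ˢ univ))
    {ψ : R3 → ℝ} (hψ : ContDiff ℝ ∞ ψ) (hψc : HasCompactSupport ψ) (ht : 0 < t) (i : Fin 3) :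
    ∫ y, ψ y * E t y i = (∫ y, dirD dirT (spread ψ) (t, y) * E₀ y i)
      + ∫ s in (0 : ℝ)..t, ∫ y, dirD (dirX i) (spread ψ) (t - s, y) * rho s y
        - dirD dirT (spread ψ) (t - s, y) * cur s y i := by
  have cE := contDiffOn_comp h.contDiff_E
  have cB := contDiffOn_comp h.contDiff_B
  have e12 : i + 1 + 1 = i + 2 := by fin_cases i <;> rfl
  have e13 : i + 1 + 2 = i := by fin_cases i <;> rfl
  have e21 : i + 2 + 1 = i := by fin_cases i <;> rfl
  have e22 : i + 2 + 2 = i + 1 := by fin_cases i <;> rfl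
  have hamp : ∀ s, 0 < s → ∀ y k, dirD dirT (comp E k) (s, y)
      = dirD (dirX (k + 1)) (comp B (k + 2)) (s, y) - dirD (dirX (k + 2)) (comp B (k + 1)) (s, y)
        - cur s y k := by
    intro s hs y k
    have := congrArg (fun v : R3 => v k) (h.ampere s hs.le y)
    simp only [PiLp.sub_apply, PiLp.neg_apply, curl_apply, derivWithin_eq_dirD_comp h.contDiff_E k hs,
      pd_eq_dirD_comp h.contDiff_B _ _ hs] at this
    linarith
  have hfar : ∀ s, 0 < s → ∀ y k, dirD dirT (comp B k) (s, y)
      = -(dirD (dirX (k + 1)) (comp E (k + 2)) (s, y)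
        - dirD (dirX (k + 2)) (comp E (k + 1)) (s, y)) := by
    intro s hs y k
    have := congrArg (fun v : R3 => v k) (h.faraday s hs.le y)
    simp only [PiLp.add_apply, PiLp.zero_apply, curl_apply,
      derivWithin_eq_dirD_comp h.contDiff_B k hs, pd_eq_dirD_comp h.contDiff_E _ _ hs] at this
    linarith
  have key := integral_mul_eq_of_maxwell (i₁ := i) (i₂ := i + 1) (i₃ := i + 2) (t := t) hψ hψc
    (sum_cyclic i) (cE i) (cE (i + 1)) (cE (i + 2)) (cB (i + 1)) (cB (i + 2))
    (ρ := fun p => rho p.1 p.2) (j := fun p => cur p.1 p.2 i) (k₂ := fun _ => 0) (k₃ := fun _ => 0)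
    hρ ((EuclideanSpace.proj (𝕜 := ℝ) i).continuous.comp_continuousOn hj)
    continuousOn_const continuousOn_const (fun s hs y => hamp s hs y i)
    (fun s hs y => by rw [hfar s hs y (i + 1), e12, e13]; ring)
    (fun s hs y => by rw [hfar s hs y (i + 2), e21, e22]; ring)
    (fun s hs y => by
      rw [← h.gauss s hs.le y, divg_eq _ _ i]
      simp only [pd_eq_dirD_comp h.contDiff_E _ _ hs]) ht
  simpa [comp, h.init_E, h.init_B] using key

/-- The dual system: `(B, -E)` takes the place of `(E, B)`. It has no charge and no electric
current, and the negative of the true current enters through `k₂` and `k₃`. -/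
theorem IsMaxwellSolution.integral_mul_magnetic (h : IsMaxwellSolution rho cur E₀ E B)
    (hj : ContinuousOn (fun p : ℝ × R3 => cur p.1 p.2) (Ici 0 ×ˢ univ))
    {ψ : R3 → ℝ} (hψ : ContDiff ℝ ∞ ψ) (hψc : HasCompactSupport ψ) (ht : 0 < t) (i : Fin 3) :
    ∫ y, ψ y * B t y i = (∫ y, dirD (dirX (i + 1)) (spread ψ) (t, y) * E₀ y (i + 2)
          - dirD (dirX (i + 2)) (spread ψ) (t, y) * E₀ y (i + 1))
      - ∫ s in (0 : ℝ)..t, ∫ y, dirD (dirX (i + 1)) (spread ψ) (t - s, y) * cur s y (i + 2)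
        - dirD (dirX (i + 2)) (spread ψ) (t - s, y) * cur s y (i + 1) := by
  have cE := contDiffOn_comp h.contDiff_E
  have cB := contDiffOn_comp h.contDiff_B
  have e12 : i + 1 + 1 = i + 2 := by fin_cases i <;> rfl
  have e13 : i + 1 + 2 = i := by fin_cases i <;> rfl
  have e21 : i + 2 + 1 = i := by fin_cases i <;> rfl
  have e22 : i + 2 + 2 = i + 1 := by fin_cases i <;> rfl
  have hneg : ∀ v k p, dirD v (fun q => -comp E k q) p = -dirD v (comp E k) p := fun v k p => by
    simp [dirD, fderiv_fun_neg]
  have hamp : ∀ s, 0 < s → ∀ y k, dirD dirT (comp E k) (s, y)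
      = dirD (dirX (k + 1)) (comp B (k + 2)) (s, y) - dirD (dirX (k + 2)) (comp B (k + 1)) (s, y)
        - cur s y k := by
    intro s hs y k
    have := congrArg (fun v : R3 => v k) (h.ampere s hs.le y)
    simp only [PiLp.sub_apply, PiLp.neg_apply, curl_apply, derivWithin_eq_dirD_comp h.contDiff_E k hs,
      pd_eq_dirD_comp h.contDiff_B _ _ hs] at this
    linarith
  have hfar : ∀ s, 0 < s → ∀ y k, dirD dirT (comp B k) (s, y)
      = -(dirD (dirX (k + 1)) (comp E (k + 2)) (s, y)
        - dirD (dirX (k + 2)) (comp E (k + 1)) (s, y)) := by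
    intro s hs y k
    have := congrArg (fun v : R3 => v k) (h.faraday s hs.le y)
    simp only [PiLp.add_apply, PiLp.zero_apply, curl_apply,
      derivWithin_eq_dirD_comp h.contDiff_B k hs, pd_eq_dirD_comp h.contDiff_E _ _ hs] at this
    linarith
  have hjk : ∀ k, ContinuousOn (fun p : ℝ × R3 => -cur p.1 p.2 k) (Ici 0 ×ˢ univ) := fun k =>
    ((EuclideanSpace.proj (𝕜 := ℝ) k).continuous.comp_continuousOn hj).neg
  have key := integral_mul_eq_of_maxwell (i₁ := i) (i₂ := i + 1) (i₃ := i + 2) (t := t) hψ hψc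
    (sum_cyclic i) (cB i) (cB (i + 1)) (cB (i + 2)) (cE (i + 1)).neg (cE (i + 2)).neg
    (ρ := fun _ => 0) (j := fun _ => 0) (k₂ := fun p => -cur p.1 p.2 (i + 1))
    (k₃ := fun p => -cur p.1 p.2 (i + 2))
    continuousOn_const continuousOn_const (hjk _) (hjk _)
    (fun s hs y => by simp only [hneg]; rw [hfar s hs y i]; ring)
    (fun s hs y => by simp only [hneg]; rw [hamp s hs y (i + 1), e12, e13]; ring)
    (fun s hs y => by simp only [hneg]; rw [hamp s hs y (i + 2), e21, e22]; ring)
    (fun s hs y => by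
      rw [← h.div_B s hs.le y, divg_eq _ _ i]
      simp only [pd_eq_dirD_comp h.contDiff_B _ _ hs]) ht
  simp only [comp, h.init_E, h.init_B, PiLp.zero_apply, mul_zero, zero_sub, sub_zero, mul_neg] at key
  rw [key, sub_eq_add_neg, ← intervalIntegral.integral_neg]
  congr 1
  · refine integral_congr_ae (Eventually.of_forall fun y => ?_)
    simp only
    ring
  · refine intervalIntegral.integral_congr fun s _ => ?_
    simp only
    rw [← integral_neg]
    refine integral_congr_ae (Eventually.of_forall fun y => ?_)
    simp only
    ring

end MaxwellRepresentation
end RegVM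

namespace RegVM
-- Kernels with support in a light cone, and their convolution with the Newtonian potential.
section Kernels

variable {G : Type} [NormedAddCommGroup G] [NormedSpace ℝ G] {T R : ℝ}

/-- `K` is smooth, and together with its differential it is bounded on bounded time intervals. -/
structure BoundedKernel (K : ℝ × R3 → G) : Prop where
  smooth : ContDiff ℝ ∞ K
  bound : ∀ T, ∃ M, ∀ p : ℝ × R3, |p.1| ≤ T → ‖K p‖ ≤ M ∧ ‖fderiv ℝ K p‖ ≤ M

/-- `K` vanishes outside of the light cone over the ball of radius `R`. -/
def ConeSupported (R : ℝ) (K : ℝ × R3 → G) : Prop := ∀ p, R + |p.1| < ‖p.2‖ → K p = 0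

theorem ConeSupported.fderiv {K : ℝ × R3 → G} (h : ConeSupported R K) :
    ConeSupported R (fderiv ℝ K) := by
  intro p hp
  have hU : IsOpen {p : ℝ × R3 | R + |p.1| < ‖p.2‖} := isOpen_lt (by fun_prop) (by fun_prop)
  have : K =ᶠ[𝓝 p] fun _ => 0 := by
    filter_upwards [hU.mem_nhds hp] with q hq using h q hq
  rw [this.fderiv_eq]
  simp

theorem ConeSupported.exists_bound {K : ℝ × R3 → G} (h : ConeSupported R K) (hK : Continuous K)
    (T : ℝ) : ∃ M, 0 ≤ M ∧ ∀ p : ℝ × R3, |p.1| ≤ T → ‖K p‖ ≤ M := by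
  obtain ⟨C, hC⟩ := ((isCompact_Icc (a := -T) (b := T)).prod
    (isCompact_closedBall (0 : R3) (R + T))).exists_bound_of_continuousOn hK.continuousOn
  refine ⟨max C 0, le_max_right _ _, fun p hp => ?_⟩
  by_cases hx : ‖p.2‖ ≤ R + T
  · exact (hC p ⟨abs_le.1 hp, by simpa using hx⟩).trans (le_max_left _ _)
  · rw [h p (by linarith [not_le.1 hx]), norm_zero]
    exact le_max_right _ _

theorem ConeSupported.boundedKernel {K : ℝ × R3 → G} (h : ConeSupported R K)
    (hK : ContDiff ℝ ∞ K) : BoundedKernel K := by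
  refine ⟨hK, fun T => ?_⟩
  obtain ⟨M, _, hM⟩ := h.exists_bound hK.continuous T
  obtain ⟨M', _, hM'⟩ := h.fderiv.exists_bound (hK.continuous_fderiv (by simp)) T
  exact ⟨max M M', fun p hp => ⟨(hM p hp).trans (le_max_left _ _),
    (hM' p hp).trans (le_max_right _ _)⟩⟩

theorem BoundedKernel.differentiable {K : ℝ × R3 → G} (h : BoundedKernel K) : Differentiable ℝ K :=
  h.smooth.differentiable (by simp)

theorem BoundedKernel.norm_fderiv_slice_le {K : ℝ × R3 → G} (h : BoundedKernel K) (p : ℝ × R3) :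
    ‖_root_.fderiv ℝ (fun x => K (p.1, x)) p.2‖ ≤ ‖_root_.fderiv ℝ K p‖ := by
  rw [(hasFDerivAt_slice_space (h.differentiable (p.1, p.2))).fderiv]
  refine (ContinuousLinearMap.opNorm_comp_le _ _).trans ?_
  exact mul_le_of_le_one_right (norm_nonneg _) (ContinuousLinearMap.norm_inr_le_one _ _ _)

/-- A real supremum of an unbounded family has the value `0`, so `normLW` bounds anything only once
this is known. -/
theorem BoundedKernel.bddAbove {K : ℝ × R3 → G} (h : BoundedKernel K) (T : ℝ) :
    BddAbove (range fun p : Icc (0 : ℝ) T × R3 =>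
      max ‖K (p.1, p.2)‖ ‖_root_.fderiv ℝ (fun x => K (p.1, x)) p.2‖) := by
  obtain ⟨M, hM⟩ := h.bound T
  refine ⟨M, ?_⟩
  rintro _ ⟨p, rfl⟩
  have := hM (p.1, p.2) (by simpa [abs_of_nonneg p.1.2.1] using p.1.2.2)
  exact max_le this.1 ((h.norm_fderiv_slice_le (p.1, p.2)).trans this.2)

theorem BoundedKernel.norm_le {K : ℝ → R3 → G} (h : BoundedKernel fun p : ℝ × R3 => K p.1 p.2)
    {t : ℝ} (ht : t ∈ Icc 0 T) (x : R3) : ‖K t x‖ ≤ normLW T K :=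
  (le_max_left _ _).trans (le_ciSup (h.bddAbove T) (⟨t, ht⟩, x))

theorem BoundedKernel.norm_sub_le {K : ℝ → R3 → G} (h : BoundedKernel fun p : ℝ × R3 => K p.1 p.2)
    {t : ℝ} (ht : t ∈ Icc 0 T) (x y : R3) : ‖K t x - K t y‖ ≤ normLW T K * ‖x - y‖ := by
  have hd : ∀ z ∈ (univ : Set R3), DifferentiableAt ℝ (K t) z := fun z _ =>
    (hasFDerivAt_slice_space (F := fun p : ℝ × R3 => K p.1 p.2)
      (h.differentiable (t, z))).differentiableAt
  exact convex_univ.norm_image_sub_le_of_norm_fderiv_le hd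
    (fun z _ => (le_max_right _ _).trans (le_ciSup (h.bddAbove T) (⟨t, ht⟩, z))) trivial trivial

theorem normLW_nonneg (K : ℝ → R3 → G) : 0 ≤ normLW T K :=
  Real.iSup_nonneg fun _ => (norm_nonneg _).trans (le_max_left _ _)

/-- Uniform Lipschitz bounds in time and space on a bounded time interval. -/
theorem BoundedKernel.exists_lipschitz {K : ℝ × R3 → G} (h : BoundedKernel K) (T : ℝ) :
    ∃ M, 0 ≤ M ∧ (∀ p : ℝ × R3, |p.1| ≤ T → ‖K p‖ ≤ M) ∧
      ∀ p q : ℝ × R3, |p.1| ≤ T → |q.1| ≤ T → ‖K p - K q‖ ≤ M * ‖p - q‖ := by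
  obtain ⟨M, hM⟩ := h.bound T
  refine ⟨max M 0, le_max_right _ _, fun p hp => (hM p hp).1.trans (le_max_left _ _),
    fun p q hp hq => ?_⟩
  have hconv : Convex ℝ (Icc (-T) T ×ˢ (univ : Set R3)) := (convex_Icc _ _).prod convex_univ
  exact hconv.norm_image_sub_le_of_norm_fderiv_le (fun z _ => h.differentiable z)
    (fun z hz => (hM z (abs_le.2 hz.1)).2.trans (le_max_left _ _))
    (show q ∈ _ from ⟨abs_le.1 hq, trivial⟩) (show p ∈ _ from ⟨abs_le.1 hp, trivial⟩)

section Green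

theorem green_nonneg (z : R3) : 0 ≤ green z := by unfold green; positivity

/-- In polar coordinates the singularity `1 / r` is absorbed by the factor `r²`. -/
theorem integrableOn_green_ball (R : ℝ) : IntegrableOn green (Metric.ball (0 : R3) R) := by
  have h := (integrableOn_fun_norm_addHaar (volume : Measure R3)
    (f := fun r : ℝ => 1 / (4 * Real.pi * r)) (r := R)).2 ?_
  · exact h
  · have hdim : Module.finrank ℝ R3 - 1 = 2 := by simp
    rw [hdim]
    have : IntegrableOn (fun r : ℝ => (4 * Real.pi)⁻¹ * r) (Ioo 0 R) :=
      ((continuous_const.mul continuous_id).integrableOn_Icc (a := 0) (b := R)).mono_set Ioo_subset_Icc_self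
    refine this.congr_fun (fun r hr => ?_) measurableSet_Ioo
    have : r ≠ 0 := hr.1.ne'
    simp only [smul_eq_mul]
    field_simp

theorem locallyIntegrable_green : LocallyIntegrable green volume := by
  rw [locallyIntegrable_iff]
  intro k hk
  obtain ⟨R, hR⟩ := hk.isBounded.subset_ball 0
  exact (integrableOn_green_ball R).mono_set hR

theorem green_le {z : R3} (hz : 1 ≤ ‖z‖) : green z ≤ 1 := by
  unfold green
  rw [div_le_one (by positivity)]
  nlinarith [Real.pi_gt_three]

/-- The bound must not depend on the center, for it yields uniform bounds for convolutions. The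
potential is at most `1` away from the unit ball about its pole, and the part in that ball has a
fixed integral. -/
theorem integral_green_ball_le (R : ℝ) :
    ∃ M, 0 ≤ M ∧ ∀ x : R3, ∫ z in Metric.closedBall x R, green z ≤ M := by
  refine ⟨(∫ z in Metric.ball (0 : R3) 1, green z) + volume.real (Metric.closedBall (0 : R3) R),
    add_nonneg (integral_nonneg green_nonneg) measureReal_nonneg, fun x => ?_⟩
  have hle : ∀ z, green z ≤ (Metric.ball (0 : R3) 1).indicator green z + 1 := by
    intro z
    by_cases hz : z ∈ Metric.ball (0 : R3) 1
    · rw [indicator_of_mem hz]; linarith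
    · rw [indicator_of_notMem hz, zero_add]
      exact green_le (by simpa using hz)
  have hi1 : Integrable ((Metric.ball (0 : R3) 1).indicator green) :=
    (integrable_indicator_iff Metric.isOpen_ball.measurableSet).2 (integrableOn_green_ball 1)
  have hi2 : IntegrableOn (fun _ : R3 => (1 : ℝ)) (Metric.closedBall x R) :=
    integrableOn_const (by exact measure_closedBall_lt_top.ne)
  have hg : IntegrableOn green (Metric.closedBall x R) :=
    (locallyIntegrable_iff.1 locallyIntegrable_green) _ (isCompact_closedBall x R)
  calc ∫ z in Metric.closedBall x R, green z
      ≤ ∫ z in Metric.closedBall x R, ((Metric.ball (0 : R3) 1).indicator green z + 1) :=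
        integral_mono hg (hi1.integrableOn.add hi2) hle
    _ = (∫ z in Metric.closedBall x R, (Metric.ball (0 : R3) 1).indicator green z)
        + volume.real (Metric.closedBall x R) := by
        rw [integral_add hi1.integrableOn hi2]
        simp
    _ ≤ _ := by
        refine add_le_add ?_ (le_of_eq ?_)
        · rw [← integral_indicator Metric.isOpen_ball.measurableSet]
          exact setIntegral_le_integral hi1 (Eventually.of_forall fun z =>
            indicator_nonneg (fun z _ => green_nonneg z) z)
        · simp [Measure.real, Measure.addHaar_closedBall_center]

/-- Convolution in space with the Newtonian potential. -/
def greenConv (K : ℝ × R3 → G) (p : ℝ × R3) : G :=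
  ∫ z, green z • K (p.1, p.2 - z)

theorem ConeSupported.hasCompactSupport_slice {K : ℝ × R3 → G} (h : ConeSupported R K) (t : ℝ) :
    HasCompactSupport fun x => K (t, x) :=
  HasCompactSupport.intro (isCompact_closedBall (0 : R3) (R + |t|)) fun x hx =>
    h (t, x) (by simpa using hx)

theorem ConeSupported.integrable_green {K : ℝ × R3 → G} (h : ConeSupported R K)
    (hK : Continuous K) (p : ℝ × R3) : Integrable fun z => green z • K (p.1, p.2 - z) := by
  have h1 : HasCompactSupport fun z => K (p.1, p.2 - z) := by
    refine HasCompactSupport.intro (isCompact_closedBall p.2 (R + |p.1|)) fun z hz =>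
      h (p.1, p.2 - z) ?_
    rw [Metric.mem_closedBall, not_le, dist_comm, dist_eq_norm] at hz
    exact hz
  have h2 := locallyIntegrable_green.integrable_smul_right_of_hasCompactSupport
    (g := fun z => K (p.1, p.2 - z)) (hK.comp (by fun_prop)) h1
  exact h2

theorem ConeSupported.norm_greenConv_le {K : ℝ × R3 → G} (h : ConeSupported R K)
    (hK : Continuous K) (T : ℝ) : ∃ M, ∀ p : ℝ × R3, |p.1| ≤ T → ‖greenConv K p‖ ≤ M := by
  obtain ⟨C, hC0, hC⟩ := h.exists_bound hK T
  obtain ⟨M, hM0, hM⟩ := integral_green_ball_le (R + T)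
  refine ⟨C * M, fun p hp => ?_⟩
  have hg : IntegrableOn green (Metric.closedBall p.2 (R + T)) :=
    (locallyIntegrable_iff.1 locallyIntegrable_green) _ (isCompact_closedBall _ _)
  have hi : Integrable ((Metric.closedBall p.2 (R + T)).indicator fun z => C * green z) :=
    (integrable_indicator_iff Metric.isClosed_closedBall.measurableSet).2 (hg.const_mul C)
  calc ‖greenConv K p‖ ≤ ∫ z, (Metric.closedBall p.2 (R + T)).indicator (fun z => C * green z) z := by
        refine norm_integral_le_of_norm_le hi (Eventually.of_forall fun z => ?_)
        by_cases hz : z ∈ Metric.closedBall p.2 (R + T)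
        · rw [indicator_of_mem hz, norm_smul, Real.norm_of_nonneg (green_nonneg z), mul_comm]
          exact mul_le_mul_of_nonneg_right (hC _ hp) (green_nonneg z)
        · rw [indicator_of_notMem hz, h (p.1, p.2 - z), smul_zero, norm_zero]
          rw [Metric.mem_closedBall, not_le, dist_comm, dist_eq_norm] at hz
          simp only
          linarith
    _ = C * ∫ z in Metric.closedBall p.2 (R + T), green z := by
        rw [integral_indicator Metric.isClosed_closedBall.measurableSet, integral_const_mul]
    _ ≤ C * M := mul_le_mul_of_nonneg_left (hM _) hC0

/-- Smoothness of convolutions with a parameter requires one compact set supporting all slices. The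
cone grows with time, so the argument is local, in a time window of half-width `1`. All derivatives
fall on `K`; the potential only has to be locally integrable. -/
theorem ConeSupported.contDiff_greenConv {K : ℝ × R3 → G} (h : ConeSupported R K)
    (hK : ContDiff ℝ ∞ K) : ContDiff ℝ ∞ (greenConv K) := by
  rw [contDiff_iff_contDiffAt]
  intro p
  have hs : IsOpen (Ioo (p.1 - 1) (p.1 + 1)) := isOpen_Ioo
  have hon := contDiffOn_convolution_right_with_param (n := ⊤) (ContinuousLinearMap.lsmul ℝ ℝ)
    (μ := (volume : Measure R3)) (f := green) (g := fun t x => K (t, x))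
    (k := Metric.closedBall (0 : R3) (R + (|p.1| + 1))) hs (isCompact_closedBall _ _) (by
      intro t x ht hx
      refine h (t, x) ?_
      rw [mem_closedBall_zero_iff, not_le] at hx
      have : |t| ≤ |p.1| + 1 := by
        have := abs_sub_abs_le_abs_sub t p.1
        have h2 : |t - p.1| ≤ 1 := abs_le.2 ⟨by linarith [ht.1], by linarith [ht.2]⟩
        linarith
      simp only
      linarith) locallyIntegrable_green hK.contDiffOn
  exact hon.contDiffAt ((hs.prod isOpen_univ).mem_nhds
    ⟨⟨by linarith, by linarith⟩, trivial⟩)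

theorem ConeSupported.hasFDerivAt_greenConv {K : ℝ × R3 → G} (h : ConeSupported R K)
    (hK : ContDiff ℝ ∞ K) (p : ℝ × R3) :
    HasFDerivAt (greenConv K) (greenConv (_root_.fderiv ℝ K) p) p := by
  have hs : IsOpen (Ioo (p.1 - 1) (p.1 + 1)) := isOpen_Ioo
  have hd := hasFDerivAt_convolution_right_with_param (ContinuousLinearMap.lsmul ℝ ℝ)
    (μ := (volume : Measure R3)) (f := green) (g := fun t x => K (t, x))
    (k := Metric.closedBall (0 : R3) (R + (|p.1| + 1))) hs (isCompact_closedBall _ _) (by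
      intro t x ht hx
      refine h (t, x) ?_
      rw [mem_closedBall_zero_iff, not_le] at hx
      have : |t| ≤ |p.1| + 1 := by
        have := abs_sub_abs_le_abs_sub t p.1
        have h2 : |t - p.1| ≤ 1 := abs_le.2 ⟨by linarith [ht.1], by linarith [ht.2]⟩
        linarith
      simp only
      linarith) locallyIntegrable_green (hK.of_le (by simp)).contDiffOn p ⟨by linarith, by linarith⟩
  refine HasFDerivAt.congr_fderiv (f := greenConv K) hd ?_
  refine integral_congr_ae (Eventually.of_forall fun z => ?_)
  refine ContinuousLinearMap.ext fun v => ?_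
  simp only [ContinuousLinearMap.precompR_apply]
  rfl

theorem ConeSupported.boundedKernel_greenConv {K : ℝ × R3 → G} (h : ConeSupported R K)
    (hK : ContDiff ℝ ∞ K) : BoundedKernel (greenConv K) := by
  refine ⟨h.contDiff_greenConv hK, fun T => ?_⟩
  obtain ⟨M, hM⟩ := h.norm_greenConv_le hK.continuous T
  obtain ⟨M', hM'⟩ := h.fderiv.norm_greenConv_le (hK.continuous_fderiv (by simp)) T
  refine ⟨max M M', fun p hp => ⟨(hM p hp).trans (le_max_left _ _), ?_⟩⟩
  rw [(h.hasFDerivAt_greenConv hK p).fderiv]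
  exact (hM' p hp).trans (le_max_right _ _)

theorem ConeSupported.dirD_greenConv {K : ℝ × R3 → G} (h : ConeSupported R K)
    (hK : ContDiff ℝ ∞ K) (v : ℝ × R3) : dirD v (greenConv K) = greenConv (dirD v K) := by
  funext p
  rw [dirD, (h.hasFDerivAt_greenConv hK p).fderiv, greenConv, ContinuousLinearMap.integral_apply
    (h.fderiv.integrable_green (hK.continuous_fderiv (by simp)) p)]
  rfl

end Green
end Kernels
end RegVM

namespace RegVM
-- The regularized fundamental solution and the kernels derived from it.
section RegularizedKernels

variable {χ : R3 → ℝ} {ε : ℝ}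

theorem contDiff_chiEps (hχ : IsMollifier χ) (ε : ℝ) : ContDiff ℝ ∞ (chiEps χ ε) := by
  have h : ContDiff ℝ ∞ fun x : R3 => χ (ε⁻¹ • x) := hχ.smooth.comp (by fun_prop)
  exact contDiff_const.mul h

theorem chiEps_eq_zero (hχ : IsMollifier χ) (hε : 0 < ε) {x : R3} (hx : ε < ‖x‖) :
    chiEps χ ε x = 0 := by
  have : χ (ε⁻¹ • x) = 0 := by
    refine image_eq_zero_of_notMem_tsupport fun h => ?_
    have h1 := hχ.supp h
    rw [mem_closedBall_zero_iff, norm_smul, norm_inv, Real.norm_of_nonneg hε.le,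
      inv_mul_le_iff₀ hε, mul_one] at h1
    linarith
  rw [chiEps, this, mul_zero]

theorem hasCompactSupport_chiEps (hχ : IsMollifier χ) (hε : 0 < ε) :
    HasCompactSupport (chiEps χ ε) :=
  HasCompactSupport.intro (isCompact_closedBall (0 : R3) ε) fun _ hx =>
    chiEps_eq_zero hχ hε (by simpa using hx)

theorem contDiff_chi2 (hχ : IsMollifier χ) (hε : 0 < ε) : ContDiff ℝ ∞ (chi2 χ ε) :=
  (hasCompactSupport_chiEps hχ hε).contDiff_convolution_right _
    (contDiff_chiEps hχ ε).continuous.locallyIntegrable (contDiff_chiEps hχ ε)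

theorem chi2_eq_zero (hχ : IsMollifier χ) (hε : 0 < ε) {x : R3} (hx : 2 * ε < ‖x‖) :
    chi2 χ ε x = 0 := by
  refine integral_eq_zero_of_ae (Eventually.of_forall fun t => ?_)
  simp only [ContinuousLinearMap.mul_apply', Pi.zero_apply, mul_eq_zero]
  by_cases ht : ε < ‖t‖
  · exact Or.inl (chiEps_eq_zero hχ hε ht)
  · refine Or.inr (chiEps_eq_zero hχ hε ?_)
    have := norm_sub_norm_le x t
    linarith

/-- `Y_ε` as a function on space-time. -/
def kernelY (χ : R3 → ℝ) (ε : ℝ) (p : ℝ × R3) : ℝ := Yeps χ ε p.1 p.2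

theorem contDiff_kernelY (hχ : IsMollifier χ) (hε : 0 < ε) : ContDiff ℝ ∞ (kernelY χ ε) :=
  contDiff_kirchhoff (contDiff_chi2 hχ hε)

theorem coneSupported_kernelY (hχ : IsMollifier χ) (hε : 0 < ε) :
    ConeSupported (2 * ε) (kernelY χ ε) := fun _ hp =>
  kirchhoff_eq_zero (g := chi2 χ ε) (fun _ hx => chi2_eq_zero hχ hε hx) hp

theorem ConeSupported.dirD {G : Type} [NormedAddCommGroup G] [NormedSpace ℝ G] {R : ℝ}
    {K : ℝ × R3 → G} (h : ConeSupported R K) (v : ℝ × R3) : ConeSupported R (dirD v K) :=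
  fun p hp => by rw [RegVM.dirD, h.fderiv p hp]; simp

theorem dtY_eq (hχ : IsMollifier χ) (hε : 0 < ε) (t : ℝ) (x : R3) :
    dtY χ ε t x = dirD dirT (kernelY χ ε) (t, x) :=
  (hasDerivAt_slice_time ((contDiff_kernelY hχ hε).differentiable (by simp) (t, x))).deriv

theorem inner_basisVec (v : R3) (i : Fin 3) : inner ℝ v (basisVec i) = v i := by
  simp [basisVec, EuclideanSpace.inner_single_right]

theorem gradient_apply (g : R3 → ℝ) (x : R3) (i : Fin 3) :
    gradient g x i = fderiv ℝ g x (basisVec i) := by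
  have h := InnerProductSpace.toDual_symm_apply (𝕜 := ℝ) (x := basisVec i) (y := fderiv ℝ g x)
  rw [← h, inner_basisVec, gradient]

/-- The gradient in the space variable of a function on space-time. -/
def spaceGrad (F : ℝ × R3 → ℝ) (p : ℝ × R3) : R3 :=
  (InnerProductSpace.toDual ℝ R3).symm ((fderiv ℝ F p).comp (ContinuousLinearMap.inr ℝ ℝ R3))

theorem gradient_slice {F : ℝ × R3 → ℝ} (hF : Differentiable ℝ F) (t : ℝ) (x : R3) :
    gradient (fun x => F (t, x)) x = spaceGrad F (t, x) := by
  rw [gradient, (hasFDerivAt_slice_space (hF (t, x))).fderiv, spaceGrad]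

theorem contDiff_spaceGrad {F : ℝ × R3 → ℝ} (hF : ContDiff ℝ ∞ F) :
    ContDiff ℝ ∞ (spaceGrad F) := by
  have h : ContDiff ℝ ∞ fun p => (fderiv ℝ F p).comp (ContinuousLinearMap.inr ℝ ℝ R3) :=
    (hF.fderiv_right (m := ∞) (by simp)).clm_comp contDiff_const
  exact (InnerProductSpace.toDual ℝ R3).symm.toContinuousLinearEquiv.contDiff.comp h

theorem ConeSupported.spaceGrad {F : ℝ × R3 → ℝ} {R : ℝ} (h : ConeSupported R F) :
    ConeSupported R (spaceGrad F) := fun p hp => by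
  rw [RegVM.spaceGrad, h.fderiv p hp]
  simp

theorem spaceGrad_apply {F : ℝ × R3 → ℝ} (p : ℝ × R3) (i : Fin 3) :
    spaceGrad F p i = dirD (dirX i) F p := by
  have h := InnerProductSpace.toDual_symm_apply (𝕜 := ℝ) (x := basisVec i)
    (y := (fderiv ℝ F p).comp (ContinuousLinearMap.inr ℝ ℝ R3))
  have h2 : dirD (dirX i) F p = (fderiv ℝ F p).comp (ContinuousLinearMap.inr ℝ ℝ R3) (basisVec i) := by
    simp [dirD, dirX]
  rw [h2, ← h, inner_basisVec, spaceGrad]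

theorem gradY_eq (hχ : IsMollifier χ) (hε : 0 < ε) (t : ℝ) (x : R3) :
    gradY χ ε t x = spaceGrad (kernelY χ ε) (t, x) :=
  gradient_slice ((contDiff_kernelY hχ hε).differentiable (by simp)) t x

theorem boundedKernel_gradY (hχ : IsMollifier χ) (hε : 0 < ε) :
    BoundedKernel fun p : ℝ × R3 => gradY χ ε p.1 p.2 := by
  simp only [gradY_eq hχ hε]
  exact (coneSupported_kernelY hχ hε).spaceGrad.boundedKernel
    (contDiff_spaceGrad (contDiff_kernelY hχ hε))

theorem boundedKernel_dtY (hχ : IsMollifier χ) (hε : 0 < ε) :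
    BoundedKernel fun p : ℝ × R3 => dtY χ ε p.1 p.2 := by
  simp only [dtY_eq hχ hε]
  exact ((coneSupported_kernelY hχ hε).dirD dirT).boundedKernel
    (contDiff_dirD (contDiff_kernelY hχ hε) dirT)

theorem boundedKernel_gradtxY (hχ : IsMollifier χ) (hε : 0 < ε) :
    BoundedKernel fun p : ℝ × R3 => gradtxY χ ε p.1 p.2 := by
  have hk := contDiff_kernelY hχ hε
  have hs := coneSupported_kernelY hχ hε
  have e : (fun p : ℝ × R3 => gradtxY χ ε p.1 p.2)
      = fun p => (WithLp.prodContinuousLinearEquiv 2 ℝ ℝ R3).symm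
        (dirD dirT (kernelY χ ε) p, spaceGrad (kernelY χ ε) p) := by
    funext p
    simp only [gradtxY, dtY_eq hχ hε, gradY_eq hχ hε]
    rfl
  rw [e]
  have hsupp : ConeSupported (2 * ε) fun p => (WithLp.prodContinuousLinearEquiv 2 ℝ ℝ R3).symm
        (dirD dirT (kernelY χ ε) p, spaceGrad (kernelY χ ε) p) := fun p hp => by
    simp only [hs.dirD dirT p hp, hs.spaceGrad p hp]
    exact map_zero (WithLp.prodContinuousLinearEquiv 2 ℝ ℝ R3).symm
  refine hsupp.boundedKernel ?_
  exact (WithLp.prodContinuousLinearEquiv 2 ℝ ℝ R3).symm.contDiff.comp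
    ((contDiff_dirD hk dirT).prodMk (contDiff_spaceGrad hk))

theorem gradDtYG_eq (hχ : IsMollifier χ) (hε : 0 < ε) (t : ℝ) (x : R3) :
    gradDtYG χ ε t x = greenConv (spaceGrad (dirD dirT (kernelY χ ε))) (t, x) := by
  have hd := (contDiff_dirD (contDiff_kernelY hχ hε) dirT).differentiable (by simp)
  have e : dtY χ ε t = fun x => dirD dirT (kernelY χ ε) (t, x) := funext fun x => dtY_eq hχ hε t x
  have e2 : gradient (dtY χ ε t) = fun x => spaceGrad (dirD dirT (kernelY χ ε)) (t, x) := by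
    funext x
    rw [e, gradient_slice hd]
  rw [gradDtYG, e2]
  rfl

theorem boundedKernel_gradDtYG (hχ : IsMollifier χ) (hε : 0 < ε) :
    BoundedKernel fun p : ℝ × R3 => gradDtYG χ ε p.1 p.2 := by
  simp only [gradDtYG_eq hχ hε]
  exact ((coneSupported_kernelY hχ hε).dirD dirT).spaceGrad.boundedKernel_greenConv
    (contDiff_spaceGrad (contDiff_dirD (contDiff_kernelY hχ hε) dirT))

end RegularizedKernels

/-! ### Transposing the wave propagator from the test function to the mollifier. -/

section Transposition

/-- The spread function is the transpose of the Kirchhoff operator. -/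
theorem integral_spread_mul {ψ h : R3 → ℝ} (hψ : Continuous ψ) (hψc : HasCompactSupport ψ)
    (hh : Continuous h) (τ : ℝ) (w : R3) :
    ∫ y, spread ψ (τ, y) * h (y - w) = ∫ y, ψ y * kirchhoff h τ (y - w) := by
  have hint : Integrable (fun q : R3 × Metric.sphere (0 : R3) 1 =>
      ψ (q.1 + τ • (q.2 : R3)) * h (q.1 - w)) (volume.prod sphereMeasure) := by
    have hcont : Continuous fun q : R3 × Metric.sphere (0 : R3) 1 =>
        ψ (q.1 + τ • (q.2 : R3)) * h (q.1 - w) :=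
      (hψ.comp (by fun_prop)).mul (hh.comp (by fun_prop))
    refine hcont.integrable_of_hasCompactSupport ?_
    obtain ⟨R, hR⟩ := hψc.isBounded.subset_closedBall 0
    refine HasCompactSupport.intro ((isCompact_closedBall (0 : R3) (R + |τ|)).prod isCompact_univ)
      fun q hq => ?_
    have hq' : R + |τ| < ‖q.1‖ := by simpa using hq
    have : ψ (q.1 + τ • (q.2 : R3)) = 0 := by
      refine image_eq_zero_of_notMem_tsupport fun hx => ?_
      have h1 := hR hx
      rw [mem_closedBall_zero_iff] at h1
      have h2 := norm_sub_le (q.1 + τ • (q.2 : R3)) (τ • (q.2 : R3))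
      rw [add_sub_cancel_right, norm_smul, norm_eq_of_mem_sphere, mul_one, Real.norm_eq_abs] at h2
      linarith
    rw [this, zero_mul]
  have hint2 : Integrable (fun q : R3 × Metric.sphere (0 : R3) 1 =>
      ψ q.1 * h (q.1 - τ • (q.2 : R3) - w)) (volume.prod sphereMeasure) := by
    have hcont : Continuous fun q : R3 × Metric.sphere (0 : R3) 1 =>
        ψ q.1 * h (q.1 - τ • (q.2 : R3) - w) :=
      (hψ.comp (by fun_prop)).mul (hh.comp (by fun_prop))
    refine hcont.integrable_of_hasCompactSupport (HasCompactSupport.intro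
      (hψc.isCompact.prod isCompact_univ) fun q hq => ?_)
    rw [image_eq_zero_of_notMem_tsupport (f := ψ) fun hx => hq ⟨hx, trivial⟩, zero_mul]
  have e1 : ∀ y, spread ψ (τ, y) * h (y - w) = τ / (4 * Real.pi) *
      ∫ σ : Metric.sphere (0 : R3) 1, ψ (y + τ • (σ : R3)) * h (y - w) ∂sphereMeasure := fun y => by
    rw [integral_mul_const]
    simp only [spread, sphInt, neg_smul, sub_neg_eq_add]
    ring
  have e2 : ∀ y, ψ y * kirchhoff h τ (y - w) = τ / (4 * Real.pi) *
      ∫ σ : Metric.sphere (0 : R3) 1, ψ y * h (y - τ • (σ : R3) - w) ∂sphereMeasure := fun y => by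
    rw [integral_const_mul]
    simp only [kirchhoff, sphInt, smul_eq_mul, sub_right_comm]
    ring
  simp only [e1, e2]
  rw [integral_const_mul, integral_const_mul]
  congr 1
  refine (integral_integral_swap hint).trans (Eq.trans ?_ (integral_integral_swap hint2).symm)
  refine integral_congr_ae (Eventually.of_forall fun σ => ?_)
  simp only
  rw [← integral_add_right_eq_self (fun y => ψ y * h (y - τ • (σ : R3) - w)) (τ • (σ : R3))]
  simp only [add_sub_cancel_right]

variable {χ : R3 → ℝ} {ε : ℝ} {ψ : R3 → ℝ}

theorem spread_zero_off (hψc : HasCompactSupport ψ) : ∃ R, ConeSupported R (spread ψ) ∧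
    ∀ y, R < ‖y‖ → ψ y = 0 := by
  obtain ⟨R, hR⟩ := hψc.isBounded.subset_closedBall 0
  have hψ0 : ∀ y, R < ‖y‖ → ψ y = 0 := fun y hy => image_eq_zero_of_notMem_tsupport fun h =>
    absurd (hR h) (by simpa using hy)
  exact ⟨R, fun p hp => spread_eq_zero hψ0 hp, hψ0⟩

/-- The transposition identity `integral_spread_mul` holds for every `τ`; this is its derivative in
`τ`, by uniqueness of derivatives. -/
theorem integral_dirT_spread_mul (hψ : ContDiff ℝ ∞ ψ) (hψc : HasCompactSupport ψ) {h : R3 → ℝ}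
    (hh : ContDiff ℝ ∞ h) (τ : ℝ) (w : R3) :
    ∫ y, dirD dirT (spread ψ) (τ, y) * h (y - w)
      = ∫ y, ψ y * dirD dirT (fun p : ℝ × R3 => kirchhoff h p.1 p.2) (τ, y - w) := by
  obtain ⟨R, hR, hψ0⟩ := spread_zero_off hψc
  have cS := contDiff_spread hψ
  have cK := contDiff_kirchhoff hh
  have h1 := (hasDerivAt_integral_slices (a := τ - 1) (b := τ + 1) (R := R + (|τ| + 1)) (s := τ)
    (F := fun p => spread ψ p * h (p.2 - w))
    ((cS.mul (hh.comp (by fun_prop : ContDiff ℝ ∞ fun p : ℝ × R3 => p.2 - w))).of_le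
      (by simp)).contDiffOn (fun s hs y hy => by
        have : |s| ≤ |τ| + 1 := by
          have := abs_sub_abs_le_abs_sub s τ
          have h2 : |s - τ| ≤ 1 := abs_le.2 ⟨by linarith [hs.1], by linarith [hs.2]⟩
          linarith
        rw [hR (s, y) (by simp only; linarith), zero_mul]) ⟨by linarith, by linarith⟩).2
  have cK' : ContDiff ℝ ∞ fun p : ℝ × R3 => kirchhoff h p.1 (p.2 - w) :=
    cK.comp (f := fun p : ℝ × R3 => (p.1, p.2 - w)) (by fun_prop)
  have h2 := (hasDerivAt_integral_slices (a := τ - 1) (b := τ + 1) (R := R) (s := τ)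
    (F := fun p => ψ p.2 * kirchhoff h p.1 (p.2 - w))
    (((hψ.comp contDiff_snd).mul cK').of_le (by simp)).contDiffOn (fun s hs y hy => by
        rw [hψ0 y hy, zero_mul]) ⟨by linarith, by linarith⟩).2
  simp only [integral_spread_mul hψ.continuous hψc hh.continuous] at h1
  have h3 := h1.unique h2
  have e1 : ∀ y, dirD dirT (fun p => spread ψ p * h (p.2 - w)) (τ, y)
      = dirD dirT (spread ψ) (τ, y) * h (y - w) := fun y => by
    have hd := ((cS.mul (hh.comp (by fun_prop : ContDiff ℝ ∞ fun p : ℝ × R3 => p.2 - w))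
      ).differentiable (by simp) (τ, y))
    have a := hasDerivAt_slice_time hd
    have b := (hasDerivAt_slice_time (cS.differentiable (by simp) (τ, y))).mul_const (h (y - w))
    exact a.unique b
  have e2 : ∀ y, dirD dirT (fun p : ℝ × R3 => ψ p.2 * kirchhoff h p.1 (p.2 - w)) (τ, y)
      = ψ y * dirD dirT (fun p : ℝ × R3 => kirchhoff h p.1 p.2) (τ, y - w) := fun y => by
    have hd := (((hψ.comp contDiff_snd).mul cK').differentiable (by simp) (τ, y))
    have a := hasDerivAt_slice_time hd
    have b := (hasDerivAt_slice_time (cK.differentiable (by simp) (τ, y - w))).const_mul (ψ y)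
    exact a.unique b
  simpa only [e1, e2] using h3

theorem integral_dirT_spread_chi2 (hχ : IsMollifier χ) (hε : 0 < ε) (hψ : ContDiff ℝ ∞ ψ)
    (hψc : HasCompactSupport ψ) (τ : ℝ) (w : R3) :
    ∫ y, dirD dirT (spread ψ) (τ, y) * chi2 χ ε (y - w) = ∫ y, ψ y * dtY χ ε τ (y - w) := by
  rw [integral_dirT_spread_mul hψ hψc (contDiff_chi2 hχ hε)]
  simp only [dtY_eq hχ hε]
  rfl

/-- Space derivatives commute with spherical means, so the derivative first moves onto `ψ`; after
transposition, an integration by parts puts it on `Y_ε`, which is the origin of the sign. -/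
theorem integral_dirX_spread_chi2 (hχ : IsMollifier χ) (hε : 0 < ε) (hψ : ContDiff ℝ ∞ ψ)
    (hψc : HasCompactSupport ψ) (τ : ℝ) (w : R3) (i : Fin 3) :
    ∫ y, dirD (dirX i) (spread ψ) (τ, y) * chi2 χ ε (y - w)
      = -∫ y, ψ y * gradY χ ε τ (y - w) i := by
  obtain ⟨R, hR, hψ0⟩ := spread_zero_off hψc
  have hc : HasCompactSupport (dirD (basisVec i) ψ) := hψc.fderiv_apply (𝕜 := ℝ) _
  rw [dirX_spread hψ, integral_spread_mul (contDiff_dirD hψ _).continuous hc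
    (contDiff_chi2 hχ hε).continuous, eq_neg_iff_add_eq_zero]
  have cY : ContDiff ℝ ∞ fun y => kernelY χ ε (τ, y - w) :=
    (contDiff_kernelY hχ hε).comp (by fun_prop)
  have hz := zeroIntegral_fderiv_mul (f := ψ) (g := fun y => kernelY χ ε (τ, y - w))
    (hψ.of_le (by simp)) hψ0 (cY.of_le (by simp)) (basisVec i)
  have e : ∀ y, fderiv ℝ (fun y => kernelY χ ε (τ, y - w)) y (basisVec i) = gradY χ ε τ (y - w) i :=
    fun y => by
      rw [fderiv_comp_sub (f := fun y => kernelY χ ε (τ, y)) w, gradY_eq hχ hε,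
        spaceGrad_apply]
      exact fderiv_slice_space ((contDiff_kernelY hχ hε).differentiable (by simp) _) _
  simp only [e] at hz
  have cg : Continuous fun y => gradY χ ε τ (y - w) i := by
    simp only [← e]
    exact continuous_dirD (cY.of_le (by simp)) _
  rw [← integral_add]
  · exact hz.2
  · exact ((contDiff_dirD hψ _).continuous.mul cY.continuous).integrable_of_hasCompactSupport
      hc.mul_right
  · exact (hψ.continuous.mul cg).integrable_of_hasCompactSupport hψc.mul_right

/-- The regularized Newtonian potential `G ⋆ χ_ε ⋆ χ_ε`. -/
def regGreen (χ : R3 → ℝ) (ε : ℝ) : R3 → ℝ :=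
  convolution green (chi2 χ ε) (ContinuousLinearMap.mul ℝ ℝ) volume

theorem coneSupported_chi2 (hχ : IsMollifier χ) (hε : 0 < ε) :
    ConeSupported (2 * ε) fun p : ℝ × R3 => chi2 χ ε p.2 := fun p hp =>
  chi2_eq_zero hχ hε (by linarith [abs_nonneg p.1])

theorem boundedKernel_regGreen (hχ : IsMollifier χ) (hε : 0 < ε) :
    BoundedKernel (greenConv fun p : ℝ × R3 => chi2 χ ε p.2) :=
  (coneSupported_chi2 hχ hε).boundedKernel_greenConv ((contDiff_chi2 hχ hε).comp contDiff_snd)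

theorem contDiff_regGreen (hχ : IsMollifier χ) (hε : 0 < ε) : ContDiff ℝ ∞ (regGreen χ ε) :=
  (boundedKernel_regGreen hχ hε).smooth.comp (f := fun x : R3 => ((0 : ℝ), x)) (by fun_prop)

/-- The derivative falls on the smooth, compactly supported factor of the convolution and not on the
singular one. -/
theorem dirD_regGreen (hχ : IsMollifier χ) (hε : 0 < ε) (i : Fin 3) (x : R3) :
    dirD (basisVec i) (regGreen χ ε) x = ∫ z, green z * dirD (basisVec i) (chi2 χ ε) (x - z) := by
  have hb := boundedKernel_regGreen hχ hε
  have hc2 : ContDiff ℝ ∞ fun p : ℝ × R3 => chi2 χ ε p.2 := (contDiff_chi2 hχ hε).comp contDiff_snd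
  have h1 := fderiv_slice_space (hb.differentiable ((0 : ℝ), x)) (basisVec i)
  rw [show dirD (basisVec i) (regGreen χ ε) x = _ from h1]
  rw [(coneSupported_chi2 hχ hε).dirD_greenConv hc2]
  refine integral_congr_ae (Eventually.of_forall fun z => ?_)
  simp only [smul_eq_mul]
  rw [← fderiv_slice_space (F := fun p : ℝ × R3 => chi2 χ ε p.2) (hc2.differentiable (by simp) _)]
  rfl

/-- Spherical means commute with convolution by `G`. Fubini's theorem applies since the mollifier
confines the integrand to a fixed ball, where a multiple of the integrable `G` dominates it. -/
theorem kirchhoff_dirD_regGreen (hχ : IsMollifier χ) (hε : 0 < ε) (i : Fin 3) (p : ℝ × R3) :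
    kirchhoff (dirD (basisVec i) (regGreen χ ε)) p.1 p.2
      = greenConv (dirD (dirX i) (kernelY χ ε)) p := by
  have hdc := contDiff_dirD (contDiff_chi2 hχ hε) (basisVec i)
  have hint : Integrable (fun q : Metric.sphere (0 : R3) 1 × R3 =>
      green q.2 * dirD (basisVec i) (chi2 χ ε) (p.2 - p.1 • (q.1 : R3) - q.2))
      (sphereMeasure.prod volume) := by
    have hcont : Continuous fun q : Metric.sphere (0 : R3) 1 × R3 =>
        dirD (basisVec i) (chi2 χ ε) (p.2 - p.1 • (q.1 : R3) - q.2) :=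
      hdc.continuous.comp (by fun_prop)
    have h0 : ∀ q : Metric.sphere (0 : R3) 1 × R3, q.2 ∉ Metric.closedBall (0 : R3)
        (‖p.2‖ + |p.1| + 2 * ε) →
        dirD (basisVec i) (chi2 χ ε) (p.2 - p.1 • (q.1 : R3) - q.2) = 0 := by
      intro q hq
      refine dirD_eq_zero (U := {x : R3 | 2 * ε < ‖x‖}) (isOpen_lt continuous_const continuous_norm)
        (fun x hx => chi2_eq_zero hχ hε hx) _ ?_
      have h1 : ‖p.2‖ + |p.1| + 2 * ε < ‖q.2‖ := by simpa using hq
      have h2 : ‖p.2 - p.1 • (q.1 : R3)‖ ≤ ‖p.2‖ + |p.1| := by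
        refine (norm_sub_le _ _).trans ?_
        rw [norm_smul, norm_eq_of_mem_sphere, mul_one, Real.norm_eq_abs]
      have h3 := norm_sub_norm_le q.2 (p.2 - p.1 • (q.1 : R3))
      rw [norm_sub_rev q.2 (p.2 - p.1 • (q.1 : R3))] at h3
      show 2 * ε < ‖p.2 - p.1 • (q.1 : R3) - q.2‖
      linarith
    obtain ⟨C, hC⟩ := (isCompact_univ.prod (isCompact_closedBall (0 : R3)
      (‖p.2‖ + |p.1| + 2 * ε))).exists_bound_of_continuousOn hcont.continuousOn
    have hgi : Integrable ((Metric.closedBall (0 : R3) (‖p.2‖ + |p.1| + 2 * ε)).indicator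
        fun z => C * green z) := by
      refine (integrable_indicator_iff Metric.isClosed_closedBall.measurableSet).2 ?_
      exact ((locallyIntegrable_iff.1 locallyIntegrable_green) _ (isCompact_closedBall _ _)).const_mul C
    refine (hgi.comp_snd sphereMeasure).mono' ?_ (Eventually.of_forall fun q => ?_)
    · exact (locallyIntegrable_green.aestronglyMeasurable.comp_snd).mul hcont.aestronglyMeasurable
    · by_cases hq : q.2 ∈ Metric.closedBall (0 : R3) (‖p.2‖ + |p.1| + 2 * ε)
      · rw [indicator_of_mem hq, norm_mul, Real.norm_of_nonneg (green_nonneg _), mul_comm]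
        exact mul_le_mul_of_nonneg_right (hC q ⟨trivial, hq⟩) (green_nonneg _)
      · rw [indicator_of_notMem hq, h0 q hq, mul_zero, norm_zero]
  have e : ∀ q, dirD (dirX i) (kernelY χ ε) q
      = q.1 / (4 * Real.pi) * sphInt (dirD (basisVec i) (chi2 χ ε)) q.1 q.2 := by
    rintro ⟨t, x⟩
    rw [dirX, ← fderiv_slice_space ((contDiff_kernelY hχ hε).differentiable (by simp) _)]
    have hd : DifferentiableAt ℝ (sphInt (chi2 χ ε) t) x :=
      ((contDiff_sphInt (contDiff_chi2 hχ hε)).comp (f := fun y : R3 => (t, y))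
        (by fun_prop)).differentiable (by simp) x
    rw [show (fun z => kernelY χ ε (t, z)) = fun z => t / (4 * Real.pi) * sphInt (chi2 χ ε) t z
      from rfl, fderiv_const_mul hd]
    simp only [_root_.smul_apply, smul_eq_mul]
    rw [fderiv_sphInt_space (contDiff_chi2 hχ hε)]
    rfl
  simp only [kirchhoff, greenConv, sphInt, e, dirD_regGreen hχ hε, smul_eq_mul]
  rw [integral_integral_swap hint, ← integral_const_mul]
  refine integral_congr_ae (Eventually.of_forall fun z => ?_)
  simp only [integral_const_mul, sub_right_comm]
  ring

/-- This is where the kernel of `m_ε` comes from: the initial electrostatic field of a unit charge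
is `-∇(G ⋆ χ_ε ⋆ χ_ε)`, and the time derivative of the propagator turns it into `-∂_t∇Y_ε ⋆ G`. -/
theorem integral_dirT_spread_regGreen (hχ : IsMollifier χ) (hε : 0 < ε) (hψ : ContDiff ℝ ∞ ψ)
    (hψc : HasCompactSupport ψ) (τ : ℝ) (w : R3) (i : Fin 3) :
    ∫ y, dirD dirT (spread ψ) (τ, y) * dirD (basisVec i) (regGreen χ ε) (y - w)
      = ∫ y, ψ y * gradDtYG χ ε τ (y - w) i := by
  have hs := coneSupported_kernelY hχ hε
  have hk := contDiff_kernelY hχ hε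
  have hsT := hs.dirD dirT
  have hkT := contDiff_dirD hk dirT
  rw [integral_dirT_spread_mul hψ hψc (contDiff_dirD (contDiff_regGreen hχ hε) _)]
  refine integral_congr_ae (Eventually.of_forall fun y => ?_)
  simp only
  congr 1
  rw [funext (kirchhoff_dirD_regGreen hχ hε i), (hs.dirD (dirX i)).dirD_greenConv
    (contDiff_dirD hk (dirX i)), gradDtYG_eq hχ hε]
  have hi := hsT.spaceGrad.integrable_green (contDiff_spaceGrad hkT).continuous (τ, y - w)
  have hp := (EuclideanSpace.proj (𝕜 := ℝ) i : R3 →L[ℝ] ℝ).integral_comp_comm hi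
  simp only [greenConv]
  refine Eq.trans ?_ hp
  refine integral_congr_ae (Eventually.of_forall fun z => ?_)
  simp only [map_smul]
  rw [dirD_comm hk]
  exact congrArg _ (spaceGrad_apply _ i).symm

end Transposition
end RegVM

namespace RegVM
-- The relativistic velocity and the vector product.
section VelocityAndCross

theorem norm_vel_sq (ξ : R3) : ‖vel ξ‖ ^ 2 = 1 - (1 + ‖ξ‖ ^ 2)⁻¹ := by
  have h : 0 < 1 + ‖ξ‖ ^ 2 := by positivity
  rw [vel, norm_smul, norm_inv, Real.norm_of_nonneg (Real.sqrt_nonneg _), mul_pow, inv_pow,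
    Real.sq_sqrt h.le]
  field_simp
  ring

theorem norm_vel_le (ξ : R3) : ‖vel ξ‖ ≤ 1 := by
  have h := norm_vel_sq ξ
  have : 0 < (1 + ‖ξ‖ ^ 2)⁻¹ := by positivity
  exact (sq_le_one_iff₀ (norm_nonneg _)).1 (by linarith)

/-- With `a² = 1 + |ξ|²`, `b² = 1 + |η|²` and `s = ξ · η`, the square of the left side is `2 - a⁻² -
b⁻² - 2s / (ab) ≤ 2 (ab - 1 - s) / (ab)`. Since `ab ≥ 1` and, by Cauchy-Schwarz, `ab ≥ 1 + s`, this
is at most `2 (ab - 1 - s)`, hence at most `a² + b² - 2 - 2s`, the square of the right side. -/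
theorem norm_vel_sub_le (ξ η : R3) : ‖vel ξ - vel η‖ ≤ ‖ξ - η‖ := by
  refine (pow_le_pow_iff_left₀ (norm_nonneg _) (norm_nonneg _) two_ne_zero).1 ?_
  have hx : 1 ≤ 1 + ‖ξ‖ ^ 2 := by nlinarith [sq_nonneg ‖ξ‖]
  have hy : 1 ≤ 1 + ‖η‖ ^ 2 := by nlinarith [sq_nonneg ‖η‖]
  have hs : inner ℝ ξ η ≤ ‖ξ‖ * ‖η‖ := real_inner_le_norm ξ η
  have ha := Real.sq_sqrt (zero_le_one.trans hx)
  have hb := Real.sq_sqrt (zero_le_one.trans hy)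
  have ha1 : 1 ≤ √(1 + ‖ξ‖ ^ 2) := Real.one_le_sqrt.2 hx
  have hb1 : 1 ≤ √(1 + ‖η‖ ^ 2) := Real.one_le_sqrt.2 hy
  rw [norm_sub_sq_real, norm_sub_sq_real, norm_vel_sq, norm_vel_sq]
  simp only [vel, inner_smul_left, inner_smul_right, conj_trivial]
  set s : ℝ := inner ℝ ξ η
  set a := √(1 + ‖ξ‖ ^ 2)
  set b := √(1 + ‖η‖ ^ 2)
  rw [← ha, ← hb]
  have hab : 1 + s ≤ a * b := by
    have : (1 + ‖ξ‖ * ‖η‖) ^ 2 ≤ (a * b) ^ 2 := by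
      rw [mul_pow, ha, hb]
      nlinarith [sq_nonneg (‖ξ‖ - ‖η‖)]
    have h2 := abs_le_of_sq_le_sq this (by positivity)
    linarith [le_abs_self (1 + ‖ξ‖ * ‖η‖)]
  have h1 : 2 * (a⁻¹ * b⁻¹) ≤ (a ^ 2)⁻¹ + (b ^ 2)⁻¹ := by
    rw [← inv_pow, ← inv_pow]
    nlinarith [sq_nonneg (a⁻¹ - b⁻¹)]
  have h2 : (a * b - 1 - s) * (a⁻¹ * b⁻¹) ≤ (a * b - 1 - s) * 1 := by
    refine mul_le_mul_of_nonneg_left ?_ (by linarith)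
    exact mul_le_one₀ (inv_le_one_of_one_le₀ ha1) (by positivity) (inv_le_one_of_one_le₀ hb1)
  have h3 : a * b * (a⁻¹ * b⁻¹) = 1 := by field_simp
  nlinarith [sq_nonneg (a - b), sq_nonneg ‖ξ‖]

theorem continuous_vel : Continuous vel :=
  (LipschitzWith.of_dist_le_mul (K := 1) fun ξ η => by
    simpa [dist_eq_norm] using norm_vel_sub_le ξ η).continuous

/-- The components of the velocity. -/
def velBCF (i : Fin 3) : Phase →ᵇ ℝ :=
  BoundedContinuousFunction.ofNormedAddCommGroup (fun ζ : Phase => vel ζ.2 i)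
    ((EuclideanSpace.proj (𝕜 := ℝ) i : R3 →L[ℝ] ℝ).continuous.comp
      (continuous_vel.comp continuous_snd)) 1
    fun ζ => (PiLp.norm_apply_le (vel ζ.2) i).trans (norm_vel_le _)

theorem cross_apply (a b : R3) (i : Fin 3) :
    cross a b i = a (i + 1) * b (i + 2) - a (i + 2) * b (i + 1) := by
  fin_cases i <;> simp [cross, crossProduct]

theorem cross_neg_swap (a b : R3) : cross b a = -cross a b := by
  ext i
  simp only [PiLp.neg_apply, cross_apply]
  ring

theorem norm_cross_le (a b : R3) : ‖cross a b‖ ≤ ‖a‖ * ‖b‖ := by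
  refine (pow_le_pow_iff_left₀ (norm_nonneg _) (by positivity) two_ne_zero).1 ?_
  rw [mul_pow]
  simp only [EuclideanSpace.norm_sq_eq, Fin.sum_univ_three, cross_apply, Real.norm_eq_abs, sq_abs]
  have e1 : (0 : Fin 3) + 1 = 1 := rfl
  have e2 : (0 : Fin 3) + 2 = 2 := rfl
  have e3 : (1 : Fin 3) + 1 = 2 := rfl
  have e4 : (1 : Fin 3) + 2 = 0 := rfl
  have e5 : (2 : Fin 3) + 1 = 0 := rfl
  have e6 : (2 : Fin 3) + 2 = 1 := rfl
  simp only [e1, e2, e3, e4, e5, e6]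
  -- Lagrange's identity: the defect is the square of the inner product.
  nlinarith [sq_nonneg (a 0 * b 0 + a 1 * b 1 + a 2 * b 2)]

theorem cross_add_right (a b c : R3) : cross a (b + c) = cross a b + cross a c := by
  ext i
  simp only [PiLp.add_apply, cross_apply]
  ring

theorem cross_smul_right (a : R3) (r : ℝ) (b : R3) : cross a (r • b) = r • cross a b := by
  ext i
  simp only [PiLp.smul_apply, cross_apply, smul_eq_mul]
  ring

/-- The vector product with `a` from the left, as a continuous linear map. -/
def crossL (a : R3) : R3 →L[ℝ] R3 :=
  LinearMap.mkContinuous (IsLinearMap.mk' (cross a) ⟨cross_add_right a, cross_smul_right a⟩) ‖a‖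
    fun b => norm_cross_le a b

theorem crossL_apply (a b : R3) : crossL a b = cross a b := rfl

theorem cross_sub_right (a b c : R3) : cross a (b - c) = cross a b - cross a c :=
  (crossL a).map_sub b c

theorem cross_sub_left (a b c : R3) : cross (a - b) c = cross a c - cross b c := by
  ext i
  simp only [PiLp.sub_apply, cross_apply]
  ring

theorem continuous_cross {X : Type*} [TopologicalSpace X] {f g : X → R3} (hf : Continuous f)
    (hg : Continuous g) : Continuous fun x => cross (f x) (g x) := by
  have hp : ∀ (h : X → R3), Continuous h → ∀ i, Continuous fun x => h x i := fun h hh i =>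
    (EuclideanSpace.proj (𝕜 := ℝ) i : R3 →L[ℝ] ℝ).continuous.comp hh
  refine (PiLp.continuous_toLp 2 _).comp (continuous_pi fun i => ?_)
  simp only [← show ∀ x, cross (f x) (g x) i = crossProduct (WithLp.ofLp (f x)) (WithLp.ofLp (g x)) i
    from fun x => rfl, cross_apply]
  exact ((hp f hf _).mul (hp g hg _)).sub ((hp f hf _).mul (hp g hg _))

end VelocityAndCross

/-! ### Averages of kernels over weakly continuous families of measures. -/

section Averages

/-- A weakly continuous family of finite measures. -/
structure WeaklyContinuous (μ : ℝ → Measure Phase) : Prop where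
  finite : ∀ t, IsFiniteMeasure (μ t)
  cont : ∀ φ : Phase →ᵇ ℝ, Continuous fun t => ∫ z, φ z ∂μ t

variable {μ : ℝ → Measure Phase}

/-- Joint continuity from two separate ones: the test functions vary continuously in the sup norm
and the masses are locally bounded, so the test function may be frozen at `x₀`, where weak
continuity applies. -/
theorem WeaklyContinuous.continuous_integral (hμ : WeaklyContinuous μ) {X : Type*}
    [TopologicalSpace X] {K : X → (Phase →ᵇ ℝ)} (hK : Continuous K) {s : X → ℝ} (hs : Continuous s) :
    Continuous fun x => ∫ z, K x z ∂μ (s x) := by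
  have := hμ.finite
  refine continuous_iff_continuousAt.2 fun x₀ => ?_
  have hmass : Continuous fun x => ‖K x - K x₀‖ * (μ (s x)).real univ := by
    have h1 := (hμ.cont 1).comp hs
    have h2 : (fun x => (μ (s x)).real univ)
        = (fun t => ∫ z, (1 : Phase →ᵇ ℝ) z ∂μ t) ∘ s := by
      funext x; simp
    rw [h2.symm] at h1
    exact (hK.sub continuous_const).norm.mul h1
  have hlim : Tendsto (fun x => ‖K x - K x₀‖ * (μ (s x)).real univ) (𝓝 x₀) (𝓝 0) := by
    have := hmass.tendsto x₀
    simpa using this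
  have hi : ∀ (φ : Phase →ᵇ ℝ) t, Integrable φ (μ t) := fun φ t => φ.integrable _
  have hdiff : Tendsto (fun x => ∫ z, (K x - K x₀) z ∂μ (s x)) (𝓝 x₀) (𝓝 0) := by
    refine squeeze_zero_norm (fun x => ?_) hlim
    exact norm_integral_le_of_norm_le_const (Eventually.of_forall fun z =>
      (K x - K x₀).norm_coe_le_norm z)
  have hmain : Tendsto (fun x => ∫ z, K x₀ z ∂μ (s x)) (𝓝 x₀) (𝓝 (∫ z, K x₀ z ∂μ (s x₀))) :=
    ((hμ.cont (K x₀)).comp hs).tendsto x₀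
  have := hdiff.add hmain
  rw [zero_add] at this
  refine this.congr fun x => ?_
  rw [← integral_add (hi _ _) (hi _ _)]
  exact integral_congr_ae (Eventually.of_forall fun z => by simp)

/-- The average of the translates of `k`, weighted by `b`. -/
def avg (μ : Measure Phase) (k : R3 → ℝ) (b : Phase → ℝ) (x : R3) : ℝ :=
  ∫ ζ, k (x - ζ.1) * b ζ ∂μ

theorem BoundedKernel.exists_slice_bound {G : Type} [NormedAddCommGroup G] [NormedSpace ℝ G]
    {K : ℝ × R3 → G} (h : BoundedKernel K) (t : ℝ) : ∃ M, ∀ x, ‖K (t, x)‖ ≤ M := by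
  obtain ⟨M, hM⟩ := h.bound |t|
  exact ⟨M, fun x => (hM (t, x) le_rfl).1⟩

/-- The integrand of `avg` as a bounded continuous function. -/
def kernelBCF {K : ℝ × R3 → ℝ} (hK : BoundedKernel K) (b : Phase →ᵇ ℝ) (p : ℝ × R3) : Phase →ᵇ ℝ :=
  BoundedContinuousFunction.ofNormedAddCommGroup (fun ζ : Phase => K (p.1, p.2 - ζ.1) * b ζ)
    ((hK.smooth.continuous.comp (by fun_prop)).mul b.continuous)
    ((hK.exists_slice_bound p.1).choose * ‖b‖) fun ζ => by
      rw [norm_mul]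
      have h := (hK.exists_slice_bound p.1).choose_spec (p.2 - ζ.1)
      exact mul_le_mul h (b.norm_coe_le_norm ζ) (norm_nonneg _) ((norm_nonneg _).trans h)

theorem kernelBCF_apply {K : ℝ × R3 → ℝ} (hK : BoundedKernel K) (b : Phase →ᵇ ℝ) (p : ℝ × R3)
    (ζ : Phase) : kernelBCF hK b p ζ = K (p.1, p.2 - ζ.1) * b ζ := rfl

/-- The bound on the differential of `K` is uniform in space. Hence moving `(t, x)` changes the
integrand uniformly little, although the source points range over an unbounded set. -/
theorem continuous_kernelBCF {K : ℝ × R3 → ℝ} (hK : BoundedKernel K) (b : Phase →ᵇ ℝ) :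
    Continuous (kernelBCF hK b) := by
  refine continuous_iff_continuousAt.2 fun p₀ => ?_
  obtain ⟨M, hM0, -, hM⟩ := hK.exists_lipschitz (|p₀.1| + 1)
  have hlim : Tendsto (fun p : ℝ × R3 => M * ‖p - p₀‖ * ‖b‖) (𝓝 p₀) (𝓝 0) := by
    have : Continuous fun p : ℝ × R3 => M * ‖p - p₀‖ * ‖b‖ := by fun_prop
    simpa using this.tendsto p₀
  refine tendsto_iff_norm_sub_tendsto_zero.2 (squeeze_zero' (Eventually.of_forall fun _ =>
    norm_nonneg _) ?_ hlim)
  have hnear : ∀ᶠ p : ℝ × R3 in 𝓝 p₀, |p.1| ≤ |p₀.1| + 1 := by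
    have : Continuous fun p : ℝ × R3 => |p.1| := by fun_prop
    filter_upwards [this.tendsto p₀ |>.eventually (gt_mem_nhds (lt_add_one |p₀.1|))] with p hp
    exact hp.le
  filter_upwards [hnear] with p hp
  refine (BoundedContinuousFunction.norm_le (by positivity)).2 fun ζ => ?_
  simp only [BoundedContinuousFunction.coe_sub, Pi.sub_apply, kernelBCF_apply]
  rw [← sub_mul, norm_mul]
  refine mul_le_mul ?_ (b.norm_coe_le_norm ζ) (norm_nonneg _) (by positivity)
  refine (hM (p.1, p.2 - ζ.1) (p₀.1, p₀.2 - ζ.1) hp (by simp)).trans_eq ?_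
  congr 2
  ext <;> simp

theorem WeaklyContinuous.continuous_avg (hμ : WeaklyContinuous μ) {K : ℝ × R3 → ℝ}
    (hK : BoundedKernel K) (b : Phase →ᵇ ℝ) {X : Type*} [TopologicalSpace X] {s : X → ℝ}
    (hs : Continuous s) {p : X → ℝ × R3} (hp : Continuous p) :
    Continuous fun x => avg (μ (s x)) (fun y => K ((p x).1, y)) b (p x).2 :=
  hμ.continuous_integral ((continuous_kernelBCF hK b).comp hp) hs

theorem integrable_kernel_mul {μ : Measure Phase} [IsFiniteMeasure μ] {K : ℝ × R3 → ℝ}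
    (hK : BoundedKernel K) (b : Phase →ᵇ ℝ) (t : ℝ) (x : R3) :
    Integrable (fun ζ : Phase => K (t, x - ζ.1) * b ζ) μ :=
  (kernelBCF hK b (t, x)).integrable μ

theorem integral_mul_avg {μ : Measure Phase} [IsFiniteMeasure μ] {w : R3 → ℝ} (hw : Continuous w)
    (hwc : HasCompactSupport w) {K : ℝ × R3 → ℝ} (hK : BoundedKernel K) (b : Phase →ᵇ ℝ) (t : ℝ) :
    ∫ y, w y * avg μ (fun y => K (t, y)) b y
      = ∫ ζ, (∫ y, w y * K (t, y - ζ.1)) * b ζ ∂μ := by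
  obtain ⟨M, hM⟩ := hK.exists_slice_bound t
  have hint : Integrable (fun q : R3 × Phase => w q.1 * (K (t, q.1 - q.2.1) * b q.2))
      (volume.prod μ) := by
    refine (((hw.integrable_of_hasCompactSupport hwc).norm.mul_const (M * ‖b‖)).comp_fst μ).mono'
      ?_ (Eventually.of_forall fun q => ?_)
    · have : Continuous fun q : R3 × Phase => w q.1 * (K (t, q.1 - q.2.1) * b q.2) :=
        (hw.comp continuous_fst).mul ((hK.smooth.continuous.comp (by fun_prop)).mul
          (b.continuous.comp continuous_snd))
      exact this.aestronglyMeasurable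
    · rw [norm_mul, norm_mul]
      refine mul_le_mul_of_nonneg_left ?_ (norm_nonneg _)
      exact mul_le_mul (hM _) (b.norm_coe_le_norm _) (norm_nonneg _) ((norm_nonneg _).trans (hM 0))
  simp only [avg, ← integral_const_mul, ← integral_mul_const]
  rw [integral_integral_swap hint]
  simp only [mul_assoc]

/-- Transfer of an identity between convolutions with `K` and `K'` to averages. -/
theorem integral_mul_avg_transfer {μ : Measure Phase} [IsFiniteMeasure μ] {w ψ : R3 → ℝ}
    (hw : Continuous w) (hwc : HasCompactSupport w) (hψ : Continuous ψ) (hψc : HasCompactSupport ψ)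
    {K K' : ℝ × R3 → ℝ} (hK : BoundedKernel K) (hK' : BoundedKernel K') (b : Phase →ᵇ ℝ) {t t' c : ℝ}
    (h : ∀ v, ∫ y, w y * K (t, y - v) = c * ∫ y, ψ y * K' (t', y - v)) :
    ∫ y, w y * avg μ (fun y => K (t, y)) b y = c * ∫ y, ψ y * avg μ (fun y => K' (t', y)) b y := by
  rw [integral_mul_avg hw hwc hK, integral_mul_avg hψ hψc hK', ← integral_const_mul]
  simp only [h, mul_assoc]

end Averages
end RegVM

namespace RegVM
-- Pointwise formulas for the components of the regularized fields.
section FieldRepresentation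

theorem BoundedKernel.clm_comp {G H : Type} [NormedAddCommGroup G] [NormedSpace ℝ G]
    [NormedAddCommGroup H] [NormedSpace ℝ H] {K : ℝ × R3 → G} (h : BoundedKernel K) (A : G →L[ℝ] H) :
    BoundedKernel fun p => A (K p) := by
  refine ⟨A.contDiff.comp h.smooth, fun T => ?_⟩
  obtain ⟨M, hM⟩ := h.bound T
  refine ⟨‖A‖ * M, fun p hp => ⟨(A.le_opNorm _).trans
    (mul_le_mul_of_nonneg_left (hM p hp).1 (norm_nonneg _)), ?_⟩⟩
  have e : fderiv ℝ (fun p => A (K p)) p = A.comp (fderiv ℝ K p) :=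
    (A.hasFDerivAt.comp p (h.differentiable p).hasFDerivAt).fderiv
  rw [e]
  exact (A.opNorm_comp_le _).trans (mul_le_mul_of_nonneg_left (hM p hp).2 (norm_nonneg _))

theorem BoundedKernel.apply {K : ℝ × R3 → R3} (h : BoundedKernel K) (i : Fin 3) :
    BoundedKernel fun p => K p i :=
  h.clm_comp (EuclideanSpace.proj i : R3 →L[ℝ] ℝ)

theorem integral_apply_R3 {X : Type*} [MeasurableSpace X] {μ : Measure X} {f : X → R3}
    (hf : Integrable f μ) (i : Fin 3) : (∫ x, f x ∂μ) i = ∫ x, f x i ∂μ :=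
  ((EuclideanSpace.proj (𝕜 := ℝ) i : R3 →L[ℝ] ℝ).integral_comp_comm hf).symm

theorem integrable_of_continuous_of_le {X : Type*} [TopologicalSpace X] [MeasurableSpace X]
    [OpensMeasurableSpace X] [SecondCountableTopology X] {G : Type} [NormedAddCommGroup G]
    {μ : Measure X} [IsFiniteMeasure μ] {f : X → G} (hf : Continuous f) {C : ℝ}
    (hC : ∀ x, ‖f x‖ ≤ C) : Integrable f μ :=
  Integrable.of_bound hf.aestronglyMeasurable C (Eventually.of_forall hC)

theorem continuous_of_apply {X : Type*} [TopologicalSpace X] {f : X → R3}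
    (hf : ∀ i, Continuous fun x => f x i) : Continuous f :=
  (PiLp.continuous_toLp 2 _).comp (continuous_pi hf)

theorem continuous_apply_R3 (i : Fin 3) : Continuous fun v : R3 => v i :=
  (EuclideanSpace.proj (𝕜 := ℝ) i : R3 →L[ℝ] ℝ).continuous

variable {χ : R3 → ℝ} {ε : ℝ} {μ : ℝ → Measure Phase} {E B : ℝ → R3 → R3}

theorem boundedKernel_chi2 (hχ : IsMollifier χ) (hε : 0 < ε) :
    BoundedKernel fun p : ℝ × R3 => chi2 χ ε p.2 :=
  (coneSupported_chi2 hχ hε).boundedKernel ((contDiff_chi2 hχ hε).comp contDiff_snd)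

theorem regCharge_eq (hχ : IsMollifier χ) (hε : 0 < ε) (ν : Measure Phase) (x : R3) :
    regCharge χ ε ν x = avg ν (chi2 χ ε) 1 x := by
  rw [regCharge, charge, Measure.fst, integral_map measurable_fst.aemeasurable]
  · simp [avg]
  · exact ((contDiff_chi2 hχ hε).continuous.comp (by fun_prop)).aestronglyMeasurable

theorem regCurrent_apply (hχ : IsMollifier χ) (hε : 0 < ε) (ν : Measure Phase) [IsFiniteMeasure ν]
    (x : R3) (i : Fin 3) : regCurrent χ ε ν x i = avg ν (chi2 χ ε) (velBCF i) x := by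
  obtain ⟨M, hM⟩ := (boundedKernel_chi2 hχ hε).exists_slice_bound 0
  rw [regCurrent, current, integral_apply_R3]
  · rfl
  · refine integrable_of_continuous_of_le (C := M) (((contDiff_chi2 hχ hε).continuous.comp
      (by fun_prop)).smul (continuous_vel.comp continuous_snd)) fun z => ?_
    rw [norm_smul]
    exact (mul_le_of_le_one_right (norm_nonneg _) (norm_vel_le _)).trans (hM _)

theorem boundedKernel_grad_regGreen (hχ : IsMollifier χ) (hε : 0 < ε) (i : Fin 3) :
    BoundedKernel fun p : ℝ × R3 => dirD (basisVec i) (regGreen χ ε) p.2 := by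
  have hc2 : ContDiff ℝ ∞ fun p : ℝ × R3 => chi2 χ ε p.2 := (contDiff_chi2 hχ hε).comp contDiff_snd
  have h := ((coneSupported_chi2 hχ hε).dirD (dirX i)).boundedKernel_greenConv
    (contDiff_dirD hc2 (dirX i))
  refine (congrArg BoundedKernel (funext fun p => ?_)).mp h
  rw [dirD_regGreen hχ hε, greenConv]
  refine integral_congr_ae (Eventually.of_forall fun z => ?_)
  simp only [smul_eq_mul]
  congr 1
  rw [dirX, ← fderiv_slice_space (F := fun p : ℝ × R3 => chi2 χ ε p.2)
    (hc2.differentiable (by simp) _)]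
  rfl

theorem electrostatic_apply (hχ : IsMollifier χ) (hε : 0 < ε) (ν : Measure Phase)
    [IsFiniteMeasure ν] (x : R3) (i : Fin 3) :
    electrostatic χ ε ν x i = -avg ν (dirD (basisVec i) (regGreen χ ε)) 1 x := by
  have hG := contDiff_regGreen hχ hε
  have e : (fun x' => ∫ y, convolution green (chi2 χ ε) (ContinuousLinearMap.mul ℝ ℝ) volume
      (x' - y) ∂(charge ν)) = fun x' => ∫ ζ, regGreen χ ε (x' - ζ.1) ∂ν := by
    funext x'
    rw [charge, Measure.fst, integral_map measurable_fst.aemeasurable]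
    · rfl
    · exact (hG.continuous.comp (by fun_prop)).aestronglyMeasurable
  obtain ⟨M, hM⟩ := (boundedKernel_regGreen hχ hε).exists_slice_bound 0
  obtain ⟨M', hM'⟩ := (boundedKernel_regGreen hχ hε).bound 0
  have hM'' : ∀ y, ‖fderiv ℝ (regGreen χ ε) y‖ ≤ M' := fun y =>
    ((boundedKernel_regGreen hχ hε).norm_fderiv_slice_le (0, y)).trans (hM' (0, y) (by simp)).2
  have hcf : ∀ x, Continuous fun ζ : Phase => fderiv ℝ (regGreen χ ε) (x - ζ.1) := fun x =>
    (hG.continuous_fderiv (by simp)).comp (by fun_prop)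
  have hd := hasFDerivAt_integral_of_dominated_of_fderiv_le (𝕜 := ℝ) (μ := ν) (x₀ := x) (s := univ)
    (F := fun x' (ζ : Phase) => regGreen χ ε (x' - ζ.1))
    (F' := fun x' (ζ : Phase) => fderiv ℝ (regGreen χ ε) (x' - ζ.1)) (bound := fun _ => M')
    univ_mem (Eventually.of_forall fun x' =>
      (hG.continuous.comp (by fun_prop)).aestronglyMeasurable)
    (integrable_of_continuous_of_le (hG.continuous.comp (by fun_prop)) fun ζ => hM (x - ζ.1))
    (hcf x).aestronglyMeasurable (Eventually.of_forall fun ζ x' _ => hM'' _)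
    (integrable_const _) (Eventually.of_forall fun ζ x' _ => by
      have := (hG.differentiable (by simp) (x' - ζ.1)).hasFDerivAt
      exact (hasFDerivAt_comp_sub ζ.1).2 this)
  rw [electrostatic, e, PiLp.neg_apply, gradient_apply, hd.fderiv,
    ContinuousLinearMap.integral_apply]
  · simp [avg, dirD]
  · exact integrable_of_continuous_of_le (hcf x) fun ζ => hM'' _

theorem eq_of_integral_mul_eq {f g : R3 → ℝ} (hf : Continuous f) (hg : Continuous g)
    (h : ∀ ψ : R3 → ℝ, ContDiff ℝ ∞ ψ → HasCompactSupport ψ → ∫ y, ψ y * f y = ∫ y, ψ y * g y) :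
    f = g :=
  (hf.ae_eq_iff_eq volume hg).1 (ae_eq_of_integral_contDiff_smul_eq hf.locallyIntegrable
    hg.locallyIntegrable h)

theorem integral_mul_intervalIntegral {ψ : R3 → ℝ} (hψ : Continuous ψ) (hψc : HasCompactSupport ψ)
    {A : ℝ → R3 → ℝ} (hA : Continuous fun p : ℝ × R3 => A p.1 p.2) (t : ℝ) :
    ∫ s in (0 : ℝ)..t, ∫ y, ψ y * A s y = ∫ y, ψ y * ∫ s in (0 : ℝ)..t, A s y := by
  simp only [← intervalIntegral.integral_const_mul]
  refine intervalIntegral_integral_swap ?_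
  have hcont : Continuous fun p : ℝ × R3 => ψ p.2 * A p.1 p.2 := (hψ.comp continuous_snd).mul hA
  obtain ⟨C, hC⟩ := (isCompact_uIcc (a := (0 : ℝ)) (b := t)).prod hψc.isCompact
    |>.exists_bound_of_continuousOn hcont.continuousOn
  have : IntegrableOn (fun p : ℝ × R3 => ψ p.2 * A p.1 p.2) (uIcc 0 t ×ˢ tsupport ψ)
      (volume.prod volume) :=
    hcont.continuousOn.integrableOn_compact (isCompact_uIcc.prod hψc.isCompact)
  have h2 : IntegrableOn (fun p : ℝ × R3 => ψ p.2 * A p.1 p.2) (uIoc 0 t ×ˢ univ)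
      (volume.prod volume) := by
    refine (this.of_forall_sdiff_eq_zero (measurableSet_uIoc.prod .univ) fun p hp => ?_)
    have : p.2 ∉ tsupport ψ := fun h => hp.2 ⟨uIoc_subset_uIcc hp.1.1, h⟩
    rw [image_eq_zero_of_notMem_tsupport this, zero_mul]
  rwa [IntegrableOn, ← Measure.prod_restrict, Measure.restrict_univ] at h2

theorem continuous_intervalIntegral_slice {A : ℝ → R3 → ℝ}
    (hA : Continuous fun p : ℝ × R3 => A p.1 p.2) (t : ℝ) :
    Continuous fun y => ∫ s in (0 : ℝ)..t, A s y :=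
  intervalIntegral.continuous_parametric_intervalIntegral_of_continuous'
    (f := fun y s => A s y) (hA.comp continuous_swap) 0 t

/-- Averages of the retarded kernel `K`. -/
def retAvg (μ : ℝ → Measure Phase) (K : ℝ × R3 → ℝ) (b : Phase →ᵇ ℝ) (t s : ℝ) (y : R3) : ℝ :=
  avg (μ s) (fun y => K (t - s, y)) b y

theorem WeaklyContinuous.continuous_retAvg (hμ : WeaklyContinuous μ) {K : ℝ × R3 → ℝ}
    (hK : BoundedKernel K) (b : Phase →ᵇ ℝ) (t : ℝ) :
    Continuous fun p : ℝ × R3 => retAvg μ K b t p.1 p.2 :=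
  hμ.continuous_avg hK b (s := fun p : ℝ × R3 => p.1) continuous_fst
    (p := fun p : ℝ × R3 => (t - p.1, p.2)) (by fun_prop)

theorem continuous_regCharge (hχ : IsMollifier χ) (hε : 0 < ε) (hμ : WeaklyContinuous μ) :
    Continuous fun p : ℝ × R3 => regCharge χ ε (μ p.1) p.2 := by
  simp only [regCharge_eq hχ hε]
  exact hμ.continuous_avg (boundedKernel_chi2 hχ hε) 1 continuous_fst continuous_id

theorem continuous_regCurrent (hχ : IsMollifier χ) (hε : 0 < ε) (hμ : WeaklyContinuous μ) :
    Continuous fun p : ℝ × R3 => regCurrent χ ε (μ p.1) p.2 := by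
  have := hμ.finite
  refine continuous_of_apply fun i => ?_
  simp only [regCurrent_apply hχ hε]
  exact hμ.continuous_avg (boundedKernel_chi2 hχ hε) (velBCF i) continuous_fst continuous_id

theorem contDiff_slice {F : ℝ × R3 → ℝ} (hF : ContDiff ℝ ∞ F) (t : ℝ) :
    ContDiff ℝ ∞ fun y => F (t, y) := hF.comp (by fun_prop)

/-- Both sides are continuous in `x`, so it suffices to test with `ψ`. The weak representation pairs
derivatives of `spread ψ` with averages of translates of the mollifier; under the average, the
transposition identities replace `spread ψ` by `ψ` and the mollifier by `Y_ε`. -/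
theorem electric_apply_eq (hχ : IsMollifier χ) (hε : 0 < ε) (hμ : WeaklyContinuous μ)
    (h : IsFieldOf χ ε μ E B) {t : ℝ} (ht : 0 ≤ t) (x : R3) (i : Fin 3) :
    E t x i = -avg (μ 0) (fun y => gradDtYG χ ε t y i) 1 x
      - ∫ s in (0 : ℝ)..t, (retAvg μ (fun p => gradY χ ε p.1 p.2 i) 1 t s x
        + retAvg μ (fun p => dtY χ ε p.1 p.2) (velBCF i) t s x) := by
  have := hμ.finite
  have bY := (boundedKernel_gradY hχ hε).apply i
  have bT := boundedKernel_dtY hχ hε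
  have bG := (boundedKernel_gradDtYG hχ hε).apply i
  have hA : Continuous fun p : ℝ × R3 => retAvg μ (fun p => gradY χ ε p.1 p.2 i) 1 t p.1 p.2
      + retAvg μ (fun p => dtY χ ε p.1 p.2) (velBCF i) t p.1 p.2 :=
    (hμ.continuous_retAvg bY 1 t).add (hμ.continuous_retAvg bT (velBCF i) t)
  have hG : Continuous fun y => avg (μ 0) (fun y => gradDtYG χ ε t y i) 1 y :=
    hμ.continuous_avg bG 1 (s := fun _ => 0) continuous_const (p := fun y => (t, y)) (by fun_prop)
  have hAi : Continuous fun y => ∫ s in (0 : ℝ)..t, (retAvg μ (fun p => gradY χ ε p.1 p.2 i) 1 t s y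
      + retAvg μ (fun p => dtY χ ε p.1 p.2) (velBCF i) t s y) :=
    continuous_intervalIntegral_slice (A := fun s y => retAvg μ (fun p => gradY χ ε p.1 p.2 i) 1 t s y
      + retAvg μ (fun p => dtY χ ε p.1 p.2) (velBCF i) t s y) hA t
  have hcE : Continuous fun y => E t y i := (continuous_apply_R3 i).comp
    (continuousOn_univ.1 (h.contDiff_E.continuousOn.comp (f := fun y : R3 => (t, y))
      (by fun_prop) fun _ _ => ⟨ht, trivial⟩))
  refine congrFun (eq_of_integral_mul_eq hcE (hG.neg.sub hAi)
    fun ψ hψ hψc => ?_) x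
  obtain ⟨R, hR, -⟩ := spread_zero_off hψc
  have cS := contDiff_spread hψ
  have cT := contDiff_dirD cS dirT
  have cX := contDiff_dirD cS (dirX i)
  -- the contribution of the initial field
  have h0 : ∫ y, dirD dirT (spread ψ) (t, y) * electrostatic χ ε (μ 0) y i
      = -∫ y, ψ y * avg (μ 0) (fun y => gradDtYG χ ε t y i) 1 y := by
    have := integral_mul_avg_transfer (μ := μ 0) (w := fun y => dirD dirT (spread ψ) (t, y))
      (ψ := ψ) (contDiff_slice cT t).continuous ((hR.dirD dirT).hasCompactSupport_slice t)
      hψ.continuous hψc (boundedKernel_grad_regGreen hχ hε i) bG 1 (t := 0) (t' := t) (c := 1)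
      fun v => by rw [one_mul]; exact integral_dirT_spread_regGreen hχ hε hψ hψc t v i
    rw [one_mul] at this
    refine Eq.trans ?_ (congrArg Neg.neg this)
    rw [← integral_neg]
    refine integral_congr_ae (Eventually.of_forall fun y => ?_)
    simp only [electrostatic_apply hχ hε, mul_neg]
    rfl
  have hweak : ∫ y, ψ y * E t y i
      = (∫ y, dirD dirT (spread ψ) (t, y) * electrostatic χ ε (μ 0) y i)
      + ∫ s in (0 : ℝ)..t, ∫ y, dirD (dirX i) (spread ψ) (t - s, y) * regCharge χ ε (μ s) y
        - dirD dirT (spread ψ) (t - s, y) * regCurrent χ ε (μ s) y i := by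
    -- The weak representation assumes `t > 0`; at `t = 0` it reduces to the initial condition,
    -- because `∂_t spread ψ = ψ` there.
    rcases ht.eq_or_lt with rfl | ht
    · simp [h.init_E, dirT_spread_zero hψ]
    · exact h.integral_mul_electric (continuous_regCharge hχ hε hμ).continuousOn
        (continuous_regCurrent hχ hε hμ).continuousOn hψ hψc ht i
  have hs : ∀ s, ∫ y, dirD (dirX i) (spread ψ) (t - s, y) * regCharge χ ε (μ s) y
        - dirD dirT (spread ψ) (t - s, y) * regCurrent χ ε (μ s) y i
      = ∫ y, ψ y * -(retAvg μ (fun p => gradY χ ε p.1 p.2 i) 1 t s y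
        + retAvg μ (fun p => dtY χ ε p.1 p.2) (velBCF i) t s y) := fun s => by
    have wX := (contDiff_slice cX (t - s)).continuous
    have wXc := (hR.dirD (dirX i)).hasCompactSupport_slice (t - s)
    have wT := (contDiff_slice cT (t - s)).continuous
    have wTc := (hR.dirD dirT).hasCompactSupport_slice (t - s)
    have e1 := integral_mul_avg_transfer (μ := μ s) wX wXc hψ.continuous hψc
      (boundedKernel_chi2 hχ hε) bY 1 (t := 0) (t' := t - s) (c := -1)
      fun v => by rw [neg_one_mul]; exact integral_dirX_spread_chi2 hχ hε hψ hψc (t - s) v i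
    have e2 := integral_mul_avg_transfer (μ := μ s) wT wTc hψ.continuous hψc
      (boundedKernel_chi2 hχ hε) bT (velBCF i) (t := 0) (t' := t - s) (c := 1)
      fun v => by rw [one_mul]; exact integral_dirT_spread_chi2 hχ hε hψ hψc (t - s) v
    have c1 := hμ.continuous_avg (boundedKernel_chi2 hχ hε) 1 (s := fun _ : R3 => s)
      continuous_const (p := fun y : R3 => ((0 : ℝ), y)) (by fun_prop)
    have c2 := hμ.continuous_avg (boundedKernel_chi2 hχ hε) (velBCF i) (s := fun _ : R3 => s)
      continuous_const (p := fun y : R3 => ((0 : ℝ), y)) (by fun_prop)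
    have c3 : Continuous fun y => retAvg μ (fun p => gradY χ ε p.1 p.2 i) 1 t s y :=
      (hμ.continuous_retAvg bY 1 t).comp (f := fun y : R3 => (s, y)) (by fun_prop)
    have c4 : Continuous fun y => retAvg μ (fun p => dtY χ ε p.1 p.2) (velBCF i) t s y :=
      (hμ.continuous_retAvg bT (velBCF i) t).comp (f := fun y : R3 => (s, y)) (by fun_prop)
    have i1 : Integrable fun y => dirD (dirX i) (spread ψ) (t - s, y) * avg (μ s) (chi2 χ ε) 1 y :=
      (wX.mul c1).integrable_of_hasCompactSupport wXc.mul_right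
    have i2 : Integrable fun y => dirD dirT (spread ψ) (t - s, y)
        * avg (μ s) (chi2 χ ε) (velBCF i) y :=
      (wT.mul c2).integrable_of_hasCompactSupport wTc.mul_right
    have i3 : Integrable fun y => ψ y * retAvg μ (fun p => gradY χ ε p.1 p.2 i) 1 t s y :=
      (hψ.continuous.mul c3).integrable_of_hasCompactSupport hψc.mul_right
    have i4 : Integrable fun y => ψ y * retAvg μ (fun p => dtY χ ε p.1 p.2) (velBCF i) t s y :=
      (hψ.continuous.mul c4).integrable_of_hasCompactSupport hψc.mul_right
    simp only [regCharge_eq hχ hε, regCurrent_apply hχ hε, mul_neg, mul_add]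
    rw [integral_sub i1 i2, integral_neg, integral_add i3 i4]
    rw [one_mul] at e2
    have e1' : ∫ y, dirD (dirX i) (spread ψ) (t - s, y) * avg (μ s) (chi2 χ ε) 1 y
      = -1 * ∫ y, ψ y * retAvg μ (fun p => gradY χ ε p.1 p.2 i) 1 t s y := e1
    have e2' : ∫ y, dirD dirT (spread ψ) (t - s, y) * avg (μ s) (chi2 χ ε) (velBCF i) y
      = ∫ y, ψ y * retAvg μ (fun p => dtY χ ε p.1 p.2) (velBCF i) t s y := e2
    rw [e1', e2']
    ring
  rw [hweak, h0]
  simp only [hs]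
  rw [integral_mul_intervalIntegral hψ.continuous hψc (A := fun s y =>
    -(retAvg μ (fun p => gradY χ ε p.1 p.2 i) 1 t s y
        + retAvg μ (fun p => dtY χ ε p.1 p.2) (velBCF i) t s y)) hA.neg]
  have i5 : Integrable fun y => ψ y * -avg (μ 0) (fun y => gradDtYG χ ε t y i) 1 y :=
    (hψ.continuous.mul hG.neg).integrable_of_hasCompactSupport hψc.mul_right
  have i6 : Integrable fun y => ψ y * ∫ s in (0 : ℝ)..t,
      (retAvg μ (fun p => gradY χ ε p.1 p.2 i) 1 t s y
        + retAvg μ (fun p => dtY χ ε p.1 p.2) (velBCF i) t s y) :=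
    (hψ.continuous.mul hAi).integrable_of_hasCompactSupport hψc.mul_right
  simp only [Pi.sub_apply, Pi.neg_apply, mul_sub, intervalIntegral.integral_neg]
  rw [integral_sub i5 i6]
  simp only [mul_neg, integral_neg]
  ring

/-- The initial electric field is a gradient, so it creates no magnetic field: after an integration
by parts, the two terms contain the same mixed second derivative of the potential. -/
theorem integral_curl_spread_grad (hχ : IsMollifier χ) (hε : 0 < ε) {ν : Measure Phase}
    [IsFiniteMeasure ν] {ψ : R3 → ℝ} (hψ : ContDiff ℝ ∞ ψ) (hψc : HasCompactSupport ψ) (t : ℝ)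
    (i j : Fin 3) :
    ∫ y, (dirD (dirX i) (spread ψ) (t, y) * electrostatic χ ε ν y j
      - dirD (dirX j) (spread ψ) (t, y) * electrostatic χ ε ν y i) = 0 := by
  obtain ⟨R, hR, -⟩ := spread_zero_off hψc
  have cS := contDiff_spread hψ
  have cG := contDiff_regGreen hχ hε
  have key : ∀ (a b : Fin 3) (v : R3),
      ∫ y, dirD (dirX a) (spread ψ) (t, y) * dirD (basisVec b) (regGreen χ ε) (y - v)
        = -∫ y, spread ψ (t, y) * dirD (basisVec a) (dirD (basisVec b) (regGreen χ ε)) (y - v) := by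
    intro a b v
    have cGb : ContDiff ℝ ∞ fun y => dirD (basisVec b) (regGreen χ ε) (y - v) :=
      (contDiff_dirD cG (basisVec b)).comp (by fun_prop)
    have hz := zeroIntegral_fderiv_mul (f := fun y => spread ψ (t, y))
      (g := fun y => dirD (basisVec b) (regGreen χ ε) (y - v)) (R := R + |t|)
      ((contDiff_slice cS t).of_le (by simp)) (fun y hy => hR (t, y) hy) (cGb.of_le (by simp))
      (basisVec a)
    have e1 : ∀ y, fderiv ℝ (fun y => spread ψ (t, y)) y (basisVec a)
        = dirD (dirX a) (spread ψ) (t, y) := fun y =>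
      fderiv_slice_space (cS.differentiable (by simp) _) _
    have e2 : ∀ y, fderiv ℝ (fun y => dirD (basisVec b) (regGreen χ ε) (y - v)) y (basisVec a)
        = dirD (basisVec a) (dirD (basisVec b) (regGreen χ ε)) (y - v) := fun y => by
      rw [fderiv_comp_sub (f := dirD (basisVec b) (regGreen χ ε)) v]
      rfl
    simp only [e1, e2] at hz
    have i1 : Integrable fun y => dirD (dirX a) (spread ψ) (t, y)
        * dirD (basisVec b) (regGreen χ ε) (y - v) :=
      ((contDiff_slice (contDiff_dirD cS _) t).continuous.mul
        cGb.continuous).integrable_of_hasCompactSupport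
        ((hR.dirD (dirX a)).hasCompactSupport_slice t).mul_right
    have i2 : Integrable fun y => spread ψ (t, y)
        * dirD (basisVec a) (dirD (basisVec b) (regGreen χ ε)) (y - v) :=
      ((contDiff_slice cS t).continuous.mul ((contDiff_dirD (contDiff_dirD cG _)
        _).continuous.comp (by fun_prop))).integrable_of_hasCompactSupport
        (hR.hasCompactSupport_slice t).mul_right
    rw [eq_neg_iff_add_eq_zero, ← integral_add i1 i2]
    exact hz.2
  have cX := fun a => (contDiff_slice (contDiff_dirD cS (dirX a)) t).continuous
  have cXc := fun a => (hR.dirD (dirX a)).hasCompactSupport_slice t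
  have full : ∀ a b : Fin 3, ∫ y, dirD (dirX a) (spread ψ) (t, y)
        * avg ν (dirD (basisVec b) (regGreen χ ε)) 1 y
      = ∫ y, dirD (dirX b) (spread ψ) (t, y) * avg ν (dirD (basisVec a) (regGreen χ ε)) 1 y := by
    intro a b
    have h1 := integral_mul_avg (μ := ν) (cX a) (cXc a) (boundedKernel_grad_regGreen hχ hε b) 1 0
    have h2 := integral_mul_avg (μ := ν) (cX b) (cXc b) (boundedKernel_grad_regGreen hχ hε a) 1 0
    refine h1.trans (Eq.trans ?_ h2.symm)
    refine integral_congr_ae (Eventually.of_forall fun ζ => ?_)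
    simp only [key]
    rw [dirD_comm cG]
  have ci : ∀ b, Continuous (avg ν (dirD (basisVec b) (regGreen χ ε)) 1) := fun b =>
    WeaklyContinuous.continuous_avg (μ := fun _ => ν) ⟨fun _ => inferInstance, fun _ =>
      continuous_const⟩ (boundedKernel_grad_regGreen hχ hε b) 1 (s := fun _ : R3 => 0)
      continuous_const (p := fun y => (0, y)) (by fun_prop)
  have ii : ∀ a b, Integrable fun y => dirD (dirX a) (spread ψ) (t, y)
      * avg ν (dirD (basisVec b) (regGreen χ ε)) 1 y := fun a b =>
    ((cX a).mul (ci b)).integrable_of_hasCompactSupport (cXc a).mul_right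
  have e : ∀ y, dirD (dirX i) (spread ψ) (t, y) * electrostatic χ ε ν y j
      - dirD (dirX j) (spread ψ) (t, y) * electrostatic χ ε ν y i
      = dirD (dirX j) (spread ψ) (t, y) * avg ν (dirD (basisVec i) (regGreen χ ε)) 1 y
        - dirD (dirX i) (spread ψ) (t, y) * avg ν (dirD (basisVec j) (regGreen χ ε)) 1 y := fun y => by
    rw [electrostatic_apply hχ hε, electrostatic_apply hχ hε]
    ring
  simp only [e]
  rw [integral_sub (ii j i) (ii i j), full i j, sub_self]

theorem magnetic_apply_eq (hχ : IsMollifier χ) (hε : 0 < ε) (hμ : WeaklyContinuous μ)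
    (h : IsFieldOf χ ε μ E B) {t : ℝ} (ht : 0 ≤ t) (x : R3) (i : Fin 3) :
    B t x i = ∫ s in (0 : ℝ)..t,
      (retAvg μ (fun p => gradY χ ε p.1 p.2 (i + 1)) (velBCF (i + 2)) t s x
        - retAvg μ (fun p => gradY χ ε p.1 p.2 (i + 2)) (velBCF (i + 1)) t s x) := by
  have := hμ.finite
  rcases ht.eq_or_lt with rfl | ht'
  · simp [h.init_B]
  have bY := fun i => (boundedKernel_gradY hχ hε).apply i
  have hA : Continuous fun p : ℝ × R3 =>
      retAvg μ (fun p => gradY χ ε p.1 p.2 (i + 1)) (velBCF (i + 2)) t p.1 p.2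
        - retAvg μ (fun p => gradY χ ε p.1 p.2 (i + 2)) (velBCF (i + 1)) t p.1 p.2 :=
    (hμ.continuous_retAvg (bY _) _ t).sub (hμ.continuous_retAvg (bY _) _ t)
  have hAi : Continuous fun y => ∫ s in (0 : ℝ)..t,
      (retAvg μ (fun p => gradY χ ε p.1 p.2 (i + 1)) (velBCF (i + 2)) t s y
        - retAvg μ (fun p => gradY χ ε p.1 p.2 (i + 2)) (velBCF (i + 1)) t s y) :=
    continuous_intervalIntegral_slice (A := fun s y =>
      retAvg μ (fun p => gradY χ ε p.1 p.2 (i + 1)) (velBCF (i + 2)) t s y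
        - retAvg μ (fun p => gradY χ ε p.1 p.2 (i + 2)) (velBCF (i + 1)) t s y) hA t
  have hcB : Continuous fun y => B t y i := (continuous_apply_R3 i).comp
    (continuousOn_univ.1 (h.contDiff_B.continuousOn.comp (f := fun y : R3 => (t, y))
      (by fun_prop) fun _ _ => ⟨ht, trivial⟩))
  refine congrFun (eq_of_integral_mul_eq hcB hAi fun ψ hψ hψc => ?_) x
  obtain ⟨R, hR, -⟩ := spread_zero_off hψc
  have cS := contDiff_spread hψ
  have hs : ∀ s, ∫ y, dirD (dirX (i + 1)) (spread ψ) (t - s, y) * regCurrent χ ε (μ s) y (i + 2)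
        - dirD (dirX (i + 2)) (spread ψ) (t - s, y) * regCurrent χ ε (μ s) y (i + 1)
      = -∫ y, ψ y * (retAvg μ (fun p => gradY χ ε p.1 p.2 (i + 1)) (velBCF (i + 2)) t s y
        - retAvg μ (fun p => gradY χ ε p.1 p.2 (i + 2)) (velBCF (i + 1)) t s y) := fun s => by
    have wX := fun a => (contDiff_slice (contDiff_dirD cS (dirX a)) (t - s)).continuous
    have wXc := fun a => (hR.dirD (dirX a)).hasCompactSupport_slice (t - s)
    have e : ∀ a b, ∫ y, dirD (dirX a) (spread ψ) (t - s, y) * avg (μ s) (chi2 χ ε) (velBCF b) y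
        = -1 * ∫ y, ψ y * retAvg μ (fun p => gradY χ ε p.1 p.2 a) (velBCF b) t s y := fun a b =>
      integral_mul_avg_transfer (μ := μ s) (wX a) (wXc a) hψ.continuous hψc
        (boundedKernel_chi2 hχ hε) (bY a) (velBCF b) (t := 0) (t' := t - s) (c := -1)
        fun v => by rw [neg_one_mul]; exact integral_dirX_spread_chi2 hχ hε hψ hψc (t - s) v a
    have c1 := fun b => hμ.continuous_avg (boundedKernel_chi2 hχ hε) (velBCF b)
      (s := fun _ : R3 => s) continuous_const (p := fun y : R3 => ((0 : ℝ), y)) (by fun_prop)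
    have i1 : ∀ a b, Integrable fun y => dirD (dirX a) (spread ψ) (t - s, y)
        * avg (μ s) (chi2 χ ε) (velBCF b) y := fun a b =>
      ((wX a).mul (c1 b)).integrable_of_hasCompactSupport (wXc a).mul_right
    have c3 : ∀ a b, Continuous fun y =>
        retAvg μ (fun p => gradY χ ε p.1 p.2 a) (velBCF b) t s y := fun a b =>
      (hμ.continuous_retAvg (bY a) _ t).comp (f := fun y : R3 => (s, y)) (by fun_prop)
    have i3 : ∀ a b, Integrable fun y =>
        ψ y * retAvg μ (fun p => gradY χ ε p.1 p.2 a) (velBCF b) t s y := fun a b =>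
      (hψ.continuous.mul (c3 a b)).integrable_of_hasCompactSupport hψc.mul_right
    simp only [regCurrent_apply hχ hε, mul_sub]
    rw [integral_sub (i1 _ _) (i1 _ _), integral_sub (i3 _ _) (i3 _ _), e, e]
    ring
  rw [h.integral_mul_magnetic (continuous_regCurrent hχ hε hμ).continuousOn hψ hψc ht' i,
    integral_curl_spread_grad hχ hε hψ hψc, zero_sub]
  simp only [hs, intervalIntegral.integral_neg, neg_neg]
  exact integral_mul_intervalIntegral hψ.continuous hψc (A := fun s y =>
    retAvg μ (fun p => gradY χ ε p.1 p.2 (i + 1)) (velBCF (i + 2)) t s y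
        - retAvg μ (fun p => gradY χ ε p.1 p.2 (i + 2)) (velBCF (i + 1)) t s y) hA t

end FieldRepresentation
end RegVM

namespace RegVM
-- Vector form of the fields and the Lorentz force as a mean-field force.
section VectorRepresentation

variable {χ : R3 → ℝ} {ε : ℝ} {μ : ℝ → Measure Phase} {E B : ℝ → R3 → R3}

/-- `F s` is integrable for `μ s`, with an integral depending continuously on `s`. -/
structure AverageContinuous (μ : ℝ → Measure Phase) (F : ℝ → Phase → R3) : Prop where
  integrable : ∀ s, Integrable (F s) (μ s)
  cont : Continuous fun s => ∫ ζ, F s ζ ∂μ s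

theorem AverageContinuous.intervalIntegrable {F : ℝ → Phase → R3} (hF : AverageContinuous μ F)
    (a b : ℝ) : IntervalIntegrable (fun s => ∫ ζ, F s ζ ∂μ s) volume a b :=
  hF.cont.intervalIntegrable a b

theorem AverageContinuous.clm {F : ℝ → Phase → R3} (hF : AverageContinuous μ F) (A : R3 →L[ℝ] R3) :
    AverageContinuous μ fun s ζ => A (F s ζ) := by
  refine ⟨fun s => A.integrable_comp (hF.integrable s), ?_⟩
  simp only [fun s => A.integral_comp_comm (hF.integrable s)]
  exact A.continuous.comp hF.cont

theorem AverageContinuous.clm_integral {F : ℝ → Phase → R3} (hF : AverageContinuous μ F)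
    (A : R3 →L[ℝ] R3) (a b : ℝ) :
    A (∫ s in a..b, ∫ ζ, F s ζ ∂μ s) = ∫ s in a..b, ∫ ζ, A (F s ζ) ∂μ s := by
  simp only [fun s => A.integral_comp_comm (hF.integrable s)]
  exact (A.intervalIntegral_comp_comm (hF.intervalIntegrable a b)).symm

theorem AverageContinuous.add {F G : ℝ → Phase → R3} (hF : AverageContinuous μ F)
    (hG : AverageContinuous μ G) : AverageContinuous μ fun s ζ => F s ζ + G s ζ := by
  refine ⟨fun s => (hF.integrable s).add (hG.integrable s), ?_⟩
  simp only [fun s => integral_add (hF.integrable s) (hG.integrable s)]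
  exact hF.cont.add hG.cont

theorem AverageContinuous.add_integral {F G : ℝ → Phase → R3} (hF : AverageContinuous μ F)
    (hG : AverageContinuous μ G) (a b : ℝ) :
    ∫ s in a..b, ∫ ζ, (F s ζ + G s ζ) ∂μ s
      = (∫ s in a..b, ∫ ζ, F s ζ ∂μ s) + ∫ s in a..b, ∫ ζ, G s ζ ∂μ s := by
  simp only [fun s => integral_add (hF.integrable s) (hG.integrable s)]
  exact intervalIntegral.integral_add (hF.intervalIntegrable a b) (hG.intervalIntegrable a b)

theorem AverageContinuous.neg {F : ℝ → Phase → R3} (hF : AverageContinuous μ F) :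
    AverageContinuous μ fun s ζ => -F s ζ := by
  refine ⟨fun s => (hF.integrable s).neg, ?_⟩
  simp only [integral_neg]
  exact hF.cont.neg

theorem AverageContinuous.of_apply {F : ℝ → Phase → R3} (h : ∀ s, Integrable (F s) (μ s))
    (hc : ∀ i, Continuous fun s => ∫ ζ, F s ζ i ∂μ s) : AverageContinuous μ F :=
  ⟨h, continuous_of_apply fun i => by
    simp only [fun s => integral_apply_R3 (h s) i]
    exact hc i⟩

theorem AverageContinuous.integral_apply {F : ℝ → Phase → R3} (hF : AverageContinuous μ F)
    (a b : ℝ) (i : Fin 3) :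
    (∫ s in a..b, ∫ ζ, F s ζ ∂μ s) i = ∫ s in a..b, ∫ ζ, F s ζ i ∂μ s := by
  simp only [fun s => (integral_apply_R3 (hF.integrable s) i).symm]
  exact ((EuclideanSpace.proj (𝕜 := ℝ) i : R3 →L[ℝ] ℝ).intervalIntegral_comp_comm
    (hF.intervalIntegrable a b)).symm

theorem WeaklyContinuous.continuous_retAvg_slice (hμ : WeaklyContinuous μ) {K : ℝ × R3 → ℝ}
    (hK : BoundedKernel K) (b : Phase →ᵇ ℝ) (t : ℝ) (x : R3) :
    Continuous fun s => retAvg μ K b t s x :=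
  (hμ.continuous_retAvg hK b t).comp (f := fun s : ℝ => (s, x)) (by fun_prop)

theorem averageContinuous_gradY (hχ : IsMollifier χ) (hε : 0 < ε) (hμ : WeaklyContinuous μ) (t : ℝ)
    (x : R3) : AverageContinuous μ fun s ζ => gradY χ ε (t - s) (x - ζ.1) := by
  have := hμ.finite
  have hb := boundedKernel_gradY hχ hε
  refine .of_apply (fun s => ?_) fun i => ?_
  · obtain ⟨M, hM⟩ := hb.exists_slice_bound (t - s)
    exact integrable_of_continuous_of_le (hb.smooth.continuous.comp
      (by fun_prop : Continuous fun ζ : Phase => (t - s, x - ζ.1))) fun ζ => hM _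
  · have := hμ.continuous_retAvg_slice (hb.apply i) 1 t x
    simpa [retAvg, avg] using this

theorem averageContinuous_dtY (hχ : IsMollifier χ) (hε : 0 < ε) (hμ : WeaklyContinuous μ) (t : ℝ)
    (x : R3) : AverageContinuous μ fun s ζ => dtY χ ε (t - s) (x - ζ.1) • vel ζ.2 := by
  have := hμ.finite
  have hb := boundedKernel_dtY hχ hε
  refine .of_apply (fun s => ?_) fun i => hμ.continuous_retAvg_slice hb (velBCF i) t x
  obtain ⟨M, hM⟩ := hb.exists_slice_bound (t - s)
  refine integrable_of_continuous_of_le (C := M) ((hb.smooth.continuous.comp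
      (by fun_prop : Continuous fun ζ : Phase => (t - s, x - ζ.1))).smul
      (continuous_vel.comp continuous_snd)) fun ζ => ?_
  rw [norm_smul]
  exact (mul_le_of_le_one_right (norm_nonneg _) (norm_vel_le _)).trans (hM _)

theorem averageContinuous_cross (hχ : IsMollifier χ) (hε : 0 < ε) (hμ : WeaklyContinuous μ) (t : ℝ)
    (x : R3) : AverageContinuous μ fun s ζ => cross (gradY χ ε (t - s) (x - ζ.1)) (vel ζ.2) := by
  have := hμ.finite
  have hb := boundedKernel_gradY hχ hε
  refine .of_apply (fun s => ?_) fun i => ?_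
  · obtain ⟨M, hM⟩ := hb.exists_slice_bound (t - s)
    refine integrable_of_continuous_of_le (C := M) (continuous_cross (hb.smooth.continuous.comp
      (by fun_prop : Continuous fun ζ : Phase => (t - s, x - ζ.1)))
      (continuous_vel.comp continuous_snd)) fun ζ => ?_
    exact (norm_cross_le _ _).trans ((mul_le_of_le_one_right (norm_nonneg _)
      (norm_vel_le _)).trans (hM _))
  · have h := (hμ.continuous_retAvg_slice (hb.apply (i + 1)) (velBCF (i + 2)) t x).sub
      (hμ.continuous_retAvg_slice (hb.apply (i + 2)) (velBCF (i + 1)) t x)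
    refine (congrArg Continuous (funext fun s => ?_)).mp h
    simp only [cross_apply, retAvg, avg]
    exact (integral_sub (integrable_kernel_mul (hb.apply (i + 1)) (velBCF (i + 2)) _ _)
      (integrable_kernel_mul (hb.apply (i + 2)) (velBCF (i + 1)) _ _)).symm

theorem integrable_gradDtYG (hχ : IsMollifier χ) (hε : 0 < ε) (ν : Measure Phase)
    [IsFiniteMeasure ν] (t : ℝ) (x : R3) : Integrable (fun ζ : Phase => gradDtYG χ ε t (x - ζ.1)) ν := by
  have hb := boundedKernel_gradDtYG hχ hε
  obtain ⟨M, hM⟩ := hb.exists_slice_bound t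
  exact integrable_of_continuous_of_le (hb.smooth.continuous.comp
      (by fun_prop : Continuous fun ζ : Phase => (t, x - ζ.1))) fun ζ => hM _

theorem electric_eq (hχ : IsMollifier χ) (hε : 0 < ε) (hμ : WeaklyContinuous μ)
    (h : IsFieldOf χ ε μ E B) {t : ℝ} (ht : 0 ≤ t) (x : R3) :
    E t x = -(∫ ζ, gradDtYG χ ε t (x - ζ.1) ∂μ 0) - ∫ s in (0 : ℝ)..t,
      ∫ ζ, (gradY χ ε (t - s) (x - ζ.1) + dtY χ ε (t - s) (x - ζ.1) • vel ζ.2) ∂μ s := by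
  have := hμ.finite
  have hA := (averageContinuous_gradY hχ hε hμ t x).add (averageContinuous_dtY hχ hε hμ t x)
  ext i
  rw [electric_apply_eq hχ hε hμ h ht, PiLp.sub_apply, PiLp.neg_apply, hA.integral_apply,
    integral_apply_R3 (integrable_gradDtYG hχ hε _ t x)]
  congr 1
  · simp [avg]
  · refine intervalIntegral.integral_congr fun s _ => ?_
    simp only [retAvg, avg, PiLp.add_apply, PiLp.smul_apply, smul_eq_mul]
    have h1 := integrable_kernel_mul (μ := μ s) ((boundedKernel_gradY hχ hε).apply i) 1 (t - s) x
    have h2 := integrable_kernel_mul (μ := μ s) (boundedKernel_dtY hχ hε) (velBCF i) (t - s) x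
    refine (integral_add h1 h2).symm.trans (integral_congr_ae (Eventually.of_forall fun ζ => ?_))
    simp only [BoundedContinuousFunction.coe_one, Pi.one_apply, mul_one]
    rfl

theorem magnetic_eq (hχ : IsMollifier χ) (hε : 0 < ε) (hμ : WeaklyContinuous μ)
    (h : IsFieldOf χ ε μ E B) {t : ℝ} (ht : 0 ≤ t) (x : R3) :
    B t x = ∫ s in (0 : ℝ)..t, ∫ ζ, cross (gradY χ ε (t - s) (x - ζ.1)) (vel ζ.2) ∂μ s := by
  have := hμ.finite
  ext i
  rw [magnetic_apply_eq hχ hε hμ h ht, (averageContinuous_cross hχ hε hμ t x).integral_apply]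
  refine intervalIntegral.integral_congr fun s _ => ?_
  simp only [retAvg, avg, cross_apply]
  exact (integral_sub (integrable_kernel_mul ((boundedKernel_gradY hχ hε).apply (i + 1))
      (velBCF (i + 2)) _ _) (integrable_kernel_mul ((boundedKernel_gradY hχ hε).apply (i + 2))
      (velBCF (i + 1)) _ _)).symm

theorem averageContinuous_rForce (hχ : IsMollifier χ) (hε : 0 < ε) (hμ : WeaklyContinuous μ)
    (t : ℝ) (z : Phase) : AverageContinuous μ fun s ζ => rForce χ ε t z s ζ := by
  have h := ((averageContinuous_gradY hχ hε hμ t z.1).add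
    (averageContinuous_dtY hχ hε hμ t z.1)).neg.add
    ((averageContinuous_cross hχ hε hμ t z.1).clm (crossL (vel z.2)))
  refine (congrArg (AverageContinuous μ) (funext fun s => funext fun ζ => ?_)).mp h
  rw [crossL_apply, cross_neg_swap (vel ζ.2), ← crossL_apply, map_neg, crossL_apply, rForce]
  abel

/-- The Lorentz force of the regularized field is the retarded mean-field force. -/
theorem lorentz_force_eq (hχ : IsMollifier χ) (hε : 0 < ε) (hμ : WeaklyContinuous μ)
    (h : IsFieldOf χ ε μ E B) {t : ℝ} (ht : 0 ≤ t) (z : Phase) :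
    E t z.1 + cross (vel z.2) (B t z.1) = (∫ ζ, mForce χ ε t z ζ ∂μ 0)
      + ∫ s in (0 : ℝ)..t, ∫ ζ, rForce χ ε t z s ζ ∂μ s := by
  have hA := (averageContinuous_gradY hχ hε hμ t z.1).add (averageContinuous_dtY hχ hε hμ t z.1)
  have hC := averageContinuous_cross hχ hε hμ t z.1
  rw [electric_eq hχ hε hμ h ht, magnetic_eq hχ hε hμ h ht, ← crossL_apply, hC.clm_integral]
  have e : ∀ s ζ, rForce χ ε t z s ζ
      = -(gradY χ ε (t - s) (z.1 - ζ.1) + dtY χ ε (t - s) (z.1 - ζ.1) • vel ζ.2)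
        + crossL (vel z.2) (cross (gradY χ ε (t - s) (z.1 - ζ.1)) (vel ζ.2)) := fun s ζ => by
    rw [rForce, cross_neg_swap (gradY χ ε (t - s) (z.1 - ζ.1)) (vel ζ.2), ← crossL_apply, map_neg,
      crossL_apply, sub_neg_eq_add]
  simp only [e]
  rw [hA.neg.add_integral (hC.clm _)]
  simp only [integral_neg, intervalIntegral.integral_neg, mForce]
  abel

end VectorRepresentation
end RegVM

namespace RegVM
-- The constant `L(T, ε)` and the finer Lipschitz bounds which follow from it.
section LipschitzConstant

variable {χ : R3 → ℝ} {ε T : ℝ}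

theorem phaseDist_nonneg (z w : Phase) : 0 ≤ phaseDist z w := Real.sqrt_nonneg _

theorem norm_fst_le_phaseDist (z w : Phase) : ‖z.1 - w.1‖ ≤ phaseDist z w :=
  Real.le_sqrt_of_sq_le (by nlinarith [sq_nonneg ‖z.2 - w.2‖])

theorem norm_snd_le_phaseDist (z w : Phase) : ‖z.2 - w.2‖ ≤ phaseDist z w :=
  Real.le_sqrt_of_sq_le (by nlinarith [sq_nonneg ‖z.1 - w.1‖])

theorem phaseDist_le_add (z w : Phase) : phaseDist z w ≤ ‖z.1 - w.1‖ + ‖z.2 - w.2‖ :=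
  Real.sqrt_le_iff.2 ⟨by positivity, by
    nlinarith [mul_nonneg (norm_nonneg (z.1 - w.1)) (norm_nonneg (z.2 - w.2))]⟩

theorem phaseDist_of_fst_eq (x : R3) (ξ η : R3) : phaseDist (x, ξ) (x, η) = ‖ξ - η‖ := by
  simp [phaseDist, Real.sqrt_sq (norm_nonneg _)]

theorem phaseDist_of_snd_eq (x y : R3) (ξ : R3) : phaseDist (x, ξ) (y, ξ) = ‖x - y‖ := by
  simp [phaseDist, Real.sqrt_sq (norm_nonneg _)]

theorem phaseDist_self (z : Phase) : phaseDist z z = 0 := by simp [phaseDist]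

theorem min_one_add_le {a b : ℝ} (ha : 0 ≤ a) (hb : 0 ≤ b) :
    min 1 (a + b) ≤ min 1 a + min 1 b := by
  rcases min_cases 1 a with h | h <;> rcases min_cases 1 b with h' | h' <;>
    rcases min_cases 1 (a + b) with h'' | h'' <;> linarith

theorem le_mul_min_one {n a d : ℝ} (hn : 0 ≤ n) (h1 : a ≤ 2 * n) (h2 : a ≤ n * d) (hd : 0 ≤ d) :
    a ≤ 2 * n * min 1 d := by
  rcases min_cases 1 d with h | h <;> rw [h.1]
  · linarith
  · nlinarith [mul_nonneg hn hd]

theorem norm_vel_sub_le_two (ξ η : R3) : ‖vel ξ - vel η‖ ≤ 2 :=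
  (norm_sub_le _ _).trans (by linarith [norm_vel_le ξ, norm_vel_le η])

theorem norm_vel_sub_le_min (ξ η : R3) : ‖vel ξ - vel η‖ ≤ min 2 ‖ξ - η‖ :=
  le_min (norm_vel_sub_le_two ξ η) (norm_vel_sub_le ξ η)

theorem BoundedKernel.norm_sub_le_min {G : Type} [NormedAddCommGroup G] [NormedSpace ℝ G]
    {K : ℝ → R3 → G} (h : BoundedKernel fun p : ℝ × R3 => K p.1 p.2) {t : ℝ} (ht : t ∈ Icc 0 T)
    (z z' ζ ζ' : Phase) : ‖K t (z.1 - ζ.1) - K t (z'.1 - ζ'.1)‖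
      ≤ 2 * normLW T K * (min 1 (phaseDist z z') + min 1 (phaseDist ζ ζ')) := by
  have hn := normLW_nonneg (T := T) K
  refine (le_mul_min_one hn ?_ ((h.norm_sub_le ht _ _).trans (mul_le_mul_of_nonneg_left ?_ hn))
    (add_nonneg (phaseDist_nonneg z z') (phaseDist_nonneg ζ ζ'))).trans
    (mul_le_mul_of_nonneg_left (min_one_add_le (phaseDist_nonneg _ _) (phaseDist_nonneg _ _))
      (by positivity))
  · exact (_root_.norm_sub_le _ _).trans (by linarith [h.norm_le ht (z.1 - ζ.1), h.norm_le ht (z'.1 - ζ'.1)])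
  · rw [show z.1 - ζ.1 - (z'.1 - ζ'.1) = (z.1 - z'.1) - (ζ.1 - ζ'.1) by abel]
    exact (_root_.norm_sub_le _ _).trans (add_le_add (norm_fst_le_phaseDist _ _) (norm_fst_le_phaseDist _ _))

theorem norm_vel_sub_le_min_phaseDist (z w : Phase) :
    ‖vel z.2 - vel w.2‖ ≤ 2 * min 1 (phaseDist z w) := by
  have := le_mul_min_one (n := 1) zero_le_one (by simpa using norm_vel_sub_le_two z.2 w.2)
    (by simpa using (norm_vel_sub_le z.2 w.2).trans (norm_snd_le_phaseDist z w)) (phaseDist_nonneg z w)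
  simpa using this

theorem norm_smul_sub_smul_le {d d' : ℝ} {v v' : R3} (hv : ‖v‖ ≤ 1) :
    ‖d • v - d' • v'‖ ≤ |d - d'| + |d'| * ‖v - v'‖ := by
  rw [show d • v - d' • v' = (d - d') • v + d' • (v - v') by module]
  refine (norm_add_le _ _).trans (add_le_add ?_ (norm_smul_le _ _))
  rw [norm_smul, Real.norm_eq_abs]
  exact mul_le_of_le_one_right (abs_nonneg _) hv

theorem norm_cross_sub_cross_le (a a' b b' : R3) :
    ‖cross a b - cross a' b'‖ ≤ ‖a - a'‖ * ‖b‖ + ‖a'‖ * ‖b - b'‖ := by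
  rw [show cross a b - cross a' b' = cross (a - a') b + cross a' (b - b') by
    rw [cross_sub_left, cross_sub_right, sub_add_sub_cancel]]
  exact (norm_add_le _ _).trans (add_le_add (norm_cross_le _ _) (norm_cross_le _ _))

/-- The constants which satisfy the Lipschitz condition on the kernels. -/
def lipSet (χ : R3 → ℝ) (ε T : ℝ) : Set ℝ :=
  {L : ℝ | 0 ≤ L ∧ ∀ t ∈ Icc 0 T, ∀ τ ∈ Icc 0 T, ∀ z z' ζ ζ' ζ₀ ζ₀' : Phase,
    phaseDist (rKer χ ε t z τ ζ) (rKer χ ε t z' τ ζ')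
        + phaseDist (mKer χ ε t z ζ₀) (mKer χ ε t z' ζ₀')
      ≤ L * (min 1 (phaseDist z z') + min 1 (phaseDist ζ ζ') + min 1 (phaseDist ζ₀ ζ₀'))}

/-- A crude bound, whose only purpose is to show that some Lipschitz constant exists; the estimates
themselves use `lipConst`. -/
theorem norm_rForce_sub_le (hχ : IsMollifier χ) (hε : 0 < ε) {t τ : ℝ} (h : t - τ ∈ Icc 0 T)
    (z z' ζ ζ' : Phase) :
    ‖rForce χ ε t z τ ζ - rForce χ ε t z' τ ζ'‖
      ≤ (8 * normLW T (gradY χ ε) + 4 * normLW T (dtY χ ε))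
        * (min 1 (phaseDist z z') + min 1 (phaseDist ζ ζ')) := by
  have bY := boundedKernel_gradY hχ hε
  have bT := boundedKernel_dtY hχ hε
  have h1 := bY.norm_sub_le_min h z z' ζ ζ'
  have h2 := bT.norm_sub_le_min h z z' ζ ζ'
  have h3 := bY.norm_le h (z.1 - ζ.1)
  have h4 := bT.norm_le h (z'.1 - ζ'.1)
  have v1 := norm_vel_sub_le_min_phaseDist z z'
  have v2 := norm_vel_sub_le_min_phaseDist ζ ζ'
  have hd : 0 ≤ min 1 (phaseDist z z') := le_min zero_le_one (phaseDist_nonneg _ _)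
  have hd' : 0 ≤ min 1 (phaseDist ζ ζ') := le_min zero_le_one (phaseDist_nonneg _ _)
  simp only [rForce]
  set g := gradY χ ε (t - τ) (z.1 - ζ.1)
  set g' := gradY χ ε (t - τ) (z'.1 - ζ'.1)
  set d := dtY χ ε (t - τ) (z.1 - ζ.1)
  set d' := dtY χ ε (t - τ) (z'.1 - ζ'.1)
  set n := normLW T (gradY χ ε)
  set m := normLW T (dtY χ ε)
  set a := min 1 (phaseDist z z')
  set b := min 1 (phaseDist ζ ζ')
  have hn : 0 ≤ n := (norm_nonneg _).trans h3
  have hm : 0 ≤ m := (norm_nonneg _).trans h4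
  have e1 := norm_smul_sub_smul_le (d := d) (d' := d') (v' := vel ζ'.2) (norm_vel_le ζ.2)
  have e2 := norm_cross_sub_cross_le (vel ζ.2) (vel ζ'.2) g g'
  have e3 := norm_cross_sub_cross_le (vel z.2) (vel z'.2) (cross (vel ζ.2) g) (cross (vel ζ'.2) g')
  have e4 := norm_cross_le (vel ζ.2) g
  rw [Real.norm_eq_abs] at h2 h4
  have p1 : |d'| * ‖vel ζ.2 - vel ζ'.2‖ ≤ m * (2 * b) := mul_le_mul h4 v2 (norm_nonneg _) hm
  have p2 : ‖vel ζ.2 - vel ζ'.2‖ * ‖g‖ ≤ 2 * b * n := mul_le_mul v2 h3 (norm_nonneg _) (by positivity)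
  have p3 : ‖vel ζ'.2‖ * ‖g - g'‖ ≤ 1 * (2 * n * (a + b)) :=
    mul_le_mul (norm_vel_le _) h1 (norm_nonneg _) zero_le_one
  have p4 : ‖cross (vel ζ.2) g‖ ≤ n := e4.trans ((mul_le_of_le_one_left (norm_nonneg _)
    (norm_vel_le _)).trans h3)
  have p5 : ‖vel z.2 - vel z'.2‖ * ‖cross (vel ζ.2) g‖ ≤ 2 * a * n :=
    mul_le_mul v1 p4 (norm_nonneg _) (by positivity)
  have p6 : ‖vel z'.2‖ * ‖cross (vel ζ.2) g - cross (vel ζ'.2) g'‖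
      ≤ 1 * (2 * b * n + 1 * (2 * n * (a + b))) :=
    mul_le_mul (norm_vel_le _) (e2.trans (add_le_add p2 p3)) (norm_nonneg _) zero_le_one
  rw [show -(g + d • vel ζ.2) - cross (vel z.2) (cross (vel ζ.2) g)
      - (-(g' + d' • vel ζ'.2) - cross (vel z'.2) (cross (vel ζ'.2) g'))
      = -((g - g') + (d • vel ζ.2 - d' • vel ζ'.2)
        + (cross (vel z.2) (cross (vel ζ.2) g) - cross (vel z'.2) (cross (vel ζ'.2) g'))) by abel,
    norm_neg]
  refine (norm_add₃_le).trans ?_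
  nlinarith [mul_nonneg hm hd, mul_nonneg hn hd, mul_nonneg hm hd', mul_nonneg hn hd']

theorem norm_mForce_sub_le_of_bounded (hχ : IsMollifier χ) (hε : 0 < ε) {t : ℝ} (h : t ∈ Icc 0 T)
    (z z' ζ ζ' : Phase) : ‖mForce χ ε t z ζ - mForce χ ε t z' ζ'‖
      ≤ 2 * normLW T (gradDtYG χ ε) * (min 1 (phaseDist z z') + min 1 (phaseDist ζ ζ')) := by
  have := (boundedKernel_gradDtYG hχ hε).norm_sub_le_min h z z' ζ ζ'
  rw [mForce, mForce, neg_sub_neg, norm_sub_rev]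
  exact this

/-- The infimum of the empty set would be `0`, so the least constant is meaningful only because the
kernels are bounded and Lipschitz. -/
theorem nonempty_lipSet (hχ : IsMollifier χ) (hε : 0 < ε) (T : ℝ) : (lipSet χ ε T).Nonempty := by
  have n1 := normLW_nonneg (T := T) (gradY χ ε)
  have n2 := normLW_nonneg (T := T) (dtY χ ε)
  have n3 := normLW_nonneg (T := T) (gradDtYG χ ε)
  refine ⟨(8 * normLW T (gradY χ ε) + 4 * normLW T (dtY χ ε)) + 2 + 2 * normLW T (gradDtYG χ ε),
    by positivity, fun t ht τ hτ z z' ζ ζ' ζ₀ ζ₀' => ?_⟩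
  have h1 : phaseDist (rKer χ ε t z τ ζ) (rKer χ ε t z' τ ζ')
      ≤ (8 * normLW T (gradY χ ε) + 4 * normLW T (dtY χ ε))
        * (min 1 (phaseDist z z') + min 1 (phaseDist ζ ζ')) := by
    rw [rKer, rKer, phaseDist_of_fst_eq]
    split_ifs with h
    · exact norm_rForce_sub_le hχ hε ⟨by linarith [h.2], by linarith [h.1, ht.2]⟩ z z' ζ ζ'
    · rw [sub_zero, norm_zero]
      have hd : 0 ≤ min 1 (phaseDist z z') := le_min zero_le_one (phaseDist_nonneg _ _)
      have hd' : 0 ≤ min 1 (phaseDist ζ ζ') := le_min zero_le_one (phaseDist_nonneg _ _)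
      positivity
  have h2 := phaseDist_le_add (mKer χ ε t z ζ₀) (mKer χ ε t z' ζ₀')
  have h3 := norm_mForce_sub_le_of_bounded hχ hε ht z z' ζ₀ ζ₀'
  have h4 := norm_vel_sub_le_min_phaseDist z z'
  simp only [mKer] at h2 ⊢
  have hd : 0 ≤ min 1 (phaseDist z z') := le_min zero_le_one (phaseDist_nonneg _ _)
  have hd' : 0 ≤ min 1 (phaseDist ζ ζ') := le_min zero_le_one (phaseDist_nonneg _ _)
  have hd'' : 0 ≤ min 1 (phaseDist ζ₀ ζ₀') := le_min zero_le_one (phaseDist_nonneg _ _)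
  nlinarith [mul_nonneg n1 hd'', mul_nonneg n2 hd'', mul_nonneg n3 hd']

/-- The infimum is attained, since each condition has the form `A ≤ L D` with `D ≥ 0`. For `D > 0`
it bounds `L` below by `A / D`; for `D = 0` it does not involve `L`, and any admissible constant
proves it. -/
theorem lipConst_mem (hχ : IsMollifier χ) (hε : 0 < ε) (T : ℝ) :
    lipConst χ ε T ∈ lipSet χ ε T := by
  have hne := nonempty_lipSet hχ hε T
  have h0 : 0 ≤ lipConst χ ε T := Real.sInf_nonneg fun _ h => h.1
  refine ⟨h0, fun t ht τ hτ z z' ζ ζ' ζ₀ ζ₀' => ?_⟩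
  have hD : 0 ≤ min 1 (phaseDist z z') + min 1 (phaseDist ζ ζ') + min 1 (phaseDist ζ₀ ζ₀') :=
    add_nonneg (add_nonneg (le_min zero_le_one (phaseDist_nonneg _ _))
      (le_min zero_le_one (phaseDist_nonneg _ _))) (le_min zero_le_one (phaseDist_nonneg _ _))
  rcases hD.eq_or_lt with h | h
  · obtain ⟨L, hL⟩ := hne
    have := hL.2 t ht τ hτ z z' ζ ζ' ζ₀ ζ₀'
    rw [← h, mul_zero] at this ⊢
    exact this
  · rw [← div_le_iff₀ h]
    exact le_csInf hne fun L hL => (div_le_iff₀ h).2 (hL.2 t ht τ hτ z z' ζ ζ' ζ₀ ζ₀')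

/-- Velocities fill the unit ball. -/
theorem norm_apply_le_of_vel (A : R3 →L[ℝ] R3) {L : ℝ} (hL : 0 ≤ L)
    (h : ∀ ξ η : R3, ‖A (vel ξ - vel η)‖ ≤ L) (a : R3) : ‖A a‖ ≤ L / 2 * ‖a‖ := by
  have key : ∀ k : ℝ, 0 < k → (2 * ‖A a‖) ^ 2 ≤ L ^ 2 * ‖a‖ ^ 2 + L ^ 2 * k := by
    intro k hk
    have hs : 0 < √k := Real.sqrt_pos.2 hk
    have hq : 0 < √(k + ‖a‖ ^ 2) := Real.sqrt_pos.2 (by positivity)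
    -- The opposite momenta `±a / √k` have velocities `±a / √(k + |a|²)`, whose difference tends to
    -- `2a / |a|` as `k → 0` (for `a ≠ 0`). Hence a bound `L` on all velocity differences gives the
    -- operator norm `L / 2`.
    have e : vel ((√k)⁻¹ • a) = (√(k + ‖a‖ ^ 2))⁻¹ • a := by
      rw [vel, norm_smul, norm_inv, Real.norm_of_nonneg hs.le, smul_smul, mul_pow, inv_pow,
        Real.sq_sqrt hk.le, ← mul_inv, ← Real.sqrt_mul (by positivity)]
      congr 3
      field_simp
    have e' : vel (-((√k)⁻¹ • a)) = -((√(k + ‖a‖ ^ 2))⁻¹ • a) := by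
      rw [← e, vel, vel, norm_neg, smul_neg]
    have h1 := h ((√k)⁻¹ • a) (-((√k)⁻¹ • a))
    rw [e', e, sub_neg_eq_add, ← add_smul, map_smul, norm_smul, ← two_mul, norm_mul, norm_inv,
      Real.norm_of_nonneg hq.le, Real.norm_ofNat] at h1
    have h2 : 2 * ‖A a‖ ≤ L * √(k + ‖a‖ ^ 2) := by
      rw [mul_right_comm, ← div_eq_mul_inv, div_le_iff₀ hq] at h1
      exact h1
    refine (pow_le_pow_left₀ (by positivity) h2 2).trans_eq ?_
    rw [mul_pow, Real.sq_sqrt (by positivity)]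
    ring
  have h2 : (2 * ‖A a‖) ^ 2 ≤ (L * ‖a‖) ^ 2 := by
    rw [mul_pow L]
    refine le_of_forall_pos_le_add fun δ hδ => ?_
    have h3 := key (δ / (L ^ 2 + 1)) (by positivity)
    have h4 : L ^ 2 * (δ / (L ^ 2 + 1)) ≤ δ := by
      rw [mul_div_assoc', div_le_iff₀ (by positivity)]
      nlinarith
    linarith
  have := (pow_le_pow_iff_left₀ (by positivity) (by positivity) two_ne_zero).1 h2
  linarith

theorem lipConst_nonneg (χ : R3 → ℝ) (ε T : ℝ) : 0 ≤ lipConst χ ε T :=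
  Real.sInf_nonneg fun _ h => h.1

theorem norm_vel_sub_le_lipConst (hχ : IsMollifier χ) (hε : 0 < ε) (hT : 0 ≤ T) (ξ η : R3) :
    ‖vel ξ - vel η‖ ≤ lipConst χ ε T := by
  have h := (lipConst_mem hχ hε T).2 0 ⟨le_rfl, hT⟩ 0 ⟨le_rfl, hT⟩ (0, ξ) (0, η) 0 0 0 0
  simp only [phaseDist_self, min_eq_right zero_le_one, add_zero] at h
  have h1 := norm_fst_le_phaseDist (mKer χ ε 0 (0, ξ) 0) (mKer χ ε 0 (0, η) 0)
  have h2 : lipConst χ ε T * min 1 (phaseDist ((0 : R3), ξ) (0, η)) ≤ lipConst χ ε T :=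
    mul_le_of_le_one_right (lipConst_nonneg _ _ _) (min_le_left _ _)
  exact h1.trans (by linarith [phaseDist_nonneg (rKer χ ε 0 (0, ξ) 0 0) (rKer χ ε 0 (0, η) 0 0)])

/-- The first component of `m_ε` is a velocity. Differences of velocities come arbitrarily close to
length `2`, while the truncated distance on the right never exceeds `1`. -/
theorem two_le_lipConst (hχ : IsMollifier χ) (hε : 0 < ε) (hT : 0 ≤ T) : 2 ≤ lipConst χ ε T := by
  have h := norm_apply_le_of_vel (ContinuousLinearMap.id ℝ R3) (lipConst_nonneg χ ε T)
    (fun ξ η => norm_vel_sub_le_lipConst hχ hε hT ξ η) (basisVec 0)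
  have e : ‖basisVec 0‖ = 1 := by simp [basisVec]
  rw [ContinuousLinearMap.id_apply, e] at h
  linarith

/-- This force does not depend on the momenta. They can be set to `0` in the Lipschitz condition, so
that only distances of positions remain. -/
theorem norm_mForce_sub_le (hχ : IsMollifier χ) (hε : 0 < ε) {t : ℝ} (ht : t ∈ Icc 0 T)
    (z z' ζ ζ' : Phase) : ‖mForce χ ε t z ζ - mForce χ ε t z' ζ'‖
      ≤ lipConst χ ε T * (min 1 ‖z.1 - z'.1‖ + min 1 ‖ζ.1 - ζ'.1‖) := by
  have h := (lipConst_mem hχ hε T).2 t ht t ht (z.1, 0) (z'.1, 0) 0 0 (ζ.1, 0) (ζ'.1, 0)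
  simp only [phaseDist_self, min_eq_right zero_le_one, add_zero, phaseDist_of_snd_eq] at h
  have h1 := norm_snd_le_phaseDist (mKer χ ε t (z.1, 0) (ζ.1, 0)) (mKer χ ε t (z'.1, 0) (ζ'.1, 0))
  exact h1.trans (by linarith [phaseDist_nonneg (rKer χ ε t (z.1, 0) t 0) (rKer χ ε t (z'.1, 0) t 0)])

theorem phaseDist_rKer {t τ : ℝ} (h0 : 0 ≤ τ) (h : τ ≤ t) (z z' ζ ζ' : Phase) :
    phaseDist (rKer χ ε t z τ ζ) (rKer χ ε t z' τ ζ')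
      = ‖rForce χ ε t z τ ζ - rForce χ ε t z' τ ζ'‖ := by
  rw [rKer, rKer, phaseDist_of_fst_eq, if_pos ⟨h0, h⟩, if_pos ⟨h0, h⟩]

theorem norm_rForce_sub_le_of_lipConst (hχ : IsMollifier χ) (hε : 0 < ε) {t τ : ℝ} (h0 : 0 ≤ τ)
    (h : τ ≤ t) (ht : t ≤ T) (z z' ζ ζ' : Phase) :
    ‖rForce χ ε t z τ ζ - rForce χ ε t z' τ ζ'‖
      ≤ lipConst χ ε T * (min 1 (phaseDist z z') + min 1 (phaseDist ζ ζ')) := by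
  have := (lipConst_mem hχ hε T).2 t ⟨h0.trans h, ht⟩ τ ⟨h0, h.trans ht⟩ z z' ζ ζ' 0 0
  simp only [phaseDist_self, min_eq_right zero_le_one, add_zero, phaseDist_rKer h0 h] at this
  linarith [phaseDist_nonneg (mKer χ ε t z 0) (mKer χ ε t z' 0)]

/-- The dependence on the momenta is linear in the velocities, which gains a factor `2`. -/
theorem norm_rForce_sub_le_split (hχ : IsMollifier χ) (hε : 0 < ε) {t τ : ℝ} (h0 : 0 ≤ τ)
    (h : τ ≤ t) (ht : t ≤ T) (z z' ζ ζ' : Phase) :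
    ‖rForce χ ε t z τ ζ - rForce χ ε t z' τ ζ'‖
      ≤ lipConst χ ε T * (min 1 ‖z.1 - z'.1‖ + min 1 ‖ζ.1 - ζ'.1‖)
        + lipConst χ ε T / 2 * min 2 ‖z.2 - z'.2‖ + lipConst χ ε T / 2 * min 2 ‖ζ.2 - ζ'.2‖ := by
  have hL := lipConst_nonneg χ ε T
  set L := lipConst χ ε T with hLdef
  have base := fun z z' ζ ζ' => norm_rForce_sub_le_of_lipConst hχ hε h0 h ht z z' ζ ζ'
  have hpos : ‖rForce χ ε t (z.1, z.2) τ (ζ.1, ζ.2) - rForce χ ε t (z'.1, z.2) τ (ζ'.1, ζ.2)‖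
      ≤ L * (min 1 ‖z.1 - z'.1‖ + min 1 ‖ζ.1 - ζ'.1‖) := by
    have := base (z.1, z.2) (z'.1, z.2) (ζ.1, ζ.2) (ζ'.1, ζ.2)
    rwa [phaseDist_of_snd_eq, phaseDist_of_snd_eq] at this
  -- Positions are exchanged first, then one momentum at a time. With the rest fixed, the force is
  -- affine in the velocity, so its increment is a linear map applied to a velocity difference. The
  -- Lipschitz condition bounds this increment by `L`, as the truncated distance is at most `1`, and
  -- `norm_apply_le_of_vel` halves the constant.
  have hmom : ‖rForce χ ε t (z'.1, z.2) τ (ζ'.1, ζ.2) - rForce χ ε t (z'.1, z'.2) τ (ζ'.1, ζ.2)‖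
      ≤ L / 2 * ‖vel z.2 - vel z'.2‖ := by
    set g := gradY χ ε (t - τ) (z'.1 - ζ'.1) with hg
    have e : ∀ ξ ξ', rForce χ ε t (z'.1, ξ) τ (ζ'.1, ζ.2) - rForce χ ε t (z'.1, ξ') τ (ζ'.1, ζ.2)
        = crossL (cross (vel ζ.2) g) (vel ξ - vel ξ') := fun ξ ξ' => by
      rw [crossL_apply, cross_neg_swap (vel ξ - vel ξ'), cross_sub_left]
      simp only [rForce, ← hg]
      abel
    rw [e]
    refine norm_apply_le_of_vel _ hL (fun ξ ξ' => ?_) _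
    rw [← e]
    refine (base _ _ _ _).trans ?_
    rw [phaseDist_self, min_eq_right zero_le_one, add_zero]
    exact mul_le_of_le_one_right hL (min_le_left _ _)
  have hsrc : ‖rForce χ ε t (z'.1, z'.2) τ (ζ'.1, ζ.2) - rForce χ ε t (z'.1, z'.2) τ (ζ'.1, ζ'.2)‖
      ≤ L / 2 * ‖vel ζ.2 - vel ζ'.2‖ := by
    set g := gradY χ ε (t - τ) (z'.1 - ζ'.1) with hg
    set d := dtY χ ε (t - τ) (z'.1 - ζ'.1) with hd
    have e : ∀ ξ ξ', rForce χ ε t (z'.1, z'.2) τ (ζ'.1, ξ) - rForce χ ε t (z'.1, z'.2) τ (ζ'.1, ξ')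
        = ((crossL (vel z'.2)).comp (crossL g) - d • ContinuousLinearMap.id ℝ R3)
          (vel ξ - vel ξ') := fun ξ ξ' => by
      simp only [rForce, ← hg, ← hd, _root_.sub_apply, _root_.smul_apply,
        ContinuousLinearMap.comp_apply, ContinuousLinearMap.id_apply, crossL_apply,
        cross_neg_swap (vel _) g, cross_sub_right, smul_sub]
      rw [cross_neg_swap g (vel ξ), cross_neg_swap g (vel ξ'), ← crossL_apply (vel z'.2),
        ← crossL_apply (vel z'.2), ← crossL_apply (vel z'.2), ← crossL_apply (vel z'.2), map_neg,
        map_neg]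
      abel_nf
    rw [e]
    refine norm_apply_le_of_vel _ hL (fun ξ ξ' => ?_) _
    rw [← e]
    refine (base _ _ _ _).trans ?_
    rw [phaseDist_self, min_eq_right zero_le_one, zero_add]
    exact mul_le_of_le_one_right hL (min_le_left _ _)
  have t1 := norm_sub_le_norm_sub_add_norm_sub (rForce χ ε t z τ ζ)
    (rForce χ ε t (z'.1, z.2) τ (ζ'.1, ζ.2)) (rForce χ ε t z' τ ζ')
  have t2 := norm_sub_le_norm_sub_add_norm_sub (rForce χ ε t (z'.1, z.2) τ (ζ'.1, ζ.2))
    (rForce χ ε t (z'.1, z'.2) τ (ζ'.1, ζ.2)) (rForce χ ε t z' τ ζ')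
  have m1 := mul_le_mul_of_nonneg_left (norm_vel_sub_le_min z.2 z'.2) (by positivity : 0 ≤ L / 2)
  have m2 := mul_le_mul_of_nonneg_left (norm_vel_sub_le_min ζ.2 ζ'.2) (by positivity : 0 ≤ L / 2)
  simp only [Prod.mk.eta] at hpos hmom hsrc
  linarith

end LipschitzConstant
end RegVM

namespace RegVM
-- The flow of a bounded Lipschitz time-dependent vector field.
section Flow

variable {V : Type} [NormedAddCommGroup V] [NormedSpace ℝ V] [CompleteSpace V]

/-- A bounded continuous time-dependent vector field, uniformly Lipschitz in space. -/
structure NiceField (b : ℝ → V → V) (M : ℝ) (K : NNReal) : Prop where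
  cont : Continuous fun p : ℝ × V => b p.1 p.2
  bound : ∀ t z, ‖b t z‖ ≤ M
  lip : ∀ t, LipschitzWith K (b t)

variable {b : ℝ → V → V} {M : ℝ} {K : NNReal} {T : ℝ}

/-- Solutions are constructed on `[-1, T]` rather than `[0, T]`, so that `0` is an interior time and
solutions of the transport equation can be mollified across it. As the speed is at most `M`, a ball
of radius `M (T + 1)` confines the solution on the whole interval. -/
theorem NiceField.exists_solution (hb : NiceField b M K) {s : ℝ} (hs : s ∈ Icc (-1) T) (z : V) :
    ∃ α : ℝ → V, α s = z ∧ ∀ t ∈ Icc (-1) T, HasDerivWithinAt α (b t (α t)) (Icc (-1) T) t := by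
  have hM : 0 ≤ M := (norm_nonneg _).trans (hb.bound 0 0)
  have h1T : -1 ≤ T := hs.1.trans hs.2
  have hP : IsPicardLindelof b (⟨s, hs⟩ : Icc (-1 : ℝ) T) z
      (Real.toNNReal (M * (T + 1))) 0 (Real.toNNReal M) K := by
    refine ⟨fun t _ => (hb.lip t).lipschitzOnWith, fun x _ => ?_, fun t _ x _ => (hb.bound t x).trans (Real.le_coe_toNNReal M), ?_⟩
    · exact (hb.cont.comp (f := fun t : ℝ => (t, x)) (by fun_prop)).continuousOn
    · rw [NNReal.coe_zero, sub_zero, Real.coe_toNNReal _ hM,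
        Real.coe_toNNReal _ (mul_nonneg hM (by linarith))]
      exact mul_le_mul_of_nonneg_left (max_le (by linarith [hs.1]) (by linarith [hs.2])) hM
  exact hP.exists_eq_forall_mem_Icc_hasDerivWithinAt₀

open Classical in
/-- The value at time `t` of the solution which is in the state `z` at time `s`, for times in
`[-1, T]`. -/
def flow (b : ℝ → V → V) (T s : ℝ) (z : V) (t : ℝ) : V :=
  if h : ∃ α : ℝ → V, α s = z ∧ ∀ t ∈ Icc (-1) T, HasDerivWithinAt α (b t (α t)) (Icc (-1) T) t
  then h.choose t else z

theorem NiceField.flow_spec (hb : NiceField b M K) {s : ℝ} (hs : s ∈ Icc (-1) T) (z : V) :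
    flow b T s z s = z ∧ ∀ t ∈ Icc (-1) T,
      HasDerivWithinAt (flow b T s z) (b t (flow b T s z t)) (Icc (-1) T) t := by
  have h := hb.exists_solution hs z
  have e : flow b T s z = h.choose := by
    funext t
    rw [flow, dif_pos h]
  rw [e]
  exact h.choose_spec

theorem hasDerivWithinAt_Ici_of_Icc {α : ℝ → V} {w : V} {a c t : ℝ} (ht : t ∈ Ico a c)
    (h : HasDerivWithinAt α w (Icc a c) t) : HasDerivWithinAt α w (Ici t) t :=
  (h.mono (Icc_subset_Icc_left ht.1)).mono_of_mem_nhdsWithin (Icc_mem_nhdsGE ht.2)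

/-- The forward solutions are unique. -/
theorem NiceField.eq_flow (hb : NiceField b M K) {s : ℝ} (hs : s ∈ Icc (-1) T) {α : ℝ → V}
    {r : ℝ} (hr : r ≤ T) (hc : ContinuousOn α (Icc s r))
    (hα : ∀ t ∈ Ico s r, HasDerivWithinAt α (b t (α t)) (Ici t) t) {t : ℝ} (ht : t ∈ Icc s r) :
    α t = flow b T s (α s) t := by
  obtain ⟨h1, h2⟩ := hb.flow_spec hs (α s)
  have hsub : Icc s r ⊆ Icc (-1) T := Icc_subset_Icc hs.1 hr
  exact ODE_solution_unique hb.lip hc hα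
    (fun τ hτ => ((h2 τ (hsub hτ)).continuousWithinAt).mono hsub)
    (fun τ hτ => hasDerivWithinAt_Ici_of_Icc ⟨hs.1.trans hτ.1, hτ.2.trans_le hr⟩
      (h2 τ (hsub (Ico_subset_Icc_self hτ)))) h1.symm ht

theorem NiceField.flow_flow (hb : NiceField b M K) {s t r : ℝ} (hs : -1 ≤ s) (hst : s ≤ t)
    (htr : t ≤ r) (hr : r ≤ T) (z : V) :
    flow b T t (flow b T s z t) r = flow b T s z r := by
  obtain ⟨-, h2⟩ := hb.flow_spec (T := T) ⟨hs, hst.trans (htr.trans hr)⟩ z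
  have hsub : Icc t r ⊆ Icc (-1) T := Icc_subset_Icc (hs.trans hst) hr
  exact (hb.eq_flow ⟨hs.trans hst, htr.trans hr⟩ hr
    (fun τ hτ => ((h2 τ (hsub hτ)).continuousWithinAt).mono hsub)
    (fun τ hτ => hasDerivWithinAt_Ici_of_Icc ⟨hs.trans (hst.trans hτ.1), hτ.2.trans_le hr⟩
      (h2 τ (hsub (Ico_subset_Icc_self hτ)))) ⟨htr, le_rfl⟩).symm

/-- The trajectory minus the straight line with velocity `w` has speed at most `C`. With `w = 0`
this is the bound on displacements; with `w` a nearby value of the field it makes `pullback` almost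
constant along tangents. -/
theorem NiceField.norm_flow_sub_le (hb : NiceField b M K) {s t : ℝ} (hs : -1 ≤ s) (hst : s ≤ t)
    (ht : t ≤ T) (z w : V) {C : ℝ} (hC : ∀ τ ∈ Icc s t, ‖b τ (flow b T s z τ) - w‖ ≤ C) :
    ‖flow b T s z t - z - (t - s) • w‖ ≤ C * (t - s) := by
  obtain ⟨h1, h2⟩ := hb.flow_spec (T := T) ⟨hs, hst.trans ht⟩ z
  have hsub : Icc s t ⊆ Icc (-1) T := Icc_subset_Icc hs ht
  have h := (convex_Icc s t).norm_image_sub_le_of_norm_hasDerivWithin_le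
    (f := fun τ => flow b T s z τ - τ • w) (f' := fun τ => b τ (flow b T s z τ) - (1 : ℝ) • w)
    (fun τ hτ => ((h2 τ (hsub hτ)).mono hsub).sub ((hasDerivWithinAt_id τ _).smul_const w))
    (fun τ hτ => by rw [one_smul]; exact hC τ hτ) (left_mem_Icc.2 hst) (right_mem_Icc.2 hst)
  rw [h1, Real.norm_of_nonneg (sub_nonneg.2 hst)] at h
  rwa [show flow b T s z t - z - (t - s) • w = flow b T s z t - t • w - (z - s • w) by module]

theorem NiceField.norm_flow_sub_self_le (hb : NiceField b M K) {s t : ℝ} (hs : -1 ≤ s)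
    (hst : s ≤ t) (ht : t ≤ T) (z : V) : ‖flow b T s z t - z‖ ≤ M * (t - s) := by
  have := hb.norm_flow_sub_le hs hst ht z 0 (C := M) fun τ _ => by
    rw [sub_zero]
    exact hb.bound _ _
  simpa using this

theorem NiceField.dist_flow_le (hb : NiceField b M K) {s t : ℝ} (hs : -1 ≤ s) (hst : s ≤ t)
    (ht : t ≤ T) (z z' : V) :
    dist (flow b T s z t) (flow b T s z' t) ≤ dist z z' * Real.exp (K * (t - s)) := by
  have hsT : s ∈ Icc (-1) T := ⟨hs, hst.trans ht⟩
  obtain ⟨h1, h2⟩ := hb.flow_spec hsT z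
  obtain ⟨h1', h2'⟩ := hb.flow_spec hsT z'
  have hsub : Icc s t ⊆ Icc (-1) T := Icc_subset_Icc hs ht
  refine dist_le_of_trajectories_ODE hb.lip
    (fun τ hτ => ((h2 τ (hsub hτ)).continuousWithinAt).mono hsub)
    (fun τ hτ => hasDerivWithinAt_Ici_of_Icc ⟨hs.trans hτ.1, hτ.2.trans_le ht⟩
      (h2 τ (hsub (Ico_subset_Icc_self hτ))))
    (fun τ hτ => ((h2' τ (hsub hτ)).continuousWithinAt).mono hsub)
    (fun τ hτ => hasDerivWithinAt_Ici_of_Icc ⟨hs.trans hτ.1, hτ.2.trans_le ht⟩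
      (h2' τ (hsub (Ico_subset_Icc_self hτ)))) ?_ t ⟨hst, le_rfl⟩
  rw [h1, h1']

end Flow

/-! ### Lipschitz solutions of the backward transport equation. -/

section BackwardTransport

variable {V : Type} [NormedAddCommGroup V] [NormedSpace ℝ V] [CompleteSpace V]
variable {b : ℝ → V → V} {M : ℝ} {K : NNReal} {T : ℝ}

/-- The clamping of a time to `[-1, T]`. -/
def clampTime (T t : ℝ) : ℝ := max (-1) (min t T)

theorem clampTime_of_mem {t : ℝ} (ht : t ∈ Icc (-1) T) : clampTime T t = t := by
  rw [clampTime, min_eq_left ht.2, max_eq_right ht.1]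

theorem clampTime_mem (hT : -1 ≤ T) (t : ℝ) : clampTime T t ∈ Icc (-1) T :=
  ⟨le_max_left _ _, max_le hT (min_le_right _ _)⟩

theorem abs_clampTime_sub_le (t t' : ℝ) : |clampTime T t - clampTime T t'| ≤ |t - t'| := by
  exact (abs_max_sub_max_le_max _ _ _ _).trans (max_le (by simp)
    ((abs_min_sub_min_le_max _ _ _ _).trans (max_le le_rfl (by simp))))

/-- The solution of the transport equation with the value `g` at the time `T`. -/
def pullback (b : ℝ → V → V) (T : ℝ) (g : V → ℝ) (p : ℝ × V) : ℝ :=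
  g (flow b T (clampTime T p.1) p.2 T)

variable {g : V → ℝ} {Γ : ℝ}

/-- The Lipschitz constant of `pullback` in the space variable. -/
theorem NiceField.abs_pullback_sub_le (hb : NiceField b M K) (hT : -1 ≤ T) (hΓ : 0 ≤ Γ)
    (hg : ∀ z z', |g z - g z'| ≤ Γ * ‖z - z'‖) (t : ℝ) (z z' : V) :
    |pullback b T g (t, z) - pullback b T g (t, z')| ≤ Γ * Real.exp (K * (T + 1)) * ‖z - z'‖ := by
  have hc := clampTime_mem hT t
  have h := hb.dist_flow_le hc.1 hc.2 le_rfl z z'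
  rw [dist_eq_norm, dist_eq_norm] at h
  refine (hg _ _).trans ?_
  rw [mul_assoc]
  refine mul_le_mul_of_nonneg_left (h.trans ?_) hΓ
  rw [mul_comm]
  refine mul_le_mul_of_nonneg_right (Real.exp_le_exp.2 ?_) (norm_nonneg _)
  exact mul_le_mul_of_nonneg_left (by linarith [hc.1]) K.2

theorem NiceField.pullback_flow (hb : NiceField b M K) {s t : ℝ} (hs : -1 ≤ s) (hst : s ≤ t)
    (ht : t ≤ T) (z : V) : pullback b T g (t, flow b T s z t) = pullback b T g (s, z) := by
  rw [pullback, pullback, clampTime_of_mem ⟨hs.trans hst, ht⟩, clampTime_of_mem ⟨hs, hst.trans ht⟩,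
    hb.flow_flow hs hst ht le_rfl]

/-- The function is constant along trajectories, so a change of time can be traded for a
displacement of length at most `M |t - t'|`, to which the Lipschitz bound in space applies. -/
theorem NiceField.abs_pullback_sub_le_time (hb : NiceField b M K) (hT : -1 ≤ T) (hΓ : 0 ≤ Γ)
    (hg : ∀ z z', |g z - g z'| ≤ Γ * ‖z - z'‖) (t t' : ℝ) (z : V) :
    |pullback b T g (t, z) - pullback b T g (t', z)|
      ≤ Γ * Real.exp (K * (T + 1)) * M * |t - t'| := by
  wlog h : clampTime T t ≤ clampTime T t' generalizing t t'
  · rw [abs_sub_comm, abs_sub_comm t]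
    exact this t' t (le_of_not_ge h)
  have hc := clampTime_mem hT t
  have hc' := clampTime_mem hT t'
  have e : ∀ t z, pullback b T g (t, z) = pullback b T g (clampTime T t, z) := fun t z => by
    rw [pullback, pullback, clampTime_of_mem (clampTime_mem hT t)]
  rw [e t, e t', ← hb.pullback_flow hc.1 h hc'.2]
  refine (hb.abs_pullback_sub_le hT hΓ hg _ _ _).trans ?_
  have hM : 0 ≤ M := (norm_nonneg _).trans (hb.bound 0 0)
  rw [mul_assoc _ M]
  refine mul_le_mul_of_nonneg_left ?_ (by positivity)
  refine (hb.norm_flow_sub_self_le hc.1 h hc'.2 z).trans (mul_le_mul_of_nonneg_left ?_ hM)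
  rw [abs_sub_comm]
  exact (le_abs_self _).trans (abs_clampTime_sub_le t' t)

theorem NiceField.continuous_pullback (hb : NiceField b M K) (hT : -1 ≤ T) (hΓ : 0 ≤ Γ)
    (hg : ∀ z z', |g z - g z'| ≤ Γ * ‖z - z'‖) : UniformContinuous (pullback b T g) := by
  have hM : 0 ≤ M := (norm_nonneg _).trans (hb.bound 0 0)
  set Λ := Γ * Real.exp (K * (T + 1))
  have hΛ : 0 ≤ Λ := by positivity
  refine (LipschitzWith.of_dist_le_mul (K := Real.toNNReal (Λ + Λ * M)) fun p q => ?_).uniformContinuous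
  have h1 := hb.abs_pullback_sub_le_time hT hΓ hg p.1 q.1 p.2
  have h2 := hb.abs_pullback_sub_le hT hΓ hg q.1 p.2 q.2
  rw [Real.dist_eq, dist_eq_norm, Real.coe_toNNReal _ (by positivity)]
  have h3 := abs_sub_le (pullback b T g p) (pullback b T g (q.1, p.2)) (pullback b T g q)
  have h4 : |p.1 - q.1| ≤ ‖p - q‖ := norm_fst_le (p - q)
  have h5 : ‖p.2 - q.2‖ ≤ ‖p - q‖ := norm_snd_le (p - q)
  calc _ ≤ Λ * M * |p.1 - q.1| + Λ * ‖p.2 - q.2‖ := h3.trans (add_le_add h1 h2)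
    _ ≤ Λ * M * ‖p - q‖ + Λ * ‖p - q‖ := by gcongr
    _ = _ := by ring

theorem NiceField.pullback_eq_zero (hb : NiceField b M K) (hT : -1 ≤ T) {R : ℝ}
    (hg : ∀ z, R < ‖z‖ → g z = 0) {p : ℝ × V} (hp : R + M * (T + 1) < ‖p.2‖) :
    pullback b T g p = 0 := by
  have hM : 0 ≤ M := (norm_nonneg _).trans (hb.bound 0 0)
  have hc := clampTime_mem hT p.1
  refine hg _ ?_
  have h1 := hb.norm_flow_sub_self_le hc.1 hc.2 le_rfl p.2
  have h2 := norm_sub_norm_le p.2 (flow b T (clampTime T p.1) p.2 T)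
  rw [norm_sub_rev] at h2
  have h3 : M * (T - clampTime T p.1) ≤ M * (T + 1) :=
    mul_le_mul_of_nonneg_left (by linarith [hc.1]) hM
  linarith

/-- `pullback` is almost constant along straight lines tangent to the field. -/
theorem NiceField.abs_pullback_line_sub_le (hb : NiceField b M K) (hT : -1 ≤ T) (hΓ : 0 ≤ Γ)
    (hg : ∀ z z', |g z - g z'| ≤ Γ * ‖z - z'‖) {s t : ℝ} (hs : -1 ≤ s) (hst : s ≤ t) (ht : t ≤ T)
    (z w : V) {C : ℝ}
    (hC : ∀ τ ∈ Icc s t, ∀ y, ‖y - z‖ ≤ M * (t - s) → ‖b τ y - w‖ ≤ C) :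
    |pullback b T g (t, z + (t - s) • w) - pullback b T g (s, z)|
      ≤ Γ * Real.exp (K * (T + 1)) * C * (t - s) := by
  have hM : 0 ≤ M := (norm_nonneg _).trans (hb.bound 0 0)
  rw [← hb.pullback_flow hs hst ht z]
  refine (hb.abs_pullback_sub_le hT hΓ hg _ _ _).trans ?_
  rw [mul_assoc _ C]
  refine mul_le_mul_of_nonneg_left ?_ (by positivity)
  rw [norm_sub_rev, ← sub_sub]
  refine hb.norm_flow_sub_le hs hst ht z w fun τ hτ => hC τ hτ _ ?_
  exact (hb.norm_flow_sub_self_le hs hτ.1 (hτ.2.trans ht) z).trans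
    (mul_le_mul_of_nonneg_left (by linarith [hτ.2]) hM)

end BackwardTransport
end RegVM

namespace RegVM
-- Mollification on space-time.
section Mollification

instance isAddHaarMeasure_phase : (volume : Measure Phase).IsAddHaarMeasure :=
  Measure.prod.instIsAddHaarMeasure _ _

instance isAddHaarMeasure_time_phase : (volume : Measure (ℝ × Phase)).IsAddHaarMeasure :=
  Measure.prod.instIsAddHaarMeasure _ _

instance isNegInvariant_time_phase : (volume : Measure (ℝ × Phase)).IsNegInvariant :=
  Measure.IsAddHaarMeasure.isNegInvariant_of_regular _

/-- The mollification of `u` at the scale `δ`. -/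
def mollify {δ : ℝ} (hδ : 0 < δ) (u : ℝ × Phase → ℝ) : ℝ × Phase → ℝ :=
  convolution ((⟨δ / 2, δ, by linarith, by linarith⟩ : ContDiffBump (0 : ℝ × Phase)).normed volume) u
    (ContinuousLinearMap.lsmul ℝ ℝ) volume

variable {δ : ℝ} {u : ℝ × Phase → ℝ}

theorem contDiff_mollify (hδ : 0 < δ) (hu : Continuous u) : ContDiff ℝ ∞ (mollify hδ u) :=
  (ContDiffBump.hasCompactSupport_normed _).contDiff_convolution_left _
    (ContDiffBump.contDiff_normed _) hu.locallyIntegrable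

theorem abs_mollify_sub_le (hδ : 0 < δ) (hu : Continuous u) {p : ℝ × Phase} {η : ℝ}
    (h : ∀ q, dist q p < δ → |u q - u p| ≤ η) : |mollify hδ u p - u p| ≤ η :=
  ContDiffBump.dist_normed_convolution_le hu.aestronglyMeasurable fun q hq => h q hq

theorem abs_mollify_sub_mollify_le (hδ : 0 < δ) (hu : Continuous u) {p p' : ℝ × Phase} {η : ℝ}
    (h : ∀ q, ‖q‖ < δ → |u (p - q) - u (p' - q)| ≤ η) :
    |mollify hδ u p - mollify hδ u p'| ≤ η := by
  set φ : ContDiffBump (0 : ℝ × Phase) := ⟨δ / 2, δ, by linarith, by linarith⟩ with hφ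
  have hi : ∀ p, Integrable fun q => φ.normed volume q * u (p - q) := fun p =>
    (φ.continuous_normed.mul (hu.comp (by fun_prop))).integrable_of_hasCompactSupport
      φ.hasCompactSupport_normed.mul_right
  have e : mollify hδ u p - mollify hδ u p'
      = ∫ q, φ.normed volume q * (u (p - q) - u (p' - q)) := by
    simp only [mul_sub]
    rw [integral_sub (hi p) (hi p')]
    rfl
  rw [e, ← Real.norm_eq_abs]
  have hb : ∀ q, ‖φ.normed volume q * (u (p - q) - u (p' - q))‖ ≤ φ.normed volume q * η := fun q => by
    rw [norm_mul, Real.norm_of_nonneg (φ.nonneg_normed q)]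
    by_cases hq : ‖q‖ < δ
    · exact mul_le_mul_of_nonneg_left (h q hq) (φ.nonneg_normed q)
    · have : φ.normed volume q = 0 := by
        refine Function.notMem_support.1 fun hs => hq ?_
        rw [φ.support_normed_eq] at hs
        simpa using hs
      simp [this]
  refine (norm_integral_le_of_norm_le (φ.integrable_normed.mul_const η)
    (Eventually.of_forall hb)).trans_eq ?_
  rw [integral_mul_const, φ.integral_normed, one_mul]

theorem mollify_eq_zero (hδ : 0 < δ) (hu : Continuous u) {p : ℝ × Phase}
    (h : ∀ q, dist q p < δ → u q = 0) : mollify hδ u p = 0 := by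
  have hp : u p = 0 := h p (by simpa using hδ)
  have := abs_mollify_sub_le hδ hu (p := p) (η := 0) fun q hq => by rw [h q hq, hp]; simp
  rw [hp, sub_zero] at this
  exact abs_eq_zero.1 (le_antisymm this (abs_nonneg _))

end Mollification

/-! ### Smooth approximate solutions of the backward transport equation. -/

section SmoothTransport

variable {b : ℝ → Phase → Phase} {M : ℝ} {K : NNReal} {T Γ R : ℝ} {g : Phase → ℝ}

/-- Smooth approximate solutions of the backward transport equation. -/
theorem NiceField.exists_smooth_transport (hb : NiceField b M K) (hT : 0 < T) (hΓ : 0 ≤ Γ)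
    (hg : ∀ z z', |g z - g z'| ≤ Γ * ‖z - z'‖) (hR : ∀ z, R < ‖z‖ → g z = 0) {c : ℝ} (hc : c < T)
    {η : ℝ} (hη : 0 < η) :
    ∃ v : ℝ × Phase → ℝ, ContDiff ℝ ∞ v ∧ (∀ p, |v p - pullback b T g p| ≤ η) ∧
      (∀ p : ℝ × Phase, p.1 ∈ Icc (-1 / 2) c → |fderiv ℝ v p (1, b p.1 p.2)| ≤ η) ∧
      ∀ p : ℝ × Phase, R + M * (T + 1) + 1 < ‖p.2‖ → v p = 0 := by
  have hT1 : -1 ≤ T := by linarith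
  have hM : 0 ≤ M := (norm_nonneg _).trans (hb.bound 0 0)
  set R' := R + M * (T + 1) + 1 with hR'
  set Λ := Γ * Real.exp (K * (T + 1)) with hΛ
  have hΛ0 : 0 ≤ Λ := by positivity
  have hu := hb.continuous_pullback hT1 hΓ hg
  -- The field is continuous, not uniformly continuous in time, so its modulus is taken on a compact
  -- set containing the support of the mollified function and a neighbourhood of it.
  have hub := ((isCompact_Icc (a := -1) (b := T)).prod
    (isCompact_closedBall (0 : Phase) (R' + 1))).uniformContinuousOn_of_continuous
    hb.cont.continuousOn
  obtain ⟨δ₁, hδ₁, h₁⟩ := Metric.uniformContinuousOn_iff.1 hub (η / (Λ + 1)) (by positivity)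
  obtain ⟨δ₂, hδ₂, h₂⟩ := Metric.uniformContinuous_iff.1 hu η hη
  -- Shifts by the mollifier and short steps along the field both stay below `δ`. Thus `2δ < δ₁`
  -- controls the field, `2δ ≤ T - c` and `2δ ≤ 1 / 2` keep all times in `[-1, T]`, and `δ ≤ δ₂`
  -- makes the mollified function close to the original.
  obtain ⟨δ, hδ, d1, d2, d3, d4⟩ : ∃ δ : ℝ, 0 < δ ∧ 2 * δ < δ₁ ∧ δ ≤ δ₂ ∧ 2 * δ ≤ T - c ∧
      2 * δ ≤ 1 / 2 := by
    refine ⟨min (min (δ₁ / 4) δ₂) (min ((T - c) / 2) (1 / 4)), ?_, ?_, ?_, ?_, ?_⟩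
    · exact lt_min (lt_min (by positivity) hδ₂) (lt_min (by linarith) (by norm_num))
    · have := (min_le_left (min (δ₁ / 4) δ₂) (min ((T - c) / 2) (1 / 4))).trans (min_le_left _ _)
      linarith
    · exact (min_le_left (min (δ₁ / 4) δ₂) (min ((T - c) / 2) (1 / 4))).trans (min_le_right _ _)
    · have := (min_le_right (min (δ₁ / 4) δ₂) (min ((T - c) / 2) (1 / 4))).trans (min_le_left _ _)
      linarith
    · have := (min_le_right (min (δ₁ / 4) δ₂) (min ((T - c) / 2) (1 / 4))).trans (min_le_right _ _)
      linarith
  have cu := hu.continuous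
  have hv0 : ∀ p : ℝ × Phase, R' < ‖p.2‖ → mollify hδ (pullback b T g) p = 0 := fun p hp => by
    refine mollify_eq_zero hδ cu fun q hq => hb.pullback_eq_zero hT1 hR ?_
    have h1 : ‖q.2 - p.2‖ ≤ dist q p := by rw [dist_eq_norm]; exact norm_snd_le (q - p)
    have h2 := norm_sub_norm_le p.2 q.2
    rw [norm_sub_rev] at h2
    linarith
  refine ⟨mollify hδ (pullback b T g), contDiff_mollify hδ cu, fun p => ?_, fun p hp => ?_, hv0⟩
  · refine abs_mollify_sub_le hδ cu fun q hq => ?_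
    have := h₂ (hq.trans_le d2)
    rw [Real.dist_eq] at this
    exact this.le
  · have hdiff := (contDiff_mollify hδ cu).differentiable (by simp) p
    by_cases hpR : R' < ‖p.2‖
    · have hU : IsOpen {q : ℝ × Phase | R' < ‖q.2‖} := isOpen_lt (by fun_prop) (by fun_prop)
      have := dirD_eq_zero (F := mollify hδ (pullback b T g)) hU (fun q hq => hv0 q hq)
        (1, b p.1 p.2) hpR
      rw [show fderiv ℝ (mollify hδ (pullback b T g)) p (1, b p.1 p.2) = 0 from this, abs_zero]
      exact hη.le
    rw [not_lt] at hpR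
    set w := b p.1 p.2 with hw
    have hwM : ‖w‖ ≤ M := hb.bound _ _
    -- the key estimate on segments
    have seg : ∀ s k : ℝ, ∀ y : Phase, 0 ≤ k → k * (1 + 2 * M) ≤ δ → -1 ≤ s → s + k ≤ T →
        |s - p.1| ≤ δ + k → ‖y - p.2‖ ≤ δ + k * M →
        |s + k - p.1| ≤ δ + k → 
        |pullback b T g (s + k, y + k • w) - pullback b T g (s, y)| ≤ η * k := by
      intro s k y hk hkδ hs hsT hsp hyp hsk
      have h := hb.abs_pullback_line_sub_le hT1 hΓ hg hs (le_add_of_nonneg_right hk) hsT y w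
        (C := η / (Λ + 1)) fun τ hτ y' hy' => by
          have hkM : 0 ≤ k * M := by positivity
          rw [add_sub_cancel_left] at hy'
          have a1 : |τ - p.1| ≤ δ + k := by
            rw [abs_le] at hsp hsk ⊢
            exact ⟨by linarith [hτ.1, hsp.1], by linarith [hτ.2, hsk.2]⟩
          have a2 : ‖y' - p.2‖ ≤ δ + 2 * (k * M) := by
            have := norm_add_le (y' - y) (y - p.2)
            rw [sub_add_sub_cancel] at this
            linarith
          have a3 := norm_add_le (y' - p.2) p.2
          rw [sub_add_cancel] at a3
          have hd := h₁ (τ, y') ⟨⟨hs.trans hτ.1, hτ.2.trans hsT⟩, by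
              rw [mem_closedBall_zero_iff]
              linarith⟩ p ⟨⟨by linarith [hp.1], by linarith [hp.2]⟩, by
              rw [mem_closedBall_zero_iff]
              linarith⟩ (by
                rw [Prod.dist_eq, max_lt_iff, Real.dist_eq, dist_eq_norm]
                exact ⟨by simp only; linarith, by simp only; linarith⟩)
          rw [dist_eq_norm] at hd
          exact hd.le
      rw [add_sub_cancel_left] at h
      refine h.trans (mul_le_mul_of_nonneg_right ?_ hk)
      rw [mul_div_assoc', div_le_iff₀ (by positivity)]
      nlinarith
    have hline : HasDerivAt (fun h : ℝ => mollify hδ (pullback b T g) (p + h • ((1 : ℝ), w)))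
        (fderiv ℝ (mollify hδ (pullback b T g)) p (1, w)) 0 := by
      have h1 : HasDerivAt (fun h : ℝ => p + h • ((1 : ℝ), w)) ((1 : ℝ) • ((1 : ℝ), w)) 0 :=
        ((hasDerivAt_id (0 : ℝ)).smul_const _).const_add p
      rw [one_smul] at h1
      have h2 : HasFDerivAt (mollify hδ (pullback b T g))
          (fderiv ℝ (mollify hδ (pullback b T g)) p) (p + (0 : ℝ) • ((1 : ℝ), w)) := by
        rw [zero_smul, add_zero]
        exact hdiff.hasFDerivAt
      exact h2.comp_hasDerivAt 0 h1
    -- The derivative along `(1, w)` is bounded through difference quotients of the mollified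
    -- function, which are averages of increments of `pullback` along parallel segments. No
    -- differentiability of `pullback` is needed.
    refine hline.le_of_lip' hη.le ?_
    have hnear : ∀ᶠ h : ℝ in 𝓝 0, |h| * (1 + 2 * M) < δ := by
      have : Continuous fun h : ℝ => |h| * (1 + 2 * M) := by fun_prop
      refine this.tendsto 0 |>.eventually (gt_mem_nhds ?_)
      simpa using hδ
    filter_upwards [hnear] with h hh
    rw [zero_smul, add_zero, sub_zero, Real.norm_eq_abs, Real.norm_eq_abs]
    refine abs_mollify_sub_mollify_le hδ cu fun q hq => ?_
    have hq1 : |q.1| ≤ δ := (norm_fst_le q).trans hq.le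
    have hq2 : ‖q.2‖ ≤ δ := (norm_snd_le q).trans hq.le
    have hq1' := abs_le.1 hq1
    have hhM : 0 ≤ |h| * M := by positivity
    have hhw : ‖h • w‖ ≤ |h| * M := by
      rw [norm_smul, Real.norm_eq_abs]
      exact mul_le_mul_of_nonneg_left hwM (abs_nonneg _)
    have hh' : |h| ≤ δ := by nlinarith
    have hp1 := hp.1
    have hp2 := hp.2
    have e1 : p + h • ((1 : ℝ), w) - q = (p.1 - q.1 + h, p.2 - q.2 + h • w) := by
      ext1
      · simp; ring
      · simp only [Prod.snd_sub, Prod.snd_add, Prod.smul_snd]; abel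
    have e2 : p - q = (p.1 - q.1, p.2 - q.2) := rfl
    rw [e1, e2]
    rcases le_total 0 h with h0 | h0
    · rw [abs_of_nonneg h0] at hh hhM hh' hhw ⊢
      refine seg _ h _ h0 hh.le (by linarith) (by linarith) ?_ ?_ ?_
      · rw [show p.1 - q.1 - p.1 = -q.1 by ring, abs_neg]; linarith
      · rw [show p.2 - q.2 - p.2 = -q.2 by abel, norm_neg]; linarith
      · rw [show p.1 - q.1 + h - p.1 = -q.1 + h by ring]
        refine (abs_add_le _ _).trans ?_
        rw [abs_neg, abs_of_nonneg h0]; linarith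
    -- The segment estimate runs forward in time, so for `h ≤ 0` it is applied from the other end
    -- point.
    · rw [abs_of_nonpos h0] at hh hhM hh' hhw ⊢
      have := seg (p.1 - q.1 + h) (-h) (p.2 - q.2 + h • w) (by linarith) hh.le (by linarith)
        (by linarith) ?_ ?_ ?_
      · rw [abs_sub_comm]
        convert this using 5
        · ring
        · simp
      · rw [show p.1 - q.1 + h - p.1 = -q.1 + h by ring]
        refine (abs_add_le _ _).trans ?_
        rw [abs_neg, abs_of_nonpos h0]; linarith
      · rw [show p.2 - q.2 + h • w - p.2 = -q.2 + h • w by abel]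
        refine (norm_add_le _ _).trans ?_
        rw [norm_neg]; linarith
      · rw [show p.1 - q.1 + h + -h - p.1 = -q.1 by ring, abs_neg]; linarith

end SmoothTransport
end RegVM

namespace RegVM
-- Weak solutions of the continuity equation are transported by the flow.
section Liouville

variable {μ : ℝ → Measure Phase}

theorem WeaklyContinuous.continuous_integral_slice (hμ : WeaklyContinuous μ) {F : ℝ × Phase → ℝ}
    (hF : UniformContinuous F) {C : ℝ} (hC : ∀ p, |F p| ≤ C) :
    Continuous fun t => ∫ z, F (t, z) ∂μ t := by
  let k : ℝ → (Phase →ᵇ ℝ) := fun t => BoundedContinuousFunction.ofNormedAddCommGroup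
    (fun z => F (t, z)) (hF.continuous.comp (by fun_prop)) C fun z => hC (t, z)
  have hk : Continuous k := by
    refine Metric.continuous_iff.2 fun t η hη => ?_
    obtain ⟨δ, hδ, h⟩ := Metric.uniformContinuous_iff.1 hF (η / 2) (by positivity)
    refine ⟨δ, hδ, fun t' ht' => lt_of_le_of_lt ((BoundedContinuousFunction.dist_le
      (by positivity : 0 ≤ η / 2)).2 fun z => (h ?_).le) (by linarith)⟩
    simpa [Prod.dist_eq, hδ] using ht'
  exact hμ.continuous_integral hk continuous_id

theorem WeaklyContinuous.continuous_integral_of_compact (hμ : WeaklyContinuous μ)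
    {F : ℝ × Phase → ℝ} (hF : Continuous F) (hc : HasCompactSupport F) :
    Continuous fun t => ∫ z, F (t, z) ∂μ t := by
  obtain ⟨C, hC⟩ := hc.exists_bound_of_continuous hF
  exact hμ.continuous_integral_slice (hc.uniformContinuous_of_continuous hF) hC

theorem integrableOn_Ioi_of_zero_off {G : ℝ → ℝ} (hG : Continuous G) {a c : ℝ}
    (h : ∀ t, t ∉ Icc a c → G t = 0) : IntegrableOn G (Ioi 0) :=
  (hG.integrable_of_hasCompactSupport (HasCompactSupport.intro isCompact_Icc h)).integrableOn

variable {b : ℝ → Phase → Phase} {M : ℝ} {K : NNReal} {T Γ R C : ℝ} {g : Phase → ℝ}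

theorem deriv_eq_zero_off {θ : ℝ → ℝ} {a c : ℝ} (h : ∀ t, t ∉ Icc a c → θ t = 0) {t : ℝ}
    (ht : t ∉ Icc a c) : deriv θ t = 0 := by
  have : θ =ᶠ[𝓝 t] fun _ => 0 := by
    filter_upwards [isClosed_Icc.isOpen_compl.mem_nhds ht] with s hs using h s hs
  rw [this.deriv_eq, deriv_const]

/-- The natural test function `θ(t) u(t, z)`, with `u` the backward solution, is only Lipschitz.
With a smooth `v` in place of `u`, the transport derivative of `θ v` is `θ' v` up to `η |θ|`, and
all errors are at most `η` times a fixed constant `S`, so `η → 0` gives the identity. -/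
theorem NiceField.weak_transport (hb : NiceField b M K) (hμ : WeaklyContinuous μ) (hT : 0 < T)
    (hw : ∀ φ : ℝ × Phase → ℝ, ContDiff ℝ ∞ φ → HasCompactSupport φ → (∀ p, T ≤ p.1 → φ p = 0) →
      (∫ t in Ioi (0 : ℝ), ∫ z, fderiv ℝ φ (t, z) (1, b t z) ∂μ t) + ∫ z, φ (0, z) ∂μ 0 = 0)
    (hΓ : 0 ≤ Γ) (hg : ∀ z z', |g z - g z'| ≤ Γ * ‖z - z'‖) (hR : ∀ z, R < ‖z‖ → g z = 0)
    (hC : ∀ z, |g z| ≤ C) {θ : ℝ → ℝ} (hθ : ContDiff ℝ ∞ θ) {c : ℝ} (hc : c < T)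
    (hθ0 : ∀ t, t ∉ Icc (-1 / 2) c → θ t = 0) :
    (∫ t in Ioi (0 : ℝ), deriv θ t * ∫ z, pullback b T g (t, z) ∂μ t)
      + θ 0 * ∫ z, pullback b T g (0, z) ∂μ 0 = 0 := by
  have := hμ.finite
  have hu := hb.continuous_pullback (by linarith : -1 ≤ T) hΓ hg
  have huC : ∀ p, |pullback b T g p| ≤ C := fun p => hC _
  have cA := hμ.continuous_integral_slice hu huC
  have cm : Continuous fun t => (μ t).real univ := by
    have := hμ.cont 1
    simpa using this
  have cθ' : Continuous (deriv θ) := hθ.continuous_deriv (by simp)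
  set J : ℝ → ℝ := fun t => (|deriv θ t| + |θ t|) * (μ t).real univ with hJ
  have cJ : Continuous J := (cθ'.abs.add hθ.continuous.abs).mul cm
  have hJ0 : ∀ t, t ∉ Icc (-1 / 2) c → J t = 0 := fun t ht => by
    simp [hJ, hθ0 t ht, deriv_eq_zero_off hθ0 ht]
  have iJ := integrableOn_Ioi_of_zero_off cJ hJ0
  set S := (∫ t in Ioi (0 : ℝ), J t) + |θ 0| * (μ 0).real univ with hS
  have hS0 : 0 ≤ S := add_nonneg (integral_nonneg fun t => by positivity) (by positivity)
  set X := (∫ t in Ioi (0 : ℝ), deriv θ t * ∫ z, pullback b T g (t, z) ∂μ t)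
      + θ 0 * ∫ z, pullback b T g (0, z) ∂μ 0 with hX
  have key : ∀ η, 0 < η → |X| ≤ η * S := by
    intro η hη
    obtain ⟨v, cv, hv1, hv2, hv3⟩ := hb.exists_smooth_transport hT hΓ hg hR hc hη
    set φ : ℝ × Phase → ℝ := fun p => θ p.1 * v p with hφ
    have cφ : ContDiff ℝ ∞ φ := (hθ.comp contDiff_fst).mul cv
    have hφc : HasCompactSupport φ := by
      refine HasCompactSupport.intro ((isCompact_Icc (a := (-1 / 2 : ℝ)) (b := c)).prod
        (isCompact_closedBall (0 : Phase) (R + M * (T + 1) + 1))) fun p hp => ?_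
      by_cases h1 : p.1 ∈ Icc (-1 / 2) c
      · have h2 : R + M * (T + 1) + 1 < ‖p.2‖ := by
          by_contra h
          exact hp ⟨h1, by simpa using h⟩
        simp only [hφ, hv3 p h2, mul_zero]
      · simp only [hφ, hθ0 _ h1, zero_mul]
    have hweak := hw φ cφ hφc fun p hp => by
      simp only [hφ, hθ0 p.1 fun h => by linarith [h.2], zero_mul]
    have cD : Continuous fun p : ℝ × Phase => fderiv ℝ φ p (1, b p.1 p.2) :=
      (cφ.continuous_fderiv (by simp)).clm_apply (continuous_const.prodMk hb.cont)
    have hDc : HasCompactSupport fun p : ℝ × Phase => fderiv ℝ φ p (1, b p.1 p.2) :=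
      HasCompactSupport.intro (K := tsupport φ) hφc fun p hp => by
        have : fderiv ℝ φ p = 0 := image_eq_zero_of_notMem_tsupport fun h =>
          hp (tsupport_fderiv_subset ℝ h)
        rw [this, _root_.zero_apply]
    have cG := hμ.continuous_integral_of_compact cD hDc
    have hD : ∀ p : ℝ × Phase, fderiv ℝ φ p (1, b p.1 p.2)
        = deriv θ p.1 * v p + θ p.1 * fderiv ℝ v p (1, b p.1 p.2) := fun p => by
      have h1 : HasFDerivAt (fun p : ℝ × Phase => θ p.1)
          ((ContinuousLinearMap.toSpanSingleton ℝ (deriv θ p.1)).comp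
            (ContinuousLinearMap.fst ℝ ℝ Phase)) p :=
        ((hθ.differentiable (by simp) p.1).hasDerivAt.hasFDerivAt).comp p hasFDerivAt_fst
      have h2 := h1.mul (cv.differentiable (by simp) p).hasFDerivAt
      rw [show fderiv ℝ φ p = _ from h2.fderiv]
      simp
      ring
    have hG0 : ∀ t, t ∉ Icc (-1 / 2) c → ∫ z, fderiv ℝ φ (t, z) (1, b t z) ∂μ t = 0 := fun t ht => by
      have : ∀ z, fderiv ℝ φ (t, z) (1, b t z) = 0 := fun z => by
        rw [hD (t, z)]
        simp only [hθ0 t ht, deriv_eq_zero_off hθ0 ht, zero_mul, add_zero]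
      simp only [this, integral_zero]
    have iG : IntegrableOn (fun t => ∫ z, fderiv ℝ φ (t, z) (1, b t z) ∂μ t) (Ioi 0) :=
      integrableOn_Ioi_of_zero_off cG hG0
    have iH : IntegrableOn (fun t => deriv θ t * ∫ z, pullback b T g (t, z) ∂μ t) (Ioi 0) :=
      integrableOn_Ioi_of_zero_off
        (G := fun t => deriv θ t * ∫ z, pullback b T g (t, z) ∂μ t) (cθ'.mul cA)
        (a := -1 / 2) (c := c) fun t ht => by
        simp only [deriv_eq_zero_off hθ0 ht, zero_mul]
    have iu : ∀ t, Integrable (fun z => pullback b T g (t, z)) (μ t) := fun t =>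
      integrable_of_continuous_of_le (hu.continuous.comp (by fun_prop)) fun z => huC (t, z)
    have iv : ∀ t, Integrable (fun z => v (t, z)) (μ t) := fun t =>
      integrable_of_continuous_of_le (C := C + η) (cv.continuous.comp (by fun_prop)) fun z => by
        have h1 := hv1 (t, z)
        have h2 := huC (t, z)
        rw [Real.norm_eq_abs]
        have := abs_sub_abs_le_abs_sub (v (t, z)) (pullback b T g (t, z))
        linarith
    have iD : ∀ t, Integrable (fun z => fderiv ℝ φ (t, z) (1, b t z)) (μ t) := fun t => by
      obtain ⟨C', hC'⟩ := hDc.exists_bound_of_continuous cD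
      exact integrable_of_continuous_of_le (cD.comp (by fun_prop : Continuous fun z : Phase => (t, z)))
        fun z => hC' (t, z)
    have hGH : ∀ t, |(deriv θ t * ∫ z, pullback b T g (t, z) ∂μ t)
        - ∫ z, fderiv ℝ φ (t, z) (1, b t z) ∂μ t| ≤ η * J t := fun t => by
      by_cases ht : t ∈ Icc (-1 / 2) c
      · rw [← integral_const_mul, ← integral_sub ((iu t).const_mul _) (iD t), ← Real.norm_eq_abs]
        refine (norm_integral_le_of_norm_le_const (C := η * (|deriv θ t| + |θ t|))
          (Eventually.of_forall fun z => ?_)).trans_eq (by rw [hJ]; ring)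
        rw [hD (t, z), Real.norm_eq_abs]
        have e : deriv θ t * pullback b T g (t, z)
            - (deriv θ t * v (t, z) + θ t * fderiv ℝ v (t, z) (1, b t z))
            = -(deriv θ t * (v (t, z) - pullback b T g (t, z)))
              - θ t * fderiv ℝ v (t, z) (1, b t z) := by ring
        simp only [e]
        refine (abs_sub _ _).trans ?_
        rw [abs_neg, abs_mul, abs_mul]
        have h1 := mul_le_mul_of_nonneg_left (hv1 (t, z)) (abs_nonneg (deriv θ t))
        have h2 := mul_le_mul_of_nonneg_left (hv2 (t, z) ht) (abs_nonneg (θ t))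
        linarith
      · rw [hG0 t ht, deriv_eq_zero_off hθ0 ht, hJ0 t ht]
        simp
    have h0 : |θ 0 * ∫ z, pullback b T g (0, z) ∂μ 0 - ∫ z, φ (0, z) ∂μ 0|
        ≤ η * (|θ 0| * (μ 0).real univ) := by
      have e : ∫ z, φ (0, z) ∂μ 0 = θ 0 * ∫ z, v (0, z) ∂μ 0 := by
        rw [← integral_const_mul]
      rw [mul_comm (θ 0), e]
      have h1 : |(∫ z, pullback b T g (0, z) ∂μ 0) - ∫ z, v (0, z) ∂μ 0| ≤ η * (μ 0).real univ := by
        rw [← integral_sub (iu 0) (iv 0), ← Real.norm_eq_abs]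
        refine norm_integral_le_of_norm_le_const (Eventually.of_forall fun z => ?_)
        rw [Real.norm_eq_abs, abs_sub_comm]
        exact hv1 (0, z)
      rw [mul_comm _ (θ 0), ← mul_sub, abs_mul]
      have := mul_le_mul_of_nonneg_left h1 (abs_nonneg (θ 0))
      linarith
    have hX2 : X = (∫ t in Ioi (0 : ℝ), ((deriv θ t * ∫ z, pullback b T g (t, z) ∂μ t)
        - ∫ z, fderiv ℝ φ (t, z) (1, b t z) ∂μ t))
        + (θ 0 * ∫ z, pullback b T g (0, z) ∂μ 0 - ∫ z, φ (0, z) ∂μ 0) := by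
      rw [integral_sub iH iG, hX]
      linarith
    rw [hX2]
    refine (abs_add_le _ _).trans ?_
    rw [hS, mul_add]
    refine add_le_add ?_ h0
    rw [← integral_const_mul, ← Real.norm_eq_abs]
    exact norm_integral_le_of_norm_le (iJ.const_mul η) (Eventually.of_forall hGH)
  have hX0 : |X| ≤ 0 := by
    refine le_of_forall_pos_le_add fun η hη => ?_
    have h := key (η / (S + 1)) (by positivity)
    have h2 : η / (S + 1) * S ≤ η := by
      rw [div_mul_eq_mul_div, div_le_iff₀ (by positivity)]
      nlinarith
    linarith
  exact abs_eq_zero.1 (le_antisymm hX0 (abs_nonneg _))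

theorem contDiff_primitive {ψ : ℝ → ℝ} (hψ : ContDiff ℝ ∞ ψ) (a : ℝ) :
    ContDiff ℝ ∞ fun t => ∫ s in a..t, ψ s := by
  have hd : ∀ t, HasDerivAt (fun t => ∫ s in a..t, ψ s) (ψ t) t := fun t =>
    intervalIntegral.integral_hasDerivAt_right (hψ.continuous.intervalIntegrable _ _)
      hψ.continuous.stronglyMeasurable.stronglyMeasurableAtFilter hψ.continuous.continuousAt
  refine contDiff_infty_iff_deriv.2 ⟨fun t => (hd t).differentiableAt, ?_⟩
  rwa [funext fun t => (hd t).deriv]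

/-- The integral of the backward solution of the transport equation is conserved. -/
theorem NiceField.integral_pullback_eq (hb : NiceField b M K) (hμ : WeaklyContinuous μ) (hT : 0 < T)
    (hw : ∀ φ : ℝ × Phase → ℝ, ContDiff ℝ ∞ φ → HasCompactSupport φ → (∀ p, T ≤ p.1 → φ p = 0) →
      (∫ t in Ioi (0 : ℝ), ∫ z, fderiv ℝ φ (t, z) (1, b t z) ∂μ t) + ∫ z, φ (0, z) ∂μ 0 = 0)
    (hΓ : 0 ≤ Γ) (hg : ∀ z z', |g z - g z'| ≤ Γ * ‖z - z'‖) (hR : ∀ z, R < ‖z‖ → g z = 0)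
    (hC : ∀ z, |g z| ≤ C) : ∫ z, g z ∂μ T = ∫ z, g (flow b T 0 z T) ∂μ 0 := by
  have hu := hb.continuous_pullback (by linarith : -1 ≤ T) hΓ hg
  have cA := hμ.continuous_integral_slice hu fun p => hC _
  set A : ℝ → ℝ := fun t => ∫ z, pullback b T g (t, z) ∂μ t with hA
  have key : ∀ ψ : ℝ → ℝ, ContDiff ℝ ∞ ψ → HasCompactSupport ψ → tsupport ψ ⊆ Ioo 0 T →
      ∫ t, ψ t • (A t - A 0) = 0 := by
    intro ψ hψ hψc hψs
    obtain ⟨c, hcT, hc⟩ : ∃ c < T, ∀ t, c < t → ψ t = 0 := by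
      rcases (tsupport ψ).eq_empty_or_nonempty with he | hne
      · refine ⟨0, hT, fun t _ => ?_⟩
        exact image_eq_zero_of_notMem_tsupport (by simp [he])
      · obtain ⟨c, hc1, hc2⟩ := hψc.isCompact.exists_isGreatest hne
        exact ⟨c, (hψs hc1).2, fun t ht => image_eq_zero_of_notMem_tsupport fun h =>
          absurd (hc2 h) (not_le.2 ht)⟩
    have hψneg : ∀ t ≤ 0, ψ t = 0 := fun t ht => image_eq_zero_of_notMem_tsupport fun h =>
      absurd (hψs h).1 (not_lt.2 ht)
    set P : ℝ → ℝ := fun t => ∫ s in T..t, ψ s with hP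
    have cP : ContDiff ℝ ∞ P := contDiff_primitive hψ T
    -- A primitive of `ψ` which vanishes after its support. The cutoff `smoothTransition (4t + 2)`
    -- is `0` for `t ≤ -1/2` and `1` for `t ≥ -1/4`, so it provides compact support without any
    -- change at positive times. Since `θ(0) = -∫ ψ`, the weak identity becomes `∫ ψ (A - A(0)) =
    -- 0`.
    set θ : ℝ → ℝ := fun t => Real.smoothTransition (4 * t + 2) * P t with hθ
    have cθ : ContDiff ℝ ∞ θ :=
      (Real.smoothTransition.contDiff.comp (by fun_prop)).mul cP
    have hP0 : ∀ t, c < t → P t = 0 := fun t ht => by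
      simp only [hP]
      refine intervalIntegral.integral_zero_ae (Eventually.of_forall fun s hs => hc s ?_)
      exact (lt_min hcT ht).trans (mem_uIoc.1 hs |>.elim (fun h => (min_le_left _ _).trans_lt h.1)
        fun h => (min_le_right _ _).trans_lt h.1)
    have hθ0 : ∀ t, t ∉ Icc (-1 / 2) c → θ t = 0 := fun t ht => by
      rw [mem_Icc, not_and_or, not_le, not_le] at ht
      rcases ht with ht | ht
      · simp only [hθ]
        rw [Real.smoothTransition.zero_of_nonpos (by linarith), zero_mul]
      · simp only [hθ, hP0 t ht, mul_zero]
    have hθ1 : ∀ t, -1 / 4 < t → θ t = P t := fun t ht => by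
      simp only [hθ]
      rw [Real.smoothTransition.one_of_one_le (by linarith), one_mul]
    have hθ' : ∀ t, 0 < t → deriv θ t = ψ t := fun t ht => by
      have e : θ =ᶠ[𝓝 t] P := by
        filter_upwards [lt_mem_nhds (show -1 / 4 < t by linarith)] with s hs using hθ1 s hs
      rw [e.deriv_eq]
      exact (intervalIntegral.integral_hasDerivAt_right (hψ.continuous.intervalIntegrable _ _)
        hψ.continuous.stronglyMeasurable.stronglyMeasurableAtFilter hψ.continuous.continuousAt).deriv
    have h := hb.weak_transport hμ hT hw hΓ hg hR hC cθ hcT hθ0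
    have e1 : ∫ t in Ioi (0 : ℝ), deriv θ t * A t = ∫ t, ψ t * A t := by
      rw [setIntegral_congr_fun (g := fun t => ψ t * A t) measurableSet_Ioi fun t ht => by
        simp only [hθ' t ht]]
      refine setIntegral_eq_integral_of_forall_compl_eq_zero fun t ht => ?_
      rw [hψneg t (not_lt.1 ht), zero_mul]
    have e2 : θ 0 = -∫ t, ψ t := by
      rw [hθ1 0 (by norm_num)]
      simp only [hP]
      rw [intervalIntegral.integral_symm, intervalIntegral.integral_of_le hT.le,
        setIntegral_eq_integral_of_forall_compl_eq_zero]
      intro t ht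
      rw [mem_Ioc, not_and_or, not_lt, not_le] at ht
      rcases ht with ht | ht
      · exact hψneg t ht
      · exact hc t (hcT.trans ht)
    have iψA : Integrable fun t => ψ t * A t :=
      (hψ.continuous.mul cA).integrable_of_hasCompactSupport hψc.mul_right
    have iψ : Integrable fun t => ψ t * A 0 :=
      (hψ.continuous.integrable_of_hasCompactSupport hψc).mul_const _
    simp only [smul_eq_mul, mul_sub]
    rw [integral_sub iψA iψ, integral_mul_const]
    change (∫ t in Ioi (0 : ℝ), deriv θ t * A t) + θ 0 * A 0 = 0 at h
    rw [e1, e2] at h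
    linarith
  have hae := isOpen_Ioo.ae_eq_zero_of_integral_contDiff_smul_eq_zero (U := Ioo 0 T)
    ((cA.sub continuous_const).locallyIntegrable.locallyIntegrableOn _) key
  have hae' : (fun t => A t) =ᵐ[volume.restrict (Ioo 0 T)] fun _ => A 0 := by
    rw [EventuallyEq, ae_restrict_iff' measurableSet_Ioo]
    filter_upwards [hae] with t ht h
    exact sub_eq_zero.1 (ht h)
  have hon : EqOn A (fun _ => A 0) (Ioo 0 T) :=
    Measure.eqOn_open_of_ae_eq hae' isOpen_Ioo cA.continuousOn continuousOn_const
  have hcl := hon.of_subset_closure cA.continuousOn continuousOn_const Ioo_subset_Icc_self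
    (by rw [closure_Ioo hT.ne])
  have hfin := hcl (right_mem_Icc.2 hT.le)
  have e1 : ∀ z, pullback b T g (T, z) = g z := fun z => by
    rw [pullback, clampTime_of_mem ⟨by linarith, le_rfl⟩,
      (hb.flow_spec ⟨by linarith, le_rfl⟩ z).1]
  have e2 : ∀ z, pullback b T g (0, z) = g (flow b T 0 z T) := fun z => by
    rw [pullback, clampTime_of_mem ⟨by norm_num, hT.le⟩]
  simpa only [hA, e1, e2] using hfin

/-- Thickened indicators are Lipschitz with bounded support and decrease to the indicator of a
compact set. The measures therefore agree on compact sets, and inner regularity does the rest. -/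
theorem measure_ext_of_integral_lipschitz {ν ν' : Measure Phase} [IsFiniteMeasure ν]
    [IsFiniteMeasure ν'] (h : ∀ (g : Phase → ℝ) (Γ R C : ℝ), 0 ≤ Γ →
      (∀ z z', |g z - g z'| ≤ Γ * ‖z - z'‖) → (∀ z, R < ‖z‖ → g z = 0) → (∀ z, |g z| ≤ C) →
      ∫ z, g z ∂ν = ∫ z, g z ∂ν') : ν = ν' := by
  have hcomp : ∀ s : Set Phase, IsCompact s → ν s = ν' s := by
    intro s hs
    have hδ : ∀ n : ℕ, (0 : ℝ) < 1 / (n + 1) := fun n => by positivity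
    have h1 := tendsto_integral_thickenedIndicator_of_isClosed ν hs.isClosed hδ
      tendsto_one_div_add_atTop_nhds_zero_nat
    have h2 := tendsto_integral_thickenedIndicator_of_isClosed ν' hs.isClosed hδ
      tendsto_one_div_add_atTop_nhds_zero_nat
    obtain ⟨R, hR⟩ := hs.isBounded.subset_closedBall 0
    have e : ∀ n : ℕ, ∫ z, (thickenedIndicator (hδ n) s z : ℝ) ∂ν
        = ∫ z, (thickenedIndicator (hδ n) s z : ℝ) ∂ν' := fun n => by
      refine h _ (Real.toNNReal (1 / (n + 1)))⁻¹ (R + 1) 1 (by positivity) (fun z z' => ?_)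
        (fun z hz => ?_) fun z => ?_
      · have := (lipschitzWith_thickenedIndicator (hδ n) s).dist_le_mul z z'
        rwa [NNReal.dist_eq, dist_eq_norm] at this
      · rw [thickenedIndicator_zero (hδ n) s fun hm => ?_, NNReal.coe_zero]
        obtain ⟨y, hy, hzy⟩ := Metric.mem_thickening_iff.1 hm
        have hy' : ‖y‖ ≤ R := by simpa using hR hy
        have h3 : (1 : ℝ) / (n + 1) ≤ 1 := by
          rw [div_le_one (by positivity)]
          linarith [(Nat.cast_nonneg n : (0 : ℝ) ≤ n)]
        rw [dist_eq_norm] at hzy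
        have h4 := norm_sub_norm_le z y
        linarith
      · rw [abs_of_nonneg (NNReal.coe_nonneg _)]
        exact_mod_cast thickenedIndicator_le_one (hδ n) s z
    simp only [e] at h1
    have := tendsto_nhds_unique h1 h2
    exact (measureReal_eq_measureReal_iff).1 this
  refine Measure.ext fun s hs => ?_
  rw [hs.measure_eq_iSup_isCompact_of_ne_top (measure_ne_top ν s),
    hs.measure_eq_iSup_isCompact_of_ne_top (measure_ne_top ν' s)]
  exact iSup_congr fun k => iSup_congr fun _ => iSup_congr fun hk => hcomp k hk

theorem NiceField.continuous_flow (hb : NiceField b M K) {s t : ℝ} (hs : -1 ≤ s) (hst : s ≤ t)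
    (ht : t ≤ T) : Continuous fun z => flow b T s z t :=
  (LipschitzWith.of_dist_le_mul (K := Real.toNNReal (Real.exp (K * (t - s)))) fun z z' => by
    rw [Real.coe_toNNReal _ (Real.exp_pos _).le, mul_comm]
    exact hb.dist_flow_le hs hst ht z z').continuous

/-- A weakly continuous weak solution of the continuity equation is transported by the flow. -/
theorem NiceField.eq_map_flow (hb : NiceField b M K) (hμ : WeaklyContinuous μ) (hT : 0 < T)
    (hw : ∀ φ : ℝ × Phase → ℝ, ContDiff ℝ ∞ φ → HasCompactSupport φ → (∀ p, T ≤ p.1 → φ p = 0) →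
      (∫ t in Ioi (0 : ℝ), ∫ z, fderiv ℝ φ (t, z) (1, b t z) ∂μ t) + ∫ z, φ (0, z) ∂μ 0 = 0) :
    μ T = (μ 0).map fun z => flow b T 0 z T := by
  have := hμ.finite
  have hc := hb.continuous_flow (T := T) (s := 0) (t := T) (by norm_num) hT.le le_rfl
  refine measure_ext_of_integral_lipschitz fun g Γ R C hΓ hg hR hC => ?_
  rw [hb.integral_pullback_eq hμ hT hw hΓ hg hR hC, integral_map hc.measurable.aemeasurable]
  have : Continuous g := (LipschitzWith.of_dist_le_mul (K := Real.toNNReal Γ) fun z z' => by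
    rw [Real.coe_toNNReal _ hΓ, Real.dist_eq, dist_eq_norm]
    exact hg z z').continuous
  exact this.aestronglyMeasurable

end Liouville
end RegVM

namespace RegVM
-- Bounds for the Lorentz force and the flow of the characteristics.
section Characteristics

variable {χ : R3 → ℝ} {ε T : ℝ} {μ μ' : ℝ → Measure Phase} {E B : ℝ → R3 → R3}

/-- The Maxwell system sees only times `t ≥ 0`. A family of measures may therefore be extended to
negative times by its initial value, which makes it weakly continuous on the whole line. -/
theorem IsFieldOf.congr (h : IsFieldOf χ ε μ E B) (he : ∀ t, 0 ≤ t → μ' t = μ t) :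
    IsFieldOf χ ε μ' E B where
  contDiff_E := h.contDiff_E
  contDiff_B := h.contDiff_B
  div_B := h.div_B
  faraday := h.faraday
  gauss t ht x := by rw [he t ht]; exact h.gauss t ht x
  ampere t ht x := by rw [he t ht]; exact h.ampere t ht x
  init_E x := by rw [he 0 le_rfl]; exact h.init_E x
  init_B := h.init_B

theorem WeaklyContinuous.exists_mass_le (hμ : WeaklyContinuous μ) (T : ℝ) :
    ∃ m, 0 ≤ m ∧ ∀ t ∈ Icc 0 T, (μ t).real univ ≤ m := by
  obtain ⟨m, hm⟩ := isCompact_Icc.exists_bound_of_continuousOn (s := Icc 0 T)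
    (hμ.cont 1).continuousOn
  refine ⟨max m 0, le_max_right _ _, fun t ht => le_max_of_le_left ?_⟩
  have h := hm t ht
  simp only [BoundedContinuousFunction.coe_one, Pi.one_apply, integral_const, smul_eq_mul,
    mul_one] at h
  exact (le_abs_self _).trans h

theorem integrable_mForce (hχ : IsMollifier χ) (hε : 0 < ε) (ν : Measure Phase)
    [IsFiniteMeasure ν] (t : ℝ) (z : Phase) : Integrable (fun ζ => mForce χ ε t z ζ) ν :=
  (integrable_gradDtYG hχ hε ν t z.1).neg

theorem norm_mForce_le (hχ : IsMollifier χ) (hε : 0 < ε) {t : ℝ} (ht : t ∈ Icc 0 T)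
    (z ζ : Phase) : ‖mForce χ ε t z ζ‖ ≤ normLW T (gradDtYG χ ε) := by
  rw [mForce, norm_neg]
  exact (boundedKernel_gradDtYG hχ hε).norm_le ht _

theorem norm_rForce_le (hχ : IsMollifier χ) (hε : 0 < ε) {t τ : ℝ} (h : t - τ ∈ Icc 0 T)
    (z ζ : Phase) :
    ‖rForce χ ε t z τ ζ‖ ≤ 2 * normLW T (gradY χ ε) + normLW T (dtY χ ε) := by
  have h1 := (boundedKernel_gradY hχ hε).norm_le h (z.1 - ζ.1)
  have h2 := (boundedKernel_dtY hχ hε).norm_le h (z.1 - ζ.1)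
  have h3 : ‖cross (vel z.2) (cross (vel ζ.2) (gradY χ ε (t - τ) (z.1 - ζ.1)))‖
      ≤ ‖gradY χ ε (t - τ) (z.1 - ζ.1)‖ := by
    refine (norm_cross_le _ _).trans ((mul_le_of_le_one_left (norm_nonneg _)
      (norm_vel_le _)).trans ((norm_cross_le _ _).trans (mul_le_of_le_one_left (norm_nonneg _)
      (norm_vel_le _))))
  have h4 : ‖dtY χ ε (t - τ) (z.1 - ζ.1) • vel ζ.2‖ ≤ ‖dtY χ ε (t - τ) (z.1 - ζ.1)‖ := by
    rw [norm_smul]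
    exact mul_le_of_le_one_right (norm_nonneg _) (norm_vel_le _)
  rw [rForce]
  refine (norm_sub_le _ _).trans ?_
  rw [norm_neg]
  have h5 := norm_add_le (gradY χ ε (t - τ) (z.1 - ζ.1)) (dtY χ ε (t - τ) (z.1 - ζ.1) • vel ζ.2)
  linarith

/-- The Lorentz force on a particle in the state `z`. -/
def lorentz (E B : ℝ → R3 → R3) (t : ℝ) (z : Phase) : R3 :=
  E t z.1 + cross (vel z.2) (B t z.1)

theorem norm_integral_le_mass {ν : Measure Phase} [IsFiniteMeasure ν] {m C : ℝ} (hC : 0 ≤ C)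
    (hm : ν.real univ ≤ m) {F : Phase → R3} (hF : ∀ z, ‖F z‖ ≤ C) : ‖∫ z, F z ∂ν‖ ≤ C * m :=
  (norm_integral_le_of_norm_le_const (Eventually.of_forall hF)).trans
    (mul_le_mul_of_nonneg_left hm hC)

theorem norm_intervalIntegral_le_const {F : ℝ → R3} {C t : ℝ} (ht : t ∈ Icc 0 T) (hC : 0 ≤ C)
    (hF : ∀ s ∈ Ioc 0 t, ‖F s‖ ≤ C) : ‖∫ s in (0 : ℝ)..t, F s‖ ≤ C * T := by
  refine (intervalIntegral.norm_integral_le_of_norm_le_const fun s hs => hF s ?_).trans ?_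
  · rwa [uIoc_of_le ht.1] at hs
  · rw [sub_zero, abs_of_nonneg ht.1]
    exact mul_le_mul_of_nonneg_left ht.2 hC

/-- A `C¹` field need not be bounded on `[0, T] × ℝ³`; the global bound comes from the mean-field
formula for the force, with bounded kernels and bounded masses. -/
theorem exists_lorentz_le (hχ : IsMollifier χ) (hε : 0 < ε) (hμ : WeaklyContinuous μ)
    (h : IsFieldOf χ ε μ E B) (T : ℝ) :
    ∃ M, ∀ t ∈ Icc 0 T, ∀ z, ‖lorentz E B t z‖ ≤ M := by
  have := hμ.finite
  obtain ⟨m, hm0, hm⟩ := hμ.exists_mass_le T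
  have n1 := normLW_nonneg (T := T) (gradY χ ε)
  have n2 := normLW_nonneg (T := T) (dtY χ ε)
  refine ⟨normLW T (gradDtYG χ ε) * m
    + (2 * normLW T (gradY χ ε) + normLW T (dtY χ ε)) * m * T, fun t ht z => ?_⟩
  rw [lorentz, lorentz_force_eq hχ hε hμ h ht.1]
  refine (norm_add_le _ _).trans (add_le_add ?_ ?_)
  · exact norm_integral_le_mass (normLW_nonneg _) (hm 0 ⟨le_rfl, ht.1.trans ht.2⟩)
      fun ζ => norm_mForce_le hχ hε ht z ζ
  · refine norm_intervalIntegral_le_const ht (by positivity) fun s hs => ?_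
    exact norm_integral_le_mass (by positivity) (hm s ⟨hs.1.le, hs.2.trans ht.2⟩) fun ζ =>
      norm_rForce_le hχ hε ⟨by linarith [hs.2], by linarith [hs.1, ht.2]⟩ z ζ

/-- Likewise, the global Lipschitz constant is inherited from the kernels, with the source particle
kept fixed. -/
theorem exists_lorentz_sub_le (hχ : IsMollifier χ) (hε : 0 < ε) (hμ : WeaklyContinuous μ)
    (h : IsFieldOf χ ε μ E B) (T : ℝ) :
    ∃ K, ∀ t ∈ Icc 0 T, ∀ z z', ‖lorentz E B t z - lorentz E B t z'‖ ≤ K * ‖z - z'‖ := by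
  have := hμ.finite
  obtain ⟨m, hm0, hm⟩ := hμ.exists_mass_le T
  have hL := lipConst_nonneg χ ε T
  refine ⟨lipConst χ ε T * m + 2 * lipConst χ ε T * m * T, fun t ht z z' => ?_⟩
  have hx : ‖z.1 - z'.1‖ ≤ ‖z - z'‖ := norm_fst_le (z - z')
  have hξ : ‖z.2 - z'.2‖ ≤ ‖z - z'‖ := norm_snd_le (z - z')
  have h1 : min 1 ‖z.1 - z'.1‖ ≤ ‖z - z'‖ := (min_le_right _ _).trans hx
  have h2 : min 2 ‖z.2 - z'.2‖ ≤ ‖z - z'‖ := (min_le_right _ _).trans hξ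
  have hr := averageContinuous_rForce hχ hε hμ t
  rw [lorentz, lorentz, lorentz_force_eq hχ hε hμ h ht.1, lorentz_force_eq hχ hε hμ h ht.1,
    add_sub_add_comm, ← integral_sub (integrable_mForce hχ hε _ t z) (integrable_mForce hχ hε _ t z'),
    ← intervalIntegral.integral_sub ((hr z).intervalIntegrable 0 t) ((hr z').intervalIntegrable 0 t)]
  have e : (lipConst χ ε T * m + 2 * lipConst χ ε T * m * T) * ‖z - z'‖
      = lipConst χ ε T * ‖z - z'‖ * m + 2 * lipConst χ ε T * ‖z - z'‖ * m * T := by ring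
  rw [e]
  refine (norm_add_le _ _).trans (add_le_add ?_ ?_)
  · refine norm_integral_le_mass (by positivity) (hm 0 ⟨le_rfl, ht.1.trans ht.2⟩) fun ζ => ?_
    refine (norm_mForce_sub_le hχ hε ht z z' ζ ζ).trans (mul_le_mul_of_nonneg_left ?_ hL)
    simpa using h1
  · refine norm_intervalIntegral_le_const ht (by positivity) fun s hs => ?_
    rw [← integral_sub ((hr z).integrable s) ((hr z').integrable s)]
    refine norm_integral_le_mass (by positivity) (hm s ⟨hs.1.le, hs.2.trans ht.2⟩) fun ζ => ?_
    refine (norm_rForce_sub_le_split hχ hε hs.1.le hs.2 ht.2 z z' ζ ζ).trans ?_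
    simp only [sub_self, norm_zero, min_eq_right zero_le_one, min_eq_right zero_le_two, add_zero,
      mul_zero]
    nlinarith [mul_le_mul_of_nonneg_left h1 hL, mul_le_mul_of_nonneg_left h2 hL,
      mul_nonneg hL (norm_nonneg (z - z'))]

/-- The vector field of the characteristics, with the time clamped to `[0, T]`. -/
def phaseField (E B : ℝ → R3 → R3) (T t : ℝ) (z : Phase) : Phase :=
  (vel z.2, lorentz E B (max 0 (min t T)) z)

theorem phaseField_of_mem {t : ℝ} (ht : t ∈ Icc 0 T) (z : Phase) :
    phaseField E B T t z = (vel z.2, lorentz E B t z) := by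
  rw [phaseField, min_eq_left ht.2, max_eq_right ht.1]

theorem clamp_mem (hT : 0 ≤ T) (t : ℝ) : max 0 (min t T) ∈ Icc 0 T :=
  ⟨le_max_left _ _, max_le hT (min_le_right _ _)⟩

theorem exists_niceField (hχ : IsMollifier χ) (hε : 0 < ε) (hμ : WeaklyContinuous μ)
    (h : IsFieldOf χ ε μ E B) (hT : 0 ≤ T) : ∃ M K, NiceField (phaseField E B T) M K := by
  obtain ⟨M, hM⟩ := exists_lorentz_le hχ hε hμ h T
  obtain ⟨K, hK⟩ := exists_lorentz_sub_le hχ hε hμ h T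
  refine ⟨max 1 M, Real.toNNReal (max 1 K), ?_, fun t z => ?_, fun t => ?_⟩
  · have hp : Continuous fun p : ℝ × Phase => (max 0 (min p.1 T), p.2.1) := by fun_prop
    have hm : ∀ p : ℝ × Phase, (max 0 (min p.1 T), p.2.1) ∈ Ici (0 : ℝ) ×ˢ (univ : Set R3) :=
      fun p => ⟨(clamp_mem hT p.1).1, trivial⟩
    have hv : Continuous fun p : ℝ × Phase => vel p.2.2 := continuous_vel.comp (by fun_prop)
    exact hv.prodMk ((h.contDiff_E.continuousOn.comp_continuous hp hm).add
      (continuous_cross hv (h.contDiff_B.continuousOn.comp_continuous hp hm)))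
  · exact max_le ((norm_vel_le _).trans (le_max_left _ _))
      ((hM _ (clamp_mem hT t) z).trans (le_max_right _ _))
  · refine LipschitzWith.of_dist_le_mul fun z z' => ?_
    have h0 : 0 ≤ ‖z - z'‖ := norm_nonneg _
    rw [dist_eq_norm, dist_eq_norm, Real.coe_toNNReal _ (le_max_of_le_left zero_le_one)]
    refine max_le ?_ ?_
    · refine (norm_vel_sub_le _ _).trans ((norm_snd_le (z - z')).trans ?_)
      exact le_mul_of_one_le_left h0 (le_max_left _ _)
    · exact (hK _ (clamp_mem hT t) z z').trans (mul_le_mul_of_nonneg_right (le_max_right _ _) h0)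

/-- `Z t z` is the state at the time `t ∈ [0, T]` of a particle which moves in the field `(E, B)`
and is initially in the state `z`. -/
structure IsCharacteristicFlow (E B : ℝ → R3 → R3) (T : ℝ) (Z : ℝ → Phase → Phase) : Prop where
  cont : Continuous fun p : ℝ × Phase => Z p.1 p.2
  zero : ∀ z, Z 0 z = z
  deriv : ∀ z, ∀ t ∈ Icc 0 T, HasDerivWithinAt (fun s => Z s z)
    (vel (Z t z).2, lorentz E B t (Z t z)) (Icc 0 T) t

/-- The flow of the characteristics. -/
def charFlow (E B : ℝ → R3 → R3) (T t : ℝ) (z : Phase) : Phase :=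
  flow (phaseField E B T) T 0 z (max 0 (min t T))

theorem charFlow_of_mem {t : ℝ} (ht : t ∈ Icc 0 T) (z : Phase) :
    charFlow E B T t z = flow (phaseField E B T) T 0 z t := by
  rw [charFlow, min_eq_left ht.2, max_eq_right ht.1]

theorem isCharacteristicFlow_charFlow {M : ℝ} {K : NNReal} (hb : NiceField (phaseField E B T) M K)
    (hT : 0 ≤ T) : IsCharacteristicFlow E B T (charFlow E B T) := by
  have h0 : (0 : ℝ) ∈ Icc (-1) T := ⟨by norm_num, hT⟩
  have hsub : Icc 0 T ⊆ Icc (-1) T := Icc_subset_Icc_left (by norm_num)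
  refine ⟨?_, fun z => ?_, fun z t ht => ?_⟩
  · refine continuous_prod_of_continuous_lipschitzWith' (fun p : ℝ × Phase => charFlow E B T p.1 p.2)
      (Real.toNNReal (Real.exp (K * T))) (fun t => ?_) fun z => ?_
    · refine LipschitzWith.of_dist_le_mul fun z z' => ?_
      have hc := clamp_mem hT t
      rw [Real.coe_toNNReal _ (Real.exp_pos _).le, mul_comm]
      refine (hb.dist_flow_le (by norm_num) hc.1 hc.2 z z').trans
        (mul_le_mul_of_nonneg_left (Real.exp_le_exp.2 ?_) dist_nonneg)
      exact mul_le_mul_of_nonneg_left (by linarith [hc.2]) K.2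
    · have hc : ContinuousOn (flow (phaseField E B T) T 0 z) (Icc 0 T) := fun s hs =>
        (((hb.flow_spec h0 z).2 s (hsub hs)).mono hsub).continuousWithinAt
      exact hc.comp_continuous (by fun_prop) fun t => clamp_mem hT t
  · rw [charFlow_of_mem ⟨le_rfl, hT⟩, (hb.flow_spec h0 z).1]
  · have h := ((hb.flow_spec h0 z).2 t (hsub ht)).mono hsub
    rw [phaseField_of_mem ht, ← charFlow_of_mem ht] at h
    exact h.congr (fun s hs => charFlow_of_mem hs z) (charFlow_of_mem ht z)

end Characteristics
end RegVM

namespace RegVM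
-- The Vlasov equation along the characteristics.
section VlasovTransport

variable {χ : R3 → ℝ} {ε T : ℝ} {E B : ℝ → R3 → R3} {fin : Phase → ℝ} {f : ℝ → Phase → ℝ}

theorem integral_phaseMeasure {g : Phase → ℝ} (hg : Integrable g) (h0 : ∀ᵐ z, 0 ≤ g z)
    (φ : Phase → ℝ) : ∫ z, φ z ∂phaseMeasure g = ∫ z, g z * φ z := by
  rw [phaseMeasure, integral_withDensity_eq_integral_toReal_smul₀ hg.aemeasurable.ennreal_ofReal
    (Eventually.of_forall fun _ => ENNReal.ofReal_lt_top)]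
  refine integral_congr_ae ?_
  filter_upwards [h0] with z hz
  rw [ENNReal.toReal_ofReal hz, smul_eq_mul]

theorem isFiniteMeasure_phaseMeasure {g : Phase → ℝ} (hg : Integrable g) :
    IsFiniteMeasure (phaseMeasure g) := isFiniteMeasure_withDensity_ofReal hg.2

theorem isProbabilityMeasure_phaseMeasure {g : Phase → ℝ} (hg : Integrable g)
    (h0 : ∀ᵐ z, 0 ≤ g z) (h1 : ∫ z, g z = 1) : IsProbabilityMeasure (phaseMeasure g) := by
  refine ⟨?_⟩
  rw [phaseMeasure, withDensity_apply _ MeasurableSet.univ, Measure.restrict_univ,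
    ← ofReal_integral_eq_lintegral_ofReal hg h0, h1, ENNReal.ofReal_one]

theorem phaseMeasure_congr {g g' : Phase → ℝ} (h : g =ᵐ[volume] g') :
    phaseMeasure g = phaseMeasure g' :=
  withDensity_congr_ae (by filter_upwards [h] with z hz; rw [hz])

theorem IsVlasovMaxwellSolution.weaklyContinuous (hf : IsVlasovMaxwellSolution χ ε fin f E B) :
    WeaklyContinuous fun t => phaseMeasure (f (max t 0)) := by
  refine ⟨fun t => isFiniteMeasure_phaseMeasure (hf.integrable _ (le_max_right _ _)), fun φ => ?_⟩
  refine ((hf.weak_continuous φ).comp_continuous (f := fun t : ℝ => max t 0) (by fun_prop)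
    fun t => mem_Ici.2 (le_max_right _ _)).congr fun t => ?_
  rw [integral_phaseMeasure (hf.integrable _ (le_max_right _ _)) (hf.nonneg _ (le_max_right _ _))]
  exact integral_congr_ae (Eventually.of_forall fun z => mul_comm _ _)

theorem IsVlasovMaxwellSolution.isFieldOf (hf : IsVlasovMaxwellSolution χ ε fin f E B) :
    IsFieldOf χ ε (fun t => phaseMeasure (f (max t 0))) E B :=
  hf.maxwell.congr fun t ht => by rw [max_eq_left ht]

theorem NiceField.eq_charFlow {M : ℝ} {K : NNReal}
    (hb : NiceField (phaseField E B T) M K) {α : ℝ → Phase} {r : ℝ}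
    (hr : r ∈ Icc 0 T) (hα : ∀ t ∈ Icc 0 r, HasDerivWithinAt α (vel (α t).2, lorentz E B t (α t))
      (Icc 0 r) t) {t : ℝ} (ht : t ∈ Icc 0 r) : α t = charFlow E B T t (α 0) := by
  have htT : t ∈ Icc 0 T := ⟨ht.1, ht.2.trans hr.2⟩
  rw [charFlow_of_mem htT]
  refine hb.eq_flow ⟨by norm_num, hr.1.trans hr.2⟩ hr.2
    (fun s hs => (hα s hs).continuousWithinAt) (fun s hs => ?_) ht
  rw [phaseField_of_mem ⟨hs.1, hs.2.le.trans hr.2⟩]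
  exact hasDerivWithinAt_Ici_of_Icc hs (hα s (Ico_subset_Icc_self hs))

/-- The solution of the Vlasov equation is transported by the characteristics. -/
theorem IsVlasovMaxwellSolution.eq_map (hf : IsVlasovMaxwellSolution χ ε fin f E B)
    {M : ℝ} {K : NNReal} (hb : NiceField (phaseField E B T) M K) {t : ℝ} (ht : t ∈ Icc 0 T) :
    phaseMeasure (f t) = (phaseMeasure fin).map (charFlow E B T t) := by
  have h0 : phaseMeasure (f 0) = phaseMeasure fin := phaseMeasure_congr hf.init
  rcases ht.1.eq_or_lt with rfl | ht0
  · have e : charFlow E B T 0 = id := funext (isCharacteristicFlow_charFlow hb ht.2).zero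
    rw [e, Measure.map_id, h0]
  have hw := hf.weaklyContinuous
  -- The theorem is applied with final time `t`, so its test functions vanish from `t` on. Clamping
  -- the field outside of `[0, T]` is then invisible to the weak equation. The flow built on `[-1,
  -- t]` is identified with that built on `[-1, T]` by uniqueness.
  have key := hb.eq_map_flow (T := t) hw ht0 fun φ hφ hφc hφt => by
    refine Eq.trans ?_ (hf.vlasov φ hφ hφc)
    congr 1
    · refine setIntegral_congr_fun measurableSet_Ioi fun s hs => ?_
      have hs0 : (0 : ℝ) ≤ s := (mem_Ioi.1 hs).le
      simp only [max_eq_left hs0]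
      rw [← integral_phaseMeasure (hf.integrable s hs0) (hf.nonneg s hs0)]
      refine integral_congr_ae (Eventually.of_forall fun z => ?_)
      rcases le_or_gt s T with hsT | hsT
      · simp only [phaseField_of_mem ⟨hs0, hsT⟩, lorentz]
      · have : φ =ᶠ[𝓝 (s, z)] fun _ => 0 := by
          filter_upwards [((isOpen_Ioi (a := t)).preimage continuous_fst).mem_nhds
            (show (s, z) ∈ Prod.fst ⁻¹' Ioi t from lt_of_le_of_lt ht.2 hsT)] with p hp
          exact hφt p (le_of_lt hp)
        simp only [this.fderiv_eq, fderiv_const_apply]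
        rfl
    · simp only [max_self]
      rw [h0, integral_phaseMeasure ((hf.integrable 0 le_rfl).congr hf.init)]
      filter_upwards [hf.nonneg 0 le_rfl, hf.init] with z h1 h2
      rwa [← h2]
  simp only [max_eq_left ht.1, max_self, h0] at key
  rw [key]
  congr 1
  funext z
  have h00 : (0 : ℝ) ∈ Icc (-1) t := ⟨by norm_num, ht0.le⟩
  have hsub : Icc 0 t ⊆ Icc (-1) t := Icc_subset_Icc_left (by norm_num)
  have h1 := hb.flow_spec h00 z
  have h2 := hb.eq_charFlow ht
    (α := flow (phaseField E B T) t 0 z) (fun s hs => by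
      have := (h1.2 s (hsub hs)).mono hsub
      rwa [phaseField_of_mem ⟨hs.1, hs.2.trans ht.2⟩] at this) (right_mem_Icc.2 ht0.le)
  rw [h2, h1.1]

end VlasovTransport

/-! ### Empirical measures and the particle system as characteristics. -/

section Particles

variable {χ : R3 → ℝ} {ε T : ℝ} {E B : ℝ → R3 → R3} {N : ℕ} {zin : Fin N → Phase}
  {z : Fin N → ℝ → Phase}

theorem integral_empirical {G : Type} [NormedAddCommGroup G] [NormedSpace ℝ G] [CompleteSpace G]
    {w : Fin N → Phase} {F : Phase → G} :
    ∫ ζ, F ζ ∂empirical w = (N : ℝ)⁻¹ • ∑ i, F (w i) := by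
  rw [empirical, integral_smul_measure, integral_finsetSum_measure fun i _ =>
    integrable_dirac (by simp)]
  simp

theorem isProbabilityMeasure_empirical (hN : 1 ≤ N) (w : Fin N → Phase) :
    IsProbabilityMeasure (empirical w) := by
  refine ⟨?_⟩
  have h : (N : ℝ≥0∞) ≠ 0 := by
    exact_mod_cast (by omega : N ≠ 0)
  simp [empirical, ENNReal.inv_mul_cancel h (ENNReal.natCast_ne_top N)]

theorem map_empirical {g : Phase → Phase} (hg : Measurable g) (w : Fin N → Phase) :
    (empirical w).map g = empirical fun i => g (w i) := by
  ext s hs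
  rw [Measure.map_apply hg hs]
  simp [empirical, Measure.dirac_apply', hs, hg hs, indicator]
  rfl

theorem IsParticleSolution.continuousOn (hz : IsParticleSolution χ ε zin z) (i : Fin N) :
    ContinuousOn (z i) (Ici 0) := fun t ht =>
  (hz.position i t ht).continuousWithinAt.prodMk (hz.momentum i t ht).continuousWithinAt

theorem IsParticleSolution.weaklyContinuous (hN : 1 ≤ N) (hz : IsParticleSolution χ ε zin z) :
    WeaklyContinuous fun t => empirical fun i => z i (max t 0) := by
  refine ⟨fun t => ?_, fun φ => ?_⟩
  · have := isProbabilityMeasure_empirical hN fun i => z i (max t 0)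
    infer_instance
  · have hc : ∀ i, Continuous fun t => z i (max t 0) := fun i =>
      (hz.continuousOn i).comp_continuous (f := fun t : ℝ => max t 0) (by fun_prop)
        fun t => mem_Ici.2 (le_max_right _ _)
    have : Continuous fun t => ∑ i, φ (z i (max t 0)) :=
      continuous_finsetSum Finset.univ fun i _ => φ.continuous.comp (hc i)
    simpa only [integral_empirical, smul_eq_mul] using this.const_mul ((N : ℝ)⁻¹)

theorem IsParticleSolution.isFieldOf
    (h : IsFieldOf χ ε (fun t => empirical fun i => z i t) E B) :
    IsFieldOf χ ε (fun t => empirical fun i => z i (max t 0)) E B :=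
  h.congr fun t ht => by rw [max_eq_left ht]

theorem continuous_rForce_slice (hχ : IsMollifier χ) (hε : 0 < ε) (t : ℝ) (w : Phase) :
    Continuous fun p : ℝ × Phase => rForce χ ε t w p.1 p.2 := by
  have h1 : Continuous fun p : ℝ × Phase => gradY χ ε (t - p.1) (w.1 - p.2.1) :=
    Continuous.comp (g := fun q : ℝ × R3 => gradY χ ε q.1 q.2)
      (f := fun p : ℝ × Phase => (t - p.1, w.1 - p.2.1))
      (boundedKernel_gradY hχ hε).smooth.continuous (by fun_prop)
  have h2 : Continuous fun p : ℝ × Phase => dtY χ ε (t - p.1) (w.1 - p.2.1) :=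
    Continuous.comp (g := fun q : ℝ × R3 => dtY χ ε q.1 q.2)
      (f := fun p : ℝ × Phase => (t - p.1, w.1 - p.2.1))
      (boundedKernel_dtY hχ hε).smooth.continuous (by fun_prop)
  have h3 : Continuous fun p : ℝ × Phase => vel p.2.2 := continuous_vel.comp (by fun_prop)
  exact (h1.add (h2.smul h3)).neg.sub (continuous_cross continuous_const (continuous_cross h3 h1))

/-- For an empirical measure the mean-field force is the sum on the right side of the particle
system, the self-interaction `j = i` included. This is why the particles follow the characteristics
of their own field exactly. -/
theorem IsParticleSolution.lorentz_eq (hχ : IsMollifier χ) (hε : 0 < ε) (hN : 1 ≤ N)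
    (hz : IsParticleSolution χ ε zin z)
    (h : IsFieldOf χ ε (fun t => empirical fun i => z i t) E B) {t : ℝ} (ht : 0 ≤ t) (w : Phase) :
    lorentz E B t w = (N : ℝ)⁻¹ • ∑ j, (mForce χ ε t w (z j 0)
        + ∫ s in (0 : ℝ)..t, rForce χ ε t w s (z j s)) := by
  rw [lorentz, lorentz_force_eq hχ hε (hz.weaklyContinuous hN) (IsParticleSolution.isFieldOf h) ht w]
  have hc : ∀ j, Continuous fun s => rForce χ ε t w s (z j (max s 0)) := fun j =>
    Continuous.comp (g := fun p : ℝ × Phase => rForce χ ε t w p.1 p.2)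
      (f := fun s : ℝ => (s, z j (max s 0))) (continuous_rForce_slice hχ hε t w)
      (continuous_id.prodMk ((hz.continuousOn j).comp_continuous (f := fun t : ℝ => max t 0)
        (by fun_prop) fun t => mem_Ici.2 (le_max_right _ _)))
  simp only [integral_empirical, max_self]
  rw [intervalIntegral.integral_smul, intervalIntegral.integral_finsetSum fun j _ =>
    (hc j).intervalIntegrable _ _, ← smul_add, ← Finset.sum_add_distrib]
  congr 1
  refine Finset.sum_congr rfl fun j _ => ?_
  congr 1
  refine intervalIntegral.integral_congr fun s hs => ?_
  rw [uIcc_of_le ht] at hs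
  simp only [max_eq_left hs.1]

/-- The particles move along the characteristics of the field which they create. -/
theorem IsParticleSolution.eq_charFlow (hχ : IsMollifier χ) (hε : 0 < ε) (hN : 1 ≤ N)
    (hz : IsParticleSolution χ ε zin z)
    (h : IsFieldOf χ ε (fun t => empirical fun i => z i t) E B)
    {M : ℝ} {K : NNReal} (hb : NiceField (phaseField E B T) M K) {t : ℝ} (ht : t ∈ Icc 0 T)
    (i : Fin N) : z i t = charFlow E B T t (zin i) := by
  rw [← hz.init i]
  refine hb.eq_charFlow ⟨ht.1.trans ht.2, le_rfl⟩ (fun s hs => ?_) ht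
  rw [hz.lorentz_eq hχ hε hN h hs.1]
  exact ((hz.position i s hs.1).prodMk (hz.momentum i s hs.1)).mono Icc_subset_Ici_self

theorem IsParticleSolution.eq_map (hχ : IsMollifier χ) (hε : 0 < ε) (hN : 1 ≤ N)
    (hz : IsParticleSolution χ ε zin z)
    (h : IsFieldOf χ ε (fun t => empirical fun i => z i t) E B)
    {M : ℝ} {K : NNReal} (hb : NiceField (phaseField E B T) M K) {t : ℝ} (ht : t ∈ Icc 0 T) :
    (empirical fun i => z i t) = (empirical zin).map (charFlow E B T t) := by
  have hc := (isCharacteristicFlow_charFlow hb (ht.1.trans ht.2)).cont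
  have hm : Continuous (charFlow E B T t) := hc.comp (by fun_prop : Continuous fun w : Phase => (t, w))
  rw [map_empirical hm.measurable]
  simp only [fun i => hz.eq_charFlow hχ hε hN h hb ht i]

end Particles
end RegVM

namespace RegVM
-- Comparison for Volterra inequalities.
section Volterra

theorem hasDerivAt_primitive {g : ℝ → ℝ} (hg : Continuous g) (t : ℝ) :
    HasDerivAt (fun t => ∫ s in (0 : ℝ)..t, g s) (g t) t :=
  intervalIntegral.integral_hasDerivAt_right (hg.intervalIntegrable _ _)
    hg.stronglyMeasurable.stronglyMeasurableAtFilter hg.continuousAt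

theorem continuous_primitive_zero {g : ℝ → ℝ} (hg : Continuous g) :
    Continuous fun t => ∫ s in (0 : ℝ)..t, g s :=
  continuous_iff_continuousAt.2 fun t => (hasDerivAt_primitive hg t).continuousAt

/-- The integrand is the derivative of `s ∫₀ˢ g`. It merges the double time integrals in the
momentum estimate into single ones. -/
theorem integral_mul_add_primitive {g : ℝ → ℝ} (hg : Continuous g) (t : ℝ) :
    ∫ s in (0 : ℝ)..t, (s * g s + ∫ r in (0 : ℝ)..s, g r) = t * ∫ s in (0 : ℝ)..t, g s := by
  have hd : ∀ s ∈ uIcc 0 t, HasDerivAt (fun s => s * ∫ r in (0 : ℝ)..s, g r)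
      (s * g s + ∫ r in (0 : ℝ)..s, g r) s := fun s _ => by
    have := (hasDerivAt_id s).mul (hasDerivAt_primitive hg s)
    exact this.congr_deriv (by simp only [id]; ring)
  have hc : Continuous fun s => s * g s + ∫ r in (0 : ℝ)..s, g r :=
    (continuous_id.mul hg).add (continuous_primitive_zero hg)
  rw [intervalIntegral.integral_eq_sub_of_hasDerivAt hd (hc.intervalIntegrable _ _)]
  simp

theorem eq_zero_of_le_mul_primitive {w : ℝ → ℝ} {K T : ℝ} (hw : Continuous w) (h0 : ∀ t, 0 ≤ w t)
    (h : ∀ t ∈ Icc 0 T, w t ≤ K * ∫ s in (0 : ℝ)..t, w s) {t : ℝ} (ht : t ∈ Icc 0 T) :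
    w t = 0 := by
  have hb := norm_le_gronwallBound_of_norm_deriv_right_le (f := fun t => ∫ s in (0 : ℝ)..t, w s)
    (f' := w) (δ := 0) (K := K) (ε := 0) (a := 0) (b := T)
    (continuous_primitive_zero hw).continuousOn
    (fun s _ => (hasDerivAt_primitive hw s).hasDerivWithinAt) (by simp) (fun s hs => by
      rw [Real.norm_of_nonneg (h0 s), add_zero,
        Real.norm_of_nonneg (intervalIntegral.integral_nonneg hs.1 fun r _ => h0 r)]
      exact h s (Ico_subset_Icc_self hs)) t ht
  rw [gronwallBound_ε0_δ0, norm_le_zero_iff] at hb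
  refine le_antisymm ?_ (h0 t)
  have := h t ht
  rwa [hb, mul_zero] at this

/-- Comparison for a linear system of Volterra inequalities. -/
theorem volterra_nonpos {u v a b : ℝ → ℝ} {K T : ℝ} (hu : Continuous u) (hv : Continuous v)
    (hK : 0 ≤ K) (ha : ∀ t ∈ Icc 0 T, 0 ≤ a t ∧ a t ≤ K) (hb : ∀ t ∈ Icc 0 T, 0 ≤ b t ∧ b t ≤ K)
    (h1 : ∀ t ∈ Icc 0 T, u t ≤ ∫ s in (0 : ℝ)..t, v s)
    (h2 : ∀ t ∈ Icc 0 T, v t ≤ a t * (∫ s in (0 : ℝ)..t, u s) + b t * ∫ s in (0 : ℝ)..t, v s)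
    {t : ℝ} (ht : t ∈ Icc 0 T) : u t ≤ 0 ∧ v t ≤ 0 := by
  have hu' : Continuous fun t => max (u t) 0 := hu.max continuous_const
  have hv' : Continuous fun t => max (v t) 0 := hv.max continuous_const
  have hw : Continuous fun t => max (u t) 0 + max (v t) 0 := hu'.add hv'
  -- Positive parts satisfy the same inequalities, because the coefficients are nonnegative; their
  -- sum is then a nonnegative function to which Gronwall's lemma applies.
  have hmain := eq_zero_of_le_mul_primitive (K := 1 + K) (T := T) hw
    (fun t => add_nonneg (le_max_right _ _) (le_max_right _ _)) (fun t ht => by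
      have i1 : ∫ s in (0 : ℝ)..t, u s ≤ ∫ s in (0 : ℝ)..t, max (u s) 0 :=
        intervalIntegral.integral_mono_on ht.1 (hu.intervalIntegrable _ _)
          (hu'.intervalIntegrable _ _) fun s _ => le_max_left _ _
      have i2 : ∫ s in (0 : ℝ)..t, v s ≤ ∫ s in (0 : ℝ)..t, max (v s) 0 :=
        intervalIntegral.integral_mono_on ht.1 (hv.intervalIntegrable _ _)
          (hv'.intervalIntegrable _ _) fun s _ => le_max_left _ _
      have p1 : 0 ≤ ∫ s in (0 : ℝ)..t, max (u s) 0 :=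
        intervalIntegral.integral_nonneg ht.1 fun s _ => le_max_right _ _
      have p2 : 0 ≤ ∫ s in (0 : ℝ)..t, max (v s) 0 :=
        intervalIntegral.integral_nonneg ht.1 fun s _ => le_max_right _ _
      rw [intervalIntegral.integral_add (hu'.intervalIntegrable _ _) (hv'.intervalIntegrable _ _)]
      obtain ⟨a0, aK⟩ := ha t ht
      obtain ⟨b0, bK⟩ := hb t ht
      have e1 : max (u t) 0 ≤ ∫ s in (0 : ℝ)..t, max (v s) 0 := max_le ((h1 t ht).trans i2) p2
      have e2 : max (v t) 0 ≤ K * (∫ s in (0 : ℝ)..t, max (u s) 0)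
          + K * ∫ s in (0 : ℝ)..t, max (v s) 0 := by
        refine max_le ((h2 t ht).trans (add_le_add ?_ ?_)) (by positivity)
        · exact (mul_le_mul_of_nonneg_left i1 a0).trans (mul_le_mul_of_nonneg_right aK p1)
        · exact (mul_le_mul_of_nonneg_left i2 b0).trans (mul_le_mul_of_nonneg_right bK p2)
      linarith) ht
  have := le_max_left (u t) 0
  have := le_max_right (u t) 0
  have := le_max_left (v t) 0
  have := le_max_right (v t) 0
  constructor <;> linarith

end Volterra

/-! ### An explicit supersolution of the Volterra system, and its comparison with `C(T, ε)`. -/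

section Supersolution

variable {L : ℝ}

/-- The bound for the mean distance of the positions. -/
def posBound (L t : ℝ) : ℝ := (1 + 2 * t + t ^ 2 * L / 2) * Real.exp (t ^ 2 * L / 2)

/-- The derivative of `posBound`, which bounds the mean distance of the momenta. -/
def momBound (L t : ℝ) : ℝ :=
  (2 + 2 * t * L + 2 * t ^ 2 * L + t ^ 3 * L ^ 2 / 2) * Real.exp (t ^ 2 * L / 2)

theorem continuous_posBound : Continuous (posBound L) := by
  unfold posBound
  fun_prop

theorem continuous_momBound : Continuous (momBound L) := by
  unfold momBound
  fun_prop

theorem hasDerivAt_exp_sq (t : ℝ) :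
    HasDerivAt (fun t => Real.exp (t ^ 2 * L / 2)) (t * L * Real.exp (t ^ 2 * L / 2)) t := by
  have h := (((hasDerivAt_pow 2 t).mul_const L).div_const 2).exp
  exact h.congr_deriv (by push_cast; ring)

theorem hasDerivAt_posBound (t : ℝ) : HasDerivAt (posBound L) (momBound L t) t := by
  have h1 : HasDerivAt (fun t : ℝ => 1 + 2 * t + t ^ 2 * L / 2) (2 + t * L) t := by
    have := (((hasDerivAt_id t).const_mul 2).const_add 1).add
      (((hasDerivAt_pow 2 t).mul_const L).div_const 2)
    exact this.congr_deriv (by push_cast; ring)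
  have := h1.mul (hasDerivAt_exp_sq (L := L) t)
  exact this.congr_deriv (by rw [momBound]; ring)

theorem integral_momBound (t : ℝ) : ∫ s in (0 : ℝ)..t, momBound L s = posBound L t - 1 := by
  rw [intervalIntegral.integral_eq_sub_of_hasDerivAt (fun s _ => hasDerivAt_posBound s)
    (continuous_momBound.intervalIntegrable _ _)]
  simp [posBound]

theorem exp_sq_sub_one_le (t : ℝ) :
    Real.exp (t ^ 2 * L / 2) - 1 ≤ t ^ 2 * L / 2 * Real.exp (t ^ 2 * L / 2) := by
  have h := Real.add_one_le_exp (-(t ^ 2 * L / 2))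
  have h2 : Real.exp (-(t ^ 2 * L / 2)) * Real.exp (t ^ 2 * L / 2) = 1 := by
    rw [← Real.exp_add, neg_add_cancel, Real.exp_zero]
  nlinarith [Real.exp_pos (t ^ 2 * L / 2)]

/-- With `e = exp(t²L/2)`, the function `Lte/2 + 2(e - 1)` is a primitive of `L posBound - Le/2`.
The missing integral of `Le/2` has no closed form and is bounded by monotonicity of the exponential.
-/
theorem mul_integral_posBound_le (hL : 0 < L) {t : ℝ} (ht : 0 ≤ t) :
    L * ∫ s in (0 : ℝ)..t, posBound L s
      ≤ L * t * Real.exp (t ^ 2 * L / 2) + 2 * (Real.exp (t ^ 2 * L / 2) - 1) := by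
  have hce : Continuous fun s : ℝ => Real.exp (s ^ 2 * L / 2) := by fun_prop
  have hd : ∀ s ∈ uIcc 0 t, HasDerivAt (fun s => L * s * Real.exp (s ^ 2 * L / 2) / 2
      + 2 * (Real.exp (s ^ 2 * L / 2) - 1))
      (L * posBound L s - L * Real.exp (s ^ 2 * L / 2) / 2) s := fun s _ => by
    have h := (((((hasDerivAt_id s).const_mul L).mul (hasDerivAt_exp_sq (L := L) s)).div_const 2)).add
      (((hasDerivAt_exp_sq (L := L) s).sub_const 1).const_mul 2)
    exact h.congr_deriv (by simp only [posBound, id]; ring)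
  have hc : Continuous fun s => L * posBound L s - L * Real.exp (s ^ 2 * L / 2) / 2 :=
    (continuous_posBound.const_mul L).sub ((hce.const_mul L).div_const 2)
  have hi := intervalIntegral.integral_eq_sub_of_hasDerivAt hd (hc.intervalIntegrable 0 t)
  have i1 : IntervalIntegrable (fun s => L * posBound L s) volume 0 t :=
    (continuous_posBound.const_mul L).intervalIntegrable _ _
  have i2 : IntervalIntegrable (fun s => L * Real.exp (s ^ 2 * L / 2) / 2) volume 0 t :=
    ((hce.const_mul L).div_const 2).intervalIntegrable _ _
  rw [intervalIntegral.integral_sub i1 i2, intervalIntegral.integral_const_mul,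
    intervalIntegral.integral_div, intervalIntegral.integral_const_mul] at hi
  have he : ∫ s in (0 : ℝ)..t, Real.exp (s ^ 2 * L / 2) ≤ t * Real.exp (t ^ 2 * L / 2) := by
    have : ∫ s in (0 : ℝ)..t, Real.exp (s ^ 2 * L / 2) ≤ ∫ _ in (0 : ℝ)..t, Real.exp (t ^ 2 * L / 2) := by
      refine intervalIntegral.integral_mono_on ht (hce.intervalIntegrable 0 t)
        intervalIntegrable_const fun s hs => Real.exp_le_exp.2 ?_
      have : s ^ 2 ≤ t ^ 2 := pow_le_pow_left₀ hs.1 hs.2 2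
      nlinarith
    simpa using this
  have he' := mul_le_mul_of_nonneg_left he hL.le
  simp at hi
  linarith

/-- The right side of the momentum inequality for initial cost `1`, evaluated on the proposed
bounds. The position inequality `X ≤ 1 + ∫ P` holds with equality by `integral_momBound`. The
remainders `e - 1` are absorbed by means of `e - 1 ≤ (t²L/2) e` and `L ≥ 2`. -/
theorem momBound_supersolution (hL : 2 ≤ L) {t : ℝ} (ht : 0 ≤ t) :
    2 + L * t + L * (1 + t) * (∫ s in (0 : ℝ)..t, posBound L s)
      + L / 2 * t * (∫ s in (0 : ℝ)..t, momBound L s) ≤ momBound L t := by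
  have h := mul_integral_posBound_le (by linarith : 0 < L) ht
  rw [integral_momBound]
  have h1 := mul_le_mul_of_nonneg_left h (by linarith : 0 ≤ 1 + t)
  have h2 := exp_sq_sub_one_le (L := L) t
  have h3 : 1 ≤ Real.exp (t ^ 2 * L / 2) := Real.one_le_exp (by positivity)
  rw [momBound, posBound]
  set e := Real.exp (t ^ 2 * L / 2)
  have h4 : t * (e - 1) ≤ t * (t ^ 2 * L / 2 * e) := mul_le_mul_of_nonneg_left h2 ht
  have h5 : t * (t ^ 2 * L / 2 * e) ≤ L / 2 * (t * (t ^ 2 * L / 2 * e)) :=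
    le_mul_of_one_le_left (by positivity) (by linarith)
  have h6 : t * (e - 1) ≤ L / 2 * (t * (e - 1)) :=
    le_mul_of_one_le_left (mul_nonneg ht (by linarith)) (by linarith)
  nlinarith

theorem exp_sq_mul_le (t : ℝ) :
    (1 + t ^ 2 * L / 2) * Real.exp (t ^ 2 * L / 2) ≤ Real.exp (t ^ 2 * L) := by
  have h := Real.add_one_le_exp (t ^ 2 * L / 2)
  have h2 : Real.exp (t ^ 2 * L) = Real.exp (t ^ 2 * L / 2) * Real.exp (t ^ 2 * L / 2) := by
    rw [← Real.exp_add]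
    congr 1
    ring
  rw [h2]
  exact mul_le_mul_of_nonneg_right (by linarith) (Real.exp_pos _).le

/-- With `x = t²L/2`, the factor `1 + 2t + x` is at most `(1 + tL)(1 + x)` because `L ≥ 2`, and `(1
+ x) eˣ ≤ e²ˣ`. -/
theorem posBound_le (hL : 2 ≤ L) {t T : ℝ} (ht : t ∈ Icc 0 T) :
    posBound L t ≤ (1 + T * L) * Real.exp (T ^ 2 * L) := by
  have h0 := ht.1
  have h := exp_sq_mul_le (L := L) t
  have h1 : posBound L t ≤ (1 + t * L) * Real.exp (t ^ 2 * L) := by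
    refine le_trans ?_ (mul_le_mul_of_nonneg_left h (by positivity))
    rw [posBound, ← mul_assoc]
    refine mul_le_mul_of_nonneg_right ?_ (Real.exp_pos _).le
    have : 0 ≤ t * L * (t ^ 2 * L / 2) := by positivity
    nlinarith
  refine h1.trans (mul_le_mul ?_ (Real.exp_le_exp.2 ?_) (Real.exp_pos _).le ?_)
  · nlinarith [ht.2]
  · have : t ^ 2 ≤ T ^ 2 := pow_le_pow_left₀ h0 ht.2 2
    nlinarith
  · nlinarith [ht.2]

/-- The combination which bounds the mean of `weightedGap`; this is the source of the factor `4` in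
the constants for the currents and fields. -/
theorem momBound_add_le (hL : 2 ≤ L) {t T : ℝ} (ht : t ∈ Icc 0 T) :
    momBound L t + 3 / 2 * posBound L t ≤ 4 * ((1 + T * L) * Real.exp (T ^ 2 * L)) := by
  have h0 := ht.1
  have h := exp_sq_mul_le (L := L) t
  have h1 : momBound L t + 3 / 2 * posBound L t ≤ 4 * (1 + t * L) * Real.exp (t ^ 2 * L) := by
    refine le_trans ?_ (mul_le_mul_of_nonneg_left h (by positivity))
    rw [posBound, momBound, ← mul_assoc, ← mul_assoc, ← add_mul]
    refine mul_le_mul_of_nonneg_right ?_ (Real.exp_pos _).le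
    have h2 : 2 * t ≤ t * L := by nlinarith
    -- In the difference of the two polynomials the only negative term not covered by `2 ≤ L` is
    -- `-(3/4) t²L`; it is compensated by `(3/2) t³L²` through this square.
    have h3 : 0 ≤ t * (t * L - 1 / 4) ^ 2 := by positivity
    nlinarith
  refine h1.trans ?_
  rw [← mul_assoc]
  refine mul_le_mul ?_ (Real.exp_le_exp.2 ?_) (Real.exp_pos _).le ?_
  · nlinarith [ht.2]
  · have : t ^ 2 ≤ T ^ 2 := pow_le_pow_left₀ h0 ht.2 2
    nlinarith
  · nlinarith [ht.2]

end Supersolution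
end RegVM

namespace RegVM
-- Integrals over a space of trajectories.
section Averages

variable {Ω : Type} [TopologicalSpace Ω] [MeasurableSpace Ω] [OpensMeasurableSpace Ω]
  [SecondCountableTopology Ω] {π : Measure Ω} [IsFiniteMeasure π]

theorem continuous_integral_of_bounded {g : ℝ × Ω → ℝ} (hg : Continuous g) {C : ℝ}
    (hC : ∀ p, |g p| ≤ C) : Continuous fun t => ∫ u, g (t, u) ∂π :=
  continuous_of_dominated (bound := fun _ => C)
    (fun t => (hg.comp (by fun_prop : Continuous fun u => (t, u))).aestronglyMeasurable)
    (fun t => Eventually.of_forall fun u => hC (t, u)) (integrable_const C)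
    (Eventually.of_forall fun u => hg.comp (by fun_prop : Continuous fun t => (t, u)))

/-- Fubini's theorem for the time integral of a weighted bounded continuous function. -/
theorem integral_weighted_swap {g : ℝ × Ω → ℝ} (hg : Continuous g) {C : ℝ} (hC : ∀ p, |g p| ≤ C)
    {c : ℝ → ℝ} (hc : Continuous c) {t : ℝ} (ht : 0 ≤ t) :
    Integrable (fun u => ∫ s in (0 : ℝ)..t, c s * g (s, u)) π ∧
      ∫ u, (∫ s in (0 : ℝ)..t, c s * g (s, u)) ∂π
        = ∫ s in (0 : ℝ)..t, c s * ∫ u, g (s, u) ∂π := by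
  obtain ⟨M, hM⟩ := isCompact_Icc.exists_bound_of_continuousOn (s := Icc 0 t) hc.continuousOn
  have hcl : ∀ s ∈ Ioc 0 t, max 0 (min s t) = s := fun s hs => by
    rw [min_eq_left hs.2, max_eq_right hs.1.le]
  -- The weight is bounded on `[0, t]` only; clamping its argument makes the integrand bounded
  -- everywhere without changing the integral.
  have hi : Integrable (fun p : Ω × ℝ => c (max 0 (min p.2 t)) * g (p.2, p.1))
      (π.prod (volume.restrict (Ioc 0 t))) := by
    refine integrable_of_continuous_of_le (C := M * C) ((hc.comp (by fun_prop)).mul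
      (hg.comp (by fun_prop))) fun p => ?_
    rw [norm_mul]
    have h1 := hM _ (clamp_mem ht p.2)
    exact mul_le_mul h1 (hC _) (norm_nonneg _) ((norm_nonneg _).trans h1)
  have e : ∀ u, ∫ s in (0 : ℝ)..t, c s * g (s, u)
      = ∫ s in Ioc 0 t, c (max 0 (min s t)) * g (s, u) := fun u => by
    rw [intervalIntegral.integral_of_le ht]
    exact setIntegral_congr_fun measurableSet_Ioc fun s hs => by simp only [hcl s hs]
  simp only [e]
  refine ⟨hi.integral_prod_left, ?_⟩
  rw [integral_integral_swap hi, intervalIntegral.integral_of_le ht]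
  refine setIntegral_congr_fun measurableSet_Ioc fun s hs => ?_
  simp only [hcl s hs, integral_const_mul]

theorem norm_integral_map_sub_le {Y G : Type} [MeasurableSpace Y] [NormedAddCommGroup G]
    [NormedSpace ℝ G] {a b : Ω → Y} (ha : Measurable a) (hb : Measurable b) {F F' : Y → G}
    (hF : Integrable F (π.map a)) (hF' : Integrable F' (π.map b)) {h : Ω → ℝ} (hh : Integrable h π)
    (hle : ∀ᵐ u ∂π, ‖F (a u) - F' (b u)‖ ≤ h u) :
    ‖∫ y, F y ∂π.map a - ∫ y, F' y ∂π.map b‖ ≤ ∫ u, h u ∂π := by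
  have i1 : Integrable (fun x => F (a x)) π := hF.comp_measurable ha
  have i2 : Integrable (fun x => F' (b x)) π := hF'.comp_measurable hb
  rw [integral_map ha.aemeasurable hF.1, integral_map hb.aemeasurable hF'.1, ← integral_sub i1 i2]
  exact norm_integral_le_of_norm_le hh hle

end Averages

/-! ### Two mean-field solutions on one probability space of pairs of trajectories. -/

section Stability

variable {χ : R3 → ℝ} {ε T : ℝ} {μ ν : ℝ → Measure Phase} {E B E' B' : ℝ → R3 → R3}
  {π : Measure (Phase × Phase)} [IsProbabilityMeasure π] {a b : ℝ → Phase × Phase → Phase}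

/-- The measures `μ t` create the field `(E, B)` and are transported by its characteristics, which
are the trajectories `a` parametrized by a probability space. -/
structure IsMeanFieldTransport (χ : R3 → ℝ) (ε T : ℝ) (μ : ℝ → Measure Phase)
    (E B : ℝ → R3 → R3) (π : Measure (Phase × Phase)) (a : ℝ → Phase × Phase → Phase) : Prop where
  weak : WeaklyContinuous μ
  field : IsFieldOf χ ε μ E B
  cont : Continuous fun p : ℝ × (Phase × Phase) => a p.1 p.2
  deriv : ∀ u, ∀ t ∈ Icc 0 T, HasDerivWithinAt (fun s => a s u)
    (vel (a t u).2, lorentz E B t (a t u)) (Icc 0 T) t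
  push : ∀ t ∈ Icc 0 T, μ t = π.map (a t)

/-- The truncated distance of the positions at the time `t`. -/
def posGap (a b : ℝ → Phase × Phase → Phase) (p : ℝ × (Phase × Phase)) : ℝ :=
  min 1 ‖(a p.1 p.2).1 - (b p.1 p.2).1‖

/-- The truncated distance of the momenta at the time `t`. -/
def momGap (a b : ℝ → Phase × Phase → Phase) (p : ℝ × (Phase × Phase)) : ℝ :=
  min 2 ‖(a p.1 p.2).2 - (b p.1 p.2).2‖

/-- The transport cost between the initial states. -/
def initCost (π : Measure (Phase × Phase)) (a b : ℝ → Phase × Phase → Phase) : ℝ :=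
  ∫ u, min 1 (phaseDist (a 0 u) (b 0 u)) ∂π

def meanPos (π : Measure (Phase × Phase)) (a b : ℝ → Phase × Phase → Phase) (t : ℝ) : ℝ :=
  ∫ u, posGap a b (t, u) ∂π

def meanMom (π : Measure (Phase × Phase)) (a b : ℝ → Phase × Phase → Phase) (t : ℝ) : ℝ :=
  ∫ u, momGap a b (t, u) ∂π

theorem posGap_nonneg (p) : 0 ≤ posGap a b p := le_min zero_le_one (norm_nonneg _)

theorem momGap_nonneg (p) : 0 ≤ momGap a b p := le_min zero_le_two (norm_nonneg _)

theorem abs_posGap_le (p) : |posGap a b p| ≤ 1 := by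
  rw [abs_of_nonneg (posGap_nonneg p)]
  exact min_le_left _ _

theorem abs_momGap_le (p) : |momGap a b p| ≤ 2 := by
  rw [abs_of_nonneg (momGap_nonneg p)]
  exact min_le_left _ _

section Gaps

theorem continuous_posGap
    (ha : IsMeanFieldTransport χ ε T μ E B π a) (hb : IsMeanFieldTransport χ ε T ν E' B' π b) : Continuous (posGap a b) :=
  continuous_const.min ((ha.cont.fst.sub hb.cont.fst).norm)

theorem continuous_momGap
    (ha : IsMeanFieldTransport χ ε T μ E B π a) (hb : IsMeanFieldTransport χ ε T ν E' B' π b) : Continuous (momGap a b) :=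
  continuous_const.min ((ha.cont.snd.sub hb.cont.snd).norm)

theorem continuous_meanPos
    (ha : IsMeanFieldTransport χ ε T μ E B π a) (hb : IsMeanFieldTransport χ ε T ν E' B' π b) : Continuous (meanPos π a b) :=
  continuous_integral_of_bounded (continuous_posGap ha hb) abs_posGap_le

theorem continuous_meanMom
    (ha : IsMeanFieldTransport χ ε T μ E B π a) (hb : IsMeanFieldTransport χ ε T ν E' B' π b) : Continuous (meanMom π a b) :=
  continuous_integral_of_bounded (continuous_momGap ha hb) abs_momGap_le

theorem integrable_posGap
    (ha : IsMeanFieldTransport χ ε T μ E B π a) (hb : IsMeanFieldTransport χ ε T ν E' B' π b)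
    (t : ℝ) : Integrable (fun u => posGap a b (t, u)) π :=
  integrable_of_continuous_of_le ((continuous_posGap ha hb).comp (by fun_prop))
    fun u => abs_posGap_le (t, u)

theorem integrable_momGap
    (ha : IsMeanFieldTransport χ ε T μ E B π a) (hb : IsMeanFieldTransport χ ε T ν E' B' π b)
    (t : ℝ) : Integrable (fun u => momGap a b (t, u)) π :=
  integrable_of_continuous_of_le ((continuous_momGap ha hb).comp (by fun_prop))
    fun u => abs_momGap_le (t, u)

theorem continuous_phaseDist_init
    (ha : IsMeanFieldTransport χ ε T μ E B π a) (hb : IsMeanFieldTransport χ ε T ν E' B' π b) : Continuous fun u => phaseDist (a 0 u) (b 0 u) := by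
  have h1 : Continuous (a 0) := ha.cont.comp (by fun_prop : Continuous fun u : Phase × Phase => ((0 : ℝ), u))
  have h2 : Continuous (b 0) := hb.cont.comp (by fun_prop : Continuous fun u : Phase × Phase => ((0 : ℝ), u))
  unfold phaseDist
  fun_prop

theorem integrable_initCost
    (ha : IsMeanFieldTransport χ ε T μ E B π a) (hb : IsMeanFieldTransport χ ε T ν E' B' π b) : Integrable (fun u => min 1 (phaseDist (a 0 u) (b 0 u))) π :=
  integrable_of_continuous_of_le (C := 1)
    (continuous_const.min (continuous_phaseDist_init ha hb)) fun u => by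
      rw [Real.norm_of_nonneg (le_min zero_le_one (phaseDist_nonneg _ _))]
      exact min_le_left _ _

theorem measurable_slices
    (ha : IsMeanFieldTransport χ ε T μ E B π a) (hb : IsMeanFieldTransport χ ε T ν E' B' π b)
    (t : ℝ) : Measurable (a t) ∧ Measurable (b t) :=
  ⟨(ha.cont.comp (by fun_prop : Continuous fun u : Phase × Phase => (t, u))).measurable,
    (hb.cont.comp (by fun_prop : Continuous fun u : Phase × Phase => (t, u))).measurable⟩

theorem norm_integral_sub_le_of_coupling_ae
    (ha : IsMeanFieldTransport χ ε T μ E B π a) (hb : IsMeanFieldTransport χ ε T ν E' B' π b)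
    {G : Type} [NormedAddCommGroup G] [NormedSpace ℝ G]
    {t : ℝ} (ht : t ∈ Icc 0 T) {F F' : Phase → G} (hF : Integrable F (μ t))
    (hF' : Integrable F' (ν t)) {h : Phase × Phase → ℝ} (hh : Integrable h π)
    (hle : ∀ᵐ u ∂π, ‖F (a t u) - F' (b t u)‖ ≤ h u) :
    ‖∫ y, F y ∂μ t - ∫ y, F' y ∂ν t‖ ≤ ∫ u, h u ∂π := by
  rw [ha.push t ht] at hF ⊢
  rw [hb.push t ht] at hF' ⊢
  exact norm_integral_map_sub_le (measurable_slices ha hb t).1 (measurable_slices ha hb t).2 hF hF'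
    hh hle

theorem norm_integral_sub_le_of_coupling
    (ha : IsMeanFieldTransport χ ε T μ E B π a) (hb : IsMeanFieldTransport χ ε T ν E' B' π b)
    {G : Type} [NormedAddCommGroup G] [NormedSpace ℝ G]
    {t : ℝ} (ht : t ∈ Icc 0 T) {F F' : Phase → G} (hF : Integrable F (μ t))
    (hF' : Integrable F' (ν t)) {h : Phase × Phase → ℝ} (hh : Integrable h π)
    (hle : ∀ u, ‖F (a t u) - F' (b t u)‖ ≤ h u) :
    ‖∫ y, F y ∂μ t - ∫ y, F' y ∂ν t‖ ≤ ∫ u, h u ∂π :=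
  norm_integral_sub_le_of_coupling_ae ha hb ht hF hF' hh (Eventually.of_forall hle)

/-- The difference of the forces which two particles experience in the two fields. -/
theorem norm_lorentz_sub_le
    (ha : IsMeanFieldTransport χ ε T μ E B π a) (hb : IsMeanFieldTransport χ ε T ν E' B' π b)
    (hχ : IsMollifier χ) (hε : 0 < ε) {t : ℝ} (ht : t ∈ Icc 0 T)
    (z w : Phase) :
    ‖lorentz E B t z - lorentz E' B' t w‖
      ≤ lipConst χ ε T * (min 1 ‖z.1 - w.1‖ + initCost π a b)
        + (t * (lipConst χ ε T * min 1 ‖z.1 - w.1‖ + lipConst χ ε T / 2 * min 2 ‖z.2 - w.2‖)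
          + lipConst χ ε T * (∫ s in (0 : ℝ)..t, meanPos π a b s)
          + lipConst χ ε T / 2 * ∫ s in (0 : ℝ)..t, meanMom π a b s) := by
  have := ha.weak.finite
  have := hb.weak.finite
  have hL := lipConst_nonneg χ ε T
  set L := lipConst χ ε T
  set q := min 1 ‖z.1 - w.1‖
  set p := min 2 ‖z.2 - w.2‖
  have h0 : (0 : ℝ) ∈ Icc 0 T := ⟨le_rfl, ht.1.trans ht.2⟩
  have r1 := averageContinuous_rForce hχ hε ha.weak t z
  have r2 := averageContinuous_rForce hχ hε hb.weak t w
  have cX := continuous_meanPos ha hb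
  have cP := continuous_meanMom ha hb
  rw [lorentz, lorentz, lorentz_force_eq hχ hε ha.weak ha.field ht.1,
    lorentz_force_eq hχ hε hb.weak hb.field ht.1, add_sub_add_comm,
    ← intervalIntegral.integral_sub (r1.intervalIntegrable 0 t) (r2.intervalIntegrable 0 t)]
  refine (norm_add_le _ _).trans (add_le_add ?_ ?_)
  · refine (norm_integral_sub_le_of_coupling ha hb h0 (integrable_mForce hχ hε _ t z)
      (integrable_mForce hχ hε _ t w) (h := fun u => L * (q + min 1 (phaseDist (a 0 u) (b 0 u))))
      (((integrable_const q).add (integrable_initCost ha hb)).const_mul L) fun u => ?_).trans_eq ?_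
    · refine (norm_mForce_sub_le hχ hε ht z w _ _).trans (mul_le_mul_of_nonneg_left
        (add_le_add le_rfl (min_le_min le_rfl (norm_fst_le_phaseDist _ _))) hL)
    · rw [integral_const_mul, integral_add (integrable_const q) (integrable_initCost ha hb)]
      simp [initCost]
  · have hg : Continuous fun s => L * (q + meanPos π a b s) + L / 2 * p + L / 2 * meanMom π a b s := by
      fun_prop
    refine (intervalIntegral.norm_integral_le_of_norm_le ht.1 (Eventually.of_forall fun s hs => ?_)
      (hg.intervalIntegrable 0 t)).trans_eq ?_
    · have hsT : s ∈ Icc 0 T := ⟨hs.1.le, hs.2.trans ht.2⟩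
      have i1 := integrable_posGap ha hb s
      have i2 := integrable_momGap ha hb s
      refine (norm_integral_sub_le_of_coupling ha hb hsT (r1.integrable s) (r2.integrable s)
        (h := fun u => L * (q + posGap a b (s, u)) + L / 2 * p + L / 2 * momGap a b (s, u))
        (((((integrable_const q).add i1).const_mul L).add (integrable_const _)).add
          (i2.const_mul _)) fun u => norm_rForce_sub_le_split hχ hε hs.1.le hs.2 ht.2 z w _ _).trans_eq ?_
      have j1 : Integrable (fun u => L * (q + posGap a b (s, u))) π :=
        ((integrable_const q).add i1).const_mul L
      have j2 : Integrable (fun u => L * (q + posGap a b (s, u)) + L / 2 * p) π :=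
        j1.add (integrable_const _)
      rw [integral_add j2 (i2.const_mul _), integral_add j1 (integrable_const _),
        integral_const_mul, integral_const_mul, integral_add (integrable_const q) i1]
      simp [meanPos, meanMom, integral_const_mul]
    · have k1 : IntervalIntegrable (fun s => L * q + L / 2 * p) volume 0 t :=
        continuous_const.intervalIntegrable _ _
      have k2 : IntervalIntegrable (fun s => L * meanPos π a b s) volume 0 t :=
        (cX.const_mul L).intervalIntegrable _ _
      have k3 : IntervalIntegrable (fun s => L / 2 * meanMom π a b s) volume 0 t :=
        (cP.const_mul _).intervalIntegrable _ _
      have e : (fun s => L * (q + meanPos π a b s) + L / 2 * p + L / 2 * meanMom π a b s)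
          = fun s => (L * q + L / 2 * p) + L * meanPos π a b s + L / 2 * meanMom π a b s := by
        funext s
        ring
      rw [e, intervalIntegral.integral_add (k1.add k2) k3, intervalIntegral.integral_add k1 k2,
        intervalIntegral.integral_const, intervalIntegral.integral_const_mul,
        intervalIntegral.integral_const_mul]
      simp

end Gaps
end Stability
end RegVM

namespace RegVM
-- Growth in time of the mean distances.
section Growth

variable {χ : R3 → ℝ} {ε T : ℝ} {μ ν : ℝ → Measure Phase} {E B E' B' : ℝ → R3 → R3}
  {π : Measure (Phase × Phase)} [IsProbabilityMeasure π] {a b : ℝ → Phase × Phase → Phase}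

theorem hasDerivWithinAt_fst {α : ℝ → Phase} {v w : R3} {S : Set ℝ} {t : ℝ}
    (h : HasDerivWithinAt α (v, w) S t) : HasDerivWithinAt (fun s => (α s).1) v S t :=
  (ContinuousLinearMap.fst ℝ R3 R3).hasFDerivAt.comp_hasDerivWithinAt t h

theorem hasDerivWithinAt_snd {α : ℝ → Phase} {v w : R3} {S : Set ℝ} {t : ℝ}
    (h : HasDerivWithinAt α (v, w) S t) : HasDerivWithinAt (fun s => (α s).2) w S t :=
  (ContinuousLinearMap.snd ℝ R3 R3).hasFDerivAt.comp_hasDerivWithinAt t h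

/-- A comparison through one-sided derivatives, since the norm of a difference of trajectories is
not differentiable where they meet. -/
theorem norm_le_add_primitive {F F' : ℝ → R3} {g : ℝ → ℝ} (hg : Continuous g)
    (hd : ∀ s ∈ Icc 0 T, HasDerivWithinAt F (F' s) (Icc 0 T) s)
    (hle : ∀ s ∈ Icc 0 T, ‖F' s‖ ≤ g s) {t : ℝ} (ht : t ∈ Icc 0 T) :
    ‖F t‖ ≤ ‖F 0‖ + ∫ s in (0 : ℝ)..t, g s :=
  image_norm_le_of_norm_deriv_right_le_deriv_boundary (f' := F')
    (B := fun t => ‖F 0‖ + ∫ s in (0 : ℝ)..t, g s) (B' := g)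
    (fun s hs => (hd s hs).continuousWithinAt)
    (fun s hs => hasDerivWithinAt_Ici_of_Icc hs (hd s (Ico_subset_Icc_self hs))) (by simp)
    (fun s => (hasDerivAt_primitive hg s).const_add _)
    (fun s hs => hle s (Ico_subset_Icc_self hs)) ht

/-- The bound for the difference of the forces, as a function of the time and of the pair of
particles. -/
def forceGap (L : ℝ) (π : Measure (Phase × Phase)) (a b : ℝ → Phase × Phase → Phase)
    (u : Phase × Phase) (s : ℝ) : ℝ :=
  (L + L * s) * posGap a b (s, u) + L / 2 * s * momGap a b (s, u)
    + (L * initCost π a b + (L * (∫ r in (0 : ℝ)..s, meanPos π a b r)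
      + L / 2 * ∫ r in (0 : ℝ)..s, meanMom π a b r))

theorem continuous_forceGap {L : ℝ} (ha : IsMeanFieldTransport χ ε T μ E B π a)
    (hb : IsMeanFieldTransport χ ε T ν E' B' π b) (u : Phase × Phase) :
    Continuous (forceGap L π a b u) := by
  have c1 := continuous_primitive_zero (continuous_meanPos ha hb)
  have c2 := continuous_primitive_zero (continuous_meanMom ha hb)
  have c3 : Continuous fun s : ℝ => posGap a b (s, u) := (continuous_posGap ha hb).comp (by fun_prop)
  have c4 : Continuous fun s : ℝ => momGap a b (s, u) := (continuous_momGap ha hb).comp (by fun_prop)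
  unfold forceGap
  fun_prop

theorem norm_pos_sub_le (ha : IsMeanFieldTransport χ ε T μ E B π a)
    (hb : IsMeanFieldTransport χ ε T ν E' B' π b) {t : ℝ} (ht : t ∈ Icc 0 T) (u : Phase × Phase) :
    ‖(a t u).1 - (b t u).1‖
      ≤ ‖(a 0 u).1 - (b 0 u).1‖ + ∫ s in (0 : ℝ)..t, momGap a b (s, u) :=
  norm_le_add_primitive (F := fun s => (a s u).1 - (b s u).1)
    (F' := fun s => vel (a s u).2 - vel (b s u).2) (g := fun s => momGap a b (s, u))
    ((continuous_momGap ha hb).comp (by fun_prop))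
    (fun s hs => (hasDerivWithinAt_fst (ha.deriv u s hs)).sub (hasDerivWithinAt_fst (hb.deriv u s hs)))
    (fun s _ => norm_vel_sub_le_min _ _) ht

theorem norm_mom_sub_le (hχ : IsMollifier χ) (hε : 0 < ε)
    (ha : IsMeanFieldTransport χ ε T μ E B π a) (hb : IsMeanFieldTransport χ ε T ν E' B' π b)
    {t : ℝ} (ht : t ∈ Icc 0 T) (u : Phase × Phase) :
    ‖(a t u).2 - (b t u).2‖
      ≤ ‖(a 0 u).2 - (b 0 u).2‖ + ∫ s in (0 : ℝ)..t, forceGap (lipConst χ ε T) π a b u s :=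
  norm_le_add_primitive (F := fun s => (a s u).2 - (b s u).2)
    (F' := fun s => lorentz E B s (a s u) - lorentz E' B' s (b s u)) (continuous_forceGap ha hb u)
    (fun s hs => (hasDerivWithinAt_snd (ha.deriv u s hs)).sub (hasDerivWithinAt_snd (hb.deriv u s hs)))
    (fun s hs => (norm_lorentz_sub_le ha hb hχ hε hs _ _).trans_eq (by
      rw [forceGap, posGap, momGap]
      ring)) ht

theorem forceGap_nonneg {L : ℝ} (hL : 0 ≤ L) (u : Phase × Phase) {s : ℝ} (hs : 0 ≤ s) :
    0 ≤ forceGap L π a b u s := by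
  have h1 : 0 ≤ initCost π a b :=
    integral_nonneg fun _ => le_min zero_le_one (phaseDist_nonneg _ _)
  have h2 : 0 ≤ ∫ r in (0 : ℝ)..s, meanPos π a b r :=
    intervalIntegral.integral_nonneg hs fun _ _ => integral_nonneg fun _ => posGap_nonneg _
  have h3 : 0 ≤ ∫ r in (0 : ℝ)..s, meanMom π a b r :=
    intervalIntegral.integral_nonneg hs fun _ _ => integral_nonneg fun _ => momGap_nonneg _
  have h4 := posGap_nonneg (a := a) (b := b) (s, u)
  have h5 := momGap_nonneg (a := a) (b := b) (s, u)
  unfold forceGap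
  positivity

/-- Averaging over the pairs turns gaps into mean gaps. The retarded force contributes twice: the
position of the particle itself gives `L s X(s)`, the sources give `L ∫₀ˢ X`. By
`integral_mul_add_primitive` both together integrate to `L t ∫ X`; the momenta give `(L/2) t ∫ P` in
the same way. -/
theorem integral_forceGap {L : ℝ} (ha : IsMeanFieldTransport χ ε T μ E B π a)
    (hb : IsMeanFieldTransport χ ε T ν E' B' π b) {t : ℝ} (ht : 0 ≤ t) :
    Integrable (fun u => ∫ s in (0 : ℝ)..t, forceGap L π a b u s) π ∧
      ∫ u, (∫ s in (0 : ℝ)..t, forceGap L π a b u s) ∂π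
        = L * initCost π a b * t + L * (1 + t) * (∫ s in (0 : ℝ)..t, meanPos π a b s)
          + L / 2 * t * ∫ s in (0 : ℝ)..t, meanMom π a b s := by
  have cX := continuous_meanPos ha hb
  have cP := continuous_meanMom ha hb
  have c1 := continuous_primitive_zero cX
  have c2 := continuous_primitive_zero cP
  have w1 : Continuous fun s : ℝ => L + L * s := by fun_prop
  have w2 : Continuous fun s : ℝ => L / 2 * s := by fun_prop
  have w3 : Continuous fun s => L * initCost π a b + (L * (∫ r in (0 : ℝ)..s, meanPos π a b r)
      + L / 2 * ∫ r in (0 : ℝ)..s, meanMom π a b r) := by fun_prop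
  have c3 : ∀ u, Continuous fun s : ℝ => posGap a b (s, u) := fun u =>
    (continuous_posGap ha hb).comp (by fun_prop)
  have c4 : ∀ u, Continuous fun s : ℝ => momGap a b (s, u) := fun u =>
    (continuous_momGap ha hb).comp (by fun_prop)
  obtain ⟨i1, e1⟩ := integral_weighted_swap (π := π) (continuous_posGap ha hb) abs_posGap_le w1 ht
  obtain ⟨i2, e2⟩ := integral_weighted_swap (π := π) (continuous_momGap ha hb) abs_momGap_le w2 ht
  have e : ∀ u, ∫ s in (0 : ℝ)..t, forceGap L π a b u s
      = ((∫ s in (0 : ℝ)..t, (L + L * s) * posGap a b (s, u))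
        + ∫ s in (0 : ℝ)..t, L / 2 * s * momGap a b (s, u))
        + ∫ s in (0 : ℝ)..t, (L * initCost π a b + (L * (∫ r in (0 : ℝ)..s, meanPos π a b r)
      + L / 2 * ∫ r in (0 : ℝ)..s, meanMom π a b r)) := fun u => by
    have j1 : IntervalIntegrable (fun s => (L + L * s) * posGap a b (s, u)) volume 0 t :=
      (w1.mul (c3 u)).intervalIntegrable _ _
    have j2 : IntervalIntegrable (fun s => L / 2 * s * momGap a b (s, u)) volume 0 t :=
      (w2.mul (c4 u)).intervalIntegrable _ _
    rw [← intervalIntegral.integral_add j1 j2, ← intervalIntegral.integral_add (j1.add j2)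
      (w3.intervalIntegrable _ _)]
    rfl
  simp only [e]
  refine ⟨(i1.add i2).add (integrable_const _), ?_⟩
  have i12 : Integrable (fun u => (∫ s in (0 : ℝ)..t, (L + L * s) * posGap a b (s, u))
        + ∫ s in (0 : ℝ)..t, L / 2 * s * momGap a b (s, u)) π := i1.add i2
  rw [integral_add i12 (integrable_const _), integral_add i1 i2, e1, e2]
  have m1 := integral_mul_add_primitive cX t
  have m2 := integral_mul_add_primitive cP t
  have k1 : IntervalIntegrable (fun s => s * meanPos π a b s) volume 0 t :=
    (continuous_id.mul cX).intervalIntegrable _ _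
  have k2 : IntervalIntegrable (fun s => s * meanMom π a b s) volume 0 t :=
    (continuous_id.mul cP).intervalIntegrable _ _
  have k3 := c1.intervalIntegrable (μ := volume) 0 t
  have k4 := c2.intervalIntegrable (μ := volume) 0 t
  have k5 := cX.intervalIntegrable (μ := volume) 0 t
  rw [intervalIntegral.integral_add k1 k3] at m1
  rw [intervalIntegral.integral_add k2 k4] at m2
  have f1 : ∫ s in (0 : ℝ)..t, (L + L * s) * ∫ u, posGap a b (s, u) ∂π
      = L * (∫ s in (0 : ℝ)..t, meanPos π a b s) + L * ∫ s in (0 : ℝ)..t, s * meanPos π a b s := by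
    rw [← intervalIntegral.integral_const_mul, ← intervalIntegral.integral_const_mul,
      ← intervalIntegral.integral_add (k5.const_mul L) (k1.const_mul L)]
    refine intervalIntegral.integral_congr fun s _ => ?_
    simp only [meanPos]
    ring
  have f2 : ∫ s in (0 : ℝ)..t, L / 2 * s * ∫ u, momGap a b (s, u) ∂π
      = L / 2 * ∫ s in (0 : ℝ)..t, s * meanMom π a b s := by
    rw [← intervalIntegral.integral_const_mul]
    refine intervalIntegral.integral_congr fun s _ => ?_
    simp only [meanMom]
    ring
  rw [f1, f2, intervalIntegral.integral_add intervalIntegrable_const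
    ((k3.const_mul L).add (k4.const_mul (L / 2))), intervalIntegral.integral_add (k3.const_mul L)
    (k4.const_mul (L / 2)), intervalIntegral.integral_const, intervalIntegral.integral_const_mul L,
    intervalIntegral.integral_const_mul (L / 2), integral_const]
  simp only [probReal_univ, smul_eq_mul, one_mul, sub_zero]
  linear_combination L * m1 + L / 2 * m2

theorem integral_primitive_momGap (ha : IsMeanFieldTransport χ ε T μ E B π a)
    (hb : IsMeanFieldTransport χ ε T ν E' B' π b) {t : ℝ} (ht : 0 ≤ t) :
    Integrable (fun u => ∫ s in (0 : ℝ)..t, momGap a b (s, u)) π ∧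
      ∫ u, (∫ s in (0 : ℝ)..t, momGap a b (s, u)) ∂π = ∫ s in (0 : ℝ)..t, meanMom π a b s := by
  have := integral_weighted_swap (π := π) (continuous_momGap ha hb) abs_momGap_le
    (continuous_const (y := (1 : ℝ))) ht
  simp only [one_mul] at this
  exact this

theorem min_add_le_add {c x y : ℝ} (hy : 0 ≤ y) : min c (x + y) ≤ min c x + y := by
  rcases min_cases c x with h | h <;> rcases min_cases c (x + y) with h' | h' <;> linarith

theorem min_mul_le {c k x d : ℝ} (hd : 0 ≤ d) (hk : k ≤ c) (hx : x ≤ k * d) :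
    min c x ≤ c * min 1 d := by
  rcases min_cases 1 d with h | h <;> rw [h.1]
  · rw [mul_one]
    exact min_le_left _ _
  · exact (min_le_right _ _).trans (hx.trans (mul_le_mul_of_nonneg_right hk hd))

theorem meanPos_le_add (ha : IsMeanFieldTransport χ ε T μ E B π a)
    (hb : IsMeanFieldTransport χ ε T ν E' B' π b) {t : ℝ} (ht : t ∈ Icc 0 T) :
    meanPos π a b t ≤ initCost π a b + ∫ s in (0 : ℝ)..t, meanMom π a b s := by
  obtain ⟨i, e⟩ := integral_primitive_momGap ha hb ht.1
  have h0 := integrable_initCost ha hb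
  rw [← e, initCost, ← integral_add h0 i]
  refine integral_mono (integrable_posGap ha hb t) (h0.add i) fun u => ?_
  refine (min_le_min le_rfl (norm_pos_sub_le ha hb ht u)).trans ((min_add_le_add
    (intervalIntegral.integral_nonneg ht.1 fun s _ => momGap_nonneg _)).trans ?_)
  exact add_le_add (min_le_min le_rfl (norm_fst_le_phaseDist _ _)) le_rfl

/-- The truncation at `2`, natural because velocities differ by at most `2`, costs the factor `2` in
front of the initial cost, which is truncated at `1`. -/
theorem meanMom_le_add (hχ : IsMollifier χ) (hε : 0 < ε)
    (ha : IsMeanFieldTransport χ ε T μ E B π a) (hb : IsMeanFieldTransport χ ε T ν E' B' π b)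
    {t : ℝ} (ht : t ∈ Icc 0 T) :
    meanMom π a b t ≤ 2 * initCost π a b
      + ∫ u, (∫ s in (0 : ℝ)..t, forceGap (lipConst χ ε T) π a b u s) ∂π := by
  obtain ⟨i, -⟩ := integral_forceGap (L := lipConst χ ε T) ha hb ht.1
  have h0 := (integrable_initCost ha hb).const_mul 2
  rw [initCost, ← integral_const_mul, ← integral_add h0 i]
  refine integral_mono (integrable_momGap ha hb t) (h0.add i) fun u => ?_
  refine (min_le_min le_rfl (norm_mom_sub_le hχ hε ha hb ht u)).trans ((min_add_le_add
    (intervalIntegral.integral_nonneg ht.1 fun s hs =>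
      forceGap_nonneg (lipConst_nonneg _ _ _) u hs.1)).trans ?_)
  refine add_le_add (min_mul_le (k := 1) (phaseDist_nonneg _ _) one_le_two ?_) le_rfl
  rw [one_mul]
  exact norm_snd_le_phaseDist _ _

/-- A truncated weighted distance in phase space. -/
def weightedGap (a b : ℝ → Phase × Phase → Phase) (p : ℝ × (Phase × Phase)) : ℝ :=
  min 3 (3 / 2 * ‖(a p.1 p.2).1 - (b p.1 p.2).1‖ + ‖(a p.1 p.2).2 - (b p.1 p.2).2‖)

theorem weightedGap_nonneg (p) : 0 ≤ weightedGap a b p := le_min (by norm_num) (by positivity)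

theorem abs_weightedGap_le (p) : |weightedGap a b p| ≤ 3 := by
  rw [abs_of_nonneg (weightedGap_nonneg p)]
  exact min_le_left _ _

theorem continuous_weightedGap (ha : IsMeanFieldTransport χ ε T μ E B π a)
    (hb : IsMeanFieldTransport χ ε T ν E' B' π b) : Continuous (weightedGap a b) :=
  continuous_const.min (((ha.cont.fst.sub hb.cont.fst).norm.const_mul _).add
    (ha.cont.snd.sub hb.cont.snd).norm)

theorem integrable_weightedGap (ha : IsMeanFieldTransport χ ε T μ E B π a)
    (hb : IsMeanFieldTransport χ ε T ν E' B' π b) (t : ℝ) :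
    Integrable (fun u => weightedGap a b (t, u)) π :=
  integrable_of_continuous_of_le ((continuous_weightedGap ha hb).comp (by fun_prop))
    fun u => abs_weightedGap_le (t, u)

/-- The best constant is `√13 / 2`. That it is less than `3` keeps the truncated initial weighted
distance below `3` times the initial cost. -/
theorem weighted_norm_le_phaseDist (z w : Phase) :
    3 / 2 * ‖z.1 - w.1‖ + ‖z.2 - w.2‖ ≤ 2 * phaseDist z w := by
  have h := Real.sq_sqrt (show 0 ≤ ‖z.1 - w.1‖ ^ 2 + ‖z.2 - w.2‖ ^ 2 by positivity)
  have h0 := phaseDist_nonneg z w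
  rw [← phaseDist] at h
  refine abs_le_of_sq_le_sq' ?_ (by positivity) |>.2
  nlinarith [sq_nonneg (‖z.1 - w.1‖ - 3 / 2 * ‖z.2 - w.2‖), sq_nonneg ‖z.1 - w.1‖,
    sq_nonneg ‖z.2 - w.2‖]

theorem integral_weightedGap_le_add (hχ : IsMollifier χ) (hε : 0 < ε)
    (ha : IsMeanFieldTransport χ ε T μ E B π a) (hb : IsMeanFieldTransport χ ε T ν E' B' π b)
    {t : ℝ} (ht : t ∈ Icc 0 T) :
    ∫ u, weightedGap a b (t, u) ∂π ≤ 3 * initCost π a b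
      + 3 / 2 * (∫ s in (0 : ℝ)..t, meanMom π a b s)
      + ∫ u, (∫ s in (0 : ℝ)..t, forceGap (lipConst χ ε T) π a b u s) ∂π := by
  obtain ⟨i, -⟩ := integral_forceGap (L := lipConst χ ε T) ha hb ht.1
  obtain ⟨i', e⟩ := integral_primitive_momGap ha hb ht.1
  have h0 := (integrable_initCost ha hb).const_mul 3
  have h1 := i'.const_mul (3 / 2)
  have h01 : Integrable (fun u => 3 * min 1 (phaseDist (a 0 u) (b 0 u))
    + 3 / 2 * ∫ s in (0 : ℝ)..t, momGap a b (s, u)) π := h0.add h1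
  rw [initCost, ← e, ← integral_const_mul, ← integral_const_mul, ← integral_add h0 h1,
    ← integral_add h01 i]
  refine integral_mono (integrable_weightedGap ha hb t) (h01.add i) fun u => ?_
  have g1 := norm_pos_sub_le ha hb ht u
  have g2 := norm_mom_sub_le hχ hε ha hb ht u
  have n1 : 0 ≤ ∫ s in (0 : ℝ)..t, momGap a b (s, u) :=
    intervalIntegral.integral_nonneg ht.1 fun s _ => momGap_nonneg _
  have n2 : 0 ≤ ∫ s in (0 : ℝ)..t, forceGap (lipConst χ ε T) π a b u s :=
    intervalIntegral.integral_nonneg ht.1 fun s hs => forceGap_nonneg (lipConst_nonneg _ _ _) u hs.1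
  have g3 : 3 / 2 * ‖(a t u).1 - (b t u).1‖ + ‖(a t u).2 - (b t u).2‖
      ≤ (3 / 2 * ‖(a 0 u).1 - (b 0 u).1‖ + ‖(a 0 u).2 - (b 0 u).2‖)
        + (3 / 2 * (∫ s in (0 : ℝ)..t, momGap a b (s, u))
          + ∫ s in (0 : ℝ)..t, forceGap (lipConst χ ε T) π a b u s) := by linarith
  refine (min_le_min le_rfl g3).trans ((min_add_le_add (by positivity)).trans ?_)
  have g4 := min_mul_le (c := 3) (k := 2) (phaseDist_nonneg _ _) (by norm_num)
    (weighted_norm_le_phaseDist (a 0 u) (b 0 u))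
  linarith

/-- The mean distances of the trajectories are controlled by the initial transport cost. -/
theorem meanPos_and_meanMom_le (hχ : IsMollifier χ) (hε : 0 < ε)
    (ha : IsMeanFieldTransport χ ε T μ E B π a) (hb : IsMeanFieldTransport χ ε T ν E' B' π b)
    {t : ℝ} (ht : t ∈ Icc 0 T) :
    meanPos π a b t ≤ initCost π a b * posBound (lipConst χ ε T) t ∧
      meanMom π a b t ≤ initCost π a b * momBound (lipConst χ ε T) t := by
  have hT : 0 ≤ T := ht.1.trans ht.2
  have hL := two_le_lipConst hχ hε hT
  set L := lipConst χ ε T with hLdef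
  set D := initCost π a b
  have hD : 0 ≤ D := integral_nonneg fun _ => le_min zero_le_one (phaseDist_nonneg _ _)
  have cX := continuous_meanPos ha hb
  have cP := continuous_meanMom ha hb
  have iXb : ∀ t, ∫ s in (0 : ℝ)..t, (meanPos π a b s - D * posBound L s)
      = (∫ s in (0 : ℝ)..t, meanPos π a b s) - D * ∫ s in (0 : ℝ)..t, posBound L s := fun t => by
    rw [intervalIntegral.integral_sub (cX.intervalIntegrable _ _)
      ((continuous_posBound.intervalIntegrable _ _).const_mul D), intervalIntegral.integral_const_mul]
  have iPb : ∀ t, ∫ s in (0 : ℝ)..t, (meanMom π a b s - D * momBound L s)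
      = (∫ s in (0 : ℝ)..t, meanMom π a b s) - D * ∫ s in (0 : ℝ)..t, momBound L s := fun t => by
    rw [intervalIntegral.integral_sub (cP.intervalIntegrable _ _)
      ((continuous_momBound.intervalIntegrable _ _).const_mul D), intervalIntegral.integral_const_mul]
  -- The mean distances satisfy the Volterra inequalities, and `D` times the bounds satisfy the
  -- opposite ones with the same coefficients, so the differences form a subsolution with zero data.
  have := volterra_nonpos (u := fun t => meanPos π a b t - D * posBound L t)
    (v := fun t => meanMom π a b t - D * momBound L t) (a := fun t => L * (1 + t))
    (b := fun t => L / 2 * t) (K := L * (1 + T)) (T := T) (cX.sub (continuous_posBound.const_mul D))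
    (cP.sub (continuous_momBound.const_mul D)) (by positivity)
    (fun t ht => ⟨by nlinarith [ht.1], by nlinarith [ht.2]⟩)
    (fun t ht => ⟨by nlinarith [ht.1], by nlinarith [ht.2, ht.1]⟩)
    (fun t ht => by
      rw [iPb, integral_momBound]
      have := meanPos_le_add ha hb ht
      linarith)
    (fun t ht => by
      rw [iPb, iXb]
      have h1 := meanMom_le_add hχ hε ha hb ht
      rw [(integral_forceGap ha hb ht.1).2, ← hLdef] at h1
      have h2 := mul_le_mul_of_nonneg_left (momBound_supersolution hL ht.1) hD
      linarith) ht
  constructor <;> linarith [this.1, this.2]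

theorem meanPos_le (hχ : IsMollifier χ) (hε : 0 < ε)
    (ha : IsMeanFieldTransport χ ε T μ E B π a) (hb : IsMeanFieldTransport χ ε T ν E' B' π b)
    {t : ℝ} (ht : t ∈ Icc 0 T) : meanPos π a b t ≤ constC χ ε T * initCost π a b := by
  have hD : 0 ≤ initCost π a b := integral_nonneg fun _ => le_min zero_le_one (phaseDist_nonneg _ _)
  refine (meanPos_and_meanMom_le hχ hε ha hb ht).1.trans ?_
  rw [mul_comm]
  exact mul_le_mul_of_nonneg_right
    (posBound_le (two_le_lipConst hχ hε (ht.1.trans ht.2)) ht) hD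

/-- In units of the initial cost, the right side of `integral_weightedGap_le_add` is at most `3 +
(3/2)(posBound - 1) + (momBound - 2)`, where the supersolution inequality bounds the last part. This
is `momBound + (3/2) posBound - 1/2`, hence at most `4 C(T, ε)`. -/
theorem integral_weightedGap_le (hχ : IsMollifier χ) (hε : 0 < ε)
    (ha : IsMeanFieldTransport χ ε T μ E B π a) (hb : IsMeanFieldTransport χ ε T ν E' B' π b)
    {t : ℝ} (ht : t ∈ Icc 0 T) :
    ∫ u, weightedGap a b (t, u) ∂π ≤ 4 * constC χ ε T * initCost π a b := by
  have hT : 0 ≤ T := ht.1.trans ht.2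
  have hL := two_le_lipConst hχ hε hT
  have hD : 0 ≤ initCost π a b := integral_nonneg fun _ => le_min zero_le_one (phaseDist_nonneg _ _)
  have h1 := integral_weightedGap_le_add hχ hε ha hb ht
  rw [(integral_forceGap ha hb ht.1).2] at h1
  have cX := continuous_meanPos ha hb
  have cP := continuous_meanMom ha hb
  have hB : ∀ s ∈ Icc 0 t, s ∈ Icc 0 T := fun s hs => ⟨hs.1, hs.2.trans ht.2⟩
  have h2 : ∫ s in (0 : ℝ)..t, meanPos π a b s
      ≤ initCost π a b * ∫ s in (0 : ℝ)..t, posBound (lipConst χ ε T) s := by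
    rw [← intervalIntegral.integral_const_mul]
    exact intervalIntegral.integral_mono_on ht.1 (cX.intervalIntegrable _ _)
      ((continuous_posBound.intervalIntegrable _ _).const_mul _)
      fun s hs => (meanPos_and_meanMom_le hχ hε ha hb (hB s hs)).1
  have h3 : ∫ s in (0 : ℝ)..t, meanMom π a b s
      ≤ initCost π a b * ∫ s in (0 : ℝ)..t, momBound (lipConst χ ε T) s := by
    rw [← intervalIntegral.integral_const_mul]
    exact intervalIntegral.integral_mono_on ht.1 (cP.intervalIntegrable _ _)
      ((continuous_momBound.intervalIntegrable _ _).const_mul _)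
      fun s hs => (meanPos_and_meanMom_le hχ hε ha hb (hB s hs)).2
  have h4 := mul_le_mul_of_nonneg_left (momBound_supersolution hL ht.1) hD
  have h5 := mul_le_mul_of_nonneg_left (momBound_add_le hL ht) hD
  have h6 := integral_momBound (L := lipConst χ ε T) t
  have h7 : 0 ≤ lipConst χ ε T * (1 + t) := mul_nonneg (by linarith) (by linarith [ht.1])
  have h8 : 0 ≤ lipConst χ ε T / 2 * t := mul_nonneg (by linarith) ht.1
  have h9 := mul_le_mul_of_nonneg_left h2 h7
  have h10 := mul_le_mul_of_nonneg_left h3 h8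
  rw [h6] at h3
  rw [constC]
  linarith

end Growth
end RegVM

namespace RegVM
-- Estimates for charges, currents and fields in terms of a coupling.
section Estimates

variable {χ : R3 → ℝ} {ε T : ℝ} {μ ν : ℝ → Measure Phase} {E B E' B' : ℝ → R3 → R3}
  {π : Measure (Phase × Phase)} [IsProbabilityMeasure π] {a b : ℝ → Phase × Phase → Phase}

theorem initCost_nonneg : 0 ≤ initCost π a b :=
  integral_nonneg fun _ => le_min zero_le_one (phaseDist_nonneg _ _)

theorem constC_nonneg (hT : 0 ≤ T) : 0 ≤ constC χ ε T :=
  mul_nonneg (add_nonneg zero_le_one (mul_nonneg hT (lipConst_nonneg _ _ _))) (Real.exp_pos _).le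

/-- The joint law of the two positions at time `t` is a coupling of the charge densities, and its
cost is `meanPos`. -/
theorem mkr_charge_le (hχ : IsMollifier χ) (hε : 0 < ε)
    (ha : IsMeanFieldTransport χ ε T μ E B π a) (hb : IsMeanFieldTransport χ ε T ν E' B' π b)
    {t : ℝ} (ht : t ∈ Icc 0 T) :
    mkr dist (charge (μ t)) (charge (ν t)) ≤ ENNReal.ofReal (constC χ ε T * initCost π a b) := by
  obtain ⟨ma, mb⟩ := measurable_slices ha hb t
  have mg : Measurable fun u => ((a t u).1, (b t u).1) := ma.fst.prodMk mb.fst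
  have h1 : (π.map fun u => ((a t u).1, (b t u).1)).fst = charge (μ t) := by
    rw [Measure.fst, Measure.map_map measurable_fst mg, charge, ha.push t ht, Measure.fst,
      Measure.map_map measurable_fst ma]
    rfl
  have h2 : (π.map fun u => ((a t u).1, (b t u).1)).snd = charge (ν t) := by
    rw [Measure.snd, Measure.map_map measurable_snd mg, charge, hb.push t ht, Measure.fst,
      Measure.map_map measurable_fst mb]
    rfl
  refine (iInf₂_le (π.map fun u => ((a t u).1, (b t u).1)) ⟨h1, h2⟩).trans ?_
  rw [lintegral_map (by fun_prop) mg]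
  refine le_of_eq_of_le ?_ (ENNReal.ofReal_le_ofReal (meanPos_le hχ hε ha hb ht))
  rw [meanPos, ofReal_integral_eq_lintegral_ofReal (integrable_posGap ha hb t)
    (Eventually.of_forall fun u => posGap_nonneg _)]
  simp only [posGap, dist_eq_norm]

theorem le_weightedGap {n c t : ℝ} {u : Phase × Phase} (hn : 0 ≤ n) (h1 : c ≤ 3 * n)
    (h2 : c ≤ n * (3 / 2 * ‖(a t u).1 - (b t u).1‖) + n * ‖(a t u).2 - (b t u).2‖) :
    c ≤ n * weightedGap a b (t, u) := by
  rw [weightedGap, mul_min_of_nonneg _ _ hn]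
  exact le_min (by linarith) (by rw [mul_add]; exact h2)

/-- The integrand `ψ · v` is bounded by `1` and changes by at most `|x - x'| + |ξ - ξ'|`; both
bounds together are dominated by `weightedGap`. -/
theorem currentNegNorm_le (hχ : IsMollifier χ) (hε : 0 < ε)
    (ha : IsMeanFieldTransport χ ε T μ E B π a) (hb : IsMeanFieldTransport χ ε T ν E' B' π b)
    {t : ℝ} (ht : t ∈ Icc 0 T) :
    currentNegNorm (μ t) (ν t) ≤ ENNReal.ofReal (4 * constC χ ε T * initCost π a b) := by
  have := ha.weak.finite
  have := hb.weak.finite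
  refine iSup₂_le fun ψ hψ => ENNReal.ofReal_le_ofReal ?_
  obtain ⟨hψ1, hψ2⟩ := hψ
  have hc : Continuous fun z : Phase => (inner ℝ (ψ z.1) (vel z.2) : ℝ) :=
    (hψ2.continuous.comp continuous_fst).inner (continuous_vel.comp continuous_snd)
  have hle : ∀ z : Phase, ‖(inner ℝ (ψ z.1) (vel z.2) : ℝ)‖ ≤ 1 := fun z =>
    (norm_inner_le_norm _ _).trans (mul_le_one₀ (hψ1 _) (norm_nonneg _) (norm_vel_le _))
  refine le_trans ?_ (integral_weightedGap_le hχ hε ha hb ht)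
  refine norm_integral_sub_le_of_coupling ha hb ht (integrable_of_continuous_of_le hc hle)
    (integrable_of_continuous_of_le hc hle) (integrable_weightedGap ha hb t) fun u => ?_
  rw [← one_mul (weightedGap a b (t, u))]
  refine le_weightedGap zero_le_one ((norm_sub_le _ _).trans (by linarith [hle (a t u), hle (b t u)])) ?_
  have e : (inner ℝ (ψ (a t u).1) (vel (a t u).2) - inner ℝ (ψ (b t u).1) (vel (b t u).2) : ℝ)
      = inner ℝ (ψ (a t u).1 - ψ (b t u).1) (vel (a t u).2)
        + inner ℝ (ψ (b t u).1) (vel (a t u).2 - vel (b t u).2) := by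
    rw [inner_sub_left, inner_sub_right]
    ring
  have h1 : ‖ψ (a t u).1 - ψ (b t u).1‖ ≤ ‖(a t u).1 - (b t u).1‖ := by
    simpa [dist_eq_norm] using hψ2.dist_le_mul (a t u).1 (b t u).1
  have h2 := norm_vel_sub_le (a t u).2 (b t u).2
  have h3 : ‖(inner ℝ (ψ (a t u).1 - ψ (b t u).1) (vel (a t u).2) : ℝ)‖ ≤ ‖(a t u).1 - (b t u).1‖ :=
    (norm_inner_le_norm _ _).trans ((mul_le_of_le_one_right (norm_nonneg _) (norm_vel_le _)).trans h1)
  have h4 : ‖(inner ℝ (ψ (b t u).1) (vel (a t u).2 - vel (b t u).2) : ℝ)‖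
      ≤ ‖(a t u).2 - (b t u).2‖ :=
    (norm_inner_le_norm _ _).trans ((mul_le_of_le_one_left (norm_nonneg _) (hψ1 _)).trans h2)
  rw [e]
  have h5 := norm_add_le (inner ℝ (ψ (a t u).1 - ψ (b t u).1) (vel (a t u).2) : ℝ)
    (inner ℝ (ψ (b t u).1) (vel (a t u).2 - vel (b t u).2))
  linarith [norm_nonneg ((a t u).1 - (b t u).1)]

/-- The difference of retarded integrals with a kernel controlled by the weighted distance. -/
theorem norm_retarded_sub_le (hχ : IsMollifier χ) (hε : 0 < ε)
    (ha : IsMeanFieldTransport χ ε T μ E B π a) (hb : IsMeanFieldTransport χ ε T ν E' B' π b)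
    {t : ℝ} (ht : t ∈ Icc 0 T) {F : ℝ → Phase → R3} (hF : AverageContinuous μ F)
    (hF' : AverageContinuous ν F) {n : ℝ} (hn : 0 ≤ n)
    (hle : ∀ s ∈ Ioc 0 t, ∀ u, ‖F s (a s u) - F s (b s u)‖ ≤ n * weightedGap a b (s, u)) :
    ‖(∫ s in (0 : ℝ)..t, ∫ ζ, F s ζ ∂μ s) - ∫ s in (0 : ℝ)..t, ∫ ζ, F s ζ ∂ν s‖
      ≤ 4 * T * constC χ ε T * n * initCost π a b := by
  have hC := constC_nonneg (χ := χ) (ε := ε) (ht.1.trans ht.2)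
  have hD := initCost_nonneg (π := π) (a := a) (b := b)
  rw [← intervalIntegral.integral_sub (hF.intervalIntegrable 0 t) (hF'.intervalIntegrable 0 t)]
  refine (norm_intervalIntegral_le_const (C := n * (4 * constC χ ε T * initCost π a b)) ht
    (by positivity) fun s hs => ?_).trans_eq (by ring)
  have hsT : s ∈ Icc 0 T := ⟨hs.1.le, hs.2.trans ht.2⟩
  refine (norm_integral_sub_le_of_coupling ha hb hsT (hF.integrable s) (hF'.integrable s)
    ((integrable_weightedGap ha hb s).const_mul n) (hle s hs)).trans ?_
  rw [integral_const_mul]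
  exact mul_le_mul_of_nonneg_left (integral_weightedGap_le hχ hε ha hb hsT) hn

theorem norm_magnetic_sub_le (hχ : IsMollifier χ) (hε : 0 < ε)
    (ha : IsMeanFieldTransport χ ε T μ E B π a) (hb : IsMeanFieldTransport χ ε T ν E' B' π b)
    {t : ℝ} (ht : t ∈ Icc 0 T) (x : R3) :
    ‖B t x - B' t x‖ ≤ constC' χ ε T * initCost π a b := by
  rw [magnetic_eq hχ hε ha.weak ha.field ht.1, magnetic_eq hχ hε hb.weak hb.field ht.1]
  refine norm_retarded_sub_le hχ hε ha hb ht (averageContinuous_cross hχ hε ha.weak t x)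
    (averageContinuous_cross hχ hε hb.weak t x) (normLW_nonneg _) fun s hs u => ?_
  have hk := boundedKernel_gradY hχ hε
  have hts : t - s ∈ Icc 0 T := ⟨by linarith [hs.2], by linarith [hs.1, ht.2]⟩
  have h1 := hk.norm_le hts (x - (a s u).1)
  have h2 := hk.norm_le hts (x - (b s u).1)
  have h3 := hk.norm_sub_le hts (x - (a s u).1) (x - (b s u).1)
  have hn := normLW_nonneg (T := T) (gradY χ ε)
  rw [sub_sub_sub_cancel_left, norm_sub_rev (b s u).1] at h3
  have hv := norm_vel_sub_le (a s u).2 (b s u).2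
  refine le_weightedGap hn ((norm_sub_le _ _).trans ?_) ((norm_cross_sub_cross_le _ _ _ _).trans ?_)
  · have c1 := norm_cross_le (gradY χ ε (t - s) (x - (a s u).1)) (vel (a s u).2)
    have c2 := norm_cross_le (gradY χ ε (t - s) (x - (b s u).1)) (vel (b s u).2)
    have c3 := c1.trans (mul_le_of_le_one_right (norm_nonneg _) (norm_vel_le _))
    have c4 := c2.trans (mul_le_of_le_one_right (norm_nonneg _) (norm_vel_le _))
    linarith
  · refine add_le_add ((mul_le_of_le_one_right (norm_nonneg _) (norm_vel_le _)).trans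
      (h3.trans (mul_le_mul_of_nonneg_left ?_ hn))) (mul_le_mul h2 hv (norm_nonneg _) hn)
    linarith [norm_nonneg ((a s u).1 - (b s u).1)]

/-- The constant `3 / 2` stands for `√2`. It explains the weight of the positions in `weightedGap`,
and its truncation at `3`: the electric kernel `∇Y + ∂_tY v` has norm at most `3 / 2` times that of
`∇_{t,x}Y`, hence oscillates by at most `3` times it. -/
theorem norm_add_abs_le (d : ℝ) (g : R3) :
    ‖g‖ + |d| ≤ 3 / 2 * ‖(WithLp.toLp 2 (d, g) : WithLp 2 (ℝ × R3))‖ := by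
  have h : ‖(WithLp.toLp 2 (d, g) : WithLp 2 (ℝ × R3))‖ ^ 2 = d ^ 2 + ‖g‖ ^ 2 := by
    rw [WithLp.prod_norm_sq_eq_of_L2, ← sq_abs d]
    rfl
  refine (abs_le_of_sq_le_sq' ?_ (by positivity)).2
  rw [mul_pow, h]
  nlinarith [sq_nonneg (‖g‖ - |d|), sq_abs d, sq_nonneg ‖g‖, sq_nonneg d]

theorem norm_electric_kernel_sub_le (hχ : IsMollifier χ) (hε : 0 < ε) {τ : ℝ} (hτ : τ ∈ Icc 0 T)
    (x y ξ η : R3) :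
    ‖(gradY χ ε τ x + dtY χ ε τ x • vel ξ) - (gradY χ ε τ y + dtY χ ε τ y • vel η)‖
      ≤ 3 * normLW T (gradtxY χ ε) ∧
    ‖(gradY χ ε τ x + dtY χ ε τ x • vel ξ) - (gradY χ ε τ y + dtY χ ε τ y • vel η)‖
      ≤ normLW T (gradtxY χ ε) * (3 / 2 * ‖x - y‖) + normLW T (gradtxY χ ε) * ‖ξ - η‖ := by
  have hk := boundedKernel_gradtxY hχ hε
  have hn := normLW_nonneg (T := T) (gradtxY χ ε)
  have hs : ∀ x ξ, ‖gradY χ ε τ x + dtY χ ε τ x • vel ξ‖ ≤ ‖gradY χ ε τ x‖ + |dtY χ ε τ x| := by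
    intro x ξ
    refine (norm_add_le _ _).trans (add_le_add le_rfl ?_)
    rw [norm_smul, Real.norm_eq_abs]
    exact mul_le_of_le_one_right (abs_nonneg _) (norm_vel_le _)
  have hb : ∀ x, ‖gradY χ ε τ x‖ + |dtY χ ε τ x| ≤ 3 / 2 * normLW T (gradtxY χ ε) := fun x =>
    (norm_add_abs_le _ _).trans (mul_le_mul_of_nonneg_left (hk.norm_le hτ x) (by norm_num))
  constructor
  · refine (norm_sub_le _ _).trans ?_
    linarith [hs x ξ, hs y η, hb x, hb y]
  · have h1 := hk.norm_sub_le hτ x y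
    have h2 := norm_add_abs_le (dtY χ ε τ x - dtY χ ε τ y) (gradY χ ε τ x - gradY χ ε τ y)
    have e : (WithLp.toLp 2 (dtY χ ε τ x - dtY χ ε τ y, gradY χ ε τ x - gradY χ ε τ y)
        : WithLp 2 (ℝ × R3)) = gradtxY χ ε τ x - gradtxY χ ε τ y := rfl
    rw [e] at h2
    have h3 := norm_smul_sub_smul_le (d := dtY χ ε τ x) (d' := dtY χ ε τ y) (v' := vel η)
      (norm_vel_le ξ)
    have h4 : |dtY χ ε τ y| ≤ normLW T (gradtxY χ ε) := by
      refine le_trans ?_ (hk.norm_le hτ y)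
      exact WithLp.norm_fst_le (p := 2) _ (gradtxY χ ε τ y)
    have h5 := mul_le_mul h4 (norm_vel_sub_le ξ η) (norm_nonneg _) hn
    rw [add_sub_add_comm]
    have h6 := norm_add_le (gradY χ ε τ x - gradY χ ε τ y) (dtY χ ε τ x • vel ξ - dtY χ ε τ y • vel η)
    linarith

/-- The two summands of `C''` are the retarded part, treated like the magnetic field, and the
initial field. The latter involves only the initial states, so it is estimated by the initial cost
itself, without any growth in time. -/
theorem norm_electric_sub_le (hχ : IsMollifier χ) (hε : 0 < ε)
    (ha : IsMeanFieldTransport χ ε T μ E B π a) (hb : IsMeanFieldTransport χ ε T ν E' B' π b)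
    {t : ℝ} (ht : t ∈ Icc 0 T) (x : R3) :
    ‖E t x - E' t x‖ ≤ constC'' χ ε T * initCost π a b := by
  have := ha.weak.finite
  have := hb.weak.finite
  have h0 : (0 : ℝ) ∈ Icc 0 T := ⟨le_rfl, ht.1.trans ht.2⟩
  have hn := normLW_nonneg (T := T) (gradtxY χ ε)
  rw [electric_eq hχ hε ha.weak ha.field ht.1, electric_eq hχ hε hb.weak hb.field ht.1,
    sub_sub_sub_comm, neg_sub_neg]
  refine (norm_sub_le _ _).trans ?_
  rw [constC'', add_mul, add_comm]
  refine add_le_add ?_ ?_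
  · refine norm_retarded_sub_le hχ hε ha hb ht
      ((averageContinuous_gradY hχ hε ha.weak t x).add (averageContinuous_dtY hχ hε ha.weak t x))
      ((averageContinuous_gradY hχ hε hb.weak t x).add (averageContinuous_dtY hχ hε hb.weak t x))
      hn fun s hs u => ?_
    have hts : t - s ∈ Icc 0 T := ⟨by linarith [hs.2], by linarith [hs.1, ht.2]⟩
    obtain ⟨h1, h2⟩ := norm_electric_kernel_sub_le hχ hε hts (x - (a s u).1) (x - (b s u).1)
      (a s u).2 (b s u).2
    rw [sub_sub_sub_cancel_left, norm_sub_rev (b s u).1] at h2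
    exact le_weightedGap hn h1 h2
  · rw [norm_sub_rev]
    refine (norm_integral_sub_le_of_coupling ha hb h0 (integrable_gradDtYG hχ hε _ t x)
      (integrable_gradDtYG hχ hε _ t x) ((integrable_initCost ha hb).const_mul
        (2 * normLW T (gradDtYG χ ε))) fun u => ?_).trans_eq (integral_const_mul _ _)
    have := (boundedKernel_gradDtYG hχ hε).norm_sub_le_min ht (x, 0) (x, 0) (a 0 u) (b 0 u)
    rwa [phaseDist_self, min_eq_right zero_le_one, zero_add] at this

end Estimates

/-! ### From all couplings to the transport distance. -/

section OptimalTransport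

/-- A constant factor can be taken out of an infimum in `ℝ≥0∞` only if the infimum is not over the
empty set or the constant is positive; hence the existence of a coupling is required. -/
theorem le_mul_mkr {X : Type} [MeasurableSpace X] {d : X → X → ℝ} {μ ν : Measure X}
    (hne : ∃ π : Measure (X × X), π.fst = μ ∧ π.snd = ν) {c : ℝ} {q : ℝ≥0∞}
    (h : ∀ π : Measure (X × X), π.fst = μ → π.snd = ν →
      q ≤ ENNReal.ofReal c * ∫⁻ p, ENNReal.ofReal (min 1 (d p.1 p.2)) ∂π) :
    q ≤ ENNReal.ofReal c * mkr d μ ν := by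
  obtain ⟨π₀, h₀⟩ := hne
  rw [mkr, iInf_subtype', ENNReal.mul_iInf' (fun h => absurd h ENNReal.ofReal_ne_top)
    fun _ => ⟨⟨π₀, h₀⟩⟩]
  exact le_iInf fun π => h π.1 π.2.1 π.2.2

theorem exists_coupling {X : Type} [MeasurableSpace X] (μ ν : Measure X) [IsProbabilityMeasure μ]
    [IsProbabilityMeasure ν] : ∃ π : Measure (X × X), π.fst = μ ∧ π.snd = ν :=
  ⟨μ.prod ν, by simp, by simp⟩

variable {χ : R3 → ℝ} {ε T : ℝ} {μ ν : ℝ → Measure Phase} {E B E' B' : ℝ → R3 → R3}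
  {π : Measure (Phase × Phase)} {Z Z' : ℝ → Phase → Phase}

theorem isMeanFieldTransport_fst (hw : WeaklyContinuous μ) (hf : IsFieldOf χ ε μ E B)
    (hZ : IsCharacteristicFlow E B T Z) (hp : ∀ t ∈ Icc 0 T, μ t = (μ 0).map (Z t))
    (hπ : π.fst = μ 0) : IsMeanFieldTransport χ ε T μ E B π fun t u => Z t u.1 where
  weak := hw
  field := hf
  cont := hZ.cont.comp (by fun_prop : Continuous fun p : ℝ × (Phase × Phase) => (p.1, p.2.1))
  deriv u t ht := hZ.deriv u.1 t ht
  push t ht := by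
    have hc : Continuous (Z t) := hZ.cont.comp (by fun_prop : Continuous fun z : Phase => (t, z))
    rw [hp t ht, ← hπ, Measure.fst, Measure.map_map hc.measurable measurable_fst]
    rfl

theorem isMeanFieldTransport_snd (hw : WeaklyContinuous μ) (hf : IsFieldOf χ ε μ E B)
    (hZ : IsCharacteristicFlow E B T Z) (hp : ∀ t ∈ Icc 0 T, μ t = (μ 0).map (Z t))
    (hπ : π.snd = μ 0) : IsMeanFieldTransport χ ε T μ E B π fun t u => Z t u.2 where
  weak := hw
  field := hf
  cont := hZ.cont.comp (by fun_prop : Continuous fun p : ℝ × (Phase × Phase) => (p.1, p.2.2))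
  deriv u t ht := hZ.deriv u.2 t ht
  push t ht := by
    have hc : Continuous (Z t) := hZ.cont.comp (by fun_prop : Continuous fun z : Phase => (t, z))
    rw [hp t ht, ← hπ, Measure.snd, Measure.map_map hc.measurable measurable_snd]
    rfl

theorem ofReal_initCost [IsProbabilityMeasure π] (hZ : ∀ z, Z 0 z = z) (hZ' : ∀ z, Z' 0 z = z) :
    ENNReal.ofReal (initCost π (fun t u => Z t u.1) fun t u => Z' t u.2)
      = ∫⁻ p, ENNReal.ofReal (min 1 (phaseDist p.1 p.2)) ∂π := by
  have hc : Continuous fun p : Phase × Phase => min 1 (phaseDist p.1 p.2) := by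
    unfold phaseDist
    fun_prop
  simp only [initCost, hZ, hZ']
  refine ofReal_integral_eq_lintegral_ofReal (integrable_of_continuous_of_le (C := 1) hc fun p => ?_)
    (Eventually.of_forall fun p => le_min zero_le_one (phaseDist_nonneg _ _))
  rw [Real.norm_of_nonneg (le_min zero_le_one (phaseDist_nonneg _ _))]
  exact min_le_left _ _

/-- Two mean-field solutions, each given with the flow of its characteristics. -/
structure IsMeanFieldSolution (χ : R3 → ℝ) (ε T : ℝ) (μ : ℝ → Measure Phase)
    (E B : ℝ → R3 → R3) (Z : ℝ → Phase → Phase) : Prop where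
  weak : WeaklyContinuous μ
  field : IsFieldOf χ ε μ E B
  flow : IsCharacteristicFlow E B T Z
  push : ∀ t ∈ Icc 0 T, μ t = (μ 0).map (Z t)
  prob : IsProbabilityMeasure (μ 0)

/-- An estimate in terms of the cost of every coupling of the initial data is an estimate in terms
of their distance. -/
theorem IsMeanFieldSolution.le_mul_mkr (hμ : IsMeanFieldSolution χ ε T μ E B Z)
    (hν : IsMeanFieldSolution χ ε T ν E' B' Z') {c : ℝ} (hc : 0 ≤ c) {q : ℝ≥0∞}
    (h : ∀ (π : Measure (Phase × Phase)) (a b : ℝ → Phase × Phase → Phase),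
      IsProbabilityMeasure π → IsMeanFieldTransport χ ε T μ E B π a →
      IsMeanFieldTransport χ ε T ν E' B' π b → q ≤ ENNReal.ofReal (c * initCost π a b)) :
    q ≤ ENNReal.ofReal c * mkr phaseDist (μ 0) (ν 0) := by
  have := hμ.prob
  have := hν.prob
  refine RegVM.le_mul_mkr (exists_coupling _ _) fun π h1 h2 => ?_
  have hπ : IsProbabilityMeasure π := ⟨by rw [← Measure.fst_univ, h1]; exact measure_univ⟩
  rw [← ofReal_initCost hμ.flow.zero hν.flow.zero, ← ENNReal.ofReal_mul hc]
  exact h π _ _ hπ (isMeanFieldTransport_fst hμ.weak hμ.field hμ.flow hμ.push h1)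
    (isMeanFieldTransport_snd hν.weak hν.field hν.flow hν.push h2)

end OptimalTransport
end RegVM

namespace RegVM
-- A coupling adapted to a finite partition.
section PartitionCoupling

variable {X κ : Type} [MeasurableSpace X] [Fintype κ] {μ ν : Measure X} {A : κ → Set X}

/-- The marginal computation: matched mass `m k` plus the residual, normalized by its total mass,
restores `p k`. If nothing is left over, the normalizing factor is `∞`, but it multiplies `0`. -/
theorem sum_residual_add {m p q : κ → ℝ≥0∞} (hm : ∀ k, m k ≤ p k) (hp : ∑ k, p k ≠ ⊤) :
    ∑ k, m k * q k + (∑ k, (p k - m k))⁻¹ * ((∑ k, (p k - m k)) * ∑ k, (p k - m k) * q k)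
      = ∑ k, p k * q k := by
  have hr : ∑ k, (p k - m k) ≠ ⊤ :=
    ne_top_of_le_ne_top hp (Finset.sum_le_sum fun k _ => tsub_le_self)
  have e : (∑ k, (p k - m k))⁻¹ * ((∑ k, (p k - m k)) * ∑ k, (p k - m k) * q k)
      = ∑ k, (p k - m k) * q k := by
    by_cases h0 : ∑ k, (p k - m k) = 0
    · have : ∀ k, p k - m k = 0 := fun k => Finset.sum_eq_zero_iff.1 h0 k (Finset.mem_univ k)
      simp [this]
    · rw [← mul_assoc, ENNReal.inv_mul_cancel h0 hr, one_mul]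
  rw [e, ← Finset.sum_add_distrib]
  refine Finset.sum_congr rfl fun k _ => ?_
  rw [← add_mul, add_tsub_cancel_of_le (hm k)]

/-- The part of `μ` which is not matched with `ν`. -/
def residual (μ ν : Measure X) (A : κ → Set X) : Measure X :=
  ∑ k, (μ (A k) - min (μ (A k)) (ν (A k))) • ProbabilityTheory.cond μ (A k)

/-- A coupling of `μ` and `ν` which leaves as much mass as possible in the sets of a partition. -/
def partitionCoupling (μ ν : Measure X) (A : κ → Set X) : Measure (X × X) :=
  ∑ k, min (μ (A k)) (ν (A k)) •
      (ProbabilityTheory.cond μ (A k)).prod (ProbabilityTheory.cond ν (A k))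
    + (∑ k, (μ (A k) - min (μ (A k)) (ν (A k))))⁻¹ • (residual μ ν A).prod (residual ν μ A)

theorem measure_mul_cond [IsFiniteMeasure μ] {s : Set X} (t : Set X) :
    μ s * ProbabilityTheory.cond μ s t = μ.restrict s t := by
  rw [ProbabilityTheory.cond, Measure.smul_apply, smul_eq_mul]
  by_cases h : μ s = 0
  · rw [h, zero_mul, Measure.restrict_eq_zero.2 h, Measure.coe_zero, Pi.zero_apply]
  · rw [← mul_assoc, ENNReal.mul_inv_cancel h (measure_ne_top _ _), one_mul]

theorem mul_cond_univ [IsFiniteMeasure μ] {s : Set X} {c : ℝ≥0∞} (hc : c ≤ μ s) :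
    c * ProbabilityTheory.cond μ s univ = c := by
  by_cases h : μ s = 0
  · rw [le_antisymm (hc.trans h.le) zero_le, zero_mul]
  · have := ProbabilityTheory.cond_isProbabilityMeasure h
    rw [measure_univ, mul_one]

variable [IsProbabilityMeasure μ] [IsProbabilityMeasure ν]

theorem sum_restrict (hA : ∀ k, MeasurableSet (A k)) (hd : Pairwise fun i j => Disjoint (A i) (A j))
    (hu : ⋃ k, A k = univ) (t : Set X) : ∑ k, μ.restrict (A k) t = μ t := by
  have := Measure.restrict_iUnion (μ := μ) hd hA
  rw [hu, Measure.restrict_univ, Measure.sum_fintype] at this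
  conv_rhs => rw [this]
  simp

theorem sum_measure (hA : ∀ k, MeasurableSet (A k)) (hd : Pairwise fun i j => Disjoint (A i) (A j))
    (hu : ⋃ k, A k = univ) : ∑ k, μ (A k) = 1 := by
  have := sum_restrict (μ := μ) hA hd hu univ
  simpa using this

theorem residual_univ : residual μ ν A univ = ∑ k, (μ (A k) - min (μ (A k)) (ν (A k))) := by
  simp only [residual, Measure.coe_finsetSum, Finset.sum_apply, Measure.smul_apply, smul_eq_mul,
    mul_cond_univ tsub_le_self]

/-- The unmatched mass is the same for `μ` and `ν`, both being probability measures. Hence the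
product of the residuals, divided by this mass, has the right marginals on both sides. -/
theorem sum_sub_min (hA : ∀ k, MeasurableSet (A k))
    (hd : Pairwise fun i j => Disjoint (A i) (A j)) (hu : ⋃ k, A k = univ) :
    ∑ k, (μ (A k) - min (μ (A k)) (ν (A k))) = 1 - ∑ k, min (μ (A k)) (ν (A k)) := by
  have hle : ∑ k, min (μ (A k)) (ν (A k)) ≤ 1 := by
    rw [← sum_measure (μ := μ) hA hd hu]
    exact Finset.sum_le_sum fun k _ => min_le_left _ _
  refine ENNReal.eq_sub_of_add_eq (ne_top_of_le_ne_top ENNReal.one_ne_top hle) ?_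
  rw [← Finset.sum_add_distrib, ← sum_measure (μ := μ) hA hd hu]
  exact Finset.sum_congr rfl fun k _ => tsub_add_cancel_of_le (min_le_left _ _)

theorem partitionCoupling_prod (s t : Set X) : partitionCoupling μ ν A (s ×ˢ t)
    = ∑ k, min (μ (A k)) (ν (A k)) * (ProbabilityTheory.cond μ (A k) s
        * ProbabilityTheory.cond ν (A k) t)
      + (∑ k, (μ (A k) - min (μ (A k)) (ν (A k))))⁻¹ * (residual μ ν A s * residual ν μ A t) := by
  have : ∀ (μ ν : Measure X) [IsProbabilityMeasure μ] [IsProbabilityMeasure ν],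
      IsFiniteMeasure (residual μ ν A) := fun μ ν _ _ => ⟨by
    rw [residual_univ]
    exact (ENNReal.sum_lt_top.2 fun k _ => tsub_le_self.trans_lt (measure_lt_top _ _))⟩
  have := this ν μ
  simp only [partitionCoupling, Measure.coe_add, Pi.add_apply, Measure.coe_finsetSum,
    Finset.sum_apply, Measure.smul_apply, smul_eq_mul, Measure.prod_prod]

theorem partitionCoupling_fst (hA : ∀ k, MeasurableSet (A k))
    (hd : Pairwise fun i j => Disjoint (A i) (A j)) (hu : ⋃ k, A k = univ) :
    (partitionCoupling μ ν A).fst = μ := by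
  ext s hs
  rw [Measure.fst_apply hs, ← prod_univ, partitionCoupling_prod, residual_univ,
    ← sum_restrict (μ := μ) hA hd hu s]
  have e : ∑ k, (ν (A k) - min (ν (A k)) (μ (A k))) = ∑ k, (μ (A k) - min (μ (A k)) (ν (A k))) := by
    rw [sum_sub_min hA hd hu, sum_sub_min hA hd hu]
    simp only [min_comm]
  have e1 : ∀ k, min (μ (A k)) (ν (A k)) * (ProbabilityTheory.cond μ (A k) s
      * ProbabilityTheory.cond ν (A k) univ)
      = min (μ (A k)) (ν (A k)) * ProbabilityTheory.cond μ (A k) s := fun k => by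
    rw [mul_left_comm, mul_cond_univ (min_le_right _ _), mul_comm]
  rw [e, mul_comm (residual μ ν A s)]
  simp only [e1, ← measure_mul_cond (μ := μ) s]
  have := sum_residual_add (m := fun k => min (μ (A k)) (ν (A k))) (p := fun k => μ (A k))
    (q := fun k => ProbabilityTheory.cond μ (A k) s) (fun k => min_le_left _ _)
    (by rw [sum_measure hA hd hu]; exact ENNReal.one_ne_top)
  rw [← this]
  simp only [residual, Measure.coe_finsetSum, Finset.sum_apply, Measure.smul_apply, smul_eq_mul]

theorem partitionCoupling_snd (hA : ∀ k, MeasurableSet (A k))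
    (hd : Pairwise fun i j => Disjoint (A i) (A j)) (hu : ⋃ k, A k = univ) :
    (partitionCoupling μ ν A).snd = ν := by
  have h := partitionCoupling_fst (μ := ν) (ν := μ) hA hd hu
  ext s hs
  conv_rhs => rw [← h]
  rw [Measure.snd_apply hs, Measure.fst_apply hs, ← prod_univ, ← univ_prod, partitionCoupling_prod,
    partitionCoupling_prod, sum_sub_min hA hd hu, sum_sub_min hA hd hu]
  simp only [min_comm, mul_comm]

/-- The transport distance is controlled by the masses of the sets of a partition. -/
theorem mkr_le_of_partition {d : X → X → ℝ} (hA : ∀ k, MeasurableSet (A k))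
    (hd : Pairwise fun i j => Disjoint (A i) (A j)) (hu : ⋃ k, A k = univ) {δ : ℝ≥0∞} {k₀ : κ}
    (h0 : μ (A k₀) = 0)
    (hδ : ∀ k, k ≠ k₀ → ∀ x ∈ A k, ∀ y ∈ A k, ENNReal.ofReal (min 1 (d x y)) ≤ δ) :
    mkr d μ ν ≤ δ + (1 - ∑ k, min (μ (A k)) (ν (A k))) := by
  refine (iInf₂_le (partitionCoupling μ ν A) ⟨partitionCoupling_fst hA hd hu,
    partitionCoupling_snd hA hd hu⟩).trans ?_
  have h1 : ∀ p : X × X, ENNReal.ofReal (min 1 (d p.1 p.2)) ≤ 1 := fun p => by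
    rw [← ENNReal.ofReal_one]
    exact ENNReal.ofReal_le_ofReal (min_le_left _ _)
  rw [partitionCoupling, lintegral_add_measure, lintegral_finsetSum_measure]
  refine add_le_add ?_ ?_
  · calc _ ≤ ∑ k, μ (A k) * δ := Finset.sum_le_sum fun k _ => ?_
      _ = δ := by rw [← Finset.sum_mul, sum_measure hA hd hu, one_mul]
    rw [lintegral_smul_measure, smul_eq_mul]
    -- The exceptional set may be unbounded, but it is null for `μ`, so no mass is matched in it.
    by_cases hk : k = k₀
    · rw [hk, h0, min_eq_left zero_le, zero_mul, zero_mul]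
    refine mul_le_mul' (min_le_left _ _) ?_
    rw [ProbabilityTheory.cond, ProbabilityTheory.cond, Measure.prod_smul_left,
      Measure.prod_smul_right, Measure.prod_restrict, lintegral_smul_measure,
      lintegral_smul_measure, smul_eq_mul, smul_eq_mul]
    have h2 : ∫⁻ p in A k ×ˢ A k, ENNReal.ofReal (min 1 (d p.1 p.2)) ∂(μ.prod ν)
        ≤ δ * (μ (A k) * ν (A k)) := by
      rw [← Measure.prod_prod, ← setLIntegral_const]
      exact setLIntegral_mono' ((hA k).prod (hA k)) fun p hp => hδ k hk _ hp.1 _ hp.2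
    calc _ ≤ (μ (A k))⁻¹ * ((ν (A k))⁻¹ * (δ * (μ (A k) * ν (A k)))) := by gcongr
      _ = ((μ (A k))⁻¹ * μ (A k)) * ((ν (A k))⁻¹ * ν (A k)) * δ := by ring
      _ ≤ 1 * 1 * δ := by
        gcongr <;> exact ENNReal.inv_mul_le_one _
      _ = δ := by rw [one_mul, one_mul]
  · rw [lintegral_smul_measure, smul_eq_mul, ← sum_sub_min hA hd hu]
    refine (mul_le_mul' le_rfl ((lintegral_mono h1).trans_eq (lintegral_one))).trans ?_
    have hs : ∀ (μ ν : Measure X) [IsProbabilityMeasure μ] [IsProbabilityMeasure ν],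
        SFinite (residual μ ν A) := fun μ ν _ _ => by
      have : IsFiniteMeasure (residual μ ν A) := ⟨by
        rw [residual_univ]
        exact (ENNReal.sum_lt_top.2 fun k _ => tsub_le_self.trans_lt (measure_lt_top _ _))⟩
      infer_instance
    have := hs ν μ
    rw [← univ_prod_univ, Measure.prod_prod, residual_univ, residual_univ, sum_sub_min hA hd hu,
      sum_sub_min hA hd hu, ← mul_assoc]
    simp only [min_comm]
    exact mul_le_of_le_one_left zero_le (ENNReal.inv_mul_le_one _)

end PartitionCoupling
end RegVM

namespace RegVM
-- The partition generated by finitely many balls.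
section BallPartition

variable {X : Type} [PseudoMetricSpace X] {S : Finset X} {ρ : ℝ}

/-- The points which lie in exactly the balls with centers in `I`. -/
def ballAtom (S : Finset X) (ρ : ℝ) (I : Set S) : Set X :=
  {x | ∀ i : S, x ∈ Metric.ball (i : X) ρ ↔ i ∈ I}

theorem measurableSet_ballAtom [MeasurableSpace X] [OpensMeasurableSpace X] (I : Set S) :
    MeasurableSet (ballAtom S ρ I) := by
  have e : ballAtom S ρ I = ⋂ i : S, {x | x ∈ Metric.ball (i : X) ρ ↔ i ∈ I} := by
    ext x
    simp [ballAtom]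
  rw [e]
  refine MeasurableSet.iInter fun i => ?_
  by_cases h : i ∈ I
  · simp only [h, iff_true]
    exact measurableSet_ball
  · simp only [h, iff_false]
    exact measurableSet_ball.compl

theorem pairwise_disjoint_ballAtom :
    Pairwise fun I J => Disjoint (ballAtom S ρ I) (ballAtom S ρ J) := fun _ _ hIJ =>
  Set.disjoint_left.2 fun _ hx hy => hIJ (Set.ext fun i => (hx i).symm.trans (hy i))

theorem iUnion_ballAtom : ⋃ I, ballAtom S ρ I = univ :=
  eq_univ_of_forall fun x => mem_iUnion.2 ⟨{i | x ∈ Metric.ball (i : X) ρ}, fun _ => Iff.rfl⟩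

/-- Off the spheres, membership in each of the finitely many balls is locally constant, and so is
membership in an atom. -/
theorem frontier_ballAtom_subset (I : Set S) :
    frontier (ballAtom S ρ I) ⊆ ⋃ i : S, Metric.sphere (i : X) ρ := by
  intro x hx
  by_contra hn
  have h : ∀ i : S, ∀ᶠ y in 𝓝 x, (y ∈ Metric.ball (i : X) ρ ↔ x ∈ Metric.ball (i : X) ρ) := by
    intro i
    have hne : dist x i ≠ ρ := fun h => hn (mem_iUnion.2 ⟨i, h⟩)
    rcases lt_or_gt_of_ne hne with h | h
    · filter_upwards [Metric.isOpen_ball.mem_nhds (Metric.mem_ball.2 h)] with y hy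
      exact ⟨fun _ => h, fun _ => hy⟩
    · filter_upwards [Metric.isClosed_closedBall.isOpen_compl.mem_nhds
        (show x ∈ (Metric.closedBall (i : X) ρ)ᶜ from fun hm => absurd h (not_lt.2 hm))] with y hy
      exact ⟨fun hm => absurd (Metric.ball_subset_closedBall hm) hy,
        fun hm => absurd hm (not_lt.2 h.le)⟩
  have h2 : ∀ᶠ y in 𝓝 x, (y ∈ ballAtom S ρ I ↔ x ∈ ballAtom S ρ I) := by
    filter_upwards [eventually_all.2 h] with y hy
    exact forall_congr' fun i => by rw [hy i]
  by_cases hm : x ∈ ballAtom S ρ I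
  · refine hx.2 (mem_interior_iff_mem_nhds.2 ?_)
    filter_upwards [h2] with y hy using hy.2 hm
  · obtain ⟨y, hy1, hy2⟩ := mem_closure_iff_nhds.1 hx.1 _ h2
    exact hm (hy1.1 hy2)

end BallPartition

/-! ### Weak convergence implies convergence in the transport distance. -/

section DistanceToZero

theorem phaseDist_le_two_mul (z w : Phase) : phaseDist z w ≤ 2 * dist z w := by
  have h1 : ‖z.1 - w.1‖ ≤ dist z w := by
    rw [dist_eq_norm]
    exact norm_fst_le (z - w)
  have h2 : ‖z.2 - w.2‖ ≤ dist z w := by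
    rw [dist_eq_norm]
    exact norm_snd_le (z - w)
  linarith [phaseDist_le_add z w]

/-- Weak convergence to an absolutely continuous measure with compact support implies convergence
in the transport distance. -/
theorem tendsto_mkr_zero {μ : Measure Phase} [IsProbabilityMeasure μ] (hac : μ ≪ volume)
    {K : Set Phase} (hK : IsCompact K) (hμK : μ Kᶜ = 0) {ν : ℕ → Measure Phase}
    (hν : ∀ N, 1 ≤ N → IsProbabilityMeasure (ν N))
    (h : ∀ φ : Phase →ᵇ ℝ, Tendsto (fun N => ∫ z, φ z ∂ν N) atTop (𝓝 (∫ z, φ z ∂μ))) :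
    Tendsto (fun N => mkr phaseDist μ (ν N)) atTop (𝓝 0) := by
  classical
  -- The measures are probability measures for `N ≥ 1` only, so the sequence is shifted by one.
  rw [← tendsto_add_atTop_iff_nat 1]
  let P : ProbabilityMeasure Phase := ⟨μ, inferInstance⟩
  let Q : ℕ → ProbabilityMeasure Phase := fun N => ⟨ν (N + 1), hν _ (by omega)⟩
  have hQ : Tendsto Q atTop (𝓝 P) := ProbabilityMeasure.tendsto_iff_forall_integral_tendsto.2
    fun φ => (tendsto_add_atTop_iff_nat 1).2 (h φ)
  refine ENNReal.tendsto_nhds_zero.2 fun η hη => ?_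
  -- Two points of one ball of radius `ρ` have sup distance below `2ρ`, hence Euclidean distance
  -- below `4ρ`.
  obtain ⟨ρ, hρ, hρη⟩ : ∃ ρ : ℝ, 0 < ρ ∧ ENNReal.ofReal (4 * ρ) ≤ η / 2 := by
    obtain ⟨r, hr0, hr⟩ := ENNReal.lt_iff_exists_nnreal_btwn.1 (ENNReal.half_pos hη.ne')
    refine ⟨r / 4, by have : (0 : NNReal) < r := by exact_mod_cast hr0
                      positivity, ?_⟩
    rw [mul_div_cancel₀ _ (by norm_num : (4 : ℝ) ≠ 0), ENNReal.ofReal_coe_nnreal]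
    exact hr.le
  obtain ⟨S, -, hS⟩ := hK.elim_nhds_subcover (fun x => Metric.ball x ρ)
    fun x _ => Metric.ball_mem_nhds x hρ
  have hA := fun I : Set S => measurableSet_ballAtom (ρ := ρ) I
  have hd := pairwise_disjoint_ballAtom (S := S) (ρ := ρ)
  have hu := iUnion_ballAtom (S := S) (ρ := ρ)
  -- The atom of the empty index set is the complement of all balls, which misses the compact set
  -- carrying `μ`.
  have h0 : μ (ballAtom S ρ ∅) = 0 := by
    have hsub : ballAtom S ρ ∅ ⊆ Kᶜ := fun x hx hxK => by
      obtain ⟨i, hi, hxi⟩ := mem_iUnion₂.1 (hS hxK)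
      exact (hx ⟨i, hi⟩).1 hxi
    exact measure_mono_null hsub hμK
  -- Spheres are Lebesgue null sets. By the portmanteau theorem the masses of all atoms then
  -- converge, hence so does the matched mass, to `1`.
  have hfr : ∀ I : Set S, μ (frontier (ballAtom S ρ I)) = 0 := fun I =>
    measure_mono_null (frontier_ballAtom_subset I) (measure_iUnion_null fun i =>
      hac (Measure.addHaar_sphere_of_ne_zero volume _ hρ.ne'))
  have hlim : ∀ I : Set S, Tendsto (fun N => ν (N + 1) (ballAtom S ρ I)) atTop
      (𝓝 (μ (ballAtom S ρ I))) := fun I =>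
    ProbabilityMeasure.tendsto_measure_of_null_frontier_of_tendsto' hQ (hfr I)
  have hsum : Tendsto (fun N => 1 - ∑ I : Set S,
      min (μ (ballAtom S ρ I)) (ν (N + 1) (ballAtom S ρ I))) atTop (𝓝 0) := by
    have h1 : Tendsto (fun N => ∑ I : Set S,
        min (μ (ballAtom S ρ I)) (ν (N + 1) (ballAtom S ρ I))) atTop (𝓝 1) := by
      have := tendsto_finsetSum Finset.univ fun (I : Set S) _ =>
        (tendsto_const_nhds (x := μ (ballAtom S ρ I))).min (hlim I)
      simpa only [min_self, sum_measure (μ := μ) hA hd hu] using this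
    have h2 := ENNReal.Tendsto.sub (tendsto_const_nhds (x := (1 : ℝ≥0∞)) (f := (atTop : Filter ℕ))) h1
      (Or.inl ENNReal.one_ne_top)
    simpa using h2
  filter_upwards [ENNReal.tendsto_nhds_zero.1 hsum (η / 2) (ENNReal.half_pos hη.ne')] with N hN
  have := hν (N + 1) (by omega)
  refine (mkr_le_of_partition hA hd hu h0 (δ := η / 2) fun I hI x hx y hy => ?_).trans
    ((add_le_add le_rfl hN).trans (ENNReal.add_halves η).le)
  obtain ⟨i, hi⟩ := Set.nonempty_iff_ne_empty.2 hI
  refine (ENNReal.ofReal_le_ofReal ?_).trans hρη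
  have hx' := Metric.mem_ball.1 ((hx i).2 hi)
  have hy' := Metric.mem_ball.1 ((hy i).2 hi)
  have := dist_triangle_right x y (i : Phase)
  exact (min_le_right _ _).trans ((phaseDist_le_two_mul x y).trans (by linarith))

end DistanceToZero

/-! ### Uniform convergence in time for bounded continuous test functions. -/

section UniformConvergence

variable {χ : R3 → ℝ} {ε T : ℝ} {μ ν : ℝ → Measure Phase} {E B E' B' : ℝ → R3 → R3}
  {Z Z' : ℝ → Phase → Phase} {G : Type} [NormedAddCommGroup G]

/-- One point runs through a compact set and the other is arbitrary. For close points, uniform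
continuity at the compact set gives `η`; for distant ones, boundedness of `F` is compared with the
truncated distance, which is then bounded below. -/
theorem exists_modulus {F : Phase → G} (hF : Continuous F) {C : ℝ} (hC : ∀ z, ‖F z‖ ≤ C)
    {K : Set Phase} (hK : IsCompact K) {η : ℝ} (hη : 0 < η) :
    ∃ M, 0 ≤ M ∧ ∀ z ∈ K, ∀ w, ‖F z - F w‖
      ≤ η + M * min 3 (3 / 2 * ‖z.1 - w.1‖ + ‖z.2 - w.2‖) := by
  have hC0 : 0 ≤ C := (norm_nonneg _).trans (hC 0)
  obtain ⟨δ, hδ, hd⟩ := Metric.mem_uniformity_dist.1 (hK.uniformContinuousAt_of_continuousAt F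
    (fun z _ => hF.continuousAt) (Metric.dist_mem_uniformity hη))
  have hm : 0 < min 3 δ := lt_min (by norm_num) hδ
  refine ⟨2 * C / min 3 δ, by positivity, fun z hz w => ?_⟩
  rcases lt_or_ge (dist z w) δ with h | h
  · have h1 : dist (F z) (F w) < η := hd h hz
    rw [← dist_eq_norm]
    exact h1.le.trans (le_add_of_nonneg_right (by positivity))
  · have h1 : δ ≤ 3 / 2 * ‖z.1 - w.1‖ + ‖z.2 - w.2‖ := by
      refine h.trans ?_
      rw [dist_eq_norm]
      have := norm_nonneg (z.1 - w.1)
      have := norm_nonneg (z.2 - w.2)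
      exact max_le (by simp only [Prod.fst_sub]; linarith) (by simp only [Prod.snd_sub]; linarith)
    have h2 : 2 * C / min 3 δ * min 3 δ
        ≤ 2 * C / min 3 δ * min 3 (3 / 2 * ‖z.1 - w.1‖ + ‖z.2 - w.2‖) :=
      mul_le_mul_of_nonneg_left (min_le_min le_rfl h1) (by positivity)
    rw [div_mul_cancel₀ _ hm.ne'] at h2
    have h3 := norm_sub_le (F z) (F w)
    linarith [hC z, hC w]

theorem IsMeanFieldSolution.exists_compact (hμ : IsMeanFieldSolution χ ε T μ E B Z)
    {K : Set Phase} (hK : IsCompact K) (hμK : μ 0 Kᶜ = 0) :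
    ∃ K' : Set Phase, IsCompact K' ∧ ∀ t ∈ Icc 0 T, ∀ᵐ z ∂μ t, z ∈ K' := by
  have hK' := (isCompact_Icc (a := 0) (b := T)).prod hK |>.image hμ.flow.cont
  refine ⟨_, hK', fun t ht => ?_⟩
  have hc : Continuous (Z t) := hμ.flow.cont.comp (by fun_prop : Continuous fun z : Phase => (t, z))
  rw [hμ.push t ht]
  refine (ae_map_iff hc.aemeasurable hK'.measurableSet).2 ?_
  filter_upwards [measure_eq_zero_iff_ae_notMem.1 hμK] with z hz
  exact ⟨(t, z), ⟨ht, not_not.1 hz⟩, rfl⟩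

variable [NormedSpace ℝ G]

/-- Only the fixed solution `μ` has to stay in a compact set; nothing is required of the supports of
`ν`. The constant depends on `F` and `η`, not on `ν` or `t`, which makes the convergence uniform in
time. -/
theorem IsMeanFieldSolution.exists_integral_sub_le (hχ : IsMollifier χ) (hε : 0 < ε)
    (hμ : IsMeanFieldSolution χ ε T μ E B Z) {K : Set Phase} (hK : IsCompact K)
    (hμK : μ 0 Kᶜ = 0) {F : Phase → G} (hF : Continuous F) {C : ℝ} (hC : ∀ z, ‖F z‖ ≤ C) {η : ℝ}
    (hη : 0 < η) :
    ∃ c : ℝ, ∀ (ν : ℝ → Measure Phase) (E' B' : ℝ → R3 → R3) (Z' : ℝ → Phase → Phase),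
      IsMeanFieldSolution χ ε T ν E' B' Z' → ∀ t ∈ Icc 0 T,
      ENNReal.ofReal (‖∫ z, F z ∂μ t - ∫ z, F z ∂ν t‖ - η)
        ≤ ENNReal.ofReal c * mkr phaseDist (μ 0) (ν 0) := by
  obtain ⟨K', hK', hae⟩ := hμ.exists_compact hK hμK
  obtain ⟨M, hM, hF'⟩ := exists_modulus hF hC hK' hη
  refine ⟨M * (4 * constC χ ε T), fun ν E' B' Z' hν t ht => ?_⟩
  have hcC := constC_nonneg (χ := χ) (ε := ε) (ht.1.trans ht.2)
  refine hμ.le_mul_mkr hν (by positivity) fun π a b hπ ha hb => ENNReal.ofReal_le_ofReal ?_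
  have := ha.weak.finite
  have := hb.weak.finite
  have hw := integrable_weightedGap ha hb t
  have h1 := norm_integral_sub_le_of_coupling_ae ha hb ht (integrable_of_continuous_of_le hF hC)
    (integrable_of_continuous_of_le hF hC) ((integrable_const η).add (hw.const_mul M)) (by
      have h := hae t ht
      rw [ha.push t ht] at h
      filter_upwards [ae_of_ae_map (measurable_slices ha hb t).1.aemeasurable h] with u hu
      exact hF' _ hu _)
  simp only [Pi.add_apply] at h1
  rw [integral_add (integrable_const η) (hw.const_mul M), integral_const_mul] at h1
  have h2 := mul_le_mul_of_nonneg_left (integral_weightedGap_le hχ hε ha hb ht) hM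
  simp only [integral_const, probReal_univ, smul_eq_mul, one_mul] at h1
  linarith

theorem tendstoUniformlyOn_of_le_mul {α : Type} {F : ℕ → α → G} {g : α → G} {s : Set α}
    {κ : ℕ → ℝ≥0∞} (hκ : Tendsto κ atTop (𝓝 0))
    (h : ∀ η : ℝ, 0 < η → ∃ c : ℝ, ∀ N, 1 ≤ N → ∀ x ∈ s,
      ENNReal.ofReal (‖g x - F N x‖ - η) ≤ ENNReal.ofReal c * κ N) :
    TendstoUniformlyOn F g atTop s := by
  refine Metric.tendstoUniformlyOn_iff.2 fun η hη => ?_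
  obtain ⟨c, hc⟩ := h (η / 2) (by positivity)
  have hlim : Tendsto (fun N => ENNReal.ofReal c * κ N) atTop (𝓝 0) := by
    simpa using ENNReal.Tendsto.const_mul (a := ENNReal.ofReal c) hκ (Or.inr ENNReal.ofReal_ne_top)
  filter_upwards [hlim.eventually_lt_const (ENNReal.ofReal_pos.2 (half_pos hη)),
    eventually_ge_atTop 1] with N hN h1 x hx
  have := (ENNReal.ofReal_lt_ofReal_iff (half_pos hη)).1 ((hc N h1 x hx).trans_lt hN)
  rw [dist_eq_norm]
  linarith

end UniformConvergence
end RegVM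

namespace RegVM
-- The density and the particles as mean-field solutions.
section Assembly

variable {χ : R3 → ℝ} {ε T : ℝ} {E B : ℝ → R3 → R3}

theorem IsVlasovMaxwellSolution.isMeanFieldSolution {fin : Phase → ℝ} {f : ℝ → Phase → ℝ}
    (hf : IsVlasovMaxwellSolution χ ε fin f E B) (hχ : IsMollifier χ) (hε : 0 < ε)
    (hi : Integrable fin) (h0 : ∀ᵐ z, 0 ≤ fin z) (h1 : ∫ z, fin z = 1) (hT : 0 ≤ T) :
    ∃ Z, IsMeanFieldSolution χ ε T (fun t => phaseMeasure (f (max t 0))) E B Z := by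
  obtain ⟨M, K, hb⟩ := exists_niceField hχ hε hf.weaklyContinuous hf.isFieldOf hT
  have e0 : phaseMeasure (f (max 0 0)) = phaseMeasure fin := by
    rw [max_self]
    exact phaseMeasure_congr hf.init
  refine ⟨charFlow E B T, hf.weaklyContinuous, hf.isFieldOf, isCharacteristicFlow_charFlow hb hT,
    fun t ht => ?_, ?_⟩
  · simp only [e0, max_eq_left ht.1]
    exact hf.eq_map hb ht
  · simp only [e0]
    exact isProbabilityMeasure_phaseMeasure hi h0 h1

theorem IsParticleSolution.isMeanFieldSolution {N : ℕ} {zin : Fin N → Phase}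
    {z : Fin N → ℝ → Phase} (hz : IsParticleSolution χ ε zin z) (hχ : IsMollifier χ) (hε : 0 < ε)
    (hN : 1 ≤ N) (h : IsFieldOf χ ε (fun t => empirical fun i => z i t) E B) (hT : 0 ≤ T) :
    ∃ Z, IsMeanFieldSolution χ ε T (fun t => empirical fun i => z i (max t 0)) E B Z := by
  obtain ⟨M, K, hb⟩ := exists_niceField hχ hε (hz.weaklyContinuous hN)
    (IsParticleSolution.isFieldOf h) hT
  refine ⟨charFlow E B T, hz.weaklyContinuous hN, IsParticleSolution.isFieldOf h,
    isCharacteristicFlow_charFlow hb hT, fun t ht => ?_, isProbabilityMeasure_empirical hN _⟩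
  simp only [max_self, hz.init, max_eq_left ht.1]
  exact hz.eq_map hχ hε hN h hb ht

theorem phaseMeasure_compl_eq_zero {fin : Phase → ℝ} {K : Set Phase} (hK : IsCompact K)
    (h : ∀ᵐ z, z ∉ K → fin z = 0) : phaseMeasure fin Kᶜ = 0 := by
  rw [phaseMeasure, withDensity_apply _ hK.measurableSet.compl]
  refine (setLIntegral_congr_fun_ae hK.measurableSet.compl (g := fun _ => 0) ?_).trans (by simp)
  filter_upwards [h] with z hz hzK
  rw [hz hzK, ENNReal.ofReal_zero]

theorem integral_charge (μ : Measure Phase) (φ : R3 →ᵇ ℝ) :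
    ∫ x, φ x ∂charge μ = ∫ z, φ z.1 ∂μ := by
  rw [charge, Measure.fst, integral_map measurable_fst.aemeasurable
    φ.continuous.aestronglyMeasurable]

end Assembly
end RegVM

end

theorem mainTheorem4
    -- the mollifier and the regularization parameter
    (χ : RegVM.R3 → ℝ) (hχ : RegVM.IsMollifier χ) (ε : ℝ) (hε : 0 < ε)
    -- the initial probability density, bounded and with compact support
    (fin : RegVM.Phase → ℝ) (fin_bdd : MemLp fin ⊤ volume)
    (fin_nonneg : ∀ᵐ z, 0 ≤ fin z)
    (fin_supp : ∃ K : Set RegVM.Phase, IsCompact K ∧ ∀ᵐ z, z ∉ K → fin z = 0)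
    (fin_mass : ∫ z, fin z = 1)
    -- the solution of the regularized Vlasov-Maxwell system
    (f : ℝ → RegVM.Phase → ℝ) (E B : ℝ → RegVM.R3 → RegVM.R3)
    (hf : RegVM.IsVlasovMaxwellSolution χ ε fin f E B)
    -- the initial configurations, whose empirical measures converge weakly to the initial density
    (zin : ∀ N : ℕ, Fin N → RegVM.Phase)
    (hzin : ∀ φ : RegVM.Phase →ᵇ ℝ,
      Tendsto (fun N => ∫ z, φ z ∂(RegVM.empirical (zin N))) atTop
        (𝓝 (∫ z, φ z ∂(RegVM.phaseMeasure fin))))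
    -- the particle trajectories and the fields which they create
    (z : ∀ N : ℕ, Fin N → ℝ → RegVM.Phase)
    (hz : ∀ N, 1 ≤ N → RegVM.IsParticleSolution χ ε (zin N) (z N))
    (EN BN : ℕ → ℝ → RegVM.R3 → RegVM.R3)
    (hEB : ∀ N, 1 ≤ N →
      RegVM.IsFieldOf χ ε (fun t => RegVM.empirical fun i => z N i t) (EN N) (BN N))
    (T : ℝ) (hT : 0 < T) :
    -- charge densities and currents: estimates
    (∀ N, 1 ≤ N → ∀ t ∈ Icc 0 T,
      RegVM.mkr dist (RegVM.charge (RegVM.phaseMeasure (f t)))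
          (RegVM.charge (RegVM.empirical fun i => z N i t))
        ≤ ENNReal.ofReal (RegVM.constC χ ε T) *
          RegVM.mkr RegVM.phaseDist (RegVM.phaseMeasure fin) (RegVM.empirical (zin N)) ∧
      RegVM.currentNegNorm (RegVM.phaseMeasure (f t)) (RegVM.empirical fun i => z N i t)
        ≤ ENNReal.ofReal (4 * RegVM.constC χ ε T) *
          RegVM.mkr RegVM.phaseDist (RegVM.phaseMeasure fin) (RegVM.empirical (zin N))) ∧
    -- charge densities and currents: weak convergence, uniform in time
    (∀ φ : RegVM.R3 →ᵇ ℝ,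
      TendstoUniformlyOn
        (fun N t => ∫ x, φ x ∂(RegVM.charge (RegVM.empirical fun i => z N i t)))
        (fun t => ∫ x, φ x ∂(RegVM.charge (RegVM.phaseMeasure (f t)))) atTop (Icc 0 T) ∧
      TendstoUniformlyOn
        (fun N t => RegVM.current (RegVM.empirical fun i => z N i t) φ)
        (fun t => RegVM.current (RegVM.phaseMeasure (f t)) φ) atTop (Icc 0 T)) ∧
    -- fields: uniform convergence
    TendstoUniformlyOn (fun N (p : ℝ × RegVM.R3) => EN N p.1 p.2) (fun p => E p.1 p.2) atTop
      (Icc 0 T ×ˢ univ) ∧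
    TendstoUniformlyOn (fun N (p : ℝ × RegVM.R3) => BN N p.1 p.2) (fun p => B p.1 p.2) atTop
      (Icc 0 T ×ˢ univ) ∧
    -- fields: estimates
    (∀ N, 1 ≤ N → ∀ t ∈ Icc 0 T, ∀ x : RegVM.R3,
      ENNReal.ofReal ‖B t x - BN N t x‖
        ≤ ENNReal.ofReal (RegVM.constC' χ ε T) *
          RegVM.mkr RegVM.phaseDist (RegVM.phaseMeasure fin) (RegVM.empirical (zin N)) ∧
      ENNReal.ofReal ‖E t x - EN N t x‖
        ≤ ENNReal.ofReal (RegVM.constC'' χ ε T) *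
          RegVM.mkr RegVM.phaseDist (RegVM.phaseMeasure fin) (RegVM.empirical (zin N))) := by
  have hfi : Integrable fin := (hf.integrable 0 le_rfl).congr hf.init
  have hT0 : (0 : ℝ) ∈ Icc 0 T := ⟨le_rfl, hT.le⟩
  have hsol := hf.isMeanFieldSolution hχ hε hfi fin_nonneg fin_mass hT.le
  obtain ⟨Z, hsol⟩ := hsol
  have hpart : ∀ N, 1 ≤ N → ∃ Z', RegVM.IsMeanFieldSolution χ ε T
      (fun t => RegVM.empirical fun i => z N i (max t 0)) (EN N) (BN N) Z' := fun N hN =>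
    (hz N hN).isMeanFieldSolution hχ hε hN (hEB N hN) hT.le
  -- Both families are extended to negative times through `max t 0`; at time `0` they have to be
  -- identified with the given initial data.
  have e0 : RegVM.phaseMeasure (f (max 0 0)) = RegVM.phaseMeasure fin := by
    rw [max_self]
    exact RegVM.phaseMeasure_congr hf.init
  have e0' : ∀ N, 1 ≤ N → (RegVM.empirical fun i => z N i (max 0 0)) = RegVM.empirical (zin N) :=
    fun N hN => by simp only [max_self, (hz N hN).init]
  obtain ⟨K, hK, hKf⟩ := fin_supp
  have hKμ : RegVM.phaseMeasure fin Kᶜ = 0 := RegVM.phaseMeasure_compl_eq_zero hK hKf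
  have hKμ' : RegVM.phaseMeasure (f (max 0 0)) Kᶜ = 0 := by rwa [e0]
  have hprob := RegVM.isProbabilityMeasure_phaseMeasure hfi fin_nonneg fin_mass
  have hmkr : Tendsto (fun N => RegVM.mkr RegVM.phaseDist (RegVM.phaseMeasure fin)
      (RegVM.empirical (zin N))) atTop (𝓝 0) :=
    RegVM.tendsto_mkr_zero (μ := RegVM.phaseMeasure fin)
      (withDensity_absolutelyContinuous _ _) hK hKμ
      (fun N hN => RegVM.isProbabilityMeasure_empirical hN _) hzin
  have hC := RegVM.constC_nonneg (χ := χ) (ε := ε) hT.le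
  have hC' : 0 ≤ RegVM.constC' χ ε T :=
    mul_nonneg (by positivity) (RegVM.normLW_nonneg _)
  have hC'' : 0 ≤ RegVM.constC'' χ ε T :=
    add_nonneg (mul_nonneg (by positivity) (RegVM.normLW_nonneg _))
      (mul_nonneg zero_le_two (RegVM.normLW_nonneg _))
  have hfields : ∀ N, 1 ≤ N → ∀ t ∈ Icc 0 T, ∀ x : RegVM.R3,
      ENNReal.ofReal ‖B t x - BN N t x‖
        ≤ ENNReal.ofReal (RegVM.constC' χ ε T) *
          RegVM.mkr RegVM.phaseDist (RegVM.phaseMeasure fin) (RegVM.empirical (zin N)) ∧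
      ENNReal.ofReal ‖E t x - EN N t x‖
        ≤ ENNReal.ofReal (RegVM.constC'' χ ε T) *
          RegVM.mkr RegVM.phaseDist (RegVM.phaseMeasure fin) (RegVM.empirical (zin N)) := by
    intro N hN t ht x
    obtain ⟨Z', hsol'⟩ := hpart N hN
    rw [← e0, ← e0' N hN]
    exact ⟨hsol.le_mul_mkr hsol' hC' fun π a b _ ha hb =>
        ENNReal.ofReal_le_ofReal (RegVM.norm_magnetic_sub_le hχ hε ha hb ht x),
      hsol.le_mul_mkr hsol' hC'' fun π a b _ ha hb =>
        ENNReal.ofReal_le_ofReal (RegVM.norm_electric_sub_le hχ hε ha hb ht x)⟩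
  refine ⟨fun N hN t ht => ?_, fun φ => ⟨?_, ?_⟩, ?_, ?_, hfields⟩
  · obtain ⟨Z', hsol'⟩ := hpart N hN
    rw [← e0, ← e0' N hN]
    refine ⟨hsol.le_mul_mkr hsol' hC fun π a b _ ha hb => ?_,
      hsol.le_mul_mkr hsol' (by positivity) fun π a b _ ha hb => ?_⟩
    · simpa only [max_eq_left ht.1] using RegVM.mkr_charge_le hχ hε ha hb ht
    · simpa only [max_eq_left ht.1] using RegVM.currentNegNorm_le hχ hε ha hb ht
  · refine RegVM.tendstoUniformlyOn_of_le_mul hmkr fun η hη => ?_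
    obtain ⟨c, hc⟩ := hsol.exists_integral_sub_le hχ hε hK hKμ' (F := fun w => φ w.1)
      (φ.continuous.comp continuous_fst) (fun w => φ.norm_coe_le_norm w.1) hη
    refine ⟨c, fun N hN t ht => ?_⟩
    obtain ⟨Z', hsol'⟩ := hpart N hN
    have := hc _ _ _ _ hsol' t ht
    rw [e0, e0' N hN] at this
    simpa only [max_eq_left ht.1, RegVM.integral_charge] using this
  · refine RegVM.tendstoUniformlyOn_of_le_mul hmkr fun η hη => ?_
    obtain ⟨c, hc⟩ := hsol.exists_integral_sub_le hχ hε hK hKμ'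
      (F := fun w => φ w.1 • RegVM.vel w.2) ((φ.continuous.comp continuous_fst).smul
      (RegVM.continuous_vel.comp continuous_snd)) (C := ‖φ‖) (fun w => by
        rw [norm_smul]
        exact (mul_le_of_le_one_right (norm_nonneg _) (RegVM.norm_vel_le _)).trans
          (φ.norm_coe_le_norm w.1)) hη
    refine ⟨c, fun N hN t ht => ?_⟩
    obtain ⟨Z', hsol'⟩ := hpart N hN
    have := hc _ _ _ _ hsol' t ht
    rw [e0, e0' N hN] at this
    simp only [max_eq_left ht.1] at this
    exact this
  -- The quantitative estimate holds without the slack `η`, so `C''` serves for every `η`.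
  · exact RegVM.tendstoUniformlyOn_of_le_mul hmkr fun η hη => ⟨_, fun N hN p hp =>
      (ENNReal.ofReal_le_ofReal (by linarith)).trans (hfields N hN p.1 hp.1 p.2).2⟩
  · exact RegVM.tendstoUniformlyOn_of_le_mul hmkr fun η hη => ⟨_, fun N hN p hp =>
      (ENNReal.ofReal_le_ofReal (by linarith)).trans (hfields N hN p.1 hp.1 p.2).1⟩
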